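/- **Setup.** Let $(X^*,\Phi,X_*,\Phi^\vee)$ be a reduced root datum with a base, positive roots $\Phi^+$, Weyl group $W$, reflections $s_\alpha$, and $\Phi(w)=w\Phi^-\cap\Phi^+$; put $2\rho=\sum_{\alpha>0}\alpha$, $2\rho^\vee=\sum_{\alpha>0}\alpha^\vee$. Let $E$ be an elliptic curve over $\mathbb C$, let $\hbar\in E(\mathbb C)$, fix $\kappa\in E(\mathbb C)$ with $\hbar=2\kappa$, and write $\hbar\rho:=\kappa\cdot(2\rho)$, $\hbar\rho^\vee:=\kappa\cdot(2\rho^\vee)$. Put $\mathfrak A=X_*\otimes E=\mathrm{Hom}(X^*,E)$ and $\mathfrak A^\vee=X^*\otimes E=\mathrm{Hom}(X_*,E)$, with the functions $z_\mu:\mathfrak A\to E$ ($\mu\in X^*$) and $\lambda_{\nu}:\mathfrak A^\vee\to E$ ($\nu\in X_*$). $W$ acts on $\mathfrak A$, and $W\times W$ acts on $\mathfrak A\times\mathfrak A^\vee$; for a rational function put ${}^gf=f\circ g^{-1}$. Let $p:\mathfrak A\times\mathfrak A^\vee\to\mathfrak A$ be the projection and let $D_\alpha=\{z_\alpha=0\}$,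 $D_{\hbar,\alpha}=\{z_\alpha=\hbar\}$, $D_{\alpha^\vee}=\{\lambda_{\alpha^\vee}=0\}$. Let $\mathbb L=\mathcal P\otimes(\mathcal O(\hbar\rho)\boxtimes\mathcal O(-\hbar\rho^\vee))$ on $\mathfrak A\times\mathfrak A^\vee$, where $\mathcal P$ is the normalized Poincaré bundle. Explicitly, for dual bases $e_i$ of $X^*$ and $e_i^\vee$ of $X_*$ and $z_i=z_{e_i}$, $\lambda_i=\lambda_{e_i^\vee}$, $\mathbb L=\mathcal O(D)$ where $D$ is the sum over $i$ of $\{z_i=\lambda_i\}-\{z_i=0\}-\{\lambda_i=0\}$, $\{z_i=\kappa\langle 2\rho,e_i^\vee\rangle\}-\{z_i=0\}$ and $\{\lambda_i=-\kappa\langle e_i,2\rho^\vee\rangle\}-\{\lambda_i=0\}$. For $g=(w,v)\in W\times W$ let $\mathbb S_{w,v}=\mathbb L\otimes(g^{-1})^*\mathbb L^{-1}$. The dynamical twisted group algebra is $\mathbb S=\bigoplus_{w,v}\mathbb S_{w,v}$, whose rational sections are written $\sum a_{w,v}\delta_w\delta^{\mathrm d}_v$, with $\delta_w\delta^{\mathrm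 d}_v f={}^{(w,v)}f\,\delta_w\delta^{\mathrm d}_v$; it acts on rational sections of $\mathbb L$ by $\ell\mapsto\sum a_{w,v}\,{}^{(w,v)}\ell$. The dynamical elliptic Hecke algebra $\mathcal H^{\mathrm d}$ is the sheaf of those rational sections of $\mathbb S$ with: (i) the $a_{w,v}$ have at most simple poles, along the $D_\alpha$ and $D_{\alpha^\vee}$, $\alpha\in\Phi^+$; (ii) $\mathrm{Res}_\alpha(a_{w,v}+a_{s_\alpha w,v})=0$ and $\mathrm{Res}_{\alpha^\vee}(a_{w,v}+a_{w,s_\alpha v})=0$ for $\alpha\in\Phi^+$ (the fibres of the two line bundles are identified because the reflection fixes the divisor pointwise); (iii) for $\alpha\in\Phi(w)$, $a_{w,v}$ times a local equation of $D_\alpha$ and divided by a local equation of $D_{\hbar,\alpha}$ is regular at the generic points of $D_{\hbar,\alpha}$. The elliptic affine Hecke algebra $\mathcal H$ on $\mathfrak A$ is the sheaf of rational sections $\sum_w a_w\delta_w$ of $\mathcal O_{\mathfrak A}\rtimes W$ with the analogous conditions along $D_\alpha$ and $D_{\hbar,\alpha}$. An $\mathcal H$-module is a coherent sheaf $\mathcal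 F$ on $\mathfrak A$ together with a structure of $\mathcal H(V)$-module on $\mathcal F(V)$ for every $W$-invariant open $V$, extending the $\mathcal O(V)$-module structure and compatible with restrictions; morphisms are the $\mathcal O$-linear maps that commute with these actions. $\mathcal H^{\mathrm d}$-modules are defined in the same way on $\mathfrak A\times\mathfrak A^\vee$ with the $W\times W$-invariant open sets. Let $\mathcal H^{\mathrm d}+\mathbb S$ denote the sheaf of algebras of rational sections of $\mathbb S$ generated by $\mathcal H^{\mathrm d}$ and $\mathbb S$. **Theorem.** (1) For every section $T=\sum a_{w,v}\delta_w\delta_v^{\mathrm d}$ of $\mathcal H^{\mathrm d}$ over a $W\times W$-invariant open set $U$, the element $\Psi(T)=\sum a_{w,v}\delta_w\delta_v^{\mathrm d}\otimes\delta_w$ is a section of $(\mathcal H^{\mathrm d}+\mathbb S)\otimes p^*\mathcal H$: every point of $U$ has a $W\times W$-invariant open neighbourhood $U'\subseteq U$ and there is a $W$-invariant open $V\subseteq\mathfrak A$ with $U'\subseteq p^{-1}(V)$ such that, as rational sections of $\mathbb S\otimes p^*(\mathcal O_{\mathfrak A}\rtimes W)$, $\Psi(T)=\sum_k a_k\otimes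 h_k$ is a finite sum with $a_k$ in the algebra generated by $\mathcal H^{\mathrm d}(U')$ and $\mathbb S(U')$, and $h_k\in\mathcal H(V)$. (2) There is a functor $\mathrm{Mod}\,\mathcal H\to\mathrm{Mod}\,\mathcal H^{\mathrm d}$ which, after forgetting the actions, is isomorphic to $\mathcal F\mapsto\mathbb L\otimes p^*\mathcal F$, and for which the action on $\mathbb L\otimes p^*\mathcal F$ is given by $\Psi$: if $U$ is a $W\times W$-invariant open set, $V\subseteq\mathfrak A$ a $W$-invariant open set with $U\subseteq p^{-1}(V)$, $T\in\mathcal H^{\mathrm d}(U)$, and $\Psi(T)=\sum_k a_k\otimes h_k$ with $a_k$ in the algebra generated by $\mathcal H^{\mathrm d}(U)$ and $\mathbb S(U)$ and $h_k\in\mathcal H(V)$, then for all $\ell\in\mathbb L(U)$, $n\in\mathcal F(V)$ one has $a_k(\ell)\in\mathbb L(U)$ and $$T\cdot(\ell\otimes p^*n)=\sum_k a_k(\ell)\otimes p^*(h_k\cdot n).$$ -/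

import Mathlib

open CategoryTheory MonoidalCategory AlgebraicGeometry

namespace EllipticHecke

noncomputable section

open CartesianMonoidalCategory Limits
open scoped MonObj

/-! ### Elliptic curves and the abelian varieties attached to a lattice -/

/-- The category of schemes over `ℂ`. -/
abbrev SchC := Over (Spec (CommRingCat.of ℂ))

/-- A group scheme over `ℂ` is an elliptic curve if it is proper, geometrically integral and
smooth of relative dimension one. -/
class IsEllipticCurve (E : SchC) [GrpObj E] : Prop where
  proper : IsProper E.hom
  geometricallyIntegral : GeometricallyIntegral E.hom
  smooth : SmoothOfRelativeDimension 1 E.hom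

attribute [instance] IsEllipticCurve.proper IsEllipticCurve.geometricallyIntegral

instance isCommMonObj_of_isEllipticCurve (E : SchC) [GrpObj E] [IsEllipticCurve E] :
    IsCommMonObj E :=
  isCommMonObj_of_isProper_of_geometricallyIntegral E

/-- The `n`-fold product `E × ⋯ × E` over `ℂ`. -/
def power (E : SchC) : ℕ → SchC
  | 0 => 𝟙_ SchC
  | n + 1 => E ⊗ power E n

/-- The coordinates on `power E n`. -/
def power.coord (E : SchC) : (n : ℕ) → Fin n → (power E n ⟶ E)
  | 0, i => i.elim0
  | n + 1, i => Fin.cases (fst E (power E n)) (fun j => snd E (power E n) ≫ coord E n j) i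

/-- The morphism to `power E n` with prescribed coordinates. -/
def power.lift {E T : SchC} : (n : ℕ) → (Fin n → (T ⟶ E)) → (T ⟶ power E n)
  | 0, _ => toUnit T
  | n + 1, z => CartesianMonoidalCategory.lift (z 0) (lift n fun j => z j.succ)

lemma power.lift_coord {E T : SchC} (n : ℕ) (z : Fin n → (T ⟶ E)) (i : Fin n) :
    power.lift n z ≫ power.coord E n i = z i := by
  induction n with
  | zero => exact i.elim0
  | succ n ih =>
    refine Fin.cases ?_ (fun j => ?_) i
    · exact lift_fst _ _
    · exact (lift_snd_assoc _ _ _).trans (ih _ j)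

lemma power.hom_ext {E T : SchC} (n : ℕ) {f g : T ⟶ power E n}
    (h : ∀ i, f ≫ power.coord E n i = g ≫ power.coord E n i) : f = g := by
  induction n with
  | zero => exact toUnit_unique (X := T) f g
  | succ n ih =>
    refine CartesianMonoidalCategory.hom_ext _ _ ?_ (ih fun j => ?_)
    · simpa [power.coord] using! h 0
    · simpa [power.coord, Category.assoc] using! h j.succ

section Integrality

instance locallyOfFiniteType_tensor (A B : SchC) [LocallyOfFiniteType A.hom]
    [LocallyOfFiniteType B.hom] : LocallyOfFiniteType (A ⊗ B).hom := by
  have : (A ⊗ B).hom = pullback.fst A.hom B.hom ≫ A.hom := rfl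
  rw [this]; infer_instance

instance locallyOfFiniteType_power (E : SchC) [LocallyOfFiniteType E.hom] (n : ℕ) :
    LocallyOfFiniteType (power E n).hom := by
  induction n with
  | zero =>
    change LocallyOfFiniteType (𝟙 _)
    infer_instance
  | succ n ih => exact locallyOfFiniteType_tensor E (power E n)

lemma isLocallyNoetherian_left (A : SchC) [LocallyOfFiniteType A.hom] :
    IsLocallyNoetherian A.left :=
  LocallyOfFiniteType.isLocallyNoetherian A.hom

lemma isIntegral_tensor (E B : SchC) [GeometricallyIntegral E.hom]
    [LocallyOfFiniteType B.hom] [IsIntegral B.left] : IsIntegral (E ⊗ B).left := by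
  have := isLocallyNoetherian_left B
  exact inferInstanceAs (IsIntegral (pullback E.hom B.hom))

lemma isIntegral_power_tensor (E B : SchC) [GeometricallyIntegral E.hom]
    [LocallyOfFiniteType E.hom] [LocallyOfFiniteType B.hom] [IsIntegral B.left] (n : ℕ) :
    IsIntegral (power E n ⊗ B).left := by
  induction n with
  | zero =>
    have : IsIso (λ_ B).inv.left := inferInstanceAs (IsIso ((Over.forget _).map (λ_ B).inv))
    have key : IsIntegral (𝟙_ SchC ⊗ B).left := .of_isIso (X := B.left) (λ_ B).inv.left
    exact key
  | succ n ih =>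
    have := isIntegral_tensor E (power E n ⊗ B)
    have : IsIso (α_ E (power E n) B).inv.left :=
      inferInstanceAs (IsIso ((Over.forget _).map (α_ E (power E n) B).inv))
    have key : IsIntegral ((E ⊗ power E n) ⊗ B).left :=
      .of_isIso (X := (E ⊗ power E n ⊗ B).left) (α_ E (power E n) B).inv.left
    exact key

instance isIntegral_power (E : SchC) [GeometricallyIntegral E.hom]
    [LocallyOfFiniteType E.hom] (n : ℕ) : IsIntegral (power E n).left := by
  induction n with
  | zero => exact inferInstanceAs (IsIntegral (Spec (CommRingCat.of ℂ)))
  | succ n ih => exact isIntegral_tensor E (power E n)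

instance isIntegral_power_tensor_power (E : SchC) [GeometricallyIntegral E.hom]
    [LocallyOfFiniteType E.hom] (m n : ℕ) : IsIntegral (power E m ⊗ power E n).left :=
  isIntegral_power_tensor E (power E n) m

instance isDominant_fst (A B : SchC) [Nonempty B.left] : IsDominant (fst A B).left := by
  have : Surjective B.hom :=
    ⟨Function.surjective_to_subsingleton (α := B.left) (β := Spec (CommRingCat.of ℂ)) _⟩
  have : Surjective (fst A B).left := inferInstanceAs (Surjective (pullback.fst A.hom B.hom))
  infer_instance

end Integrality

/-- The abelian variety `Hom(Λ, E)` of homomorphisms from a lattice `Λ` to `E`, that is, the tensor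
product of the dual lattice with `E`.  A basis of `Λ` identifies it with a power of `E`. -/
abbrev HomTorus (E : SchC) (Λ : Type*) [AddCommGroup Λ] : SchC :=
  power E (Module.finrank ℤ Λ)

namespace HomTorus

variable (E : SchC) (Λ Λ' : Type*) [AddCommGroup Λ] [AddCommGroup Λ']

instance [GrpObj E] [IsEllipticCurve E] : IsIntegral (HomTorus E Λ).left :=
  isIntegral_power E _

instance [GrpObj E] [IsEllipticCurve E] : IsIntegral (HomTorus E Λ ⊗ HomTorus E Λ').left :=
  isIntegral_power_tensor_power E _ _

variable [GrpObj E] [IsEllipticCurve E] {Λ} [Module.Free ℤ Λ] [Module.Finite ℤ Λ]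

/-- The evaluation `χ_c : Hom(Λ, E) ⟶ E`, `z ↦ z_c`, at an element `c` of the lattice.  (The group
law on morphisms to `E` is written multiplicatively.) -/
def chi (c : Λ) : HomTorus E Λ ⟶ E :=
  ∏ i, power.coord E (Module.finrank ℤ Λ) i ^ (Module.finBasis ℤ Λ).repr c i

lemma chi_basis (i : Fin (Module.finrank ℤ Λ)) :
    chi E (Module.finBasis ℤ Λ i) = power.coord E (Module.finrank ℤ Λ) i := by
  rw [chi, Finset.prod_eq_single i]
  · simp
  · intro j _ hj
    simp [hj.symm]
  · simp

/-- Precomposition `z ↦ z ∘ φ` with an endomorphism `φ` of the lattice. -/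
def precomp (φ : Λ →+ Λ) : HomTorus E Λ ⟶ HomTorus E Λ :=
  power.lift _ fun i => chi E (φ (Module.finBasis ℤ Λ i))

/-- The characters `χ_c` as a homomorphism from the lattice to `Hom(Hom(Λ, E), E)`. -/
def chiHom : Multiplicative Λ →* (HomTorus E Λ ⟶ E) where
  toFun c := chi E c.toAdd
  map_one' := by simp [chi]
  map_mul' c d := by simp [chi, zpow_add, Finset.prod_mul_distrib]

/-- Composition with a fixed morphism as a group homomorphism. -/
def compHom {S T : SchC} (f : S ⟶ T) : (T ⟶ E) →* (S ⟶ E) where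
  toFun g := f ≫ g
  map_one' := MonObj.comp_one f
  map_mul' g h := MonObj.comp_mul f g h

lemma precomp_chi (φ : Λ →+ Λ) (c : Λ) : precomp E φ ≫ chi E c = chi E (φ c) := by
  have h1 : precomp E φ ≫ chi E c =
      ∏ i, chi E (φ (Module.finBasis ℤ Λ i)) ^ (Module.finBasis ℤ Λ).repr c i := by
    refine (map_prod (compHom E (precomp E φ)) _ _).trans (Finset.prod_congr rfl fun i _ => ?_)
    rw [map_zpow]
    exact congrArg (· ^ _) (power.lift_coord _ _ i)
  have h2 : φ c = ∑ i, (Module.finBasis ℤ Λ).repr c i • φ (Module.finBasis ℤ Λ i) := by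
    conv_lhs => rw [← (Module.finBasis ℤ Λ).sum_repr c]
    simp only [map_sum, map_zsmul]
  rw [h1, h2]
  have h3 := map_prod (chiHom E) (fun i => Multiplicative.ofAdd
    ((Module.finBasis ℤ Λ).repr c i • φ (Module.finBasis ℤ Λ i))) Finset.univ
  rw [← ofAdd_sum] at h3
  refine Eq.trans ?_ h3.symm
  refine Finset.prod_congr rfl fun i _ => ?_
  rw [ofAdd_zsmul, map_zpow]
  rfl

lemma precomp_id : precomp E (AddMonoidHom.id Λ) = 𝟙 (HomTorus E Λ) := by
  refine power.hom_ext _ fun i => ?_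
  rw [precomp, power.lift_coord]
  exact (chi_basis E i).trans (Category.id_comp _).symm

lemma precomp_comp (φ ψ : Λ →+ Λ) : precomp E (φ.comp ψ) = precomp E φ ≫ precomp E ψ := by
  refine power.hom_ext _ fun i => ?_
  rw [Category.assoc, ← chi_basis, precomp_chi, precomp_chi, precomp_chi]
  rfl

end HomTorus

/-! ### Group actions on integral schemes and function fields -/

lemma specializes_of_isDominant {X Y : Scheme.{0}} [IsIntegral X] [IsIntegral Y] (f : X ⟶ Y)
    [IsDominant f] : f (genericPoint X) ⤳ genericPoint Y := by
  have h := (genericPoint_spec X).image f.continuous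
  rw [Set.image_univ, f.denseRange.closure_range] at h
  exact h.specializes (Set.mem_univ _)

/-- The map on function fields induced by a dominant morphism of integral schemes. -/
def functionFieldMap {X Y : Scheme.{0}} [IsIntegral X] [IsIntegral Y] (f : X ⟶ Y)
    [IsDominant f] : Y.functionField →+* X.functionField :=
  (Y.presheaf.stalkSpecializes (specializes_of_isDominant f) ≫ f.stalkMap (genericPoint X)).hom

lemma functionFieldMap_id (X : Scheme.{0}) [IsIntegral X] :
    functionFieldMap (𝟙 X) = RingHom.id X.functionField := by
  ext x
  simp [functionFieldMap]

lemma functionFieldMap_comp {X Y Z : Scheme.{0}} [IsIntegral X] [IsIntegral Y] [IsIntegral Z]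
    (f : X ⟶ Y) (g : Y ⟶ Z) [IsDominant f] [IsDominant g] :
    functionFieldMap (f ≫ g) = (functionFieldMap f).comp (functionFieldMap g) := by
  have h : Z.presheaf.stalkSpecializes (specializes_of_isDominant (f ≫ g)) ≫
      (f ≫ g).stalkMap (genericPoint X) =
      (Z.presheaf.stalkSpecializes (specializes_of_isDominant g) ≫
        g.stalkMap (genericPoint Y)) ≫
      (Y.presheaf.stalkSpecializes (specializes_of_isDominant f) ≫
        f.stalkMap (genericPoint X)) := by
    rw [Category.assoc, ← Scheme.Hom.stalkSpecializes_stalkMap_assoc, ← Category.assoc,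
      TopCat.Presheaf.stalkSpecializes_comp, Scheme.Hom.stalkMap_comp]
    rfl
  exact congrArg CommRingCat.Hom.hom h

/-- An action of a group `G` on a scheme `X`, recorded through the morphisms
`inv g : x ↦ g⁻¹ x`, so that functions are moved by `(g • f)(x) = f (g⁻¹ x)`. -/
class SchemeAction (G : Type*) [Group G] (X : Scheme.{0}) where
  /-- the morphism `x ↦ g⁻¹ x` -/
  inv : G → (X ⟶ X)
  inv_one : inv 1 = 𝟙 X
  inv_mul : ∀ g h, inv (g * h) = inv g ≫ inv h

namespace SchemeAction

variable {G : Type*} [Group G] {X : Scheme.{0}} [SchemeAction G X]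

instance isIso_inv (g : G) : IsIso (inv (X := X) g) :=
  ⟨inv g⁻¹, by rw [← inv_mul, mul_inv_cancel, inv_one], by
    rw [← inv_mul, inv_mul_cancel, inv_one]⟩

variable (G) in
/-- An open subset is invariant if it is stable under the group. -/
def IsInvariant (U : X.Opens) : Prop := ∀ g : G, inv g ⁻¹ᵁ U = U

/-- The induced action on the function field, `g • f = f ∘ g⁻¹`. -/
instance functionFieldAction [IsIntegral X] : MulSemiringAction G X.functionField where
  smul g f := functionFieldMap (inv g) f
  one_smul f := by
    change functionFieldMap (inv (1 : G)) f = f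
    have : ∀ (φ : X ⟶ X) [IsDominant φ], φ = 𝟙 X → functionFieldMap φ f = f := by
      rintro φ _ rfl
      rw [functionFieldMap_id]; rfl
    exact this _ inv_one
  mul_smul g h f := by
    change functionFieldMap (inv (g * h)) f =
      functionFieldMap (inv g) (functionFieldMap (inv h) f)
    have : ∀ (φ : X ⟶ X) [IsDominant φ], φ = inv g ≫ inv h →
        functionFieldMap φ f = functionFieldMap (inv g) (functionFieldMap (inv h) f) := by
      rintro φ _ rfl
      rw [functionFieldMap_comp]; rfl
    exact this _ (inv_mul g h)
  smul_zero g := map_zero (functionFieldMap (inv g))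
  smul_add g := map_add (functionFieldMap (inv g))
  smul_one g := map_one (functionFieldMap (inv g))
  smul_mul g := map_mul (functionFieldMap (inv g))

end SchemeAction

/-! ### Invertible subsheaves of the sheaf of rational functions -/

section LineBundle

variable {X : Scheme.{0}} [IsIntegral X]

/-- The stalk at `x` of the sheaf `𝒪_X(D)`, as a subset of the function field, where `d x` is a
local equation at `x` of the divisor `D`. -/
def lineStalk (d : X → X.functionField) (x : X) : Set X.functionField :=
  {a | ∃ r : X.presheaf.stalk x, algebraMap _ X.functionField r = a * d x}

/-- The sections over `U` of `𝒪_X(D)`: locally constant functions `s : U → K(X)` (that is, elements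
of `K(X)` if `U` is non-empty) with `s x ∈ 𝒪_X(D)_x` for all `x ∈ U`. -/
def lineSections (d : X → X.functionField) (U : X.Opens) : AddSubgroup (U → X.functionField) where
  carrier := {s | IsLocallyConstant s ∧ ∀ x, s x ∈ lineStalk d x.1}
  zero_mem' := ⟨IsLocallyConstant.const 0, fun x => ⟨0, by simp⟩⟩
  add_mem' := by
    rintro a b ⟨ha, ha'⟩ ⟨hb, hb'⟩
    refine ⟨ha.add hb, fun x => ?_⟩
    obtain ⟨r, hr⟩ := ha' x
    obtain ⟨r', hr'⟩ := hb' x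
    exact ⟨r + r', by rw [map_add, hr, hr', Pi.add_apply, add_mul]⟩
  neg_mem' := by
    rintro a ⟨ha, ha'⟩
    refine ⟨ha.neg, fun x => ?_⟩
    obtain ⟨r, hr⟩ := ha' x
    exact ⟨-r, by rw [map_neg, hr, Pi.neg_apply, neg_mul]⟩

/-- The value in `K(X)` at a point of a regular function. -/
def regValue {U : X.Opens} (x : U) : Γ(X, U) →+* X.functionField :=
  (algebraMap (X.presheaf.stalk x.1) X.functionField).comp (X.presheaf.germ U x.1 x.2).hom

lemma regValue_eq {U : X.Opens} (x y : U) : regValue x = regValue (X := X) y := by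
  have : Nonempty U := ⟨x⟩
  ext r
  simp [regValue]

lemma regValue_res {U V : X.Opens} (h : V ≤ U) (x : V) (r : Γ(X, U)) :
    regValue x (X.presheaf.map (homOfLE h).op r) = regValue (X := X) ⟨x.1, h x.2⟩ r := by
  simp [regValue, TopCat.Presheaf.germ_res_apply]

instance (d : X → X.functionField) (U : X.Opens) : Module Γ(X, U) (lineSections d U) where
  smul r s := ⟨fun x => regValue x r * s.1 x, by
    refine ⟨?_, fun x => ?_⟩
    · refine IsLocallyConstant.mul ?_ s.2.1
      refine (IsLocallyConstant.iff_exists_open _).2 fun x =>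
        ⟨Set.univ, isOpen_univ, trivial, fun y _ => by rw [regValue_eq y x]⟩
    · obtain ⟨q, hq⟩ := s.2.2 x
      exact ⟨X.presheaf.germ U x.1 x.2 r * q, by
        rw [map_mul, hq, mul_assoc]; rfl⟩⟩
  one_smul s := by ext x; exact (congrArg (· * s.1 x) (map_one (regValue x))).trans (one_mul _)
  mul_smul r q s := by
    ext x
    exact (congrArg (· * s.1 x) (map_mul (regValue x) r q)).trans (mul_assoc _ _ _)
  smul_zero r := by ext x; exact mul_zero _
  smul_add r s s' := by ext x; exact mul_add _ _ _
  add_smul r q s := by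
    ext x
    exact (congrArg (· * s.1 x) (map_add (regValue x) r q)).trans (add_mul _ _ _)
  zero_smul s := by
    ext x; exact (congrArg (· * s.1 x) (map_zero (regValue x))).trans (zero_mul _)

/-- Restriction of sections of `𝒪_X(D)`. -/
def lineSectionsRes (d : X → X.functionField) {U V : X.Opens} (h : V ≤ U) :
    lineSections d U →+ lineSections d V where
  toFun s := ⟨fun x => s.1 ⟨x.1, h x.2⟩,
    ⟨s.2.1.comp_continuous (f := fun x : V => (⟨x.1, h x.2⟩ : U))
      (continuous_subtype_val.subtype_mk _), fun x => s.2.2 ⟨x.1, h x.2⟩⟩⟩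
  map_zero' := rfl
  map_add' _ _ := rfl

/-- The presheaf of abelian groups underlying `𝒪_X(D)`. -/
def linePresheafAb (d : X → X.functionField) : TopCat.Presheaf Ab X where
  obj U := AddCommGrpCat.of (lineSections d U.unop)
  map f := AddCommGrpCat.ofHom (lineSectionsRes d f.unop.le)
  map_id _ := rfl
  map_comp _ _ := rfl

lemma isSheaf_linePresheafAb (d : X → X.functionField) : (linePresheafAb d).IsSheaf := by
  rw [TopCat.Presheaf.isSheaf_iff_isSheafUniqueGluing]
  intro J U sf hsf
  have hU : ∀ x : (iSup U : X.Opens), ∃ i, x.1 ∈ U i := fun x =>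
    TopologicalSpace.Opens.mem_iSup.1 x.2
  choose k hk using hU
  let sf' : ∀ i, lineSections d (U i) := sf
  have glue : ∀ (i j) (x : X) (hi : x ∈ U i) (hj : x ∈ U j),
      (sf' i).1 ⟨x, hi⟩ = (sf' j).1 ⟨x, hj⟩ := fun i j x hi hj =>
    congrArg (fun s : lineSections d (U i ⊓ U j) => s.1 ⟨x, hi, hj⟩) (hsf i j)
  let s : ↥(iSup U) → X.functionField := fun x => (sf' (k x)).1 ⟨x.1, hk x⟩
  have hs : ∀ (i) (x : X) (hi : x ∈ U i) (hx : x ∈ iSup U), s ⟨x, hx⟩ = (sf' i).1 ⟨x, hi⟩ :=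
    fun i x hi hx => glue _ _ x _ hi
  have hlc : IsLocallyConstant s := by
    refine (IsLocallyConstant.iff_eventually_eq s).2 fun x => ?_
    have h1 := ((IsLocallyConstant.iff_eventually_eq _).1 (sf' (k x)).2.1) ⟨x.1, hk x⟩
    rw [nhds_subtype_eq_comap] at h1 ⊢
    rw [Filter.eventually_comap] at h1 ⊢
    filter_upwards [h1, (U (k x)).isOpen.mem_nhds (hk x)] with y hy hyU z hz
    subst hz
    exact (hs (k x) z.1 hyU z.2).trans (hy ⟨z.1, hyU⟩ rfl)
  refine ⟨(⟨s, hlc, fun x => (sf' (k x)).2.2 ⟨x.1, hk x⟩⟩ : lineSections d (iSup U)), ?_, ?_⟩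
  · intro i
    refine Subtype.ext (funext fun x => ?_)
    exact hs i x.1 x.2 _
  · intro s' hs'
    refine Subtype.ext (funext fun x => ?_)
    exact congrArg (fun q : lineSections d (U (k x)) => q.1 ⟨x.1, hk x⟩) (hs' (k x))

instance (d : X → X.functionField) (U : (TopologicalSpace.Opens X)ᵒᵖ) :
    Module (X.ringCatSheaf.obj.obj U) ((linePresheafAb d).obj U) :=
  inferInstanceAs (Module Γ(X, U.unop) (lineSections d U.unop))

/-- The presheaf of modules underlying `𝒪_X(D)`. -/
def linePresheaf (d : X → X.functionField) : X.PresheafOfModules :=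
  PresheafOfModules.ofPresheaf (linePresheafAb d) fun U _ f r s =>
    Subtype.ext <| funext fun x =>
      congrArg (· * (show lineSections d U.unop from s).1 ⟨x.1, f.unop.le x.2⟩)
        (regValue_res f.unop.le x r).symm

/-- The invertible sheaf `𝒪_X(D)` of the Cartier divisor `D` with local equations `d`. -/
def lineBundle (d : X → X.functionField) : X.Modules :=
  ⟨linePresheaf d, isSheaf_linePresheafAb d⟩

end LineBundle

section Tensor

variable {X Y : Scheme.{0}}

/-- Sheafification of presheaves of `𝒪_X`-modules. -/
def sheafifyModules (X : Scheme.{0}) : X.PresheafOfModules ⥤ X.Modules :=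
  PresheafOfModules.sheafification (𝟙 X.ringCatSheaf.obj)

/-- The canonical morphism from a presheaf of `𝒪_X`-modules to its sheafification. -/
def toSheafifyModules (M : X.PresheafOfModules) :
    M ⟶ (Scheme.Modules.toPresheafOfModules X).obj ((sheafifyModules X).obj M) :=
  (PresheafOfModules.sheafificationAdjunction (𝟙 X.ringCatSheaf.obj)).unit.app M

/-- The tensor product of presheaves of modules with a fixed one on the left. -/
def presheafTensorL (L : X.PresheafOfModules) : X.PresheafOfModules ⥤ X.PresheafOfModules :=
  MonoidalCategory.tensorLeft (C := PresheafOfModules (X.presheaf ⋙ forget₂ CommRingCat RingCat)) L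

/-- The functor `ℒ ⊗ -` on sheaves of modules. -/
def tensorL (L : X.Modules) : X.Modules ⥤ X.Modules :=
  Scheme.Modules.toPresheafOfModules X ⋙ presheafTensorL L.val ⋙ sheafifyModules X

/-- The section `s ⊗ m` of `ℒ ⊗ ℳ` over `U`. -/
def tensorSection (L M : X.Modules) (U : X.Opens) (s : Γ(L, U)) (m : Γ(M, U)) :
    Γ((tensorL L).obj M, U) :=
  (((toSheafifyModules ((presheafTensorL L.val).obj M.val)).app (.op U)).hom
      (s ⊗ₜ[Γ(X, U)] m : TensorProduct Γ(X, U) Γ(L, U) Γ(M, U)) :)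

/-- The section of `p^*ℱ` over `U ⊆ p⁻¹ V` defined by a section of `ℱ` over `V`. -/
def pullbackSection (p : X ⟶ Y) (F : Y.Modules) {U : X.Opens} {V : Y.Opens} (h : U ≤ p ⁻¹ᵁ V)
    (n : Γ(F, V)) : Γ((Scheme.Modules.pullback p).obj F, U) :=
  ((Scheme.Modules.pullback p).obj F).presheaf.map (homOfLE h).op
    (((Scheme.Modules.pullbackPushforwardAdjunction p).unit.app F).app V n)

end Tensor

/-! ### Divisors attached to morphisms to `E` -/

section Divisors

variable {E : SchC} [GrpObj E]

variable (E) in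
/-- The origin of `E`. -/
def zeroPt : E.left := η[E].left (IsLocalRing.closedPoint ℂ)

variable {T : SchC} [IsIntegral T.left]

/-- A local equation at `x` of the divisor `f⁻¹(0)` of a morphism `f : T ⟶ E`, obtained by pulling
back a local equation `t` of the origin of `E`. -/
def locEq (t : E.left.presheaf.stalk (zeroPt E)) (f : T ⟶ E) (x : T.left) :
    T.left.functionField :=
  open scoped Classical in
  if h : f.left x = zeroPt E then
    algebraMap (T.left.presheaf.stalk x) T.left.functionField
      (f.left.stalkMap x (E.left.presheaf.stalkSpecializes (specializes_of_eq h) t))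
  else 1

/-- `x` is the generic point of an irreducible component of the divisor `f⁻¹(0)`. -/
def IsGenericPointOf (f : T ⟶ E) (x : T.left) : Prop :=
  f.left x = zeroPt E ∧ ∀ y : T.left, f.left y = zeroPt E → y ⤳ x → y = x

end Divisors

/-! ### The twisted group algebra and residue conditions -/

section Twisted

/-- The twisted group algebra of rational functions: formal sums `∑ a_g δ_g` with coefficients in
`K(T)`, where `δ_g a = (g • a) δ_g`. -/
abbrev Twisted (G : Type*) [Group G] (T : Scheme.{0}) [IsIntegral T] [SchemeAction G T] :=
  SkewMonoidAlgebra T.functionField G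

variable {G : Type*} [Group G] {T : Scheme.{0}} [IsIntegral T] [SchemeAction G T]

/-- `a` is regular at `x` as a rational section of `𝕃 ⊗ (g⁻¹)^* 𝕃⁻¹`, where `𝕃 = 𝒪(D)` and `d`
are local equations of `D`. -/
def RegularAt (d : T → T.functionField) (g : G) (a : T.functionField) (x : T) : Prop :=
  ∀ s ∈ lineStalk d (SchemeAction.inv g x), a * g • s ∈ lineStalk d x

/-- The sections over `U` of the twisted group algebra `⨁_g 𝕃 ⊗ (g⁻¹)^* 𝕃⁻¹`. -/
def twistedSections (d : T → T.functionField) (U : T.Opens) : Set (Twisted G T) :=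
  {a | ∀ x ∈ U, ∀ g, RegularAt d g (a.coeff g) x}

/-- The action `∑ a_g δ_g · s = ∑ a_g (g • s)` on rational sections of `𝕃`. -/
def polyAct (a : Twisted G T) (s : T.functionField) : T.functionField :=
  ∑ g ∈ a.support, a.coeff g * g • s

end Twisted

section Residue

variable {G : Type*} [Group G] {E T : SchC} [GrpObj E] [IsIntegral T.left]
  [SchemeAction G T.left] (t : E.left.presheaf.stalk (zeroPt E))
  (d : T.left → T.left.functionField)

/-- Rational sections `∑ a_g δ_g` of the twisted group algebra with at most simple poles, along the
divisors `D_j = wall_j⁻¹(0)`, and with `Res_j (a_g + a_{r_j g}) = 0` for all `g`, where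
`r_j = refl j` fixes `D_j` pointwise.  The residues at a generic point `x` of `D_j` are compared
through the identification of the fibres at `x` of `𝕃 ⊗ (g⁻¹)^* 𝕃⁻¹` and
`𝕃 ⊗ ((r_j g)⁻¹)^* 𝕃⁻¹` with `Hom(𝕃(g⁻¹ x), 𝕃(x))`. -/
def residueSections {J : Type*} (wall : J → (T ⟶ E)) (refl : J → G) (U : T.left.Opens) :
    Set (Twisted G T.left) :=
  {a |
    (∀ x ∈ U, ∀ g, ∀ s ∈ lineStalk d (SchemeAction.inv g x),
      (∏ᶠ j, locEq t (wall j) x) * (a.coeff g * g • s) ∈ lineStalk d x) ∧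
    (∀ j, ∀ x ∈ U, IsGenericPointOf (wall j) x →
      ∀ g, ∀ s ∈ lineStalk d (SchemeAction.inv g x),
        ∃ r ∈ IsLocalRing.maximalIdeal (T.left.presheaf.stalk x),
          algebraMap _ T.left.functionField r =
            locEq t (wall j) x *
              (a.coeff g * g • s + a.coeff (refl j * g) * (refl j * g) • s) * d x)}

/-- The condition that `a_g · ϑ(root_j) / ϑ(shift_j)` is regular along the divisor `shift_j⁻¹(0)`
for all `g` and `j` with `Φ j g`. -/
def vanishingSections {J : Type*} (root shift : J → (T ⟶ E)) (Φ : J → G → Prop)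
    (U : T.left.Opens) : Set (Twisted G T.left) :=
  {a | ∀ j g, Φ j g → ∀ x ∈ U, IsGenericPointOf (shift j) x →
    RegularAt d g (a.coeff g * (locEq t (root j) x / locEq t (shift j) x)) x}

end Residue

/-! ### The elliptic Hecke algebras of a root datum -/

section Hecke

variable {I X Y : Type*} [AddCommGroup X] [AddCommGroup Y]

section Actions

set_option linter.unusedSectionVars false

variable [Module.Free ℤ X] [Module.Finite ℤ X] [Module.Free ℤ Y] [Module.Finite ℤ Y]
  (P : RootPairing I ℤ X Y) (E : SchC) [GrpObj E] [IsEllipticCurve E]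

/-- The action of the Weyl group on `X`. -/
def weightAct (w : P.weylGroup) : X →+ X := DistribSMul.toAddMonoidHom X w

/-- The (left) action of the Weyl group on `Y`, contragredient to the one on `X`. -/
def coweightAct (w : P.weylGroup) : Y →+ Y :=
  DistribSMul.toAddMonoidHom Y (MulOpposite.op (w⁻¹ : P.weylGroup).1)

/-- The morphism `z ↦ w⁻¹ z` of `𝔄 = Hom(X, E)`. -/
def weylInv (w : P.weylGroup) : HomTorus E X ⟶ HomTorus E X :=
  HomTorus.precomp E (weightAct P w)

/-- The morphism `λ ↦ v⁻¹ λ` of `𝔄^∨ = Hom(Y, E)`. -/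
def dualWeylInv (v : P.weylGroup) : HomTorus E Y ⟶ HomTorus E Y :=
  HomTorus.precomp E (coweightAct P v)

lemma weylInv_one : weylInv P E 1 = 𝟙 _ := by
  rw [weylInv, ← HomTorus.precomp_id]
  exact congrArg (HomTorus.precomp E) (AddMonoidHom.ext fun x => one_smul _ x)

lemma weylInv_mul (w v : P.weylGroup) : weylInv P E (w * v) = weylInv P E w ≫ weylInv P E v := by
  rw [weylInv, weylInv, weylInv, ← HomTorus.precomp_comp]
  exact congrArg (HomTorus.precomp E) (AddMonoidHom.ext fun x => mul_smul w v x)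

lemma dualWeylInv_one : dualWeylInv P E 1 = 𝟙 _ := by
  rw [dualWeylInv, ← HomTorus.precomp_id]
  congr 1
  ext x
  change MulOpposite.op ((1 : P.weylGroup)⁻¹).1 • x = x
  rw [inv_one]
  exact one_smul _ x

lemma dualWeylInv_mul (w v : P.weylGroup) :
    dualWeylInv P E (w * v) = dualWeylInv P E w ≫ dualWeylInv P E v := by
  rw [dualWeylInv, dualWeylInv, dualWeylInv, ← HomTorus.precomp_comp]
  congr 1
  ext x
  change MulOpposite.op ((w * v)⁻¹ : P.weylGroup).1 • x =
    MulOpposite.op (w⁻¹ : P.weylGroup).1 • MulOpposite.op (v⁻¹ : P.weylGroup).1 • x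
  rw [← mul_smul, mul_inv_rev]
  rfl

/-- The action of `W` on `𝔄`. -/
instance weylAction : SchemeAction P.weylGroup (HomTorus E X).left where
  inv w := (weylInv P E w).left
  inv_one := by rw [weylInv_one]; rfl
  inv_mul w v := by rw [weylInv_mul]; rfl

/-- The action of `W × W` on `𝔄 × 𝔄^∨`. -/
instance weylWeylAction :
    SchemeAction (P.weylGroup × P.weylGroup) (HomTorus E X ⊗ HomTorus E Y).left where
  inv g := (weylInv P E g.1 ⊗ₘ dualWeylInv P E g.2).left
  inv_one := by
    rw [Prod.fst_one, Prod.snd_one, weylInv_one, dualWeylInv_one, id_tensorHom_id]; rfl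
  inv_mul g h := by
    rw [Prod.fst_mul, Prod.snd_mul, weylInv_mul, dualWeylInv_mul, ← tensorHom_comp_tensorHom]; rfl

end Actions

variable {P : RootPairing I ℤ X Y} (b : P.Base)

/-- The index set of the positive roots. -/
abbrev PosIdx := {i : I // b.IsPos i}

/-- `2ρ`, the sum of the positive roots. -/
def twoRho : X := ∑ᶠ i : PosIdx b, P.root i.1

/-- `2ρ^∨`, the sum of the positive coroots. -/
def twoRhoDual : Y := ∑ᶠ i : PosIdx b, P.coroot i.1

/-- The condition `α ∈ Φ(w) = w Φ⁻ ∩ Φ⁺` for a positive root `α`. -/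
def InversionSet (i : PosIdx b) (w : P.weylGroup) : Prop := ¬ b.IsPos (w⁻¹ • i.1)

variable [Module.Free ℤ X] [Module.Finite ℤ X] [Module.Free ℤ Y] [Module.Finite ℤ Y]

variable (P) in
/-- The basis of `Y` dual to the chosen basis of `X`. -/
def dualBasisVec (i : Fin (Module.finrank ℤ X)) : Y :=
  P.toLinearMap.flip.toPerfPair.symm ((Module.finBasis ℤ X).coord i)

variable {E : SchC} [GrpObj E] [IsEllipticCurve E] (t : E.left.presheaf.stalk (zeroPt E))
  (κ : 𝟙_ SchC ⟶ E)

/-- The constant morphism with value `κ`. -/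
def constHom (T : SchC) : T ⟶ E := toUnit T ≫ κ

/-- The function `z ↦ z_α - ħ` on `𝔄`, where `ħ = 2 κ`; its zero divisor is `D_{ħ,α}`. -/
def shiftedRoot (i : I) : HomTorus E X ⟶ E :=
  HomTorus.chi E (P.root i) / constHom κ _ ^ 2

/-- The sections over `U ⊆ 𝔄` of the elliptic affine Hecke algebra `𝓗`. -/
def heckeSections (U : (HomTorus E X).left.Opens) : Set (Twisted P.weylGroup (HomTorus E X).left) :=
  residueSections t (fun _ => 1) (fun i : PosIdx b => HomTorus.chi E (P.root i.1))
      (fun i => RootPairing.weylGroup.ofIdx P i.1) U ∩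
    vanishingSections t (fun _ => 1) (fun i : PosIdx b => HomTorus.chi E (P.root i.1))
      (fun i => shiftedRoot (P := P) κ i.1) (InversionSet b) U

/-- Local equations of the divisor of `𝕃 = 𝒫 ⊗ (𝒪(ħρ) ⊠ 𝒪(-ħρ^∨))`.  In terms of the coordinates
`z_i = z_{e_i}`, `λ_i = λ_{e_i^∨}` for dual bases `e_i`, `e_i^∨` of `X` and `Y` it is the sum over
`i` of the three divisors `{z_i = λ_i} - {z_i = 0} - {λ_i = 0}`,
`{z_i = ħ⟨ρ, e_i^∨⟩} - {z_i = 0}` and `{λ_i = -ħ⟨e_i, ρ^∨⟩} - {λ_i = 0}`. -/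
def twistDivisor (x : (HomTorus E X ⊗ HomTorus E Y).left) :
    (HomTorus E X ⊗ HomTorus E Y).left.functionField :=
  ∏ i : Fin (Module.finrank ℤ X),
    (let z : HomTorus E X ⊗ HomTorus E Y ⟶ E :=
       fst _ _ ≫ HomTorus.chi E (Module.finBasis ℤ X i)
     let l : HomTorus E X ⊗ HomTorus E Y ⟶ E := snd _ _ ≫ HomTorus.chi E (dualBasisVec P i)
     locEq t (z / l) x / (locEq t z x * locEq t l x) *
       (locEq t (z / constHom κ _ ^ P.toLinearMap (twoRho b) (dualBasisVec P i)) x /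
         locEq t z x) *
       (locEq t (l * constHom κ _ ^ P.toLinearMap (Module.finBasis ℤ X i) (twoRhoDual b)) x /
         locEq t l x))

/-- The sections over `U ⊆ 𝔄 × 𝔄^∨` of the dynamical elliptic twisted group algebra `𝕊`. -/
def dynTwistedSections (U : (HomTorus E X ⊗ HomTorus E Y).left.Opens) :
    Set (Twisted (P.weylGroup × P.weylGroup) (HomTorus E X ⊗ HomTorus E Y).left) :=
  twistedSections (twistDivisor b t κ) U

/-- The sections over `U ⊆ 𝔄 × 𝔄^∨` of the algebra `𝓗̃^d`. -/
def dynHeckeTildeSections (U : (HomTorus E X ⊗ HomTorus E Y).left.Opens) :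
    Set (Twisted (P.weylGroup × P.weylGroup) (HomTorus E X ⊗ HomTorus E Y).left) :=
  residueSections t (twistDivisor b t κ)
    (Sum.elim (fun i : PosIdx b => fst _ _ ≫ HomTorus.chi E (P.root i.1))
      (fun i : PosIdx b => snd _ _ ≫ HomTorus.chi E (P.coroot i.1)))
    (Sum.elim (fun i => (RootPairing.weylGroup.ofIdx P i.1, 1))
      (fun i => (1, RootPairing.weylGroup.ofIdx P i.1))) U

/-- The sections over `U ⊆ 𝔄 × 𝔄^∨` of the dynamical elliptic Hecke algebra `𝓗^d`. -/
def dynHeckeSections (U : (HomTorus E X ⊗ HomTorus E Y).left.Opens) :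
    Set (Twisted (P.weylGroup × P.weylGroup) (HomTorus E X ⊗ HomTorus E Y).left) :=
  dynHeckeTildeSections b t κ U ∩
    vanishingSections t (twistDivisor b t κ)
      (fun i : PosIdx b => fst _ _ ≫ HomTorus.chi E (P.root i.1))
      (fun i => fst _ _ ≫ shiftedRoot (P := P) κ i.1)
      (fun i g => InversionSet b i g.1) U

/-- The algebra generated by `𝓗^d(U)` and `𝕊(U)`. -/
def dynSumSections (U : (HomTorus E X ⊗ HomTorus E Y).left.Opens) :
    Subring (Twisted (P.weylGroup × P.weylGroup) (HomTorus E X ⊗ HomTorus E Y).left) :=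
  Subring.closure (dynHeckeSections b t κ U ∪ dynTwistedSections b t κ U)

end Hecke

/-! ### Modules -/

section Modules

variable {G : Type*} [Group G] {T : Scheme.{0}} [IsIntegral T] [SchemeAction G T]

/-- Let `𝓢 U` be sets of rational sections of a twisted group algebra on `T`, for `U` open in `T`.
A coherent module over the sheaf of algebras generated by `𝓢` on `T / G` is a coherent sheaf on `T`
whose sections over the invariant open subsets `U` (that is, the open subsets of `T / G`) are
compatibly modules over the algebra generated by `𝓢 U`, such that the functions in it act by
multiplication. -/
structure HeckeModule (𝓢 : T.Opens → Set (Twisted G T)) where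
  /-- the underlying coherent sheaf -/
  sheaf : T.Modules
  coherent : sheaf.IsFinitePresentation
  /-- the action over an invariant open subset -/
  act : ∀ U : T.Opens, SchemeAction.IsInvariant G U →
    (Subring.closure (𝓢 U) →+* AddMonoid.End Γ(sheaf, U))
  act_res : ∀ (U U' : T.Opens) (hU : SchemeAction.IsInvariant G U)
    (hU' : SchemeAction.IsInvariant G U') (h : U' ≤ U) (a : Twisted G T)
    (ha : a ∈ Subring.closure (𝓢 U)) (ha' : a ∈ Subring.closure (𝓢 U')) (m : Γ(sheaf, U)),
    sheaf.presheaf.map (homOfLE h).op (act U hU ⟨a, ha⟩ m) =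
      act U' hU' ⟨a, ha'⟩ (sheaf.presheaf.map (homOfLE h).op m)
  act_fun : ∀ (U : T.Opens) (hU : SchemeAction.IsInvariant G U) (x : U) (r : Γ(T, U))
    (h : SkewMonoidAlgebra.single 1 (regValue x r) ∈ Subring.closure (𝓢 U)) (m : Γ(sheaf, U)),
    act U hU ⟨_, h⟩ m = r • m

namespace HeckeModule

variable {𝓢 : T.Opens → Set (Twisted G T)}

/-- Homomorphisms of modules: homomorphisms of the underlying sheaves that commute with the
actions. -/
@[ext]
structure Hom (M N : HeckeModule 𝓢) where
  /-- the underlying homomorphism of sheaves of modules -/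
  hom : M.sheaf ⟶ N.sheaf
  comm : ∀ (U : T.Opens) (hU : SchemeAction.IsInvariant G U) (a : Subring.closure (𝓢 U))
    (m : Γ(M.sheaf, U)), hom.app U (M.act U hU a m) = N.act U hU a (hom.app U m)

instance : Category (HeckeModule 𝓢) where
  Hom := Hom
  id M := ⟨𝟙 M.sheaf, fun _ _ _ _ => rfl⟩
  comp f g := ⟨f.hom ≫ g.hom, fun U hU a m =>
    (congrArg (g.hom.app U) (f.comm U hU a m)).trans (g.comm U hU a _)⟩
  id_comp f := Hom.ext (Category.id_comp f.hom)
  comp_id f := Hom.ext (Category.comp_id f.hom)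
  assoc f g h := Hom.ext (Category.assoc f.hom g.hom h.hom)

variable (𝓢) in
/-- The forgetful functor to sheaves of modules. -/
def forget : HeckeModule 𝓢 ⥤ T.Modules where
  obj M := M.sheaf
  map f := f.hom
  map_id _ := rfl
  map_comp _ _ := rfl

end HeckeModule

end Modules

/-! ### The coproduct -/

section Main

variable {I X Y : Type*} [AddCommGroup X] [AddCommGroup Y]
  [Module.Free ℤ X] [Module.Finite ℤ X] [Module.Free ℤ Y] [Module.Finite ℤ Y]
  {P : RootPairing I ℤ X Y} (b : P.Base) {E : SchC} [GrpObj E] [IsEllipticCurve E]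
  (t : E.left.presheaf.stalk (zeroPt E)) (κ : 𝟙_ SchC ⟶ E)

/-- The category of `𝓗`-modules. -/
abbrev ModHecke := HeckeModule (heckeSections b t κ)

/-- The category of `𝓗^d`-modules. -/
abbrev ModDynHecke := HeckeModule (dynHeckeSections b t κ)

variable (X Y E) in
/-- The projection `p : 𝔄 × 𝔄^∨ ⟶ 𝔄`. -/
abbrev proj : (HomTorus E X ⊗ HomTorus E Y).left ⟶ (HomTorus E X).left :=
  (fst (HomTorus E X) (HomTorus E Y)).left

/-- The line bundle `𝕃` on `𝔄 × 𝔄^∨`. -/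
def twistBundle : (HomTorus E X ⊗ HomTorus E Y).left.Modules := lineBundle (twistDivisor b t κ)

/-- The functor `(𝕃 ⊗ -) ∘ p^*`. -/
def twistedPullback : (HomTorus E X).left.Modules ⥤ (HomTorus E X ⊗ HomTorus E Y).left.Modules :=
  Scheme.Modules.pullback (proj X Y E) ⋙ tensorL (twistBundle b t κ)

/-- The section `s ⊗ p^* n` of `𝕃 ⊗ p^*ℱ` over `U ⊆ p⁻¹ V`. -/
def twistedPullbackSection (F : (HomTorus E X).left.Modules)
    {U : (HomTorus E X ⊗ HomTorus E Y).left.Opens} {V : (HomTorus E X).left.Opens}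
    (h : U ≤ proj X Y E ⁻¹ᵁ V) (s : lineSections (twistDivisor b t κ) U) (n : Γ(F, V)) :
    Γ((twistedPullback b t κ).obj F, U) :=
  tensorSection (twistBundle b t κ) ((Scheme.Modules.pullback (proj X Y E)).obj F) U s
    (pullbackSection (proj X Y E) F h n)

variable (P E) in
/-- `∑ k, a k ⊗ h k` equals `Ψ(T) = ∑ T_{w,v} δ_w δ_v^d ⊗ δ_w`, where
`T = ∑ T_{w,v} δ_w δ_v^d`, as a rational section of `𝕊 ⊗ p^*(𝒪 ⋊ W)`. -/
def IsCoproduct (T : Twisted (P.weylGroup × P.weylGroup) (HomTorus E X ⊗ HomTorus E Y).left)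
    {m : ℕ} (a : Fin m → Twisted (P.weylGroup × P.weylGroup) (HomTorus E X ⊗ HomTorus E Y).left)
    (h : Fin m → Twisted P.weylGroup (HomTorus E X).left) : Prop :=
  open scoped Classical in
  ∀ w v w' : P.weylGroup,
    ∑ k, (a k).coeff (w, v) * functionFieldMap (proj X Y E) ((h k).coeff w') =
      if w' = w then T.coeff (w, v) else 0

end Main

end

end EllipticHecke

open EllipticHecke

open CategoryTheory MonoidalCategory AlgebraicGeometry

namespace EllipticHecke

noncomputable section

open CartesianMonoidalCategory Limits
open scoped MonObj
set_option linter.unusedSectionVars false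

/-! ### Regularity of rational functions at points -/

section Regular

variable {X : Scheme.{0}} [IsIntegral X]

/-! Write `X_α` for a local equation of a wall `D_α`, and for a simple reflection `s` let `p_s` be a
local equation of the shifted divisor (or `1`, for coroots) divided by `X_s`. Two facts give part
(1): locally the dynamical Hecke algebra is generated by regular functions and the Demazure elements
`p_s (δ_s - 1)`, and `Ψ` is multiplicative.

The generation statement is `IsHecke.induction`, proved by triangularity with respect to length. If
`a_g` is a coefficient of maximal length, then for `α` outside `Φ(g)` the element `s_α g` is longer,
so its coefficient is zero and the residue condition removes the pole of `a_g` along `D_α`; for `α`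
in `Φ(g)` the vanishing condition gives a zero along the shifted divisor. Hence `a_g` is divisible
by the leading coefficient of the product of Demazure elements along a reduced word of `g`
(`IsHecke.div_leadEq_mem`). That product satisfies the Hecke conditions (`IsHecke.demazure_mul`), so
a multiple of it can be subtracted. The argument is made once for a reflection group acting on a
torus (`HeckeDatum`, `HeckeGeom`) and then applied to `W` on `𝔄` and to `W × W` on `𝔄 × 𝔄^∨`.

The geometric input is that a nonzero character of the torus has a reduced zero divisor
(`IsTorus.mem_span_tpull`), that independent characters have divisors without common components
(`IsTorus.apply_ne_zeroPt`), and that a reflection fixes its wall pointwise and acts by `-1` on the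
conormal space. All of this comes from the expansion `t(f + g) = t(f) + t(g) + t(f) t(g) b` of a
local parameter under addition (`tpull_mul`) and from characteristic zero.

The induction needs each `p_s`, and a trivialization of `𝕃`, to be a single rational function on an
invariant open set, that is, near a whole orbit. Prime avoidance supplies a parameter at the origin
of `E` that is a unit at any finite set of other points (`exists_semilocal_parameter`); pulling it
back gives the small sets of `exists_goodPair`. Conjugation by a trivialization then reduces
coefficients in `𝕃` to ordinary functions (`mem_lineHecke_iff`).

On generators `Ψ` is explicit. A function `f` goes to `f ⊗ 1`, a Demazure element `Δ` of a coroot to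
`Δ ⊗ 1`, and for a root, whose coefficient `p` comes from `𝔄`, `Ψ(p (δ_s - 1)) = δ_s ⊗ p (δ_s - 1) +
p (δ_s - 1) ⊗ 1`. The factor `δ_s` in the first summand is a section of `𝕊`, which is why `𝕊` has to
be added to `𝓗^d`.

For part (2), over a good pair `(U, V)` of affine sets the sections of `𝕃 ⊗ p^*ℱ` are `𝕃(U) ⊗_{𝒪(V)}
ℱ(V)`, and `T` should send `ℓ ⊗ n` to `∑ a_k(ℓ) ⊗ h_k n`. Independence of the decomposition of
`Ψ(T)` is `GoodPair.sum_eq_zero`: since `𝒪(U)` is flat over `𝒪(V)`, and `𝓗(V)` embeds in a finite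
power of the function field of `𝔄`, a relation `∑ ℓ_k ⊗ h_k = 0` between rational sections already
holds in `𝕃(U) ⊗ 𝓗(V)` and can be applied to `n`. Well-definedness over `𝒪(V)`, multiplicativity and
compatibility with restriction are all instances of this uniqueness, and the local operators glue
over arbitrary invariant open sets. -/

/-- The rational functions that are regular at `x`. -/
def regAt (x : X) : Subring X.functionField :=
  (algebraMap (X.presheaf.stalk x) X.functionField).range

/-- The rational functions that are regular at `x` and vanish there. -/
def vanAt (x : X) : Set X.functionField :=
  algebraMap (X.presheaf.stalk x) X.functionField ''
    (IsLocalRing.maximalIdeal (X.presheaf.stalk x) : Set (X.presheaf.stalk x))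

lemma algebraMap_mem_regAt {x : X} (r : X.presheaf.stalk x) :
    algebraMap _ X.functionField r ∈ regAt x := ⟨r, rfl⟩

lemma stalk_algebraMap_injective (x : X) :
    Function.Injective (algebraMap (X.presheaf.stalk x) X.functionField) :=
  IsFractionRing.injective _ _

lemma algebraMap_stalkSpecializes {x y : X} (h : y ⤳ x) (r : X.presheaf.stalk x) :
    algebraMap _ X.functionField (X.presheaf.stalkSpecializes h r) =
      algebraMap _ X.functionField r := by
  simp only [RingHom.algebraMap_toAlgebra]
  rw [← ConcreteCategory.comp_apply (X.presheaf.stalkSpecializes h),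
    TopCat.Presheaf.stalkSpecializes_comp]

lemma zero_mem_vanAt (x : X) : (0 : X.functionField) ∈ vanAt x := ⟨0, by simp, by simp⟩

lemma add_mem_vanAt {x : X} {a b : X.functionField} (ha : a ∈ vanAt x) (hb : b ∈ vanAt x) :
    a + b ∈ vanAt x := by
  obtain ⟨r, hr, rfl⟩ := ha
  obtain ⟨s, hs, rfl⟩ := hb
  exact ⟨r + s, Ideal.add_mem _ hr hs, map_add _ _ _⟩

lemma mul_mem_vanAt {x : X} {a b : X.functionField} (ha : a ∈ regAt x) (hb : b ∈ vanAt x) :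
    a * b ∈ vanAt x := by
  obtain ⟨r, rfl⟩ := ha
  obtain ⟨s, hs, rfl⟩ := hb
  exact ⟨r * s, Ideal.mul_mem_left _ _ hs, map_mul _ _ _⟩

lemma mul_mem_vanAt' {x : X} {a b : X.functionField} (ha : a ∈ vanAt x) (hb : b ∈ regAt x) :
    a * b ∈ vanAt x := mul_comm b a ▸ mul_mem_vanAt hb ha

lemma algebraMap_mem_vanAt {x : X} {r : X.presheaf.stalk x} :
    algebraMap _ X.functionField r ∈ vanAt x ↔ r ∈ IsLocalRing.maximalIdeal _ := by
  constructor
  · rintro ⟨s, hs, h⟩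
    rwa [← stalk_algebraMap_injective x h]
  · exact fun h => ⟨r, h, rfl⟩

lemma inv_mem_regAt {x : X} {a : X.functionField} (h : a ∈ regAt x) (h' : a ∉ vanAt x) :
    a⁻¹ ∈ regAt x := by
  obtain ⟨r, rfl⟩ := h
  rw [algebraMap_mem_vanAt, IsLocalRing.notMem_maximalIdeal] at h'
  obtain ⟨u, rfl⟩ := h'
  refine ⟨(u⁻¹ : (X.presheaf.stalk x)ˣ), ?_⟩
  exact eq_inv_of_mul_eq_one_left (by rw [← map_mul, Units.inv_mul, map_one])

/-- `a` and `b` differ by a unit at `x`. -/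
def AssocAt (x : X) (a b : X.functionField) : Prop :=
  a ≠ 0 ∧ b ≠ 0 ∧ a / b ∈ regAt x ∧ b / a ∈ regAt x

namespace AssocAt

variable {x : X} {a b c a' b' : X.functionField}

lemma refl (ha : a ≠ 0) : AssocAt x a a := ⟨ha, ha, by simp [ha], by simp [ha]⟩

lemma symm (h : AssocAt x a b) : AssocAt x b a := ⟨h.2.1, h.1, h.2.2.2, h.2.2.1⟩

lemma mul (h : AssocAt x a b) (h' : AssocAt x a' b') : AssocAt x (a * a') (b * b') := by
  refine ⟨mul_ne_zero h.1 h'.1, mul_ne_zero h.2.1 h'.2.1, ?_, ?_⟩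
  · rw [mul_div_mul_comm]; exact mul_mem h.2.2.1 h'.2.2.1
  · rw [mul_div_mul_comm]; exact mul_mem h.2.2.2 h'.2.2.2

lemma inv (h : AssocAt x a b) : AssocAt x a⁻¹ b⁻¹ :=
  ⟨inv_ne_zero h.1, inv_ne_zero h.2.1, by rw [inv_div_inv]; exact h.2.2.2, by
    rw [inv_div_inv]; exact h.2.2.1⟩

lemma div (h : AssocAt x a b) (h' : AssocAt x a' b') : AssocAt x (a / a') (b / b') := by
  rw [div_eq_mul_inv, div_eq_mul_inv]; exact h.mul h'.inv

lemma prod {κ : Type*} (s : Finset κ) {f g : κ → X.functionField}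
    (h : ∀ i ∈ s, AssocAt x (f i) (g i)) : AssocAt x (∏ i ∈ s, f i) (∏ i ∈ s, g i) := by
  classical
  induction s using Finset.induction_on with
  | empty => simpa using! refl one_ne_zero
  | insert i s hi ih =>
    rw [Finset.prod_insert hi, Finset.prod_insert hi]
    exact (h i (by simp)).mul (ih fun j hj => h j (by simp [hj]))

/-- Multiplication by associated functions preserves regularity. -/
lemma mul_mem_iff (h : AssocAt x a b) : a * c ∈ regAt x ↔ b * c ∈ regAt x := by
  obtain ⟨h1, h2, h3, h4⟩ := h
  constructor
  · intro h
    have := mul_mem h4 h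
    rwa [← mul_assoc, div_mul_cancel₀ _ h1] at this
  · intro h
    have := mul_mem h3 h
    rwa [← mul_assoc, div_mul_cancel₀ _ h2] at this

lemma mul_mem_vanAt_iff (h : AssocAt x a b) : a * c ∈ vanAt x ↔ b * c ∈ vanAt x := by
  obtain ⟨h1, h2, h3, h4⟩ := h
  constructor
  · intro h
    have := mul_mem_vanAt h4 h
    rwa [← mul_assoc, div_mul_cancel₀ _ h1] at this
  · intro h
    have := mul_mem_vanAt h3 h
    rwa [← mul_assoc, div_mul_cancel₀ _ h2] at this

lemma mem_iff (h : AssocAt x a b) : a ∈ regAt x ↔ b ∈ regAt x := by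
  simpa using h.mul_mem_iff (c := 1)

lemma one_of_mem (h : a ∈ regAt x) (h' : a ∉ vanAt x) : AssocAt x a 1 :=
  ⟨fun h0 => h' (h0 ▸ zero_mem_vanAt x), one_ne_zero, by simpa, by
    simpa using inv_mem_regAt h h'⟩

end AssocAt

/-- A germ is represented on a neighbourhood, where the same rational function is regular. -/
lemma isOpen_setOf_mem_regAt (a : X.functionField) : IsOpen {x : X | a ∈ regAt x} := by
  rw [isOpen_iff_forall_mem_open]
  rintro x ⟨r, rfl⟩
  obtain ⟨U, hxU, s, rfl⟩ := X.presheaf.exists_germ_eq r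
  refine ⟨U, fun y hy => ⟨X.presheaf.germ U y hy s, ?_⟩, U.isOpen, hxU⟩
  have : Nonempty U := ⟨⟨x, hxU⟩⟩
  rw [Scheme.algebraMap_germ_eq_germToFunctionField,
    Scheme.algebraMap_germ_eq_germToFunctionField]

lemma isOpen_setOf_assocAt (a b : X.functionField) : IsOpen {x : X | AssocAt x a b} := by
  by_cases ha : a = 0
  · simp [AssocAt, ha]
  by_cases hb : b = 0
  · simp [AssocAt, hb]
  simp only [AssocAt, ne_eq, ha, not_false_eq_true, hb, true_and]
  exact (isOpen_setOf_mem_regAt _).inter (isOpen_setOf_mem_regAt _)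

lemma mem_lineStalk {d : X → X.functionField} {x : X} {a : X.functionField} :
    a ∈ lineStalk d x ↔ a * d x ∈ regAt x := Iff.rfl

lemma functionFieldMap_algebraMap {Y : Scheme.{0}} [IsIntegral Y] (f : X ⟶ Y) [IsDominant f]
    (x : X) (r : Y.presheaf.stalk (f x)) :
    functionFieldMap f (algebraMap _ Y.functionField r) =
      algebraMap _ X.functionField (f.stalkMap x r) := by
  simp only [RingHom.algebraMap_toAlgebra, functionFieldMap]
  have h := Scheme.Hom.stalkSpecializes_stalkMap f (genericPoint X) x
    ((genericPoint_spec X).specializes trivial)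
  have h2 := congrArg (fun φ => φ.hom r) h
  simp only [CommRingCat.hom_comp, RingHom.comp_apply] at h2 ⊢
  rw [← h2]
  congr 1
  rw [← RingHom.comp_apply, ← CommRingCat.hom_comp, TopCat.Presheaf.stalkSpecializes_comp]

lemma functionFieldMap_mem_regAt {Y : Scheme.{0}} [IsIntegral Y] (f : X ⟶ Y) [IsDominant f]
    {x : X} {a : Y.functionField} (h : a ∈ regAt (f x)) : functionFieldMap f a ∈ regAt x := by
  obtain ⟨r, rfl⟩ := h
  rw [functionFieldMap_algebraMap]
  exact ⟨_, rfl⟩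

lemma functionFieldMap_mem_vanAt {Y : Scheme.{0}} [IsIntegral Y] (f : X ⟶ Y) [IsDominant f]
    {x : X} {a : Y.functionField} (h : a ∈ vanAt (f x)) : functionFieldMap f a ∈ vanAt x := by
  obtain ⟨r, hr, rfl⟩ := h
  rw [functionFieldMap_algebraMap, algebraMap_mem_vanAt]
  exact (IsLocalRing.mem_maximalIdeal _).2
    (map_mem_nonunits_iff (f.stalkMap x).hom r |>.2 hr)

lemma AssocAt.functionFieldMap {Y : Scheme.{0}} [IsIntegral Y] (f : X ⟶ Y) [IsDominant f]
    {x : X} {a b : Y.functionField} (h : AssocAt (f x) a b) :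
    AssocAt x (functionFieldMap f a) (functionFieldMap f b) := by
  refine ⟨(map_ne_zero _).2 h.1, (map_ne_zero _).2 h.2.1, ?_, ?_⟩
  · rw [← map_div₀]; exact functionFieldMap_mem_regAt f h.2.2.1
  · rw [← map_div₀]; exact functionFieldMap_mem_regAt f h.2.2.2

/-- A rational function that is regular at the points of an open subset is a regular function. -/
lemma exists_regValue_eq (U : X.Opens) (a : X.functionField) (h : ∀ x ∈ U, a ∈ regAt x) :
    ∃ r : Γ(X, U), ∀ x : U, regValue x r = a := by
  have h' : ∀ x : U, ∃ (V : X.Opens) (_ : x.1 ∈ V) (hV : V ≤ U) (s : Γ(X, V)),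
      ∀ y : V, regValue y s = a := by
    intro x
    obtain ⟨r, hr⟩ := h x.1 x.2
    obtain ⟨V, hV, s, rfl⟩ := X.presheaf.exists_germ_eq r
    refine ⟨V ⊓ U, ⟨hV, x.2⟩, inf_le_right, X.presheaf.map (homOfLE inf_le_left).op s,
      fun y => ?_⟩
    rw [regValue_res, regValue_eq _ ⟨x.1, hV⟩, ← hr]
    rfl
  choose V hV hVU s hs using h'
  obtain ⟨r, hr, -⟩ := TopCat.Sheaf.existsUnique_gluing' X.sheaf V U (fun x => homOfLE (hVU x))
    (fun x hx => TopologicalSpace.Opens.mem_iSup.2 ⟨⟨x, hx⟩, hV ⟨x, hx⟩⟩) s (by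
      intro x y
      by_cases hne : Nonempty (V x ⊓ V y : X.Opens)
      · obtain ⟨z⟩ := hne
        apply germ_injective_of_isIntegral X z.1 z.2
        apply stalk_algebraMap_injective z.1
        refine (regValue_res (inf_le_left : V x ⊓ V y ≤ V x) z (s x)).trans ?_
        refine Eq.trans ?_ (regValue_res (inf_le_right : V x ⊓ V y ≤ V y) z (s y)).symm
        rw [hs, hs]
      · have : (V x ⊓ V y : X.Opens) = ⊥ := by
          ext z
          simp only [TopologicalSpace.Opens.coe_bot, Set.mem_empty_iff_false, iff_false]
          exact fun hz => hne ⟨⟨z, hz⟩⟩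
        have hsub : Subsingleton Γ(X, V x ⊓ V y) := by rw [this]; infer_instance
        exact hsub.elim _ _)
  refine ⟨r, fun x => ?_⟩
  have := regValue_res (hVU x) ⟨x.1, hV x⟩ r
  rw [← this]
  exact (congrArg _ (hr x)).trans (hs x _)

end Regular

section Action

variable {G : Type*} [Group G] {X : Scheme.{0}} [IsIntegral X] [SchemeAction G X]


lemma inv_apply_mul (g h : G) (x : X) : SchemeAction.inv (g * h) x = SchemeAction.inv h
    (SchemeAction.inv g x) := by
  rw [SchemeAction.inv_mul]; rfl

lemma inv_apply_one (x : X) : SchemeAction.inv (1 : G) x = x := by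
  rw [SchemeAction.inv_one]; rfl

lemma inv_apply_inv_left (g : G) (x : X) : SchemeAction.inv g⁻¹ (SchemeAction.inv g x) = x := by
  rw [← inv_apply_mul, mul_inv_cancel, inv_apply_one]

lemma inv_apply_inv_right (g : G) (x : X) : SchemeAction.inv g (SchemeAction.inv g⁻¹ x) = x := by
  rw [← inv_apply_mul, inv_mul_cancel, inv_apply_one]

lemma smul_eq_functionFieldMap (g : G) (a : X.functionField) :
    g • a = functionFieldMap (SchemeAction.inv g) a := rfl

lemma smul_mem_regAt (g : G) {x : X} {a : X.functionField} :
    g • a ∈ regAt x ↔ a ∈ regAt (SchemeAction.inv g x) := by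
  refine ⟨fun h => ?_, fun h => functionFieldMap_mem_regAt (SchemeAction.inv g) h⟩
  have := functionFieldMap_mem_regAt (SchemeAction.inv g⁻¹) (x := SchemeAction.inv g x) (a := g • a)
    (by rwa [inv_apply_inv_left])
  rwa [← smul_eq_functionFieldMap, inv_smul_smul] at this

lemma smul_mem_vanAt (g : G) {x : X} {a : X.functionField} :
    g • a ∈ vanAt x ↔ a ∈ vanAt (SchemeAction.inv g x) := by
  refine ⟨fun h => ?_, fun h => functionFieldMap_mem_vanAt (SchemeAction.inv g) h⟩
  have := functionFieldMap_mem_vanAt (SchemeAction.inv g⁻¹) (x := SchemeAction.inv g x) (a := g • a)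
    (by rwa [inv_apply_inv_left])
  rwa [← smul_eq_functionFieldMap, inv_smul_smul] at this

lemma AssocAt.smul (g : G) {x : X} {a b : X.functionField}
    (h : AssocAt (SchemeAction.inv g x) a b) :
    AssocAt x (g • a) (g • b) :=
  AssocAt.functionFieldMap (SchemeAction.inv g) h

lemma inv_mem_iff_of_isInvariant {U : X.Opens} (hU : SchemeAction.IsInvariant G U) (g : G) {x : X} :
    SchemeAction.inv g x ∈ U ↔ x ∈ U := by
  conv_rhs => rw [← hU g]
  rfl

lemma isInvariant_inf {U V : X.Opens} (hU : SchemeAction.IsInvariant G U)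
    (hV : SchemeAction.IsInvariant G V) :
    SchemeAction.IsInvariant G (U ⊓ V) := fun g => by
  rw [Scheme.Hom.preimage_inf, hU g, hV g]

/-- The largest invariant open subset of an open subset. -/
def invCore (G : Type*) [Group G] [Finite G] [SchemeAction G X] (U : X.Opens) : X.Opens :=
  ⟨⋂ g : G, SchemeAction.inv g ⁻¹ᵁ U, isOpen_iInter_of_finite fun g =>
      (SchemeAction.inv g ⁻¹ᵁ U).isOpen⟩

lemma mem_invCore [Finite G] {U : X.Opens} {x : X} : x ∈ invCore G U ↔ ∀ g : G, SchemeAction.inv g x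
    ∈ U := by
  change x ∈ (⋂ g : G, (SchemeAction.inv g ⁻¹ᵁ U : Set X)) ↔ _
  rw [Set.mem_iInter]; rfl

lemma isInvariant_invCore [Finite G] (U : X.Opens) : SchemeAction.IsInvariant G (invCore G U) := by
  intro g
  ext x
  change SchemeAction.inv g x ∈ invCore G U ↔ x ∈ invCore G U
  simp only [mem_invCore, ← inv_apply_mul]
  exact ⟨fun h k => by simpa using h (g⁻¹ * k), fun h k => h (g * k)⟩

lemma invCore_le [Finite G] (U : X.Opens) : invCore G U ≤ U := fun x hx => by
  simpa [inv_apply_one] using mem_invCore.1 hx 1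

end Action

/-! ### Points and fibres over `ℂ` -/

section Fibres

/-- The closed point of `Spec ℂ`, as a point of the unit object. -/
def unitPt : (𝟙_ SchC).left := IsLocalRing.closedPoint ℂ

/-- The point of `E` underlying a `ℂ`-valued point. -/
def ptOf {E : SchC} (s : 𝟙_ SchC ⟶ E) : E.left := s.left unitPt

lemma eq_unitPt (x : (𝟙_ SchC).left) : x = unitPt :=
  Subsingleton.elim (α := PrimeSpectrum ℂ) x unitPt

lemma comp_constant_left {E S : SchC} (s : 𝟙_ SchC ⟶ E) (x : S.left) :
    (toUnit S ≫ s).left x = ptOf s := by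
  rw [Over.comp_left, Scheme.Hom.comp_apply, eq_unitPt ((toUnit S).left x)]
  rfl

lemma toUnit_left (S : SchC) : (toUnit S).left = S.hom := by
  have := Over.w (toUnit S)
  exact (Category.comp_id _).symm.trans this

lemma isClosed_ptOf {E : SchC} [LocallyOfFiniteType E.hom] (s : 𝟙_ SchC ⟶ E) :
    IsClosed {ptOf s} :=
  (pointEquivClosedPoint E.hom ⟨s.left, Over.w s⟩).2

lemma exists_ptOf_eq {E : SchC} [LocallyOfFiniteType E.hom] {x : E.left} (hx : IsClosed {x}) :
    ∃ s : 𝟙_ SchC ⟶ E, ptOf s = x :=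
  ⟨Over.homMk (pointOfClosedPoint E.hom x hx) (pointOfClosedPoint_comp E.hom x hx),
    pointOfClosedPoint_apply E.hom x hx _⟩

lemma ptOf_injective {E : SchC} [LocallyOfFiniteType E.hom] {s s' : 𝟙_ SchC ⟶ E}
    (h : ptOf s = ptOf s') : s = s' :=
  Over.OverMorphism.ext (ext_of_apply_closedPoint_eq E.hom (Over.w s) (Over.w s') h)

lemma stalkSpecializes_apply_apply {X : Scheme.{0}} {x y z : X} (h : x ⤳ y) (h' : y ⤳ z)
    (a : X.presheaf.stalk z) :
    X.presheaf.stalkSpecializes h (X.presheaf.stalkSpecializes h' a) =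
      X.presheaf.stalkSpecializes (h.trans h') a := by
  rw [← ConcreteCategory.comp_apply, TopCat.Presheaf.stalkSpecializes_comp]

/-- A morphism from an affine scheme that factors through a local ring and kills the maximal
ideal factors through the closed point. -/
lemma comp_fromSpecStalk_eq_of_map_eq_zero {X : Scheme.{0}} (π : X ⟶ Spec (.of ℂ))
    [LocallyOfFiniteType π] (x : X) (hx : IsClosed {x}) {Q : CommRingCat.{0}}
    (φ : X.presheaf.stalk x ⟶ Q) (hφ : ∀ a ∈ IsLocalRing.maximalIdeal (X.presheaf.stalk x),
      φ.hom a = 0) :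
    Spec.map φ ≫ X.fromSpecStalk x =
      (Spec.map φ ≫ X.fromSpecStalk x ≫ π) ≫ pointOfClosedPoint π x hx := by
  let ψ : X.residueField x ⟶ Q := CommRingCat.ofHom (Ideal.Quotient.lift _ φ.hom hφ)
  have hψ : φ = X.residue x ≫ ψ := by
    ext a
    exact (Ideal.Quotient.lift_mk _ φ.hom hφ).symm
  have h1 : Spec.map φ ≫ X.fromSpecStalk x = Spec.map ψ ≫ X.fromSpecResidueField x := by
    rw [hψ, Spec.map_comp, Category.assoc]; rfl
  have h2 : X.fromSpecResidueField x ≫ π ≫ pointOfClosedPoint π x hx =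
      X.fromSpecResidueField x := by
    rw [pointOfClosedPoint, ← Category.assoc, ← SpecMap_residueFieldIsoBase_inv π x hx,
      ← Spec.map_comp_assoc, Iso.hom_inv_id, Spec.map_id, Category.id_comp]
  rw [← Category.assoc (Spec.map φ), h1, Category.assoc, Category.assoc, h2]

/-- `T` is a product of `E` and `T'`, with projections `π` and `ρ`, as far as uniqueness of
morphisms is concerned, and `i` is the inclusion of the fibre of `π` over the point `s`. -/
structure IsFibre {E T T' : SchC} (π : T ⟶ E) (ρ : T ⟶ T') (s : 𝟙_ SchC ⟶ E) (i : T' ⟶ T) :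
    Prop where
  hom_ext : ∀ {S : SchC} (u v : S ⟶ T), u ≫ π = v ≫ π → u ≫ ρ = v ≫ ρ → u = v
  comp_fst : i ≫ π = toUnit T' ≫ s
  comp_snd : i ≫ ρ = 𝟙 T'

namespace IsFibre

variable {E T T' : SchC} [LocallyOfFiniteType E.hom] {π : T ⟶ E} {ρ : T ⟶ T'}
  {s : 𝟙_ SchC ⟶ E} {i : T' ⟶ T}

/-- The ideal generated by the maximal ideal of `E` at `π x`. -/
def fibreIdeal (π : T ⟶ E) (x : T.left) : Ideal (T.left.presheaf.stalk x) :=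
  Ideal.map (π.left.stalkMap x).hom (IsLocalRing.maximalIdeal (E.left.presheaf.stalk (π.left x)))

lemma fibreIdeal_le (x : T.left) : fibreIdeal π x ≤ IsLocalRing.maximalIdeal _ := by
  rw [fibreIdeal, Ideal.map_le_iff_le_comap]
  intro a ha
  exact (IsLocalRing.mem_maximalIdeal _).2 (map_mem_nonunits_iff (π.left.stalkMap x).hom a |>.2 ha)

/-- A `Q`-point through `x` on which the pulled back maximal ideal of `E` dies has constant
`π`-coordinate `s`. It therefore has the same two coordinates as its image under `ρ ≫ i`, and
coordinates determine morphisms. The next two results specialize `Q`. -/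
lemma comp_fromSpecStalk (h : IsFibre π ρ s i) {x : T.left} (hx : π.left x = ptOf s)
    {Q : CommRingCat.{0}} (q : T.left.presheaf.stalk x ⟶ Q)
    (hq : ∀ a ∈ IsLocalRing.maximalIdeal (E.left.presheaf.stalk (π.left x)),
      (π.left.stalkMap x ≫ q).hom a = 0) :
    Spec.map q ≫ T.left.fromSpecStalk x =
      Spec.map q ≫ T.left.fromSpecStalk x ≫ ρ.left ≫ i.left := by
  have hcl : IsClosed {π.left x} := hx ▸ isClosed_ptOf s
  have hp : pointOfClosedPoint E.hom (π.left x) hcl = s.left := by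
    refine ext_of_apply_closedPoint_eq E.hom (pointOfClosedPoint_comp _ _ _) (Over.w s) ?_
    exact (pointOfClosedPoint_apply E.hom (π.left x) hcl _).trans hx
  have h1 : Spec.map q ≫ T.left.fromSpecStalk x ≫ π.left =
      Spec.map q ≫ T.left.fromSpecStalk x ≫ T.hom ≫ s.left := by
    have := comp_fromSpecStalk_eq_of_map_eq_zero E.hom (π.left x) hcl (π.left.stalkMap x ≫ q) hq
    rw [hp, Spec.map_comp, Category.assoc, Category.assoc] at this
    simp only [Scheme.SpecMap_stalkMap_fromSpecStalk, Scheme.SpecMap_stalkMap_fromSpecStalk_assoc,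
      Category.assoc] at this
    rw [this, reassoc_of% (Over.w π)]
  let S : SchC := Over.mk (Spec.map q ≫ T.left.fromSpecStalk x ≫ T.hom)
  let u : S ⟶ T := Over.homMk (Spec.map q ≫ T.left.fromSpecStalk x) (Category.assoc _ _ _)
  have h2 : u = u ≫ ρ ≫ i := by
    refine h.hom_ext _ _ ?_ ?_
    · rw [Category.assoc, Category.assoc, h.comp_fst]
      ext1
      have h3 : ρ.left ≫ (toUnit T').left = T.hom := by rw [toUnit_left, Over.w ρ]
      change (Spec.map q ≫ T.left.fromSpecStalk x) ≫ π.left =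
        (Spec.map q ≫ T.left.fromSpecStalk x) ≫ ρ.left ≫ (toUnit T').left ≫ s.left
      rw [reassoc_of% h3, Category.assoc, Category.assoc, h1]
    · rw [Category.assoc, Category.assoc, h.comp_snd, Category.comp_id]
  have h4 := congrArg CommaMorphism.left h2
  refine h4.trans ?_
  change (Spec.map q ≫ T.left.fromSpecStalk x) ≫ ρ.left ≫ i.left = _
  rw [Category.assoc]

/-- This is the test on the residue field of `x`. -/
lemma eq_of_fst_eq (h : IsFibre π ρ s i) {x : T.left} (hx : π.left x = ptOf s) :
    x = i.left (ρ.left x) := by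
  have h1 := h.comp_fromSpecStalk hx (T.left.residue x) (fun a ha => by
    refine (IsLocalRing.residue_eq_zero_iff _).2 ?_
    exact (IsLocalRing.mem_maximalIdeal _).2
      (map_mem_nonunits_iff (π.left.stalkMap x).hom a |>.2 ha))
  have h2 : T.left.fromSpecResidueField x =
      T.left.fromSpecResidueField x ≫ ρ.left ≫ i.left := by
    refine h1.trans ?_
    rw [← Category.assoc]; rfl
  have h3 := (T.left.fromSpecResidueField_apply x default).symm.trans
    (congrArg (fun φ : Spec (T.left.residueField x) ⟶ T.left => φ default) h2)
  refine h3.trans ?_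
  change i.left (ρ.left (T.left.fromSpecResidueField x default)) = _
  rw [Scheme.fromSpecResidueField_apply]

lemma fst_apply (h : IsFibre π ρ s i) (y : T'.left) : π.left (i.left y) = ptOf s := by
  rw [← Scheme.Hom.comp_apply, ← Over.comp_left, h.comp_fst, comp_constant_left]

/-- The kernel of restriction to the fibre. -/
lemma ker_stalkMap (h : IsFibre π ρ s i) {x : T.left} (hx : π.left x = ptOf s)
    {a : T.left.presheaf.stalk x}
    (ha : (i.left.stalkMap (ρ.left x)).hom
      (T.left.presheaf.stalkSpecializes (specializes_of_eq (h.eq_of_fst_eq hx).symm) a) = 0) :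
    a ∈ fibreIdeal π x := by
  -- Every such `q` factors through restriction to the fibre and so kills `a`; the quotient of the
  -- stalk by the fibre ideal is then taken as `Q`.
  have key : ∀ {Q : CommRingCat.{0}} (q : T.left.presheaf.stalk x ⟶ Q)
    (_ : ∀ a ∈ IsLocalRing.maximalIdeal (E.left.presheaf.stalk (π.left x)),
      (π.left.stalkMap x ≫ q).hom a = 0), q.hom a = 0 := by
    intro Q q hq
    have h1 := h.comp_fromSpecStalk hx q hq
    have h2 : Spec.map q ≫ T.left.fromSpecStalk x = Spec.map
        (T.left.presheaf.stalkSpecializes (specializes_of_eq (h.eq_of_fst_eq hx).symm) ≫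
          i.left.stalkMap (ρ.left x) ≫ ρ.left.stalkMap x ≫ q) ≫ T.left.fromSpecStalk x := by
      rw [h1]
      simp only [Spec.map_comp, Category.assoc, Scheme.SpecMap_stalkSpecializes_fromSpecStalk,
        Scheme.SpecMap_stalkMap_fromSpecStalk, Scheme.SpecMap_stalkMap_fromSpecStalk_assoc]
    have h3 := Spec.map_injective ((cancel_mono _).1 h2)
    rw [h3]
    simp only [CommRingCat.hom_comp, RingHom.comp_apply]
    erw [ha]
    simp
  refine Ideal.Quotient.eq_zero_iff_mem.1
    (key (CommRingCat.ofHom (Ideal.Quotient.mk (fibreIdeal π x))) fun b hb => ?_)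
  exact Ideal.Quotient.eq_zero_iff_mem.2 (Ideal.mem_map_of_mem _ hb)

/-- A function that is regular at a point of the fibre and vanishes at the generic point of the
fibre is in the ideal of the fibre. -/
lemma mem_fibreIdeal [IsIntegral T'.left] (h : IsFibre π ρ s i) {x : T.left}
    (hx : π.left x = ptOf s) (hgen : i.left (genericPoint T'.left) ⤳ x)
    {a : T.left.presheaf.stalk x}
    (ha : T.left.presheaf.stalkSpecializes hgen a ∈ IsLocalRing.maximalIdeal _) :
    a ∈ fibreIdeal π x := by
  refine h.ker_stalkMap hx (stalk_algebraMap_injective _ ?_)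
  rw [map_zero, RingHom.algebraMap_toAlgebra]
  have h1 := Scheme.Hom.stalkSpecializes_stalkMap_apply i.left (genericPoint T'.left) (ρ.left x)
    ((genericPoint_spec T'.left).specializes trivial)
    (T.left.presheaf.stalkSpecializes (specializes_of_eq (h.eq_of_fst_eq hx).symm) a)
  refine h1.symm.trans ?_
  rw [stalkSpecializes_apply_apply]
  have h2 : (i.left.stalkMap (genericPoint T'.left)).hom (T.left.presheaf.stalkSpecializes hgen a) ∈
      IsLocalRing.maximalIdeal _ := (IsLocalRing.mem_maximalIdeal _).2
    (map_mem_nonunits_iff (i.left.stalkMap (genericPoint T'.left)).hom _ |>.2 ha)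
  by_contra hne
  exact (IsLocalRing.mem_maximalIdeal _).1 h2 ((isUnit_iff_ne_zero (G₀ := T'.left.functionField)).2
      hne)

lemma generic_specializes [IsIntegral T'.left] (h : IsFibre π ρ s i) {x : T.left}
    (hx : π.left x = ptOf s) : i.left (genericPoint T'.left) ⤳ x := by
  rw [h.eq_of_fst_eq hx]
  exact ((genericPoint_spec T'.left).specializes trivial).map i.left.continuous

end IsFibre

end Fibres

/-! ### Local parameters of an elliptic curve -/

section Translation

variable {T : SchC} [GrpObj T]

/-- Translation by a point. -/
def transl (s : 𝟙_ SchC ⟶ T) : T ⟶ T := 𝟙 T * toUnit T ≫ s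

lemma comp_transl {S : SchC} (u : S ⟶ T) (s : 𝟙_ SchC ⟶ T) :
    u ≫ transl s = u * toUnit S ≫ s := by
  rw [transl, MonObj.comp_mul, Category.comp_id, ← Category.assoc, comp_toUnit]

lemma transl_comp_transl (s s' : 𝟙_ SchC ⟶ T) : transl s ≫ transl s' = transl (s * s') := by
  rw [comp_transl, transl, transl, MonObj.comp_mul, mul_assoc]

lemma transl_one : transl (1 : 𝟙_ SchC ⟶ T) = 𝟙 T := by
  rw [transl, MonObj.comp_one, mul_one]

instance isIso_transl (s : 𝟙_ SchC ⟶ T) : IsIso (transl s) :=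
  ⟨transl s⁻¹, by rw [transl_comp_transl, mul_inv_cancel, transl_one], by
    rw [transl_comp_transl, inv_mul_cancel, transl_one]⟩

instance isIso_transl_left (s : 𝟙_ SchC ⟶ T) : IsIso (transl s).left :=
  inferInstanceAs (IsIso ((Over.forget _).map (transl s)))

lemma transl_ptOf (s s' : 𝟙_ SchC ⟶ T) : (transl s).left (ptOf s') = ptOf (s' * s) := by
  have : s' ≫ transl s = s' * s := by
    rw [comp_transl, toUnit_unique (toUnit (𝟙_ SchC)) (𝟙 _), Category.id_comp]
  rw [← this]; rfl

end Translation

/-! ### The group law in terms of a local parameter. -/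

section Elliptic

variable {E : SchC} [GrpObj E]

lemma one_left_apply {T : SchC} (x : T.left) : (1 : T ⟶ E).left x = zeroPt E :=
  comp_constant_left η[E] x

/-- The pull-back to the local ring at `x` of a local equation of the origin. -/
def tpull {T : SchC} (t : E.left.presheaf.stalk (zeroPt E)) (f : T ⟶ E) (x : T.left)
    (h : f.left x = zeroPt E) : T.left.presheaf.stalk x :=
  f.left.stalkMap x (E.left.presheaf.stalkSpecializes (specializes_of_eq h) t)

variable {t : E.left.presheaf.stalk (zeroPt E)}

lemma locEq_of_eq {T : SchC} [IsIntegral T.left] {f : T ⟶ E} {x : T.left}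
    (h : f.left x = zeroPt E) : locEq t f x = algebraMap _ _ (tpull t f x h) := by
  rw [locEq, dif_pos h]; rfl

lemma locEq_of_ne {T : SchC} [IsIntegral T.left] {f : T ⟶ E} {x : T.left}
    (h : f.left x ≠ zeroPt E) : locEq t f x = 1 := by
  rw [locEq, dif_neg h]

lemma tpull_comp {S T : SchC} (g : S ⟶ T) (f : T ⟶ E) (y : S.left)
    (h : f.left (g.left y) = zeroPt E) (h' : (g ≫ f).left y = zeroPt E) :
    tpull t (g ≫ f) y h' = g.left.stalkMap y (tpull t f (g.left y) h) :=
  ConcreteCategory.congr_hom (Scheme.Hom.stalkMap_comp g.left f.left y) _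

lemma tpull_id (x : E.left) (h : (𝟙 E : E ⟶ E).left x = zeroPt E) (h' : x = zeroPt E) :
    tpull t (𝟙 E) x h = E.left.presheaf.stalkSpecializes (specializes_of_eq h') t :=
  ConcreteCategory.congr_hom (Scheme.Hom.stalkMap_id E.left x) _

lemma stalkMap_mem_maximalIdeal {X Y : Scheme.{0}} (f : X ⟶ Y) (x : X)
    {a : Y.presheaf.stalk (f x)} (ha : a ∈ IsLocalRing.maximalIdeal _) :
    f.stalkMap x a ∈ IsLocalRing.maximalIdeal _ :=
  (IsLocalRing.mem_maximalIdeal _).2 (map_mem_nonunits_iff (f.stalkMap x).hom a |>.2 ha)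

lemma stalkSpecializes_mem_maximalIdeal {X : Scheme.{0}} {x y : X} (h : y = x)
    {a : X.presheaf.stalk x} (ha : a ∈ IsLocalRing.maximalIdeal _) :
    X.presheaf.stalkSpecializes (specializes_of_eq h) a ∈ IsLocalRing.maximalIdeal _ := by
  subst h
  simpa using ha

lemma tpull_mem {T : SchC} (ht : t ∈ IsLocalRing.maximalIdeal _) (f : T ⟶ E) (x : T.left)
    (h : f.left x = zeroPt E) : tpull t f x h ∈ IsLocalRing.maximalIdeal _ :=
  stalkMap_mem_maximalIdeal _ _ (stalkSpecializes_mem_maximalIdeal h ht)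

/-- The constant morphism factors through the spectrum of `ℂ`, whose local ring is a field, and
there the non-unit `t` has to become zero. -/
lemma tpull_one {T : SchC} (ht : t ∈ IsLocalRing.maximalIdeal _) (x : T.left) 
    (h : (1 : T ⟶ E).left x = zeroPt E) : tpull t (1 : T ⟶ E) x h = 0 := by
  have : IsIntegral (𝟙_ SchC).left := inferInstanceAs (IsIntegral (Spec (CommRingCat.of ℂ)))
  have hg : (toUnit T).left x = genericPoint (𝟙_ SchC).left := by
    rw [eq_unitPt (genericPoint _)]; exact eq_unitPt _
  have h1 := tpull_mem ht η[E] ((toUnit T).left x) h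
  have h2 : tpull t η[E] ((toUnit T).left x) h = 0 := by
    generalize tpull t η[E] ((toUnit T).left x) h = b at h1
    clear h
    revert b
    rw [hg]
    intro b hb
    by_contra hne
    exact (IsLocalRing.mem_maximalIdeal _).1 hb
      ((isUnit_iff_ne_zero (G₀ := (𝟙_ SchC).left.functionField)).2 hne)
  refine (tpull_comp (toUnit T) η[E] x h h).trans ?_
  rw [h2, map_zero]

lemma exists_ringHom_stalk {T : SchC} (x : T.left) : Nonempty (ℂ →+* T.left.presheaf.stalk x) := 
  ⟨(T.hom.stalkMap x).hom.comp (StructureSheaf.toStalk ℂ (T.hom x)).hom⟩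

/-- Characteristic zero enters here: it makes multiplication by `k` unramified at the origin. -/
lemma isUnit_intCast_stalk {T : SchC} (x : T.left) {k : ℤ} (hk : k ≠ 0) :
    IsUnit (k : T.left.presheaf.stalk x) := by
  obtain ⟨φ⟩ := exists_ringHom_stalk x
  rw [← map_intCast φ]
  exact (isUnit_iff_ne_zero.2 (Int.cast_ne_zero.2 hk)).map φ


lemma stalkSpecializes_tpull {T : SchC} (f : T ⟶ E) {x x' : T.left} (e : x' = x)
    (h : f.left x = zeroPt E) (h' : f.left x' = zeroPt E) :
    T.left.presheaf.stalkSpecializes (specializes_of_eq e) (tpull t f x h) = tpull t f x' h' := by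
  subst e
  simp

lemma tpull_congr {T : SchC} {f g : T ⟶ E} (e : f = g) {x : T.left} (h : f.left x = zeroPt E)
    (h' : g.left x = zeroPt E) : tpull t f x h = tpull t g x h' := by
  subst e; rfl

/-- Restriction to the fibre. -/
def IsFibre.restrict {F T T' : SchC} [LocallyOfFiniteType F.hom] {π : T ⟶ F} {ρ : T ⟶ T'}
    {s : 𝟙_ SchC ⟶ F} {i : T' ⟶ T} (h : IsFibre π ρ s i) {x : T.left} (hx : π.left x = ptOf s) :
    T.left.presheaf.stalk x →+* T'.left.presheaf.stalk (ρ.left x) :=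
  (T.left.presheaf.stalkSpecializes (specializes_of_eq (h.eq_of_fst_eq hx).symm) ≫
    i.left.stalkMap (ρ.left x)).hom

lemma IsFibre.restrict_tpull {F T T' : SchC} [LocallyOfFiniteType F.hom] {π : T ⟶ F} {ρ : T ⟶ T'}
    {s : 𝟙_ SchC ⟶ F} {i : T' ⟶ T} (h : IsFibre π ρ s i) {x : T.left} (hx : π.left x = ptOf s)
    {f : T ⟶ E} (hf : f.left x = zeroPt E) (hf' : (i ≫ f).left (ρ.left x) = zeroPt E) :
    h.restrict hx (tpull t f x hf) = tpull t (i ≫ f) (ρ.left x) hf' := by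
  refine Eq.trans ?_ (tpull_comp i f (ρ.left x) hf' hf').symm
  exact congrArg (i.left.stalkMap (ρ.left x)).hom
    (stalkSpecializes_tpull f (h.eq_of_fst_eq hx).symm hf hf')

lemma fibreIdeal_eq_span {T : SchC} {F : SchC} {π : T ⟶ F} {ψ : F ⟶ E} {x : T.left}
    (h : ψ.left (π.left x) = zeroPt E) (h' : (π ≫ ψ).left x = zeroPt E)
    (hψ : IsLocalRing.maximalIdeal (F.left.presheaf.stalk (π.left x)) =
      Ideal.span {tpull t ψ (π.left x) h}) :
    IsFibre.fibreIdeal π x = Ideal.span {tpull t (π ≫ ψ) x h'} := by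
  rw [IsFibre.fibreIdeal, hψ, Ideal.map_span, Set.image_singleton, tpull_comp π ψ x h h']

lemma maximalIdeal_eq_span_tpull_id
    (ht : IsLocalRing.maximalIdeal (E.left.presheaf.stalk (zeroPt E)) = Ideal.span {t})
    {x : E.left} (h : (𝟙 E : E ⟶ E).left x = zeroPt E) :
    IsLocalRing.maximalIdeal (E.left.presheaf.stalk x) = Ideal.span {tpull t (𝟙 E) x h} := by
  have h' : x = zeroPt E := h
  rw [tpull_id x h h']
  clear h
  subst h'
  rw [ht]
  simp

variable [IsEllipticCurve E]

instance isIntegral_left : IsIntegral E.left :=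
  GeometricallyIntegral.isIntegral_of_subsingleton E.hom

/-- The universal case of the formal group law. The difference of the two sides, without the product
term, vanishes on both axes through the origin: restriction to the first axis makes it a multiple of
one coordinate, and restriction of the quotient to the second axis gives the other factor. -/
lemma tpull_add_of_prod
    (ht : IsLocalRing.maximalIdeal (E.left.presheaf.stalk (zeroPt E)) = Ideal.span {t})
    (ht0 : t ≠ 0) (x : (E ⊗ E).left)
    (h1 : (fst E E).left x = zeroPt E) (h2 : (snd E E).left x = zeroPt E)
    (h3 : (fst E E * snd E E).left x = zeroPt E) :
    ∃ b, tpull t (fst E E * snd E E) x h3 = tpull t (fst E E) x h1 + tpull t (snd E E) x h2 +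
      tpull t (fst E E) x h1 * tpull t (snd E E) x h2 * b := by
  have htm : t ∈ IsLocalRing.maximalIdeal _ := ht ▸ Ideal.mem_span_singleton_self t
  have hi : IsFibre (fst E E) (snd E E) η[E] (lift (1 : E ⟶ E) (𝟙 E)) :=
    ⟨fun u v => CartesianMonoidalCategory.hom_ext u v, lift_fst _ _, lift_snd _ _⟩
  have hj : IsFibre (snd E E) (fst E E) η[E] (lift (𝟙 E) (1 : E ⟶ E)) :=
    ⟨fun u v h h' => CartesianMonoidalCategory.hom_ext u v h' h, lift_snd _ _, lift_fst _ _⟩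
  have e1 : lift (1 : E ⟶ E) (𝟙 E) ≫ (fst E E * snd E E) = 𝟙 E := by
    rw [MonObj.comp_mul, lift_fst, lift_snd, one_mul]
  have e2 : lift (𝟙 E) (1 : E ⟶ E) ≫ (fst E E * snd E E) = 𝟙 E := by
    rw [MonObj.comp_mul, lift_fst, lift_snd, mul_one]
  have hi0 : hi.restrict h1 (tpull t (fst E E * snd E E) x h3 - tpull t (fst E E) x h1 -
      tpull t (snd E E) x h2) = 0 := by
    have k1 : (𝟙 E : E ⟶ E).left ((snd E E).left x) = zeroPt E := h2
    rw [map_sub, map_sub, hi.restrict_tpull h1 h3 (by rw [e1]; exact k1),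
      hi.restrict_tpull h1 h1 (by rw [lift_fst]; exact one_left_apply _),
      hi.restrict_tpull h1 h2 (by rw [lift_snd]; exact k1), tpull_congr e1 _ k1,
      tpull_congr (lift_fst _ _) _ (one_left_apply _), tpull_congr (lift_snd _ _) _ k1,
      tpull_one htm]
    ring
  have hmem := hi.ker_stalkMap h1 hi0
  have hsp1 : IsFibre.fibreIdeal (fst E E) x = Ideal.span {tpull t (fst E E) x h1} := by
    rw [fibreIdeal_eq_span (ψ := 𝟙 E) h1 (by rw [Category.comp_id, h1])
        (maximalIdeal_eq_span_tpull_id ht _),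
      tpull_congr (Category.comp_id _) _ h1]
  have hsp2 : IsFibre.fibreIdeal (snd E E) x = Ideal.span {tpull t (snd E E) x h2} := by
    rw [fibreIdeal_eq_span (ψ := 𝟙 E) h2 (by rw [Category.comp_id, h2])
        (maximalIdeal_eq_span_tpull_id ht _),
      tpull_congr (Category.comp_id _) _ h2]
  rw [hsp1, Ideal.mem_span_singleton] at hmem
  obtain ⟨b, hb⟩ := hmem
  have k1 : (𝟙 E : E ⟶ E).left ((fst E E).left x) = zeroPt E := h1
  -- The parameter is a non-zero-divisor on the second axis, so the quotient `b` vanishes there as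
  -- soon as its product with the parameter does.
  have hj0 : hj.restrict h2 b = 0 := by
    have := congrArg (hj.restrict h2) hb
    rw [map_mul, map_sub, map_sub, hj.restrict_tpull h2 h3 (by rw [e2]; exact k1),
      hj.restrict_tpull h2 h1 (by rw [lift_fst]; exact k1),
      hj.restrict_tpull h2 h2 (by rw [lift_snd]; exact one_left_apply _), tpull_congr e2 _ k1,
      tpull_congr (lift_snd _ _) _ (one_left_apply _), tpull_congr (lift_fst _ _) _ k1,
      tpull_one htm, sub_self, sub_zero] at this
    refine (mul_eq_zero.1 this.symm).resolve_left ?_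
    rw [tpull_id _ _ h1]
    intro h0
    refine ht0 (stalk_algebraMap_injective _ ?_)
    rw [map_zero, ← algebraMap_stalkSpecializes (specializes_of_eq h1), h0, map_zero]
  have hmem := hj.ker_stalkMap h2 hj0
  rw [hsp2, Ideal.mem_span_singleton] at hmem
  obtain ⟨c, rfl⟩ := hmem
  exact ⟨c, by linear_combination hb⟩

/-- Pull-back of the universal case along `(f, g)`. -/
lemma tpull_mul
    (ht : IsLocalRing.maximalIdeal (E.left.presheaf.stalk (zeroPt E)) = Ideal.span {t})
    (ht0 : t ≠ 0) {T : SchC} (f g : T ⟶ E) {x : T.left}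
    (hf : f.left x = zeroPt E) (hg : g.left x = zeroPt E) :
    ∃ (h : (f * g).left x = zeroPt E) (b : _), tpull t (f * g) x h = tpull t f x hf +
      tpull t g x hg + tpull t f x hf * tpull t g x hg * b := by
  have h1 : (fst E E).left ((lift f g).left x) = zeroPt E := by
    rw [← Scheme.Hom.comp_apply, ← Over.comp_left, lift_fst, hf]
  have h2 : (snd E E).left ((lift f g).left x) = zeroPt E := by
    rw [← Scheme.Hom.comp_apply, ← Over.comp_left, lift_snd, hg]
  -- A point of the product scheme is not determined by its two coordinates in general; it is so
  -- here because the first one is a rational point.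
  have h3 : (fst E E * snd E E).left ((lift f g).left x) = zeroPt E := by
    have hi : IsFibre (fst E E) (snd E E) η[E] (lift (1 : E ⟶ E) (𝟙 E)) :=
      ⟨fun u v => CartesianMonoidalCategory.hom_ext u v, lift_fst _ _, lift_snd _ _⟩
    rw [hi.eq_of_fst_eq h1, ← Scheme.Hom.comp_apply, ← Over.comp_left, MonObj.comp_mul, lift_fst,
      lift_snd, one_mul, h2]
    rfl
  have e : f * g = lift f g ≫ (fst E E * snd E E) := by
    rw [MonObj.comp_mul, lift_fst, lift_snd]
  obtain ⟨b, hb⟩ := tpull_add_of_prod ht ht0 _ h1 h2 h3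
  refine ⟨by rw [e]; exact h3, (lift f g).left.stalkMap x b, ?_⟩
  have hb' := congrArg ((lift f g).left.stalkMap x).hom hb
  simp only [map_add, map_mul] at hb'
  rw [tpull_congr e _ h3, tpull_comp _ _ _ h3 h3]
  refine hb'.trans ?_
  have e1 := (tpull_comp (t := t) (lift f g) (fst E E) x h1 h1).symm.trans
    (tpull_congr (lift_fst f g) _ hf)
  have e2 := (tpull_comp (t := t) (lift f g) (snd E E) x h2 h2).symm.trans
    (tpull_congr (lift_snd f g) _ hg)
  rw [← e1, ← e2]

/-- By induction from the addition formula, the parameter is multiplied by `k` up to an element of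
the maximal ideal. -/
lemma tpull_pow
    (ht : IsLocalRing.maximalIdeal (E.left.presheaf.stalk (zeroPt E)) = Ideal.span {t})
    (ht0 : t ≠ 0) {T : SchC} (f : T ⟶ E) {x : T.left} (hf : f.left x = zeroPt E) (k : ℕ) :
    ∃ (h : (f ^ k).left x = zeroPt E), ∃ c ∈ IsLocalRing.maximalIdeal (T.left.presheaf.stalk x),
      tpull t (f ^ k) x h = (k + c) * tpull t f x hf := by
  have htm : t ∈ IsLocalRing.maximalIdeal _ := ht ▸ Ideal.mem_span_singleton_self t
  induction k with
  | zero =>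
    have h : (f ^ 0).left x = zeroPt E := by rw [pow_zero]; exact one_left_apply x
    refine ⟨h, 0, Ideal.zero_mem _, ?_⟩
    rw [tpull_congr (pow_zero f) h (one_left_apply x), tpull_one htm]
    simp
  | succ k ih =>
    obtain ⟨h, c, hc, hk⟩ := ih
    obtain ⟨h', b, hb⟩ := tpull_mul ht ht0 (f ^ k) f h hf
    have h'' : (f ^ (k + 1)).left x = zeroPt E := by rw [pow_succ]; exact h'
    refine ⟨h'', c + (k + c) * tpull t f x hf * b, ?_, ?_⟩
    · refine Ideal.add_mem _ hc (Ideal.mul_mem_right _ _ (Ideal.mul_mem_left _ _ ?_))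
      exact tpull_mem htm f x hf
    · rw [tpull_congr (pow_succ f k) h'' h', hb, hk]
      push_cast
      ring

lemma isUnit_add_of_mem {R : Type*} [CommRing R] [IsLocalRing R] {a c : R} (ha : IsUnit a)
    (hc : c ∈ IsLocalRing.maximalIdeal R) : IsUnit (a + c) := by
  by_contra h
  have h1 := Ideal.sub_mem _ ((IsLocalRing.mem_maximalIdeal _).2 h) hc
  rw [add_sub_cancel_right] at h1
  exact (IsLocalRing.mem_maximalIdeal _).1 h1 ha

/-- The addition formula for `f` and `f⁻¹`, whose product is constant, reads `0 = t(f) + t(f⁻¹) (1 +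
t(f) b)`. -/
lemma associated_tpull_inv
    (ht : IsLocalRing.maximalIdeal (E.left.presheaf.stalk (zeroPt E)) = Ideal.span {t})
    (ht0 : t ≠ 0) {T : SchC} (f : T ⟶ E) {x : T.left} (hf : f.left x = zeroPt E) :
    ∃ (h : f⁻¹.left x = zeroPt E), Associated (tpull t f x hf) (tpull t f⁻¹ x h) := by
  have htm : t ∈ IsLocalRing.maximalIdeal _ := ht ▸ Ideal.mem_span_singleton_self t
  have h : f⁻¹.left x = zeroPt E := by
    have h1 : f⁻¹ = f ≫ ι := rfl
    rw [h1]
    change ι[E].left (f.left x) = _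
    rw [hf]
    change (η[E] ≫ ι).left unitPt = _
    rw [GrpObj.one_inv]; rfl
  refine ⟨h, ?_⟩
  obtain ⟨h', b, hb⟩ := tpull_mul ht ht0 f f⁻¹ hf h
  rw [tpull_congr (mul_inv_cancel f) h' (one_left_apply x), tpull_one htm] at hb
  have hu : IsUnit (1 + tpull t f x hf * b) :=
    isUnit_add_of_mem isUnit_one (Ideal.mul_mem_right _ _ (tpull_mem htm f x hf))
  refine Associated.symm ⟨-hu.unit, ?_⟩
  rw [Units.val_neg, IsUnit.unit_spec]
  linear_combination hb

/-- The factor `k + c` in the expansion of a power is a unit, because `k` is. -/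
lemma associated_tpull_zpow
    (ht : IsLocalRing.maximalIdeal (E.left.presheaf.stalk (zeroPt E)) = Ideal.span {t})
    (ht0 : t ≠ 0) {T : SchC} (f : T ⟶ E) {x : T.left} (hf : f.left x = zeroPt E) {k : ℤ}
    (hk : k ≠ 0) :
    ∃ (h : (f ^ k).left x = zeroPt E), Associated (tpull t f x hf) (tpull t (f ^ k) x h) := by
  have key : ∀ n : ℕ, n ≠ 0 → ∃ (h : (f ^ n).left x = zeroPt E),
      Associated (tpull t f x hf) (tpull t (f ^ n) x h) := by
    intro n hn
    obtain ⟨h, c, hc, hn'⟩ := tpull_pow ht ht0 f hf n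
    have hu : IsUnit ((n : T.left.presheaf.stalk x) + c) := by
      refine isUnit_add_of_mem ?_ hc
      exact_mod_cast isUnit_intCast_stalk x (Int.natCast_ne_zero.2 hn)
    exact ⟨h, hu.unit, by rw [hn', IsUnit.unit_spec, mul_comm]⟩
  obtain ⟨n, rfl | rfl⟩ := k.eq_nat_or_neg
  · obtain ⟨h, hn⟩ := key n (by simpa using hk)
    exact ⟨by rw [zpow_natCast]; exact h,
      by rw [tpull_congr (zpow_natCast f n) _ h]; exact hn⟩
  · obtain ⟨h, hn⟩ := key n (by simpa using hk)
    obtain ⟨h', hn'⟩ := associated_tpull_inv ht ht0 (f ^ n) h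
    have e : f ^ (-(n : ℤ)) = (f ^ n)⁻¹ := by rw [zpow_neg, zpow_natCast]
    exact ⟨by rw [e]; exact h', by rw [tpull_congr e _ h']; exact hn.trans hn'⟩

instance (priority := low) compactSpace_left : CompactSpace E.left :=
  QuasiCompact.compactSpace_of_compactSpace E.hom

lemma isClosed_zeroPt : IsClosed {zeroPt E} := isClosed_ptOf η[E]

/-- The local ring at the origin is not a field. -/
lemma maximalIdeal_zeroPt_ne_bot :
    IsLocalRing.maximalIdeal (E.left.presheaf.stalk (zeroPt E)) ≠ ⊥ := by
  intro hbot
  obtain ⟨U, hU, V, hV, hx, e, hs⟩ :=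
    (IsEllipticCurve.smooth (E := E)).exists_isStandardSmoothOfRelativeDimension (zeroPt E)
  -- If the maximal ideal were zero, a function minus its value at the origin would have zero germ
  -- there. All functions on the chart would then come from the base, and there would be no
  -- differentials.
  have hsurj : Function.Surjective (E.hom.appLE U V e).hom := by
    intro r
    let i : Spec (CommRingCat.of ℂ) ⟶ E.left := η[E].left
    have hi : i ≫ E.hom = 𝟙 _ := Over.w η[E]
    have hpt : ∀ y, i y = zeroPt E := fun y =>
      congrArg i (Subsingleton.elim (α := PrimeSpectrum ℂ) y (IsLocalRing.closedPoint ℂ))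
    have e' : U ≤ i ⁻¹ᵁ V := fun y _ => by
      change i y ∈ V
      rw [hpt]; exact hx
    have hcomp : E.hom.appLE U V e ≫ i.appLE V U e' = 𝟙 _ := by
      rw [Scheme.Hom.appLE_comp_appLE]
      have : ∀ (j : Spec (CommRingCat.of ℂ) ⟶ Spec (CommRingCat.of ℂ)) (h : U ≤ j ⁻¹ᵁ U),
          j = 𝟙 _ → j.appLE U U h = 𝟙 _ := by
        rintro _ h rfl
        rw [Scheme.Hom.appLE, Scheme.Hom.id_app]
        exact (Category.id_comp _).trans (CategoryTheory.Functor.map_id _ _)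
      exact this _ _ hi
    refine ⟨i.appLE V U e' r, ?_⟩
    have hd : i.appLE V U e' ((E.hom.appLE U V e) (i.appLE V U e' r) - r) = 0 := by
      rw [map_sub, ← ConcreteCategory.comp_apply, hcomp]
      exact sub_self _
    refine sub_eq_zero.1 (germ_injective_of_isIntegral E.left (zeroPt E) hx ?_)
    rw [map_zero]
    set d := (E.hom.appLE U V e) (i.appLE V U e' r) - r with hdd
    have hmem : E.left.presheaf.germ V (zeroPt E) hx d ∈
        IsLocalRing.maximalIdeal (E.left.presheaf.stalk (zeroPt E)) := by
      rw [IsLocalRing.mem_maximalIdeal]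
      intro hu
      let pt : ↥(Spec (CommRingCat.of ℂ)) := IsLocalRing.closedPoint ℂ
      have hu2 := hu.map (i.stalkMap pt).hom
      have hU' : pt ∈ U := by
        have := e hx
        exact (Subsingleton.elim (α := PrimeSpectrum ℂ) pt (E.hom (zeroPt E))) ▸ this
      have h3 : (i.stalkMap pt).hom
          (E.left.presheaf.germ V (zeroPt E) hx d) =
          (Spec (CommRingCat.of ℂ)).presheaf.germ U _ hU' (i.appLE V U e' d) := by
        refine (Scheme.Hom.germ_stalkMap_apply i V _ hx d).trans ?_
        rw [Scheme.Hom.appLE, ConcreteCategory.comp_apply]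
        exact (TopCat.Presheaf.germ_res_apply _ (homOfLE e') _ hU' _).symm
      exact not_isUnit_zero ((h3.trans (by rw [hd, map_zero])) ▸ hu2)
    rw [hbot] at hmem
    exact hmem
  have hnt : Nontrivial Γ(E.left, V) := by
    have : Nonempty V := ⟨⟨_, hx⟩⟩
    infer_instance
  algebraize [(E.hom.appLE U V e).hom]
  -- Smoothness of relative dimension one makes the module of differentials of rank one, which
  -- contradicts its vanishing.
  have h1 := Algebra.IsStandardSmoothOfRelativeDimension.rank_kaehlerDifferential
    (R := Γ(Spec (CommRingCat.of ℂ), U)) (S := Γ(E.left, V)) 1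
  have : Subsingleton (Ω[Γ(E.left, V)⁄Γ(Spec (CommRingCat.of ℂ), U)]) :=
    KaehlerDifferential.subsingleton_of_surjective _ _ hsurj
  rw [rank_subsingleton'] at h1
  simp at h1

lemma ne_zero_of_maximalIdeal_eq
    (ht : IsLocalRing.maximalIdeal (E.left.presheaf.stalk (zeroPt E)) = Ideal.span {t}) :
    t ≠ 0 := by
  rintro rfl
  exact maximalIdeal_zeroPt_ne_bot (E := E) (by rw [ht]; simp)

instance (priority := low) isLocallyNoetherian_curve : IsLocallyNoetherian E.left :=
  isLocallyNoetherian_left E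

/-- The generizations of the origin are the primes of its local ring, which is a discrete valuation
ring because its maximal ideal is principal and nonzero. -/
lemma eq_or_eq_of_specializes_zeroPt
    (ht : IsLocalRing.maximalIdeal (E.left.presheaf.stalk (zeroPt E)) = Ideal.span {t})
    {y : E.left} (hy : y ⤳ zeroPt E) : y = zeroPt E ∨ y = genericPoint E.left := by
  have hdvr : IsDiscreteValuationRing (E.left.presheaf.stalk (zeroPt E)) := by
    have hf : ¬ IsField (E.left.presheaf.stalk (zeroPt E)) := fun h =>
      maximalIdeal_zeroPt_ne_bot (E := E) (IsLocalRing.isField_iff_maximalIdeal_eq.1 h)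
    refine ((IsDiscreteValuationRing.TFAE _ hf).out 0 4).2 ?_
    exact ⟨t, ht⟩
  have hpr : ∀ z : E.left, z ⤳ zeroPt E → z = zeroPt E ∨ z = E.left.fromSpecStalk (zeroPt E)
      (⊥ : PrimeSpectrum (E.left.presheaf.stalk (zeroPt E))) := by
    intro z hz
    have : z ∈ Set.range (E.left.fromSpecStalk (zeroPt E)) := by
      rw [Scheme.range_fromSpecStalk]; exact hz
    obtain ⟨q, rfl⟩ := this
    by_cases hq : q.asIdeal = ⊥
    · right
      congr 1
      exact PrimeSpectrum.ext hq
    · left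
      have : q = IsLocalRing.closedPoint _ :=
        PrimeSpectrum.ext (IsLocalRing.eq_maximalIdeal (q.isPrime.isMaximal hq))
      rw [this]
      exact Scheme.fromSpecStalk_closedPoint
  have hgen := hpr (genericPoint E.left) ((genericPoint_spec E.left).specializes trivial)
  rcases hgen with hgen | hgen
  · exfalso
    apply maximalIdeal_zeroPt_ne_bot (E := E)
    have h1 : ∀ z : E.left, genericPoint E.left = z →
        IsLocalRing.maximalIdeal (E.left.presheaf.stalk z) = ⊥ := by
      rintro _ rfl
      exact IsLocalRing.isField_iff_maximalIdeal_eq.1 (Field.toIsField E.left.functionField)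
    exact h1 _ hgen
  · rw [hgen]; exact hpr y hy

/-- The points of a curve are closed or generic. -/
lemma isClosed_or_eq_genericPoint
    (ht : IsLocalRing.maximalIdeal (E.left.presheaf.stalk (zeroPt E)) = Ideal.span {t})
    (y : E.left) : IsClosed {y} ∨ y = genericPoint E.left := by
  obtain ⟨z, hz, hzc⟩ := IsClosed.exists_closed_singleton (isClosed_closure (s := {y}))
    ⟨y, subset_closure rfl⟩
  have hyz : y ⤳ z := specializes_iff_mem_closure.2 hz
  obtain ⟨s, rfl⟩ := exists_ptOf_eq hzc
  -- Translation moves a closed specialization of `y` to the origin, where the local ring is known.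
  have h1 : (transl s⁻¹).left y ⤳ zeroPt E := by
    have := hyz.map (transl s⁻¹).left.continuous
    rwa [transl_ptOf, mul_inv_cancel] at this
  rcases eq_or_eq_of_specializes_zeroPt ht h1 with h | h
  · left
    have h2 : (transl s⁻¹).left y = (transl s⁻¹).left (ptOf s) := by
      rw [h, transl_ptOf, mul_inv_cancel]; rfl
    have h3 : y = ptOf s := (transl s⁻¹).left.homeomorph.injective h2
    rw [h3]; exact hzc
  · right
    have h2 : (transl s⁻¹).left (genericPoint E.left) = genericPoint E.left :=
      genericPoint_eq_of_isOpenImmersion (transl s⁻¹).left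
    exact (transl s⁻¹).left.homeomorph.injective (h.trans h2.symm)

end Elliptic

/-! ### Affine characters of a curve -/

section AffineCharacter

variable {E : SchC} [GrpObj E] {t : E.left.presheaf.stalk (zeroPt E)}

lemma stalkSpecializes_tpull' {T : SchC} (f : T ⟶ E) {x y : T.left} (e : y ⤳ x)
    (h : f.left x = zeroPt E) (h' : f.left y = zeroPt E) :
    T.left.presheaf.stalkSpecializes e (tpull t f x h) = tpull t f y h' := by
  have h1 := Scheme.Hom.stalkSpecializes_stalkMap_apply f.left y x e
    (E.left.presheaf.stalkSpecializes (specializes_of_eq h) t)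
  refine h1.symm.trans ?_
  rw [stalkSpecializes_apply_apply]
  rfl

lemma comp_constHom {S T : SchC} (u : S ⟶ T) (s : 𝟙_ SchC ⟶ E) :
    u ≫ constHom s T = constHom s S := by
  rw [constHom, constHom, ← Category.assoc, comp_toUnit]

lemma constHom_unit (s : 𝟙_ SchC ⟶ E) : constHom s (𝟙_ SchC) = s := by
  rw [constHom, toUnit_unique (toUnit (𝟙_ SchC)) (𝟙 _), Category.id_comp]

lemma mem_maximalIdeal_genericPoint {X : Scheme.{0}} [IsIntegral X]
    {a : X.presheaf.stalk (genericPoint X)} (ha : a ∈ IsLocalRing.maximalIdeal _) : a = 0 := by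
  by_contra hne
  exact (IsLocalRing.mem_maximalIdeal _).1 ha ((isUnit_iff_ne_zero (G₀ := X.functionField)).2 hne)

variable [IsEllipticCurve E]

lemma constHom_mul {T : SchC} (s s' : 𝟙_ SchC ⟶ E) :
    constHom (s * s') T = constHom s T * constHom s' T := MonObj.comp_mul _ _ _

lemma constHom_zpow {T : SchC} (s : 𝟙_ SchC ⟶ E) (k : ℤ) :
    constHom (s ^ k) T = constHom s T ^ k := GrpObj.comp_zpow _ _ _

lemma constHom_one {T : SchC} : constHom (1 : 𝟙_ SchC ⟶ E) T = 1 := MonObj.comp_one _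

lemma transl_eq (s : 𝟙_ SchC ⟶ E) : transl s = 𝟙 E * constHom s E := rfl

/-- At a zero of `z ↦ k z + s₀` the pull-back of a local parameter is a local parameter. -/
lemma maximalIdeal_eq_span_tpull_zpow
    (ht : IsLocalRing.maximalIdeal (E.left.presheaf.stalk (zeroPt E)) = Ideal.span {t})
    {k : ℤ} (hk : k ≠ 0) (s₀ s : 𝟙_ SchC ⟶ E)
    (h : (𝟙 E ^ k * constHom s₀ E).left (ptOf s) = zeroPt E) :
    IsLocalRing.maximalIdeal (E.left.presheaf.stalk (ptOf s)) =
      Ideal.span {tpull t (𝟙 E ^ k * constHom s₀ E) (ptOf s) h} := by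
  have h1 : s ^ k * s₀ = 1 := by
    refine ptOf_injective ?_
    rw [← show s ≫ (𝟙 E ^ k * constHom s₀ E) = s ^ k * s₀ by
      rw [MonObj.comp_mul, GrpObj.comp_zpow, Category.comp_id, comp_constHom, constHom_unit]]
    exact h
  -- Since `s` is a zero, `k z + s₀ = k (z - s)`. A translation moves the parameter at the origin to
  -- `s`, and multiplication by `k` only changes it by a unit.
  have h2 : 𝟙 E ^ k * constHom s₀ E = transl s⁻¹ ^ k := by
    rw [transl_eq, mul_zpow, ← constHom_zpow, inv_zpow, eq_inv_of_mul_eq_one_right h1]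
  have h3 : (transl s⁻¹).left (ptOf s) = zeroPt E := by
    rw [transl_ptOf, mul_inv_cancel]; rfl
  obtain ⟨h4, h5⟩ := associated_tpull_zpow ht (ne_zero_of_maximalIdeal_eq ht) (transl s⁻¹) h3 hk
  rw [tpull_congr h2 h h4, ← Ideal.span_singleton_eq_span_singleton.2 h5]
  have h6 : IsFibre.fibreIdeal (transl s⁻¹) (ptOf s) =
      Ideal.span {tpull t (transl s⁻¹) (ptOf s) h3} := by
    rw [fibreIdeal_eq_span (π := transl s⁻¹) (ψ := 𝟙 E) h3 (by rw [Category.comp_id, h3])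
      (maximalIdeal_eq_span_tpull_id ht _), tpull_congr (Category.comp_id _) _ h3]
  rw [← h6]
  refine le_antisymm ?_ (IsFibre.fibreIdeal_le _)
  intro a ha
  have hbij : Function.Bijective ((transl s⁻¹).left.stalkMap (ptOf s)).hom :=
    ConcreteCategory.bijective_of_isIso ((transl s⁻¹).left.stalkMap (ptOf s))
  obtain ⟨b, rfl⟩ := hbij.2 a
  refine Ideal.mem_map_of_mem _ ((IsLocalRing.mem_maximalIdeal _).2 fun hb => ?_)
  exact (IsLocalRing.mem_maximalIdeal _).1 ha (hb.map _)

lemma isDominant_of_apply_genericPoint {X Y : Scheme.{0}} [IsIntegral X] [IsIntegral Y]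
    (f : X ⟶ Y) (h : f (genericPoint X) = genericPoint Y) : IsDominant f := by
  refine ⟨dense_iff_closure_eq.2 (Set.eq_univ_of_univ_subset ?_)⟩
  rw [← (genericPoint_spec Y).def]
  exact closure_mono (Set.singleton_subset_iff.2 ⟨_, h⟩)

lemma apply_genericPoint_of_isDominant {X Y : Scheme.{0}} [IsIntegral X] [IsIntegral Y]
    (f : X ⟶ Y) [IsDominant f] : f (genericPoint X) = genericPoint Y :=
  (specializes_of_isDominant f).antisymm ((genericPoint_spec Y).specializes trivial) |>.eq

/-- If the generic point had closed image the morphism would be constant, and so would be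
multiplication by `k`. The pull-back of `t` along it would vanish, although it is associated to `t`.
-/
lemma isDominant_zpow_mul
    (ht : IsLocalRing.maximalIdeal (E.left.presheaf.stalk (zeroPt E)) = Ideal.span {t})
    {k : ℤ} (hk : k ≠ 0) (s₀ : 𝟙_ SchC ⟶ E) : IsDominant (𝟙 E ^ k * constHom s₀ E).left := by
  refine isDominant_of_apply_genericPoint _ ?_
  rcases isClosed_or_eq_genericPoint ht
    ((𝟙 E ^ k * constHom s₀ E).left (genericPoint E.left)) with hcl | h
  · exfalso
    obtain ⟨s, hs⟩ := exists_ptOf_eq hcl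
    have hall : ∀ y : E.left, (𝟙 E ^ k * constHom s₀ E).left y = ptOf s := by
      intro y
      have h1 : genericPoint E.left ⤳ y := (genericPoint_spec E.left).specializes trivial
      have h2 := h1.map (𝟙 E ^ k * constHom s₀ E).left.continuous
      rw [← hs] at h2 hcl
      exact hcl.closure_subset_iff.2 (subset_refl _) h2.mem_closure
    have hs0 : s₀ = s := by
      refine ptOf_injective ?_
      have h2 : (1 : 𝟙_ SchC ⟶ E) ≫ (𝟙 E ^ k * constHom s₀ E) = s₀ := by
        rw [MonObj.comp_mul, GrpObj.comp_zpow, Category.comp_id, comp_constHom, constHom_unit,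
          one_zpow, one_mul]
      rw [← hall (ptOf 1)]
      conv_lhs => rw [← h2]
      rfl
    have hk0 : ∀ y : E.left, (𝟙 E ^ k : E ⟶ E).left y = zeroPt E := by
      intro y
      have h3 : (𝟙 E ^ k : E ⟶ E) = (𝟙 E ^ k * constHom s₀ E) ≫ transl s⁻¹ := by
        rw [comp_transl, hs0, mul_assoc]
        change _ = 𝟙 E ^ k * (constHom s E * constHom s⁻¹ E)
        rw [← constHom_mul, mul_inv_cancel, constHom_one, mul_one]
      rw [h3, Over.comp_left, Scheme.Hom.comp_apply, hall, transl_ptOf, mul_inv_cancel]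
      rfl
    have h0 : (𝟙 E : E ⟶ E).left (zeroPt E) = zeroPt E := rfl
    obtain ⟨h4, h5⟩ := associated_tpull_zpow ht (ne_zero_of_maximalIdeal_eq ht) (𝟙 E) h0 hk
    have h6 : tpull t (𝟙 E ^ k) (zeroPt E) h4 = 0 := by
      refine stalk_algebraMap_injective _ ?_
      rw [map_zero, RingHom.algebraMap_toAlgebra]
      refine (stalkSpecializes_tpull' (𝟙 E ^ k)
        ((genericPoint_spec E.left).specializes trivial) h4 (hk0 _)).trans ?_
      refine mem_maximalIdeal_genericPoint (tpull_mem ?_ _ _ _)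
      rw [ht]; exact Ideal.mem_span_singleton_self t
    rw [h6, associated_zero_iff_eq_zero, tpull_id _ _ rfl] at h5
    refine ne_zero_of_maximalIdeal_eq ht ?_
    simpa using h5
  · exact h

end AffineCharacter

/-! ### Tori -/

section Torus

variable {E : SchC} [GrpObj E] [IsEllipticCurve E] {t : E.left.presheaf.stalk (zeroPt E)}
  {Λ : Type*} [AddCommGroup Λ] {T : SchC}

/-- `T`, with the characters `χ`, represents the functor of homomorphisms from `Λ` to `E`. -/
structure IsTorus (χ : Multiplicative Λ →* (T ⟶ E)) : Prop where
  exists_lift : ∀ {S : SchC} (φ : Multiplicative Λ →* (S ⟶ E)), ∃ u : S ⟶ T, ∀ c, u ≫ χ c = φ c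
  hom_ext : ∀ {S : SchC} (u v : S ⟶ T), (∀ c, u ≫ χ c = v ≫ χ c) → u = v

lemma exists_hom_of_basis {J S : Type*} [Finite J] [CommGroup S] (b : Module.Basis J ℤ Λ)
    (z : J → S) : ∃ φ : Multiplicative Λ →* S, ∀ i, φ (Multiplicative.ofAdd (b i)) = z i := by
  let ψ : Λ →ₗ[ℤ] Additive S := b.constr ℤ (fun i => Additive.ofMul (z i))
  refine ⟨AddMonoidHom.toMultiplicativeLeft ψ.toAddMonoidHom, fun i => ?_⟩
  change (ψ (b i)).toMul = z i
  rw [Module.Basis.constr_basis]; rfl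

lemma hom_eq_of_basis {J S : Type*} [CommGroup S] (b : Module.Basis J ℤ Λ)
    {φ ψ : Multiplicative Λ →* S} (h : ∀ i, φ (Multiplicative.ofAdd (b i)) =
      ψ (Multiplicative.ofAdd (b i))) : φ = ψ := by
  have h1 : (AddMonoidHom.toMultiplicativeLeft.symm φ).toIntLinearMap =
      (AddMonoidHom.toMultiplicativeLeft.symm ψ).toIntLinearMap :=
    b.ext fun i => congrArg Additive.ofMul (h i)
  ext c
  exact congrArg Additive.toMul (LinearMap.congr_fun h1 c)

namespace IsTorus

variable {χ : Multiplicative Λ →* (T ⟶ E)}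

lemma hom_ext_basis (h : IsTorus χ) {J : Type*} (b : Module.Basis J ℤ Λ) {S : SchC}
    (u v : S ⟶ T) (huv : ∀ i, u ≫ χ (Multiplicative.ofAdd (b i)) =
      v ≫ χ (Multiplicative.ofAdd (b i))) : u = v := by
  refine h.hom_ext u v fun c => ?_
  exact DFunLike.congr_fun (hom_eq_of_basis b (φ := (HomTorus.compHom E u).comp χ)
    (ψ := (HomTorus.compHom E v).comp χ) huv) c

lemma exists_lift_basis (h : IsTorus χ) {J : Type*} [Finite J] (b : Module.Basis J ℤ Λ) {S : SchC}
    (z : J → (S ⟶ E)) : ∃ u : S ⟶ T, ∀ i, u ≫ χ (Multiplicative.ofAdd (b i)) = z i := by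
  obtain ⟨φ, hφ⟩ := exists_hom_of_basis b z
  obtain ⟨u, hu⟩ := h.exists_lift φ
  exact ⟨u, fun i => (hu _).trans (hφ i)⟩

/-- The remaining coordinates, for a basis of the lattice. -/
def rest (χ : Multiplicative Λ →* (T ⟶ E)) {n : ℕ} (b : Module.Basis (Fin (n + 1)) ℤ Λ) :
    T ⟶ power E n :=
  power.lift n fun j => χ (Multiplicative.ofAdd (b j.succ))

lemma exists_isFibre (h : IsTorus χ) {n : ℕ} (b : Module.Basis (Fin (n + 1)) ℤ Λ)
    (s : 𝟙_ SchC ⟶ E) :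
    ∃ i : power E n ⟶ T, IsFibre (χ (Multiplicative.ofAdd (b 0))) (rest χ b) s i := by
  obtain ⟨i, hi⟩ := h.exists_lift_basis b
    (Fin.cases (constHom s (power E n)) (power.coord E n) : Fin (n + 1) → (power E n ⟶ E))
  refine ⟨i, fun u v h1 h2 => h.hom_ext_basis b u v ?_, hi 0, ?_⟩
  · refine Fin.cases h1 fun j => ?_
    have := congrArg (· ≫ power.coord E n j) h2
    simpa only [Category.assoc, rest, power.lift_coord] using this
  · refine power.hom_ext n fun j => ?_
    rw [Category.assoc, rest, power.lift_coord, Category.id_comp]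
    exact hi j.succ

end IsTorus

/-- A nonzero vector of a lattice is a multiple of a member of a basis. -/
lemma exists_basis_smul_eq [Module.Free ℤ Λ] [Module.Finite ℤ Λ] {c : Λ} (hc : c ≠ 0) :
    ∃ (n : ℕ) (b : Module.Basis (Fin (n + 1)) ℤ Λ) (k : ℤ), k ≠ 0 ∧ c = k • b 0 := by
  -- The Smith normal form of the rank one sublattice `ℤ c` yields the adapted basis; a
  -- transposition of indices puts the relevant basis vector in position `0`.
  obtain ⟨m, sm⟩ := Submodule.smithNormalForm (Module.finBasis ℤ Λ) (Submodule.span ℤ {c})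
  have hcm : c ∈ Submodule.span ℤ {c} := Submodule.mem_span_singleton_self c
  have hm : m = 1 := by
    have h1 := Module.finrank_eq_card_basis sm.bN
    rw [← (LinearEquiv.toSpanNonzeroSingleton ℤ Λ c hc).finrank_eq, Module.finrank_self] at h1
    simpa using h1.symm
  subst hm
  have h1 : c = (sm.bN.repr ⟨c, hcm⟩ 0 * sm.a 0) • sm.bM (sm.f 0) := by
    have h2 := congrArg Subtype.val (sm.bN.sum_repr ⟨c, hcm⟩)
    simp only [Finset.univ_unique, Fin.default_eq_zero, Finset.sum_singleton,
      Submodule.coe_smul] at h2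
    rw [sm.snf, smul_smul] at h2
    exact h2.symm
  obtain ⟨n, hn⟩ : ∃ n, Module.finrank ℤ Λ = n + 1 :=
    Nat.exists_eq_succ_of_ne_zero fun h0 => by
      have := sm.f 0
      rw [h0] at this
      exact this.elim0
  have hb : sm.bM.reindex ((finCongr hn).trans (Equiv.swap (finCongr hn (sm.f 0)) 0)) 0 =
      sm.bM (sm.f 0) := by
    rw [Module.Basis.reindex_apply]
    simp
  refine ⟨n, _, _, fun h0 => ?_, h1.trans (congrArg _ hb.symm)⟩
  rw [h0, zero_smul] at h1
  exact hc h1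

namespace IsTorus

variable [IsIntegral T.left] [Module.Free ℤ Λ] [Module.Finite ℤ Λ]
  {χ : Multiplicative Λ →* (T ⟶ E)}

lemma affine_eq_comp {n : ℕ} (b : Module.Basis (Fin (n + 1)) ℤ Λ) (k : ℤ) (s₀ : 𝟙_ SchC ⟶ E) :
    χ (Multiplicative.ofAdd (k • b 0)) * constHom s₀ T =
      χ (Multiplicative.ofAdd (b 0)) ≫ (𝟙 E ^ k * constHom s₀ E) := by
  rw [MonObj.comp_mul, GrpObj.comp_zpow, Category.comp_id, comp_constHom, ofAdd_zsmul, map_zpow]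

/-- The diagonal `E ⟶ T`, with all basis coordinates the identity, is a section of this character.
-/
lemma isDominant_basis (h : IsTorus χ) {n : ℕ} (b : Module.Basis (Fin (n + 1)) ℤ Λ) :
    IsDominant (χ (Multiplicative.ofAdd (b 0))).left := by
  obtain ⟨j, hj⟩ := h.exists_lift_basis b (fun _ => 𝟙 E)
  refine ⟨Function.Surjective.denseRange fun y => ⟨j.left y, ?_⟩⟩
  rw [← Scheme.Hom.comp_apply, ← Over.comp_left, hj]; rfl

lemma isDominant (h : IsTorus χ)
    (ht : IsLocalRing.maximalIdeal (E.left.presheaf.stalk (zeroPt E)) = Ideal.span {t})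
    {c : Λ} (hc : c ≠ 0) (s₀ : 𝟙_ SchC ⟶ E) :
    IsDominant (χ (Multiplicative.ofAdd c) * constHom s₀ T).left := by
  obtain ⟨n, b, k, hk, rfl⟩ := exists_basis_smul_eq hc
  rw [affine_eq_comp, Over.comp_left]
  have := h.isDominant_basis b
  have := isDominant_zpow_mul ht hk s₀
  infer_instance

lemma genericPoint_ne_zeroPt
    (ht : IsLocalRing.maximalIdeal (E.left.presheaf.stalk (zeroPt E)) = Ideal.span {t}) :
    genericPoint E.left ≠ zeroPt E := by
  intro h
  apply ne_zero_of_maximalIdeal_eq ht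
  have h1 : ∀ z : E.left, genericPoint E.left = z → ∀ a : E.left.presheaf.stalk z,
      a ∈ IsLocalRing.maximalIdeal (E.left.presheaf.stalk z) → a = 0 := by
    rintro _ rfl a ha
    exact mem_maximalIdeal_genericPoint ha
  exact h1 _ h t (ht ▸ Ideal.mem_span_singleton_self t)

/-- The generic points of the zero divisors of an affine character, in suitable coordinates. -/
lemma exists_fibre_of_apply_eq (h : IsTorus χ)
    (ht : IsLocalRing.maximalIdeal (E.left.presheaf.stalk (zeroPt E)) = Ideal.span {t})
    {n : ℕ} (b : Module.Basis (Fin (n + 1)) ℤ Λ) {k : ℤ} (hk : k ≠ 0) (s₀ : 𝟙_ SchC ⟶ E)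
    {x : T.left}
    (hx : (χ (Multiplicative.ofAdd (k • b 0)) * constHom s₀ T).left x = zeroPt E) :
    ∃ (s : 𝟙_ SchC ⟶ E) (i : power E n ⟶ T),
      IsFibre (χ (Multiplicative.ofAdd (b 0))) (rest χ b) s i ∧
      (χ (Multiplicative.ofAdd (b 0))).left x = ptOf s ∧
      IsGenericPointOf (χ (Multiplicative.ofAdd (k • b 0)) * constHom s₀ T)
        (i.left (genericPoint (power E n).left)) := by
  rw [affine_eq_comp] at hx ⊢
  have hdom := isDominant_zpow_mul ht hk s₀
  have hclosed : ∀ y : T.left, (χ (Multiplicative.ofAdd (b 0)) ≫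
      (𝟙 E ^ k * constHom s₀ E)).left y = zeroPt E →
      IsClosed {(χ (Multiplicative.ofAdd (b 0))).left y} := by
    intro y hy
    refine (isClosed_or_eq_genericPoint ht _).resolve_right fun h1 => ?_
    rw [Over.comp_left, Scheme.Hom.comp_apply, h1, apply_genericPoint_of_isDominant] at hy
    exact genericPoint_ne_zeroPt ht hy
  obtain ⟨s, hs⟩ := exists_ptOf_eq (hclosed x hx)
  obtain ⟨i, hi⟩ := h.exists_isFibre b s
  have hi0 : (χ (Multiplicative.ofAdd (b 0)) ≫ (𝟙 E ^ k * constHom s₀ E)).left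
      (i.left (genericPoint (power E n).left)) = zeroPt E := by
    rw [Over.comp_left, Scheme.Hom.comp_apply] at hx ⊢
    rw [hi.fst_apply, hs, hx]
  refine ⟨s, i, hi, hs.symm, hi0, fun y hy hyx => ?_⟩
  have h1 := hyx.map (χ (Multiplicative.ofAdd (b 0))).left.continuous
  rw [hi.fst_apply] at h1
  have h2 : ptOf s = (χ (Multiplicative.ofAdd (b 0))).left y :=
    (hclosed y hy).closure_subset_iff.2 (subset_refl _) h1.mem_closure
  exact (hyx.antisymm (hi.generic_specializes h2.symm)).eq

/-- The zero divisor of a nonconstant affine character is reduced. -/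
lemma mem_span_tpull (h : IsTorus χ)
    (ht : IsLocalRing.maximalIdeal (E.left.presheaf.stalk (zeroPt E)) = Ideal.span {t})
    {c : Λ} (hc : c ≠ 0) (s₀ : 𝟙_ SchC ⟶ E) {x : T.left}
    (hx : (χ (Multiplicative.ofAdd c) * constHom s₀ T).left x = zeroPt E)
    {a : T.left.presheaf.stalk x}
    (ha : ∀ y : T.left, IsGenericPointOf (χ (Multiplicative.ofAdd c) * constHom s₀ T) y →
      ∀ hy : y ⤳ x, T.left.presheaf.stalkSpecializes hy a ∈ IsLocalRing.maximalIdeal _) :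
    a ∈ Ideal.span {tpull t (χ (Multiplicative.ofAdd c) * constHom s₀ T) x hx} := by
  obtain ⟨n, b, k, hk, rfl⟩ := exists_basis_smul_eq hc
  obtain ⟨s, i, hi, hs, hgen⟩ := h.exists_fibre_of_apply_eq ht b hk s₀ hx
  have h1 := hi.mem_fibreIdeal hs (hi.generic_specializes hs) (ha _ hgen _)
  have hx' := hx
  rw [affine_eq_comp] at hx'
  rw [tpull_congr (affine_eq_comp b k s₀) hx hx', 
    ← fibreIdeal_eq_span (π := χ (Multiplicative.ofAdd (b 0))) (ψ := 𝟙 E ^ k * constHom s₀ E)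
      hx' hx']
  · exact h1
  · have key : ∀ y : E.left, y = ptOf s → ∀ h : (𝟙 E ^ k * constHom s₀ E).left y = zeroPt E,
        IsLocalRing.maximalIdeal (E.left.presheaf.stalk y) =
          Ideal.span {tpull t (𝟙 E ^ k * constHom s₀ E) y h} := by
      rintro _ rfl h
      exact maximalIdeal_eq_span_tpull_zpow ht hk s₀ s h
    exact key _ hs _

/-- The zero divisors of two independent affine characters have no common component. -/
lemma apply_ne_zeroPt (h : IsTorus χ)
    (ht : IsLocalRing.maximalIdeal (E.left.presheaf.stalk (zeroPt E)) = Ideal.span {t})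
    {c c' : Λ} (hcc : ∀ m n : ℤ, m • c + n • c' = 0 → m = 0 ∧ n = 0)
    (s₀ s₁ : 𝟙_ SchC ⟶ E) {x : T.left}
    (hx : IsGenericPointOf (χ (Multiplicative.ofAdd c) * constHom s₀ T) x) :
    (χ (Multiplicative.ofAdd c') * constHom s₁ T).left x ≠ zeroPt E := by
  have hc : c ≠ 0 := by
    rintro rfl
    simpa using hcc 1 0 (by simp)
  obtain ⟨n, b, k, hk, rfl⟩ := exists_basis_smul_eq hc
  obtain ⟨s, i, hi, hs, hgen⟩ := h.exists_fibre_of_apply_eq ht b hk s₀ hx.1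
  have hxi : i.left (genericPoint (power E n).left) = x :=
    hx.2 _ hgen.1 (hi.generic_specializes hs)
  obtain ⟨j, hj⟩ : ∃ j : Fin n, b.repr c' j.succ ≠ 0 := by
    by_contra! hall
    have h1 : c' = b.repr c' 0 • b 0 := by
      conv_lhs => rw [← b.sum_repr c', Fin.sum_univ_succ]
      simp [hall]
    have := (hcc (b.repr c' 0) (-k) (by rw [h1]; simp [smul_smul, mul_comm])).2
    exact hk (by simpa using this)
  -- A copy of `E` inside the component with generic point `x`: the coordinate `b 0` stays at `s`,
  -- and one further coordinate on which `c'` depends is free. Along this curve the second character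
  -- is dominant, so it cannot vanish identically on the component.
  obtain ⟨u, hu⟩ := h.exists_lift_basis b
    (fun m => if m = 0 then constHom s E else if m = j.succ then 𝟙 E else 1)
  have hu0 : u ≫ χ (Multiplicative.ofAdd (b 0)) = constHom s E := by simpa using hu 0
  have huc : u ≫ χ (Multiplicative.ofAdd c') =
      𝟙 E ^ (b.repr c' j.succ) * constHom (s ^ (b.repr c' 0)) E := by
    have h1 : c' = b.repr c' 0 • b 0 + ∑ m : Fin n, b.repr c' m.succ • b m.succ := by
      conv_lhs => rw [← b.sum_repr c', Fin.sum_univ_succ]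
    have h2 : ((HomTorus.compHom E u).comp χ) (Multiplicative.ofAdd c') =
        (u ≫ χ (Multiplicative.ofAdd (b 0))) ^ (b.repr c' 0) *
          ∏ m : Fin n, (u ≫ χ (Multiplicative.ofAdd (b m.succ))) ^ (b.repr c' m.succ) := by
      conv_lhs => rw [h1, ofAdd_add, map_mul, ofAdd_sum, map_prod]
      simp only [ofAdd_zsmul, map_zpow]
      rfl
    refine h2.trans ?_
    rw [hu0, Finset.prod_eq_single j, hu, if_neg (Fin.succ_ne_zero j), if_pos rfl, mul_comm,
      constHom_zpow]
    · intro m _ hm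
      rw [hu, if_neg (Fin.succ_ne_zero m), if_neg (by simpa using hm), one_zpow]
    · simp
  have hui : u = u ≫ rest χ b ≫ i := by
    refine hi.hom_ext _ _ ?_ ?_
    · rw [Category.assoc, Category.assoc, hi.comp_fst, hu0, ← Category.assoc, ← Category.assoc,
        comp_toUnit]
      rfl
    · rw [Category.assoc, Category.assoc, hi.comp_snd, Category.comp_id]
  intro h0
  have hdom : IsDominant (u ≫ (χ (Multiplicative.ofAdd c') * constHom s₁ T)).left := by
    rw [MonObj.comp_mul, huc, comp_constHom, mul_assoc, ← constHom_mul]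
    exact isDominant_zpow_mul ht hj _
  apply genericPoint_ne_zeroPt ht
  rw [← apply_genericPoint_of_isDominant (u ≫ (χ (Multiplicative.ofAdd c') * constHom s₁ T)).left]
  have h3 : x ⤳ u.left (genericPoint E.left) := by
    have : u.left (genericPoint E.left) =
        i.left ((rest χ b).left (u.left (genericPoint E.left))) := by
      conv_lhs => rw [hui]
      rfl
    rw [this, ← hxi]
    exact ((genericPoint_spec (power E n).left).specializes trivial).map i.left.continuous
  have h4 := h3.map (χ (Multiplicative.ofAdd c') * constHom s₁ T).left.continuous
  rw [h0] at h4
  exact isClosed_zeroPt.closure_subset_iff.2 (subset_refl _) h4.mem_closure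

end IsTorus

end Torus

/-! ### Local equations on tori -/

section LocEq

variable {E : SchC} [GrpObj E] [IsEllipticCurve E] {t : E.left.presheaf.stalk (zeroPt E)}
  {Λ : Type*} [AddCommGroup Λ] [Module.Free ℤ Λ] [Module.Finite ℤ Λ] {T : SchC}

lemma isTorus_chiHom : IsTorus (HomTorus.chiHom E (Λ := Λ)) := by
  have hb : ∀ i, HomTorus.chiHom E (Multiplicative.ofAdd (Module.finBasis ℤ Λ i)) =
    power.coord E _ i := HomTorus.chi_basis E
  refine ⟨fun {S} φ => ⟨power.lift _ fun i => φ (Multiplicative.ofAdd (Module.finBasis ℤ Λ i)),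
    fun c => ?_⟩, fun u v h => power.hom_ext _ fun i => ?_⟩
  · refine DFunLike.congr_fun (hom_eq_of_basis (Module.finBasis ℤ Λ)
      (φ := (HomTorus.compHom E (power.lift _ fun i =>
        φ (Multiplicative.ofAdd (Module.finBasis ℤ Λ i)))).comp (HomTorus.chiHom E)) (ψ := φ)
      fun i => ?_) c
    change _ ≫ HomTorus.chiHom E (Multiplicative.ofAdd (Module.finBasis ℤ Λ i)) = _
    rw [hb, power.lift_coord]
  · rw [← hb]; exact h _

/-- The characters of a product of two tori. -/
def prodChi {Λ' : Type*} [AddCommGroup Λ'] {T' : SchC} (χ : Multiplicative Λ →* (T ⟶ E))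
    (χ' : Multiplicative Λ' →* (T' ⟶ E)) : Multiplicative (Λ × Λ') →* (T ⊗ T' ⟶ E) where
  toFun c := (fst T T' ≫ χ (Multiplicative.ofAdd c.toAdd.1)) *
    (snd T T' ≫ χ' (Multiplicative.ofAdd c.toAdd.2))
  map_one' := by simp [MonObj.comp_one]
  map_mul' c d := by
    simp only [toAdd_mul, Prod.fst_add, Prod.snd_add, ofAdd_add, map_mul, MonObj.comp_mul]
    exact mul_mul_mul_comm _ _ _ _

lemma prodChi_inl {Λ' : Type*} [AddCommGroup Λ'] {T' : SchC} (χ : Multiplicative Λ →* (T ⟶ E))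
    (χ' : Multiplicative Λ' →* (T' ⟶ E)) (c : Λ) :
    prodChi χ χ' (Multiplicative.ofAdd (c, 0)) = fst T T' ≫ χ (Multiplicative.ofAdd c) := by
  change _ * (snd T T' ≫ χ' 1) = _
  rw [map_one, MonObj.comp_one, mul_one]
  rfl

lemma prodChi_inr {Λ' : Type*} [AddCommGroup Λ'] {T' : SchC} (χ : Multiplicative Λ →* (T ⟶ E))
    (χ' : Multiplicative Λ' →* (T' ⟶ E)) (c : Λ') :
    prodChi χ χ' (Multiplicative.ofAdd (0, c)) = snd T T' ≫ χ' (Multiplicative.ofAdd c) := by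
  change (fst T T' ≫ χ 1) * _ = _
  rw [map_one, MonObj.comp_one, one_mul]
  rfl

lemma IsTorus.prod {Λ' : Type*} [AddCommGroup Λ'] {T' : SchC} {χ : Multiplicative Λ →* (T ⟶ E)}
    {χ' : Multiplicative Λ' →* (T' ⟶ E)} (h : IsTorus χ) (h' : IsTorus χ') :
    IsTorus (prodChi χ χ') := by
  refine ⟨fun {S} φ => ?_, fun {S} u v huv => ?_⟩
  · obtain ⟨u, hu⟩ := h.exists_lift (φ.comp (AddMonoidHom.toMultiplicative (AddMonoidHom.inl Λ Λ')))
    obtain ⟨v, hv⟩ := h'.exists_lift (φ.comp (AddMonoidHom.toMultiplicative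
        (AddMonoidHom.inr Λ Λ')))
    refine ⟨lift u v, fun c => ?_⟩
    change lift u v ≫ ((fst T T' ≫ χ _) * (snd T T' ≫ χ' _)) = _
    rw [MonObj.comp_mul, lift_fst_assoc, lift_snd_assoc, hu, hv]
    rw [MonoidHom.comp_apply, MonoidHom.comp_apply, ← map_mul]
    congr 1
    exact Prod.ext (add_zero c.toAdd.1) (zero_add c.toAdd.2)
  · refine CartesianMonoidalCategory.hom_ext _ _ (h.hom_ext _ _ fun c => ?_)
      (h'.hom_ext _ _ fun c => ?_)
    · have := huv (Multiplicative.ofAdd (c.toAdd, 0))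
      rw [prodChi_inl] at this
      simpa using this
    · have := huv (Multiplicative.ofAdd (0, c.toAdd))
      rw [prodChi_inr] at this
      simpa using this

variable [IsIntegral T.left]

lemma locEq_eq_functionFieldMap (f : T ⟶ E) [IsDominant f.left] {x : T.left}
    (h : f.left x = zeroPt E) :
    locEq t f x = functionFieldMap f.left (algebraMap _ E.left.functionField t) := by
  rw [locEq_of_eq h, ← algebraMap_stalkSpecializes (specializes_of_eq h),
    functionFieldMap_algebraMap]
  rfl

lemma locEq_ne_zero (ht : t ≠ 0) (f : T ⟶ E) [IsDominant f.left] (x : T.left) :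
    locEq t f x ≠ 0 := by
  by_cases h : f.left x = zeroPt E
  · rw [locEq_eq_functionFieldMap f h, map_ne_zero]
    exact fun h0 => ht (stalk_algebraMap_injective _ (h0.trans (map_zero _).symm))
  · rw [locEq_of_ne h]; exact one_ne_zero

lemma locEq_mem_regAt (f : T ⟶ E) (x : T.left) : locEq t f x ∈ regAt x := by
  by_cases h : f.left x = zeroPt E
  · rw [locEq_of_eq h]; exact algebraMap_mem_regAt _
  · rw [locEq_of_ne h]; exact one_mem _

lemma locEq_mem_vanAt (ht : t ∈ IsLocalRing.maximalIdeal _) {f : T ⟶ E} {x : T.left}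
    (h : f.left x = zeroPt E) : locEq t f x ∈ vanAt x := by
  rw [locEq_of_eq h, algebraMap_mem_vanAt]
  exact tpull_mem ht f x h

lemma assocAt_of_associated {x : T.left} {a b : T.left.presheaf.stalk x} (ha : a ≠ 0)
    (h : Associated a b) : AssocAt x (algebraMap _ T.left.functionField a)
      (algebraMap _ T.left.functionField b) := by
  obtain ⟨u, rfl⟩ := h
  have h1 : algebraMap (T.left.presheaf.stalk x) T.left.functionField a ≠ 0 := fun h0 =>
    ha (stalk_algebraMap_injective x (h0.trans (map_zero _).symm))
  have h2 : algebraMap (T.left.presheaf.stalk x) T.left.functionField u ≠ 0 := fun h0 =>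
    u.ne_zero (stalk_algebraMap_injective x (h0.trans (map_zero _).symm))
  have h3 : algebraMap (T.left.presheaf.stalk x) T.left.functionField (u⁻¹ : _ˣ) =
      (algebraMap (T.left.presheaf.stalk x) T.left.functionField u)⁻¹ :=
    eq_inv_of_mul_eq_one_left (by rw [← map_mul, Units.inv_mul, map_one])
  refine ⟨h1, by rw [map_mul]; exact mul_ne_zero h1 h2, ⟨(u⁻¹ : _ˣ), ?_⟩, ⟨u, ?_⟩⟩
  · rw [h3, map_mul]; field_simp
  · rw [map_mul]; field_simp

lemma assocAt_locEq_inv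
    (ht : IsLocalRing.maximalIdeal (E.left.presheaf.stalk (zeroPt E)) = Ideal.span {t})
    (f : T ⟶ E) [IsDominant f.left] (x : T.left) : AssocAt x (locEq t f⁻¹ x) (locEq t f x) := by
  by_cases h : f.left x = zeroPt E
  · obtain ⟨h', h1⟩ := associated_tpull_inv ht (ne_zero_of_maximalIdeal_eq ht) f h
    have h2 := locEq_ne_zero (ne_zero_of_maximalIdeal_eq ht) f x
    rw [locEq_of_eq h] at h2 ⊢
    rw [locEq_of_eq h']
    refine (assocAt_of_associated (fun h0 => h2 ?_) h1).symm
    rw [h0, map_zero]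
  · have h' : f⁻¹.left x ≠ zeroPt E := fun h0 => h (by
      obtain ⟨h1, -⟩ := associated_tpull_inv ht (ne_zero_of_maximalIdeal_eq ht) f⁻¹ h0
      rwa [inv_inv] at h1)
    rw [locEq_of_ne h, locEq_of_ne h']
    exact .refl one_ne_zero

/-- The zero divisor of a nonconstant affine character is reduced. -/
lemma IsTorus.div_locEq_mem {χ : Multiplicative Λ →* (T ⟶ E)} (h : IsTorus χ)
    (ht : IsLocalRing.maximalIdeal (E.left.presheaf.stalk (zeroPt E)) = Ideal.span {t})
    {c : Λ} (hc : c ≠ 0) (s₀ : 𝟙_ SchC ⟶ E) {x : T.left} {a : T.left.functionField}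
    (ha : a ∈ regAt x) (ha' : ∀ y : T.left,
      IsGenericPointOf (χ (Multiplicative.ofAdd c) * constHom s₀ T) y → y ⤳ x → a ∈ vanAt y) :
    a / locEq t (χ (Multiplicative.ofAdd c) * constHom s₀ T) x ∈ regAt x := by
  have hdom := h.isDominant ht hc s₀
  by_cases hx : (χ (Multiplicative.ofAdd c) * constHom s₀ T).left x = zeroPt E
  · obtain ⟨r, rfl⟩ := ha
    have h1 := h.mem_span_tpull ht hc s₀ hx (a := r) fun y hy hyx => by
      rw [← algebraMap_mem_vanAt, algebraMap_stalkSpecializes]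
      exact ha' y hy hyx
    obtain ⟨q, rfl⟩ := Ideal.mem_span_singleton.1 h1
    have h2 := locEq_ne_zero (ne_zero_of_maximalIdeal_eq ht)
      (χ (Multiplicative.ofAdd c) * constHom s₀ T) x
    rw [locEq_of_eq hx] at h2 ⊢
    rw [map_mul, mul_div_cancel_left₀ _ h2]
    exact algebraMap_mem_regAt q
  · rw [locEq_of_ne hx, div_one]; exact ha

/-- An endomorphism that fixes the zero divisor of a character pointwise fixes functions modulo
its equation. -/
lemma fixed_of_comp_eq
    (ht : IsLocalRing.maximalIdeal (E.left.presheaf.stalk (zeroPt E)) = Ideal.span {t})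
    (f : T ⟶ E) [IsDominant f.left] (r : T ⟶ T) [IsDominant r.left]
    (hr : ∀ {S : SchC} (u : S ⟶ T), u ≫ f = 1 → u ≫ r = u) {x : T.left}
    (hx : f.left x = zeroPt E) :
    r.left x = x ∧ ∀ a ∈ regAt x, (functionFieldMap r.left a - a) / locEq t f x ∈ regAt x := by
  -- A `Q`-point supported on the scheme-theoretic zero locus of `f` is fixed by `r`. The residue
  -- field as `Q` shows that `x` is fixed; the quotient of the stalk by the equation of `f` shows
  -- that functions are fixed modulo that equation.
  have key : ∀ {Q : CommRingCat.{0}} (q : T.left.presheaf.stalk x ⟶ Q)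
      (_ : ∀ a ∈ IsLocalRing.maximalIdeal (E.left.presheaf.stalk (f.left x)),
        (f.left.stalkMap x ≫ q).hom a = 0),
      Spec.map q ≫ T.left.fromSpecStalk x ≫ r.left = Spec.map q ≫ T.left.fromSpecStalk x := by
    intro Q q hq
    have hcl : IsClosed {f.left x} := hx ▸ isClosed_zeroPt
    have hp : pointOfClosedPoint E.hom (f.left x) hcl = η[E].left := by
      refine ext_of_apply_closedPoint_eq E.hom (pointOfClosedPoint_comp _ _ _) (Over.w η[E]) ?_
      exact (pointOfClosedPoint_apply E.hom (f.left x) hcl _).trans hx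
    have h1 : Spec.map q ≫ T.left.fromSpecStalk x ≫ f.left =
        Spec.map q ≫ T.left.fromSpecStalk x ≫ T.hom ≫ η[E].left := by
      have := comp_fromSpecStalk_eq_of_map_eq_zero E.hom (f.left x) hcl (f.left.stalkMap x ≫ q) hq
      rw [hp, Spec.map_comp, Category.assoc, Category.assoc] at this
      simp only [Scheme.SpecMap_stalkMap_fromSpecStalk,
        Scheme.SpecMap_stalkMap_fromSpecStalk_assoc, Category.assoc] at this
      rw [this, reassoc_of% (Over.w f)]
    let S : SchC := Over.mk (Spec.map q ≫ T.left.fromSpecStalk x ≫ T.hom)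
    let u : S ⟶ T := Over.homMk (Spec.map q ≫ T.left.fromSpecStalk x) (Category.assoc _ _ _)
    have h2 : u ≫ f = 1 := by
      ext1
      change (Spec.map q ≫ T.left.fromSpecStalk x) ≫ f.left = (toUnit S).left ≫ η[E].left
      rw [toUnit_left, Category.assoc, h1]
      change _ = (Spec.map q ≫ T.left.fromSpecStalk x ≫ T.hom) ≫ η[E].left
      simp only [Category.assoc]
    have h3 := congrArg CommaMorphism.left (hr u h2)
    refine Eq.trans ?_ h3
    exact (Category.assoc _ _ _).symm
  have hfix : r.left x = x := by
    have h1 := key (T.left.residue x) (fun a ha => by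
      refine (IsLocalRing.residue_eq_zero_iff _).2 ?_
      exact stalkMap_mem_maximalIdeal _ _ ha)
    have h2 : T.left.fromSpecResidueField x ≫ r.left = T.left.fromSpecResidueField x := by
      refine Eq.trans ?_ h1
      exact Category.assoc _ _ _
    have h3 := congrArg (fun φ : Spec (T.left.residueField x) ⟶ T.left => φ default) h2
    change r.left (T.left.fromSpecResidueField x default) =
      T.left.fromSpecResidueField x default at h3
    rwa [Scheme.fromSpecResidueField_apply] at h3
  refine ⟨hfix, ?_⟩
  rintro _ ⟨a, rfl⟩
  have h1 : ∀ {Q : CommRingCat.{0}} (q : T.left.presheaf.stalk x ⟶ Q)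
      (_ : ∀ a ∈ IsLocalRing.maximalIdeal (E.left.presheaf.stalk (f.left x)),
        (f.left.stalkMap x ≫ q).hom a = 0),
      q.hom (r.left.stalkMap x
        (T.left.presheaf.stalkSpecializes (specializes_of_eq hfix) a) - a) = 0 := by
    intro Q q hq
    have h2 : Spec.map (T.left.presheaf.stalkSpecializes (specializes_of_eq hfix) ≫
        r.left.stalkMap x ≫ q) ≫ T.left.fromSpecStalk x =
        Spec.map q ≫ T.left.fromSpecStalk x := by
      rw [← key q hq]
      simp only [Spec.map_comp, Category.assoc, Scheme.SpecMap_stalkSpecializes_fromSpecStalk,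
        Scheme.SpecMap_stalkMap_fromSpecStalk]
    have h3 := Spec.map_injective ((cancel_mono _).1 h2)
    rw [map_sub, sub_eq_zero]
    exact ConcreteCategory.congr_hom h3 a
  have h2 : (r.left.stalkMap x
        (T.left.presheaf.stalkSpecializes (specializes_of_eq hfix) a) - a) ∈
      IsFibre.fibreIdeal f x := Ideal.Quotient.eq_zero_iff_mem.1
    (h1 (CommRingCat.ofHom (Ideal.Quotient.mk (IsFibre.fibreIdeal f x))) fun b hb =>
      Ideal.Quotient.eq_zero_iff_mem.2 (Ideal.mem_map_of_mem _ hb))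
  rw [fibreIdeal_eq_span (π := f) (ψ := 𝟙 E) hx (by rw [Category.comp_id, hx])
      (maximalIdeal_eq_span_tpull_id ht _), tpull_congr (Category.comp_id _) _ hx] at h2
  obtain ⟨q, hq⟩ := Ideal.mem_span_singleton.1 h2
  have h4 := locEq_ne_zero (ne_zero_of_maximalIdeal_eq ht) f x
  rw [locEq_of_eq hx] at h4 ⊢
  have h5 : functionFieldMap r.left (algebraMap _ T.left.functionField a) =
      algebraMap _ _ (r.left.stalkMap x
        (T.left.presheaf.stalkSpecializes (specializes_of_eq hfix) a)) := by
    rw [← functionFieldMap_algebraMap, algebraMap_stalkSpecializes]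
  rw [h5, ← map_sub, hq, map_mul, mul_div_cancel_left₀ _ h4]
  exact algebraMap_mem_regAt q

end LocEq

/-! ### Affine neighbourhoods of finite sets -/

section Affine

/-- The prime ideal of a point of an affine open subset. -/
def primeAt {X : Scheme.{0}} {U : X.Opens} (x : U) : Ideal Γ(X, U) :=
  (IsLocalRing.maximalIdeal (X.presheaf.stalk x.1)).comap (X.presheaf.germ U x.1 x.2).hom

instance isPrime_primeAt {X : Scheme.{0}} {U : X.Opens} (x : U) : (primeAt x).IsPrime :=
  Ideal.IsPrime.comap _

lemma notMem_primeAt {X : Scheme.{0}} {U : X.Opens} (x : U) {f : Γ(X, U)} :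
    f ∉ primeAt x ↔ x.1 ∈ X.basicOpen f := by
  rw [primeAt, Ideal.mem_comap, IsLocalRing.notMem_maximalIdeal, Scheme.mem_basicOpen _ _ _ x.2]

lemma specializes_of_primeAt_le {X : Scheme.{0}} {U : X.Opens} (hU : IsAffineOpen U) {x y : U}
    (h : primeAt x ≤ primeAt y) : x.1 ⤳ y.1 := by
  rw [specializes_iff_forall_open]
  intro W hW hy
  obtain ⟨f, hf, hyf⟩ := hU.exists_basicOpen_le (V := ⟨W, hW⟩) ⟨y.1, hy⟩ y.2
  refine hf ((notMem_primeAt x).1 fun hx => ?_)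
  exact (notMem_primeAt y).2 hyf (h hx)

/-- Prime avoidance: a finite subset of an affine open subset has a basis of affine open
neighbourhoods. -/
lemma exists_basicOpen_le_of_finite {X : Scheme.{0}} {U : X.Opens} (hU : IsAffineOpen U)
    {W : X.Opens} {S : Set X} (hS : S.Finite) (hSU : S ⊆ U) (hSW : S ⊆ W) :
    ∃ f : Γ(X, U), X.basicOpen f ≤ W ∧ S ⊆ X.basicOpen f := by
  classical
  -- The functions vanishing at all points of `U` outside `W`. An element of `I` outside the primes
  -- of the points of `S` is what is wanted.
  let I : Ideal Γ(X, U) := ⨅ y : {y : U // y.1 ∉ W}, primeAt y.1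
  have hI : ∀ x : U, x.1 ∈ W → ¬ I ≤ primeAt x := by
    intro x hx hle
    obtain ⟨f, hf, hxf⟩ := hU.exists_basicOpen_le (V := W) ⟨x.1, hx⟩ x.2
    refine (notMem_primeAt x).2 hxf (hle ?_)
    rw [Submodule.mem_iInf]
    intro y
    by_contra hy
    exact y.2 (hf ((notMem_primeAt y.1).1 hy))
  have hfin : Finite S := hS
  have := Fintype.ofFinite S
  have h1 : ¬ ((I : Set Γ(X, U)) ⊆
      ⋃ y ∈ ((Finset.univ : Finset S) : Set S), primeAt (⟨y.1, hSU y.2⟩ : U)) := by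
    rcases isEmpty_or_nonempty S with hemp | ⟨⟨a⟩⟩
    · intro h
      simpa using h I.zero_mem
    · rw [Ideal.subset_union_prime a a (fun _ _ _ _ => inferInstance)]
      rintro ⟨y, -, hy⟩
      exact hI ⟨y.1, hSU y.2⟩ (hSW y.2) hy
  obtain ⟨f, hfI, hf⟩ := Set.not_subset.1 h1
  refine ⟨f, fun y hy => ?_, fun y hy => ?_⟩
  · by_contra hyW
    have hyU : y ∈ U := X.basicOpen_le f hy
    exact (notMem_primeAt ⟨y, hyU⟩).2 hy ((Submodule.mem_iInf _).1 hfI ⟨⟨y, hyU⟩, hyW⟩)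
  · refine (notMem_primeAt (⟨y, hSU hy⟩ : U)).1 fun h => hf ?_
    exact Set.mem_iUnion₂.2 ⟨⟨y, hy⟩, by simp, h⟩

variable {T : SchC} [GrpObj T] [LocallyOfFiniteType T.hom] [IsIntegral T.left]
  [CompactSpace T.left]

/-- A finite subset of a group scheme is contained in an affine open subset. -/
lemma exists_isAffineOpen_of_finite {S : Set T.left} (hS : S.Finite) :
    ∃ O : T.left.Opens, IsAffineOpen O ∧ S ⊆ O := by
  have hJ : JacobsonSpace T.left := LocallyOfFiniteType.jacobsonSpace T.hom
  obtain ⟨_, ⟨O, hO, rfl⟩, hgO, -⟩ := T.left.isBasis_affineOpens.exists_subset_of_mem_open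
    (Set.mem_univ (genericPoint T.left)) isOpen_univ
  have hcl : ∀ y : T.left, ∃ s : 𝟙_ SchC ⟶ T, y ⤳ ptOf s := by
    intro y
    obtain ⟨z, hz, hzc⟩ := IsClosed.exists_closed_singleton (isClosed_closure (s := {y}))
      ⟨y, subset_closure rfl⟩
    obtain ⟨s, rfl⟩ := exists_ptOf_eq hzc
    exact ⟨s, specializes_iff_mem_closure.2 hz⟩
  choose σ hσ using hcl
  obtain ⟨o, ho, hoc⟩ := nonempty_inter_closedPoints (Z := (O : Set T.left)) ⟨_, hgO⟩
    O.isOpen.isLocallyClosed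
  obtain ⟨o, rfl⟩ := exists_ptOf_eq hoc
  have hl : ∀ s s' : 𝟙_ SchC ⟶ T, (constHom s T * 𝟙 T).left (ptOf s') = ptOf (s * s') := by
    intro s s'
    have : s' ≫ (constHom s T * 𝟙 T) = s * s' := by
      rw [MonObj.comp_mul, comp_constHom, constHom_unit, Category.comp_id]
    rw [← this]; rfl
  -- The points `z` with `σ y · z ∈ O` form a nonempty open set, with witness `(σ y)⁻¹ o`, hence
  -- contain the generic point.
  have hmem : ∀ y, genericPoint T.left ∈ (constHom (σ y) T * 𝟙 T).left ⁻¹ᵁ O := by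
    intro y
    refine ((genericPoint_spec T.left).specializes trivial).mem_open
      ((constHom (σ y) T * 𝟙 T).left ⁻¹ᵁ O).isOpen
      (y := ptOf ((σ y)⁻¹ * o)) ?_
    change (constHom (σ y) T * 𝟙 T).left _ ∈ O
    rw [hl, mul_inv_cancel_left]
    exact ho
  -- A finite intersection of nonempty open sets contains a closed point `a`, by the Jacobson
  -- property. Right translation by `a` carries every `σ y` into `O`, and `y`, a generization of `σ
  -- y`, goes along.
  obtain ⟨a, ha, hac⟩ := nonempty_inter_closedPoints
    (Z := ⋂ y ∈ S, ((constHom (σ y) T * 𝟙 T).left ⁻¹ᵁ O : Set T.left))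
    ⟨genericPoint T.left, Set.mem_iInter₂.2 fun y _ => hmem y⟩
    (hS.isOpen_biInter fun y _ => ((constHom (σ y) T * 𝟙 T).left ⁻¹ᵁ O).isOpen).isLocallyClosed
  obtain ⟨a, rfl⟩ := exists_ptOf_eq hac
  refine ⟨(transl a).left ⁻¹ᵁ O, hO.preimage_of_isIso _, fun y hy => ?_⟩
  refine (hσ y).mem_open ((transl a).left ⁻¹ᵁ O).isOpen ?_
  change (transl a).left (ptOf (σ y)) ∈ O
  have := Set.mem_iInter₂.1 ha y hy
  rw [transl_ptOf, ← hl]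
  exact this

lemma isSeparated_left [IsSeparated T.hom] : T.left.IsSeparated := by
  refine ⟨?_⟩
  rw [show terminal.from T.left = T.hom ≫ terminal.from _ from terminal.hom_ext _ _]
  infer_instance

/-- The affine invariant open subsets are a basis of the invariant open subsets. -/
lemma exists_isAffineOpen_isInvariant [IsSeparated T.hom] {G : Type*} [Group G] [Finite G]
    [SchemeAction G T.left] {U : T.left.Opens} (hU : SchemeAction.IsInvariant G U) {x : T.left}
    (hx : x ∈ U) : ∃ O : T.left.Opens, IsAffineOpen O ∧ SchemeAction.IsInvariant G O ∧ O ≤ U ∧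
      x ∈ O := by
  have := isSeparated_left (T := T)
  obtain ⟨O, hO, hS⟩ := exists_isAffineOpen_of_finite
    (Set.finite_range fun g : G => SchemeAction.inv g x)
  obtain ⟨f, hf, hSf⟩ := exists_basicOpen_le_of_finite hO (W := U) (Set.finite_range _) hS (by
    rintro _ ⟨g, rfl⟩
    exact (inv_mem_iff_of_isInvariant hU g).2 hx)
  refine ⟨invCore G (T.left.basicOpen f), ?_, isInvariant_invCore _, (invCore_le _).trans hf,
    mem_invCore.2 fun g => hSf ⟨g, rfl⟩⟩
  have := Fintype.ofFinite G
  -- A finite intersection of translates of an affine open set, which is affine by separatedness.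
  have h1 : invCore G (T.left.basicOpen f) = (Finset.univ : Finset G).inf' Finset.univ_nonempty
      (fun g => SchemeAction.inv g ⁻¹ᵁ T.left.basicOpen f) := by
    ext y
    rw [SetLike.mem_coe, mem_invCore, Finset.inf'_eq_inf, TopologicalSpace.Opens.coe_finset_inf,
      Finset.inf_eq_iInf]
    exact ⟨fun h => Set.mem_iInter₂.2 fun g _ => h g,
      fun h g => Set.mem_iInter₂.1 h g (Finset.mem_univ g)⟩
  rw [h1]
  exact Finset.inf'_induction (p := fun O : T.left.Opens => IsAffineOpen O) _ _
      (fun _ h _ h' => h.inf h') fun g _ =>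
    (hO.basicOpen f).preimage_of_isIso _

end Affine

/-! ### Semilocal parameters of the curve. -/

section SemiLocal

variable {E : SchC} [GrpObj E] [IsEllipticCurve E] {t : E.left.presheaf.stalk (zeroPt E)}

/-- A rational function which is a local parameter at the origin and a unit at the other points
of a neighbourhood of a given finite set. -/
lemma exists_semilocal_parameter
    (ht : IsLocalRing.maximalIdeal (E.left.presheaf.stalk (zeroPt E)) = Ideal.span {t})
    {S : Set E.left} (hS : S.Finite) :
    ∃ (e : E.left.functionField) (N : E.left.Opens), S ⊆ N ∧ zeroPt E ∈ N ∧
      AssocAt (zeroPt E) e (algebraMap _ _ t) ∧ ∀ y ∈ N, y ≠ zeroPt E → AssocAt y e 1 := by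
  classical
  have ht0 := ne_zero_of_maximalIdeal_eq ht
  obtain ⟨O, hO, hSO⟩ := exists_isAffineOpen_of_finite (T := E) (hS.insert (zeroPt E))
  have h0O : zeroPt E ∈ O := hSO (by simp)
  have hfin : Finite (insert (zeroPt E) S : Set E.left) := hS.insert _
  have := Fintype.ofFinite (insert (zeroPt E) S : Set E.left)
  let o : (insert (zeroPt E) S : Set E.left) := ⟨zeroPt E, by simp⟩
  -- Functions vanishing to order at least two at the origin. The parameter must lie in the prime of
  -- the origin, outside `J`, and outside the primes of the other points of `S`.
  let J : Ideal Γ(E.left, O) := (Ideal.span {t ^ 2}).comap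
      (E.left.presheaf.germ O (zeroPt E) h0O).hom
  let I : (insert (zeroPt E) S : Set E.left) → Ideal Γ(E.left, O) := fun y =>
    if y = o then J else primeAt (⟨y.1, hSO y.2⟩ : O)
  -- The element `t`, with denominators cleared by a unit of the local ring, vanishes at the origin
  -- to order exactly one.
  have hJ : ¬ primeAt (⟨zeroPt E, h0O⟩ : O) ≤ J := by
    intro hle
    obtain ⟨W, hW, r, hr⟩ := E.left.presheaf.exists_germ_eq t
    obtain ⟨f, hf, h0f⟩ := hO.exists_basicOpen_le (V := W) ⟨zeroPt E, hW⟩ h0O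
    have := hO.isLocalization_basicOpen f
    obtain ⟨⟨q, m⟩, hq⟩ := IsLocalization.surj (M := Submonoid.powers f)
      (E.left.presheaf.map (homOfLE hf).op r)
    have hq' := congrArg (E.left.presheaf.germ (E.left.basicOpen f) (zeroPt E) h0f) hq
    rw [map_mul, RingHom.algebraMap_toAlgebra] at hq'
    simp only [TopCat.Presheaf.germ_res_apply] at hq'
    rw [hr] at hq'
    have hm : IsUnit (E.left.presheaf.germ O (zeroPt E) h0O m) := by
      obtain ⟨_, k, rfl⟩ := m
      rw [map_pow]
      exact ((Scheme.mem_basicOpen _ _ _ h0O).1 h0f).pow k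
    have hqJ : q ∈ J := hle (by
      change E.left.presheaf.germ O (zeroPt E) h0O q ∈ IsLocalRing.maximalIdeal _
      rw [← hq', ht]
      exact Ideal.mul_mem_right _ _ (Ideal.mem_span_singleton_self t))
    obtain ⟨v, hv⟩ := Ideal.mem_span_singleton.1 (show
      E.left.presheaf.germ O (zeroPt E) h0O q ∈ Ideal.span {t ^ 2} from hqJ)
    rw [← hq', sq, mul_assoc] at hv
    have h1 := mul_left_cancel₀ ht0 hv
    refine (IsLocalRing.mem_maximalIdeal _).1 ?_ hm
    rw [h1, ht]
    exact Ideal.mul_mem_right _ _ (Ideal.mem_span_singleton_self t)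
  have hcl : ∀ y : O, y.1 ≠ zeroPt E → ¬ primeAt (⟨zeroPt E, h0O⟩ : O) ≤ primeAt y := by
    intro y hy hle
    refine hy ?_
    exact isClosed_zeroPt.closure_subset_iff.2 (subset_refl _)
      (specializes_of_primeAt_le hO hle).mem_closure
  -- Prime avoidance tolerates that `J`, unlike the other ideals of the union, is not prime.
  have h1 : ¬ ((primeAt (⟨zeroPt E, h0O⟩ : O) : Set Γ(E.left, O)) ⊆
      ⋃ y ∈ ((Finset.univ : Finset (insert (zeroPt E) S : Set E.left)) : Set _), I y) := by
    rw [Ideal.subset_union_prime o o (fun y _ hy _ => by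
      simp only [I, if_neg hy]; infer_instance)]
    rintro ⟨y, -, hy⟩
    by_cases hyo : y = o
    · simp only [I, if_pos hyo] at hy
      exact hJ hy
    · simp only [I, if_neg hyo] at hy
      exact hcl ⟨y.1, hSO y.2⟩ (fun h => hyo (Subtype.ext h)) hy
  obtain ⟨e₀, he0, he⟩ := Set.not_subset.1 h1
  have heJ : e₀ ∉ J := fun h => he (Set.mem_iUnion₂.2 ⟨o, by simp, by simpa [I] using h⟩)
  have heS : ∀ y (hy : y ∈ S), y ≠ zeroPt E → e₀ ∉ primeAt (⟨y, hSO (by simp [hy])⟩ : O) := by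
    intro y hy hne h
    refine he (Set.mem_iUnion₂.2 ⟨⟨y, by simp [hy]⟩, by simp, ?_⟩)
    have : (⟨y, by simp [hy]⟩ : (insert (zeroPt E) S : Set E.left)) ≠ o := fun h =>
      hne (congrArg Subtype.val h)
    simp only [I, if_neg this]
    exact h
  let v : Γ(E.left, O) →+* E.left.functionField := regValue (⟨zeroPt E, h0O⟩ : O)
  have hv : ∀ (y : O) r, v r ∈ regAt y.1 := fun y r => by
    rw [show v = regValue y from regValue_eq _ _]
    exact algebraMap_mem_regAt _
  have hvan : ∀ (y : O) r, v r ∈ vanAt y.1 ↔ r ∈ primeAt y := fun y r => by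
    rw [show v = regValue y from regValue_eq _ _]
    exact algebraMap_mem_vanAt
  have hassoc : AssocAt (zeroPt E) (v e₀) (algebraMap _ _ t) := by
    obtain ⟨u, hu⟩ := Ideal.mem_span_singleton.1 (ht ▸ (show
      E.left.presheaf.germ O (zeroPt E) h0O e₀ ∈ IsLocalRing.maximalIdeal _ from he0))
    refine (assocAt_of_associated (T := E) ht0 ?_).symm
    rw [hu]
    have huu : IsUnit u := by
      by_contra hnu
      rw [← mem_nonunits_iff, ← IsLocalRing.mem_maximalIdeal, ht] at hnu
      obtain ⟨w, rfl⟩ := Ideal.mem_span_singleton.1 hnu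
      refine heJ (Ideal.mem_span_singleton.2 ⟨w, ?_⟩)
      rw [sq, mul_assoc]
      exact hu
    exact ⟨huu.unit, by rw [IsUnit.unit_spec]⟩
  have hve : v e₀ ≠ 0 := hassoc.1
  have hnoeth : IsNoetherianRing Γ(E.left, O) :=
    IsLocallyNoetherian.component_noetherian (X := E.left) ⟨O, hO⟩
  obtain ⟨F, hF⟩ := (IsNoetherian.noetherian (primeAt (⟨zeroPt E, h0O⟩ : O)))
  have hF' : ∀ y : O, (∀ r ∈ F, v r / v e₀ ∈ regAt y.1) →
      ∀ r ∈ primeAt (⟨zeroPt E, h0O⟩ : O), v r / v e₀ ∈ regAt y.1 := by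
    intro y hy r hr
    rw [← hF] at hr
    induction hr using Submodule.span_induction with
    | mem r hr => exact hy r hr
    | zero => simp
    | add a b _ _ iha ihb => rw [map_add, add_div]; exact add_mem iha ihb
    | smul a b _ ihb =>
      rw [smul_eq_mul, map_mul, mul_div_assoc]; exact mul_mem (hv y a) ihb
  -- The neighbourhood has two pieces: where `e₀` is a unit, and where `e₀` divides the finitely
  -- many generators of the ideal of the origin. At a point of the second piece other than the
  -- origin some element of that ideal is a unit, so `e₀` is one too.
  have h0N : zeroPt E ∈ (O ⊓ ⟨_, isOpen_setOf_assocAt (v e₀) 1⟩) ⊔ (O ⊓ ⟨⋂ r ∈ F,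
      {x | v r / v e₀ ∈ regAt x}, isOpen_biInter_finset fun r _ => isOpen_setOf_mem_regAt _⟩) := by
    refine Or.inr ⟨h0O, Set.mem_iInter₂.2 fun r hr => ?_⟩
    have hr0 : r ∈ primeAt (⟨zeroPt E, h0O⟩ : O) := hF ▸ Submodule.subset_span hr
    obtain ⟨u, hu⟩ := Ideal.mem_span_singleton.1 (ht ▸ (show
      E.left.presheaf.germ O (zeroPt E) h0O r ∈ IsLocalRing.maximalIdeal _ from hr0))
    have h3 : v r = algebraMap _ _ t * algebraMap _ _ u := by
      rw [← map_mul, ← hu]; rfl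
    change v r / v e₀ ∈ regAt _
    rw [h3, mul_div_right_comm]
    exact mul_mem hassoc.2.2.2 (algebraMap_mem_regAt u)
  refine ⟨v e₀, (O ⊓ ⟨_, isOpen_setOf_assocAt (v e₀) 1⟩) ⊔ (O ⊓ ⟨⋂ r ∈ F,
    {x | v r / v e₀ ∈ regAt x}, isOpen_biInter_finset fun r _ => isOpen_setOf_mem_regAt _⟩),
    ?_, ?_, hassoc, ?_⟩
  · intro y hy
    by_cases hy0 : y = zeroPt E
    · rw [hy0]; exact h0N
    · exact Or.inl ⟨hSO (by simp [hy]), AssocAt.one_of_mem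
        (hv ⟨y, hSO (by simp [hy])⟩ e₀)
        (fun h => heS y hy hy0 ((hvan ⟨y, hSO (by simp [hy])⟩ e₀).1 h))⟩
  · exact h0N
  · rintro y (⟨-, hy⟩ | ⟨hyO, hy⟩) hy0
    · exact hy
    · obtain ⟨r, hr, hry⟩ := Set.not_subset.1 (hcl ⟨y, hyO⟩ hy0)
      have h2 := hF' ⟨y, hyO⟩ (fun r hr => Set.mem_iInter₂.1 hy r hr) r hr
      have h3 : (v r)⁻¹ ∈ regAt y := inv_mem_regAt (hv ⟨y, hyO⟩ r) (fun h =>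
        hry ((hvan ⟨y, hyO⟩ r).1 h))
      have hvr : v r ≠ 0 := fun h0 => hry ((hvan ⟨y, hyO⟩ r).1 (h0 ▸ zero_mem_vanAt y))
      refine ⟨hve, one_ne_zero, by simpa using hv ⟨y, hyO⟩ e₀, ?_⟩
      have := mul_mem h2 h3
      rwa [div_mul_eq_mul_div, mul_inv_cancel₀ hvr] at this

end SemiLocal

/-! ### Combinatorics of reflections -/

/-- The combinatorial data of a group generated by reflections, acting on a lattice: the positive
roots, the reflections in them, the simple ones, and the set of roots for which a shifted divisor
is considered. -/
structure HeckeDatum (G Λ J : Type*) [Group G] [AddCommGroup Λ] where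
  /-- the action on the lattice -/
  act : G →* AddMonoid.End Λ
  /-- the positive roots -/
  root : J → Λ
  /-- the reflections -/
  refl : J → G
  /-- the simple roots -/
  simple : J → Prop
  /-- the roots with a shifted divisor -/
  shifted : J → Prop
  root_ne_zero : ∀ j (m : ℤ), m • root j = 0 → m = 0
  indep : ∀ i j, i ≠ j → ∀ m n : ℤ, m • root i + n • root j = 0 → m = 0 ∧ n = 0
  act_refl : ∀ j c, ∃ n : ℤ, act (refl j) c = c + n • root j
  act_refl_self : ∀ j, act (refl j) (root j) = -root j
  refl_mul_self : ∀ j, refl j * refl j = 1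
  perm : ∀ s, simple s → ∀ j, j ≠ s → ∃ j', j' ≠ s ∧ act (refl s) (root j) = root j' ∧
    refl j * refl s = refl s * refl j' ∧ (shifted j' ↔ shifted j)
  word : ∀ g, ∃ l : List J, (∀ s ∈ l, simple s) ∧ (l.map refl).prod = g

namespace HeckeDatum

variable {G Λ J : Type*} [Group G] [AddCommGroup Λ] (D : HeckeDatum G Λ J)

lemma root_injective : Function.Injective D.root := fun i j h => by
  by_contra hij
  have := D.indep i j hij 1 (-1) (by simp [h])
  simp at this

lemma root_ne_neg (i j : J) : D.root i ≠ -D.root j := by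
  intro h
  by_cases hij : i = j
  · subst hij
    have := D.root_ne_zero i 2 (by rw [two_smul]; nth_rewrite 1 [h]; simp)
    norm_num at this
  · have := D.indep i j hij 1 1 (by simp [h])
    simp at this

lemma act_mul (g h : G) (c : Λ) : D.act (g * h) c = D.act g (D.act h c) := by
  rw [map_mul]; rfl

lemma act_one (c : Λ) : D.act 1 c = c := by
  rw [map_one]; rfl

lemma refl_inv (j : J) : (D.refl j)⁻¹ = D.refl j := inv_eq_of_mul_eq_one_left (D.refl_mul_self j)

lemma act_refl_refl (j : J) (c : Λ) : D.act (D.refl j) (D.act (D.refl j) c) = c := by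
  rw [← act_mul, refl_mul_self, act_one]

lemma refl_ne_one (j : J) : D.refl j ≠ 1 := fun h => by
  have := D.act_refl_self j
  rw [h, act_one] at this
  exact D.root_ne_neg j j this

/-- The permutation of the positive roots other than a simple one by a simple reflection. -/
def perm' (s : J) (hs : D.simple s) (j : {j // j ≠ s}) : {j // j ≠ s} :=
  ⟨(D.perm s hs j.1 j.2).choose, (D.perm s hs j.1 j.2).choose_spec.1⟩

lemma root_perm' {s : J} (hs : D.simple s) (j : {j // j ≠ s}) :
    D.root (D.perm' s hs j) = D.act (D.refl s) (D.root j) :=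
  (D.perm s hs j.1 j.2).choose_spec.2.1.symm

lemma refl_perm' {s : J} (hs : D.simple s) (j : {j // j ≠ s}) :
    D.refl j * D.refl s = D.refl s * D.refl (D.perm' s hs j) :=
  (D.perm s hs j.1 j.2).choose_spec.2.2.1

lemma shifted_perm' {s : J} (hs : D.simple s) (j : {j // j ≠ s}) :
    D.shifted (D.perm' s hs j) ↔ D.shifted j :=
  (D.perm s hs j.1 j.2).choose_spec.2.2.2

lemma perm'_perm' {s : J} (hs : D.simple s) (j : {j // j ≠ s}) :
    D.perm' s hs (D.perm' s hs j) = j := by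
  apply Subtype.ext
  apply D.root_injective
  rw [root_perm', root_perm', act_refl_refl]

/-- The permutation of the positive roots other than a simple one by a simple reflection. -/
def permEquiv (s : J) (hs : D.simple s) : Equiv.Perm {j // j ≠ s} :=
  ⟨D.perm' s hs, D.perm' s hs, D.perm'_perm' hs, D.perm'_perm' hs⟩

/-- A group element makes a positive root positive or negative. -/
lemma act_root (g : G) (j : J) : ∃ j', D.act g (D.root j) = D.root j' ∨
    D.act g (D.root j) = -D.root j' := by
  obtain ⟨l, hl, rfl⟩ := D.word g
  induction l with
  | nil => exact ⟨j, Or.inl (D.act_one _)⟩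
  | cons s l ih =>
    obtain ⟨j', hj'⟩ := ih fun s hs => hl s (by simp [hs])
    have hs : D.simple s := hl s (by simp)
    rw [List.map_cons, List.prod_cons, act_mul]
    by_cases hjs : j' = s
    · subst hjs
      refine ⟨j', ?_⟩
      rcases hj' with h | h
      · right; rw [h, act_refl_self]
      · left; rw [h, map_neg, act_refl_self, neg_neg]
    · refine ⟨D.perm' s hs ⟨j', hjs⟩, ?_⟩
      rcases hj' with h | h
      · left; rw [h, root_perm']
      · right; rw [h, map_neg, root_perm']

/-- The positive root `j` is made negative by `g⁻¹`. -/
def IsInv (j : J) (g : G) : Prop := ∀ j', D.act g⁻¹ (D.root j) ≠ D.root j'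

lemma not_isInv_one (j : J) : ¬ D.IsInv j 1 := fun h => h j (by rw [inv_one, act_one])

lemma isInv_refl_mul_self {s : J} (g : G) : D.IsInv s (D.refl s * g) ↔ ¬ D.IsInv s g := by
  have h1 : D.act (D.refl s * g)⁻¹ (D.root s) = -D.act g⁻¹ (D.root s) := by
    rw [mul_inv_rev, act_mul, refl_inv, act_refl_self, map_neg]
  simp only [IsInv, h1]
  constructor
  · intro h h'
    obtain ⟨j', hj' | hj'⟩ := D.act_root g⁻¹ s
    · exact h' j' hj'
    · exact h j' (by rw [hj', neg_neg])
  · intro h j' hj'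
    push Not at h
    obtain ⟨i, hi⟩ := h
    rw [hi, neg_eq_iff_eq_neg] at hj'
    exact D.root_ne_neg _ _ hj'

lemma isInv_refl_mul {s : J} (hs : D.simple s) (j : {j // j ≠ s}) (g : G) :
    D.IsInv j (D.refl s * g) ↔ D.IsInv (D.perm' s hs j) g := by
  simp only [IsInv, mul_inv_rev, act_mul, refl_inv, root_perm']

/-- The word length with respect to the simple reflections. -/
def length (g : G) : ℕ :=
  sInf {n | ∃ l : List J, (∀ s ∈ l, D.simple s) ∧ (l.map D.refl).prod = g ∧ l.length = n}

lemma length_le {l : List J} (hl : ∀ s ∈ l, D.simple s) :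
    D.length (l.map D.refl).prod ≤ l.length := Nat.sInf_le ⟨l, hl, rfl, rfl⟩

lemma exists_word (g : G) :
    ∃ l : List J, (∀ s ∈ l, D.simple s) ∧ (l.map D.refl).prod = g ∧ l.length = D.length g := by
  obtain ⟨l, hl, h⟩ := D.word g
  exact Nat.sInf_mem (s := {n | ∃ l : List J, (∀ s ∈ l, D.simple s) ∧
    (l.map D.refl).prod = g ∧ l.length = n}) ⟨_, l, hl, h, rfl⟩

lemma length_refl_mul_le {s : J} (hs : D.simple s) (g : G) :
    D.length (D.refl s * g) ≤ D.length g + 1 := by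
  obtain ⟨l, hl, rfl, h⟩ := D.exists_word g
  have := D.length_le (l := s :: l) (by simpa [hs] using hl)
  rw [← h]
  simpa using this

/-- The exchange condition. If `j` is the first letter `s`, delete it; otherwise the remaining word
inverts the root `s(j)`, and `s_j s = s s_{s(j)}` moves the problem past the first letter. -/
lemma exists_shorter_word (l : List J) (hl : ∀ s ∈ l, D.simple s) (j : J)
    (hj : D.IsInv j (l.map D.refl).prod) :
    ∃ l' : List J, (∀ s ∈ l', D.simple s) ∧ l'.length < l.length ∧
      (l'.map D.refl).prod = D.refl j * (l.map D.refl).prod := by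
  induction l generalizing j with
  | nil => exact absurd hj (D.not_isInv_one j)
  | cons s l ih =>
    have hs : D.simple s := hl s (by simp)
    have hl' : ∀ s ∈ l, D.simple s := fun s hs => hl s (by simp [hs])
    rw [List.map_cons, List.prod_cons] at hj ⊢
    by_cases hjs : j = s
    · subst hjs
      exact ⟨l, hl', by simp, by rw [← mul_assoc, refl_mul_self, one_mul]⟩
    · rw [D.isInv_refl_mul hs ⟨j, hjs⟩] at hj
      obtain ⟨l', h1, h2, h3⟩ := ih hl' _ hj
      refine ⟨s :: l', by simpa [hs] using h1, by simpa using h2, ?_⟩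
      rw [List.map_cons, List.prod_cons, h3, ← mul_assoc, ← mul_assoc,
        ← D.refl_perm' hs ⟨j, hjs⟩]

lemma length_refl_mul_lt {j : J} {g : G} (h : D.IsInv j g) :
    D.length (D.refl j * g) < D.length g := by
  obtain ⟨l, hl, rfl, hlen⟩ := D.exists_word g
  obtain ⟨l', h1, h2, h3⟩ := D.exists_shorter_word l hl j h
  rw [← h3, ← hlen]
  exact (D.length_le h1).trans_lt h2

/-- Multiplication by the reflection turns a non-inversion into an inversion, to which the exchange
condition applies. -/
lemma lt_length_refl_mul {s : J} {g : G} (h : ¬ D.IsInv s g) :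
    D.length g < D.length (D.refl s * g) := by
  have := D.length_refl_mul_lt ((D.isInv_refl_mul_self g).2 h)
  rwa [← mul_assoc, refl_mul_self, one_mul] at this

end HeckeDatum

/-! ### Hecke conditions for a reflection group acting on an abelian variety -/

section Divisors

variable {E : SchC} [GrpObj E] [IsEllipticCurve E] {t : E.left.presheaf.stalk (zeroPt E)}
  {T : SchC} [IsIntegral T.left]

lemma locEq_comp {S : SchC} [IsIntegral S.left] (f : T ⟶ E) [IsDominant f.left] (φ : S ⟶ T)
    [IsDominant φ.left] (x : S.left) :
    locEq t (φ ≫ f) x = functionFieldMap φ.left (locEq t f (φ.left x)) := by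
  have hd : IsDominant (φ ≫ f).left := inferInstanceAs (IsDominant (φ.left ≫ f.left))
  by_cases h : f.left (φ.left x) = zeroPt E
  · have h' : (φ ≫ f).left x = zeroPt E := h
    rw [locEq_eq_functionFieldMap f h, locEq_eq_functionFieldMap (φ ≫ f) h']
    exact DFunLike.congr_fun (functionFieldMap_comp φ.left f.left) _
  · rw [locEq_of_ne h, locEq_of_ne (f := φ ≫ f) h, map_one]

/-- The local equations of a divisor at a point and at a generization of it are associated. -/
lemma assocAt_locEq_of_specializes
    (ht : IsLocalRing.maximalIdeal (E.left.presheaf.stalk (zeroPt E)) = Ideal.span {t})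
    (f : T ⟶ E) [IsDominant f.left] {x y : T.left} (hyx : y ⤳ x) :
    AssocAt y (locEq t f x) (locEq t f y) := by
  have h0 := ne_zero_of_maximalIdeal_eq ht
  by_cases hx : f.left x = zeroPt E
  · by_cases hy : f.left y = zeroPt E
    · rw [locEq_eq_functionFieldMap f hx, locEq_eq_functionFieldMap f hy]
      refine AssocAt.refl ?_
      rw [← locEq_eq_functionFieldMap f hx]
      exact locEq_ne_zero h0 f x
    · have hs : f.left y ⤳ zeroPt E := hx ▸ hyx.map f.left.continuous
      have hg := (eq_or_eq_of_specializes_zeroPt ht hs).resolve_left hy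
      rw [locEq_of_ne hy, locEq_eq_functionFieldMap f hx,
        ← map_one (functionFieldMap f.left)]
      refine AssocAt.functionFieldMap f.left ?_
      have hr : ∀ a : E.left.functionField, a ∈ regAt (f.left y) := fun a => by
        rw [hg]
        exact ⟨a, congrArg (fun φ => φ.hom a) (E.left.presheaf.stalkSpecializes_refl _)⟩
      exact ⟨fun h => h0 (stalk_algebraMap_injective _ (h.trans (map_zero _).symm)), one_ne_zero,
        hr _, hr _⟩
  · have hy : f.left y ≠ zeroPt E := fun hy => hx (by
      have hs : zeroPt E ⤳ f.left x := hy ▸ hyx.map f.left.continuous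
      have hm := specializes_iff_mem_closure.1 hs
      rw [(isClosed_zeroPt (E := E)).closure_eq] at hm
      exact hm)
    rw [locEq_of_ne hx, locEq_of_ne hy]
    exact AssocAt.refl one_ne_zero

end Divisors

/-! ### Walls and shifted divisors of a reflection group acting on a torus. -/

section Geometry

variable {E : SchC} [GrpObj E] [IsEllipticCurve E] {t : E.left.presheaf.stalk (zeroPt E)}
  {Λ : Type*} [AddCommGroup Λ] [Module.Free ℤ Λ] [Module.Finite ℤ Λ] {T : SchC} [IsIntegral T.left]
  {G J : Type*} [Group G] [SchemeAction G T.left]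

/-- A translate of a character. -/
def aff (χ : Multiplicative Λ →* (T ⟶ E)) (c : Λ) (s₀ : 𝟙_ SchC ⟶ E) : T ⟶ E :=
  χ (Multiplicative.ofAdd c) * constHom s₀ T

/-- An action on an abelian variety through automorphisms of the lattice of characters. -/
structure HeckeGeom (t : E.left.presheaf.stalk (zeroPt E)) (χ : Multiplicative Λ →* (T ⟶ E))
    (D : HeckeDatum G Λ J) : Prop where
  ht : IsLocalRing.maximalIdeal (E.left.presheaf.stalk (zeroPt E)) = Ideal.span {t}
  torus : IsTorus χ
  exists_hom : ∀ g : G, ∃ φ : T ⟶ T, φ.left = SchemeAction.inv g ∧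
    ∀ c, φ ≫ χ (Multiplicative.ofAdd c) = χ (Multiplicative.ofAdd (D.act g c))

variable {χ : Multiplicative Λ →* (T ⟶ E)} {D : HeckeDatum G Λ J}

lemma HeckeDatum.root_ne (D : HeckeDatum G Λ J) (j : J) : D.root j ≠ 0 := fun h => by
  have := D.root_ne_zero j 1 (by simp [h])
  norm_num at this

namespace HeckeGeom

lemma isDominant_aff (H : HeckeGeom t χ D) {c : Λ} (hc : c ≠ 0) (s₀ : 𝟙_ SchC ⟶ E) : IsDominant
    (aff χ c s₀).left :=
  H.torus.isDominant H.ht hc s₀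

lemma locEq_aff_ne_zero (H : HeckeGeom t χ D) {c : Λ} (hc : c ≠ 0) (s₀ : 𝟙_ SchC ⟶ E) (x : T.left) :
    locEq t (aff χ c s₀) x ≠ 0 := by
  have := H.isDominant_aff hc s₀
  exact locEq_ne_zero (ne_zero_of_maximalIdeal_eq H.ht) _ x

lemma mem_maximalIdeal (H : HeckeGeom t χ D) : t ∈ IsLocalRing.maximalIdeal
    (E.left.presheaf.stalk (zeroPt E)) := by
  rw [H.ht]; exact Ideal.mem_span_singleton_self t

lemma comp_aff (_ : HeckeGeom t χ D) {g : G} {φ : T ⟶ T}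
    (hφ : ∀ c, φ ≫ χ (Multiplicative.ofAdd c) = χ (Multiplicative.ofAdd (D.act g c)))
    (c : Λ) (s₀ : 𝟙_ SchC ⟶ E) : φ ≫ aff χ c s₀ = aff χ (D.act g c) s₀ := by
  rw [aff, MonObj.comp_mul, hφ, comp_constHom, aff]

lemma aff_apply_inv (H : HeckeGeom t χ D) (g : G) (c : Λ) (s₀ : 𝟙_ SchC ⟶ E) (x : T.left) :
    (aff χ c s₀).left (SchemeAction.inv g x) = (aff χ (D.act g c) s₀).left x := by
  obtain ⟨φ, h1, h2⟩ := H.exists_hom g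
  rw [← h1, ← H.comp_aff h2]
  rfl

/-- All local equations are pulled back from the same `t`, so the group carries them to one another
exactly, without unit factors. -/
lemma smul_locEq (H : HeckeGeom t χ D) (g : G) {c : Λ} (hc : c ≠ 0) (s₀ : 𝟙_ SchC ⟶ E)
    (x : T.left) :
    g • locEq t (aff χ c s₀) (SchemeAction.inv g x) = locEq t (aff χ (D.act g c) s₀) x := by
  obtain ⟨φ, h1, h2⟩ := H.exists_hom g
  have hd := H.isDominant_aff hc s₀
  have hφ : IsDominant φ.left := h1 ▸ inferInstance
  rw [← H.comp_aff h2, locEq_comp, smul_eq_functionFieldMap]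
  congr! 1
  · congr 1
    exact h1.symm
  · rw [h1]

lemma isGenericPointOf_inv (H : HeckeGeom t χ D) (g : G) {c : Λ} (s₀ : 𝟙_ SchC ⟶ E) {x : T.left} :
    IsGenericPointOf (aff χ c s₀) (SchemeAction.inv g x) ↔
      IsGenericPointOf (aff χ (D.act g c) s₀) x := by
  unfold IsGenericPointOf
  rw [H.aff_apply_inv]
  refine and_congr_right fun _ => ⟨fun h y hy hyx => ?_, fun h y hy hyx => ?_⟩
  · rw [← H.aff_apply_inv] at hy
    have := h _ hy (hyx.map (SchemeAction.inv g).continuous)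
    rw [← inv_apply_inv_left g y, this, inv_apply_inv_left]
  · rw [← inv_apply_inv_right g y, H.aff_apply_inv] at hy
    have := h _ hy (by
      have := hyx.map (SchemeAction.inv g⁻¹).continuous
      rwa [inv_apply_inv_left] at this)
    rw [← this, inv_apply_inv_right]

lemma assocAt_locEq (H : HeckeGeom t χ D) {c : Λ} (hc : c ≠ 0) (s₀ : 𝟙_ SchC ⟶ E) {x y : T.left}
    (hyx : y ⤳ x) :
    AssocAt y (locEq t (aff χ c s₀) x) (locEq t (aff χ c s₀) y) := by
  have := H.isDominant_aff hc s₀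
  exact assocAt_locEq_of_specializes H.ht _ hyx

/-- Divisors of distinct positive roots, shifted or not, have no common component. At the generic
points of one of them every product over the roots therefore reduces to a single factor. -/
lemma locEq_eq_one (H : HeckeGeom t χ D) {i j : J} (hij : i ≠ j) (s₀ s₁ : 𝟙_ SchC ⟶ E) {y : T.left}
    (hy : IsGenericPointOf (aff χ (D.root j) s₀) y) : locEq t (aff χ (D.root i) s₁) y = 1 :=
  locEq_of_ne (H.torus.apply_ne_zeroPt H.ht (fun m n h => D.indep j i hij.symm m n h) s₀ s₁ hy)

lemma prod_locEq (H : HeckeGeom t χ D) [Fintype J] {j : J} {s₀ : 𝟙_ SchC ⟶ E} {y : T.left}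
    (s₁ : J → (𝟙_ SchC ⟶ E))
    (hy : IsGenericPointOf (aff χ (D.root j) s₀) y) :
    ∏ i, locEq t (aff χ (D.root i) (s₁ i)) y = locEq t (aff χ (D.root j) (s₁ j)) y :=
  Finset.prod_eq_single j (fun i _ hij => H.locEq_eq_one hij _ _ hy) (by simp)

/-- A function that vanishes along several of the divisors is divisible by their product. -/
lemma div_prod_mem (H : HeckeGeom t χ D) (F : Finset J) (s₀ : J → (𝟙_ SchC ⟶ E)) {x : T.left}
    {a : T.left.functionField}
    (ha : a ∈ regAt x) (ha' : ∀ j ∈ F, ∀ y, IsGenericPointOf (aff χ (D.root j) (s₀ j)) y → y ⤳ x →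
      a ∈ vanAt y) :
    a / ∏ j ∈ F, locEq t (aff χ (D.root j) (s₀ j)) x ∈ regAt x := by
  classical
  induction F using Finset.induction_on with
  | empty => simpa using ha
  | insert j F hj ih =>
    rw [Finset.prod_insert hj, mul_comm, ← div_div]
    refine H.torus.div_locEq_mem H.ht (D.root_ne j) (s₀ j)
      (ih fun i hi => ha' i (by simp [hi])) fun y hy hyx => ?_
    -- At the generic point `y` of the `j`-th divisor the factors already divided out are units, so
    -- the vanishing of `a` at `y` survives the division.
    have h1 : AssocAt y (∏ i ∈ F, locEq t (aff χ (D.root i) (s₀ i)) x)⁻¹ 1 := by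
      rw [← inv_one]
      refine AssocAt.inv ?_
      rw [← Finset.prod_const_one (s := F)]
      refine AssocAt.prod F fun i hi => ?_
      have h2 := H.assocAt_locEq (D.root_ne i) (s₀ i) hyx
      rwa [H.locEq_eq_one (fun h : i = j => hj (h ▸ hi)) _ _ hy] at h2
    rw [div_eq_mul_inv, mul_comm, h1.mul_mem_vanAt_iff, one_mul]
    exact ha' j (by simp) y hy hyx

/-- A reflection fixes its wall pointwise. -/
lemma fix (H : HeckeGeom t χ D) (j : J) {x : T.left} (hx : (aff χ (D.root j) 1).left x = zeroPt E) :
    SchemeAction.inv (D.refl j) x = x ∧ ∀ a ∈ regAt x,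
      (D.refl j • a - a) / locEq t (aff χ (D.root j) 1) x ∈ regAt x := by
  obtain ⟨φ, h1, h2⟩ := H.exists_hom (D.refl j)
  have hd := H.isDominant_aff (D.root_ne j) 1
  have hφ : IsDominant φ.left := h1 ▸ inferInstance
  have := fixed_of_comp_eq H.ht (aff χ (D.root j) 1) φ (fun {S} u hu => ?_) hx
  · obtain ⟨h3, h4⟩ := this
    refine ⟨h1 ▸ h3, fun a ha => ?_⟩
    have h5 : D.refl j • a = functionFieldMap φ.left a := by
      rw [smul_eq_functionFieldMap]
      congr! 1
      congr 1
      exact h1.symm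
    rw [h5]
    exact h4 a ha
  -- A reflection changes `c` by a multiple of its root, and the character of the root is trivial on
  -- the wall.
  · refine H.torus.hom_ext _ _ fun c => ?_
    obtain ⟨n, hn⟩ := D.act_refl j c.toAdd
    have h6 : u ≫ χ (Multiplicative.ofAdd (D.root j)) = 1 := by
      rw [← hu, aff, constHom_one, mul_one]
    rw [Category.assoc]
    refine (congrArg (u ≫ ·) (h2 c.toAdd)).trans ?_
    rw [hn, ofAdd_add, ofAdd_zsmul, map_mul, map_zpow, MonObj.comp_mul]
    have h7 : u ≫ (χ (Multiplicative.ofAdd (D.root j)) ^ n) = 1 :=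
      (map_zpow (HomTorus.compHom E u) _ n).trans ((congrArg (· ^ n) h6).trans (one_zpow n))
    rw [h7, mul_one]
    rfl

lemma sub_mem_vanAt (H : HeckeGeom t χ D) (j : J) {x : T.left}
    (hx : (aff χ (D.root j) 1).left x = zeroPt E)
    {a : T.left.functionField} (ha : a ∈ regAt x) : D.refl j • a - a ∈ vanAt x := by
  have h1 := (H.fix j hx).2 a ha
  have h2 := mul_mem_vanAt h1 (locEq_mem_vanAt H.mem_maximalIdeal hx)
  rwa [div_mul_cancel₀ _ (H.locEq_aff_ne_zero (D.root_ne j) 1 x)] at h2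

/-- A reflection acts by `-1` on the conormal space of its wall. -/
lemma smul_add_div_mem_vanAt (H : HeckeGeom t χ D) (j : J) {x : T.left}
    (hx : (aff χ (D.root j) 1).left x = zeroPt E) :
    (D.refl j • locEq t (aff χ (D.root j) 1) x + locEq t (aff χ (D.root j) 1) x) /
      locEq t (aff χ (D.root j) 1) x ∈ vanAt x := by
  have h1 := H.smul_locEq (D.refl j) (D.root_ne j) 1 x
  have hinv : aff χ (D.act (D.refl j) (D.root j)) 1 = (aff χ (D.root j) 1)⁻¹ := by
    rw [D.act_refl_self, aff, aff, constHom_one, mul_one, mul_one, ofAdd_neg, map_inv]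
  rw [(H.fix j hx).1, hinv] at h1
  rw [h1]
  have hne := H.locEq_aff_ne_zero (D.root_ne j) 1 x
  set f := aff χ (D.root j) 1
  have hx' : (f⁻¹).left x = zeroPt E := by
    obtain ⟨h', -⟩ := associated_tpull_inv H.ht (ne_zero_of_maximalIdeal_eq H.ht) f hx
    exact h'
  -- The addition formula for `f⁻¹` and `f` shows that the sum of their parameters is a multiple of
  -- their product, hence of order two along the wall.
  obtain ⟨h3, r, hr⟩ := tpull_mul H.ht (ne_zero_of_maximalIdeal_eq H.ht) f⁻¹ f hx' hx
  have h4 : tpull t (f⁻¹ * f) x h3 = 0 := by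
    have : ∀ (u : T ⟶ E) (hu : u.left x = zeroPt E), u = 1 → tpull t u x hu = 0 := by
      rintro u hu rfl
      exact tpull_one H.mem_maximalIdeal x hu
    exact this _ _ (inv_mul_cancel f)
  rw [h4] at hr
  have h5 : locEq t f⁻¹ x + locEq t f x = -(locEq t f⁻¹ x * locEq t f x *
      algebraMap _ T.left.functionField r) := by
    rw [locEq_of_eq hx, locEq_of_eq hx', ← map_mul, ← map_mul, ← map_add, ← map_neg]
    exact congrArg _ (eq_neg_of_add_eq_zero_left hr.symm)
  rw [h5, neg_div, mul_right_comm, mul_div_cancel_right₀ _ hne]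
  rw [neg_eq_neg_one_mul]
  exact mul_mem_vanAt (neg_mem (one_mem _)) (mul_mem_vanAt' (locEq_mem_vanAt H.mem_maximalIdeal hx')
    (algebraMap_mem_regAt _))

end HeckeGeom

end Geometry

/-! ### The Hecke conditions and their stability under Demazure elements. -/

section Hecke

variable {E : SchC} [GrpObj E] [IsEllipticCurve E] {t : E.left.presheaf.stalk (zeroPt E)}
  {Λ : Type*} [AddCommGroup Λ] [Module.Free ℤ Λ] [Module.Finite ℤ Λ] {T : SchC} [IsIntegral T.left]
  {G J : Type*} [Group G] [SchemeAction G T.left] [Fintype J]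

/-- The Hecke conditions for the trivial line bundle. -/
structure IsHecke (t : E.left.presheaf.stalk (zeroPt E)) (χ : Multiplicative Λ →* (T ⟶ E))
    (D : HeckeDatum G Λ J) (h : 𝟙_ SchC ⟶ E) (U : T.left.Opens) (a : Twisted G T.left) : Prop where
  pole : ∀ x ∈ U, ∀ g, (∏ j, locEq t (aff χ (D.root j) 1) x) * a.coeff g ∈ regAt x
  res : ∀ j, ∀ x ∈ U, IsGenericPointOf (aff χ (D.root j) 1) x → ∀ g,
    locEq t (aff χ (D.root j) 1) x * (a.coeff g + a.coeff (D.refl j * g)) ∈ vanAt x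
  van : ∀ j g, D.shifted j → D.IsInv j g → ∀ x ∈ U, IsGenericPointOf (aff χ (D.root j) h) x →
    a.coeff g * (locEq t (aff χ (D.root j) 1) x / locEq t (aff χ (D.root j) h) x) ∈ regAt x

open scoped Classical in
/-- The local equation of the shifted divisor, if there is one. -/
def shiftEq (t : E.left.presheaf.stalk (zeroPt E)) (χ : Multiplicative Λ →* (T ⟶ E))
    (D : HeckeDatum G Λ J) (h : 𝟙_ SchC ⟶ E) (j : J) (x : T.left) : T.left.functionField :=
  if D.shifted j then locEq t (aff χ (D.root j) h) x else 1

/-- The element `p (δ_s - 1)`. -/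
def demazure (D : HeckeDatum G Λ J) (s : J) (p : T.left.functionField) : Twisted G T.left :=
  SkewMonoidAlgebra.single (D.refl s) p - SkewMonoidAlgebra.single 1 p

variable {χ : Multiplicative Λ →* (T ⟶ E)} {D : HeckeDatum G Λ J} {h : 𝟙_ SchC ⟶ E}
  {U : T.left.Opens}

lemma coeff_sub' (a b : Twisted G T.left) (g : G) : (a - b).coeff g = a.coeff g - b.coeff g := by
  rw [sub_eq_add_neg, SkewMonoidAlgebra.coeff_add, SkewMonoidAlgebra.coeff_neg]
  exact (sub_eq_add_neg _ _).symm

lemma coeff_demazure_mul (s : J) (p : T.left.functionField) (a : Twisted G T.left) (g : G) :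
    (demazure D s p * a).coeff g = p * (D.refl s • a.coeff (D.refl s * g) - a.coeff g) := by
  rw [demazure, sub_mul, coeff_sub', SkewMonoidAlgebra.coeff_single_mul,
    SkewMonoidAlgebra.coeff_single_one_mul, D.refl_inv, mul_sub]

lemma mem_of_specializes {x y : T.left} (hx : x ∈ U) (h : y ⤳ x) : y ∈ U :=
  h.mem_open U.isOpen hx

namespace HeckeGeom

lemma shiftEq_mem (_ : HeckeGeom t χ D) (h : 𝟙_ SchC ⟶ E) (j : J) (x : T.left) : shiftEq t χ D h j x
    ∈ regAt x := by
  unfold shiftEq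
  split_ifs
  · exact locEq_mem_regAt _ _
  · exact one_mem _

/-- The product of the local equations of the walls is invariant up to units. -/
lemma assocAt_smul_prod (H : HeckeGeom t χ D) {s : J} (hs : D.simple s) (x : T.left) :
    AssocAt x (D.refl s • ∏ j, locEq t (aff χ (D.root j) 1) (SchemeAction.inv (D.refl s) x))
      (∏ j, locEq t (aff χ (D.root j) 1) x) := by
  classical
  rw [Fintype.prod_eq_mul_prod_subtype_ne _ s, Fintype.prod_eq_mul_prod_subtype_ne _ s, smul_mul']
  refine AssocAt.mul ?_ ?_
  · rw [H.smul_locEq _ (D.root_ne s), D.act_refl_self]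
    have hd := H.isDominant_aff (D.root_ne s) 1
    have := assocAt_locEq_inv H.ht (aff χ (D.root s) 1) x
    rwa [show (aff χ (D.root s) 1)⁻¹ = aff χ (-D.root s) 1 by
      rw [aff, aff, constHom_one, mul_one, mul_one, ofAdd_neg, map_inv]] at this
  · rw [Finset.smul_prod']
    have : ∀ j : {j // j ≠ s}, D.refl s • locEq t (aff χ (D.root j.1) 1)
        (SchemeAction.inv (D.refl s) x) = locEq t (aff χ (D.root (D.permEquiv s hs j)) 1) x :=
      fun j => by
        rw [H.smul_locEq _ (D.root_ne j.1)]
        exact congrArg (fun c => locEq t (aff χ c 1) x) (D.root_perm' hs j).symm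
    simp_rw [this]
    rw [Equiv.prod_comp (D.permEquiv s hs)
      fun j : {j // j ≠ s} => locEq t (aff χ (D.root j.1) 1) x]
    exact AssocAt.refl (Finset.prod_ne_zero_iff.2 fun j _ => H.locEq_aff_ne_zero (D.root_ne _) _ _)

end HeckeGeom

lemma IsHecke.prod_smul_mem (H : HeckeGeom t χ D) {a : Twisted G T.left} (ha : IsHecke t χ D h U a)
    (hU : SchemeAction.IsInvariant G U) {s : J} (hs : D.simple s) {x : T.left} (hx : x ∈ U)
        (g : G) :
    (∏ j, locEq t (aff χ (D.root j) 1) x) * D.refl s • a.coeff g ∈ regAt x := by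
  rw [← (H.assocAt_smul_prod hs x).mul_mem_iff, ← smul_mul', smul_mem_regAt]
  exact ha.pole _ ((inv_mem_iff_of_isInvariant hU _).2 hx) g

/-- The difference `s a_{sg} - a_g` is less singular than `a` by one order along the wall of `s`. -/
lemma IsHecke.sub_div_mem (H : HeckeGeom t χ D) {a : Twisted G T.left} (ha : IsHecke t χ D h U a)
    (hU : SchemeAction.IsInvariant G U) {s : J} (hs : D.simple s) {x : T.left} (hx : x ∈ U)
        (g : G) :
    (∏ j, locEq t (aff χ (D.root j) 1) x) *
      (D.refl s • a.coeff (D.refl s * g) - a.coeff g) / locEq t (aff χ (D.root s) 1) x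
        ∈ regAt x := by
  refine H.torus.div_locEq_mem H.ht (D.root_ne s) 1 ?_ fun y hy hyx => ?_
  · rw [mul_sub]
    exact sub_mem (ha.prod_smul_mem H hU hs hx _) (ha.pole x hx g)
  · have hyU := mem_of_specializes hx hyx
    have h1 : AssocAt y (∏ j, locEq t (aff χ (D.root j) 1) x)
        (∏ j, locEq t (aff χ (D.root j) 1) y) :=
      AssocAt.prod _ fun j _ => H.assocAt_locEq (D.root_ne j) 1 hyx
    rw [h1.mul_mem_vanAt_iff]
    have h2 := H.prod_locEq (fun _ => 1) hy
    have h3 := ha.prod_smul_mem H hU hs hyU (D.refl s * g)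
    have h4 := ha.pole y hyU (D.refl s * g)
    have h5 := ha.res s y hyU hy g
    rw [h2] at h3 h4 ⊢
    have h6 := H.smul_add_div_mem_vanAt s hy.1
    have h7 := H.sub_mem_vanAt s hy.1 h4
    have hX := H.locEq_aff_ne_zero (D.root_ne s) 1 y
    rw [smul_mul'] at h7
    -- With `X` the equation of the wall, `a' = a_{sg}` and `a = a_g`, this uses `X (s a' - a) = (sX
    -- + X) s a' - (s(X a') - X a') - X (a + a')`. The terms vanish on the wall because `s` acts by
    -- `-1` on the conormal space, because `s` fixes the wall, and by the residue condition.
    have h8 := add_mem_vanAt (add_mem_vanAt (mul_mem_vanAt' h6 h3)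
      (mul_mem_vanAt (neg_mem (one_mem _)) h7)) (mul_mem_vanAt (neg_mem (one_mem _)) h5)
    convert h8 using 1
    field_simp
    ring

lemma IsHecke.zero : IsHecke t χ D h U (0 : Twisted G T.left) where
  pole x _ g := by simp
  res j x _ _ g := by simpa using zero_mem_vanAt x
  van j g _ _ x _ _ := by simp

lemma IsHecke.add {a b : Twisted G T.left} (ha : IsHecke t χ D h U a) (hb : IsHecke t χ D h U b) :
    IsHecke t χ D h U (a + b) where
  pole x hx g := by
    rw [SkewMonoidAlgebra.coeff_add, Finsupp.add_apply, mul_add]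
    exact add_mem (ha.pole x hx g) (hb.pole x hx g)
  res j x hx hx' g := by
    have := add_mem_vanAt (ha.res j x hx hx' g) (hb.res j x hx hx' g)
    rw [SkewMonoidAlgebra.coeff_add, Finsupp.add_apply, Finsupp.add_apply]
    convert this using 1
    ring
  van j g hj hg x hx hx' := by
    rw [SkewMonoidAlgebra.coeff_add, Finsupp.add_apply, add_mul]
    exact add_mem (ha.van j g hj hg x hx hx') (hb.van j g hj hg x hx hx')

lemma IsHecke.single_one_mul {a : Twisted G T.left} (ha : IsHecke t χ D h U a)
    {f : T.left.functionField} (hf : ∀ x ∈ U, f ∈ regAt x) :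
    IsHecke t χ D h U (SkewMonoidAlgebra.single 1 f * a) where
  pole x hx g := by
    rw [SkewMonoidAlgebra.coeff_single_one_mul, mul_left_comm]
    exact mul_mem (hf x hx) (ha.pole x hx g)
  res j x hx hx' g := by
    rw [SkewMonoidAlgebra.coeff_single_one_mul, SkewMonoidAlgebra.coeff_single_one_mul, ← mul_add,
      mul_left_comm]
    exact mul_mem_vanAt (hf x hx) (ha.res j x hx hx' g)
  van j g hj hg x hx hx' := by
    rw [SkewMonoidAlgebra.coeff_single_one_mul, mul_assoc]
    exact mul_mem (hf x hx) (ha.van j g hj hg x hx hx')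

lemma IsHecke.one (H : HeckeGeom t χ D) : IsHecke t χ D h U (1 : Twisted G T.left) := by
  classical
  have hr : ∀ (g : G) (x : T.left), (1 : Twisted G T.left).coeff g ∈ regAt x := fun g x => by
    rw [SkewMonoidAlgebra.coeff_one, Finsupp.single_apply]
    split_ifs
    · exact one_mem _
    · exact zero_mem _
  refine ⟨fun x _ g => mul_mem (prod_mem fun j _ => locEq_mem_regAt _ _) (hr g x),
    fun j x _ hx g => mul_mem_vanAt' (locEq_mem_vanAt H.mem_maximalIdeal hx.1)
      (add_mem (hr _ _) (hr _ _)), fun j g _ hg x _ _ => ?_⟩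
  rw [SkewMonoidAlgebra.coeff_one, Finsupp.single_apply, if_neg, zero_mul]
  · exact zero_mem _
  · rintro rfl
    exact D.not_isInv_one j hg

/-- Multiplication by Demazure operators preserves the Hecke conditions. -/
lemma IsHecke.demazure_mul (H : HeckeGeom t χ D) {a : Twisted G T.left} (ha : IsHecke t χ D h U a)
    (hU : SchemeAction.IsInvariant G U) {s : J} (hs : D.simple s) {p : T.left.functionField}
    (hp : ∀ x ∈ U, AssocAt x p (shiftEq t χ D h s x / locEq t (aff χ (D.root s) 1) x)) :
    IsHecke t χ D h U (demazure D s p * a) := by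
  have hp1 : ∀ j, j ≠ s → ∀ s₀, ∀ x ∈ U, IsGenericPointOf (aff χ (D.root j) s₀) x →
      p ∈ regAt x := fun j hj s₀ x hx hx' => by
    rw [(hp x hx).mem_iff, H.locEq_eq_one hj.symm _ _ hx', div_one]
    exact H.shiftEq_mem h s x
  -- Along the divisors of the root `s` the other factors of the product are units, so the
  -- improvement by one order of vanishing makes the difference regular.
  have hc : ∀ s₀, ∀ x ∈ U, IsGenericPointOf (aff χ (D.root s) s₀) x → ∀ g,
      D.refl s • a.coeff (D.refl s * g) - a.coeff g ∈ regAt x := fun s₀ x hx hx' g => by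
    have := ha.sub_div_mem H hU hs hx g
    rwa [H.prod_locEq (fun _ => 1) hx', mul_div_assoc,
      mul_div_cancel₀ _ (H.locEq_aff_ne_zero (D.root_ne s) 1 x)] at this
  refine ⟨fun x hx g => ?_, fun j x hx hx' g => ?_, fun j g hj hg x hx hx' => ?_⟩
  · rw [coeff_demazure_mul, mul_left_comm, (hp x hx).mul_mem_iff, div_mul_eq_mul_div, mul_div_assoc]
    exact mul_mem (H.shiftEq_mem h s x) (ha.sub_div_mem H hU hs hx g)
  · rw [coeff_demazure_mul, coeff_demazure_mul]
    by_cases hjs : j = s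
    · subst hjs
      -- With `B = s a_{sg} - a_g`, the coefficients at `g` and `sg` add up to `-p (sB - B)`. Here
      -- `B` is regular, so `sB - B` vanishes on the wall, while `p` has at most a simple pole
      -- there.
      have h1 := H.sub_mem_vanAt j hx'.1 (hc 1 x hx hx' g)
      have h2 : p * locEq t (aff χ (D.root j) 1) x ∈ regAt x := by
        rw [(hp x hx).mul_mem_iff, div_mul_cancel₀ _ (H.locEq_aff_ne_zero (D.root_ne j) 1 x)]
        exact H.shiftEq_mem h j x
      have h3 := mul_mem_vanAt (neg_mem h2) h1
      convert h3 using 1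
      rw [← mul_assoc (D.refl j), D.refl_mul_self, one_mul, smul_sub, ← mul_smul, D.refl_mul_self,
        one_smul]
      ring
    · have h1 := ha.res j x hx hx' g
      -- For `j ≠ s` the coefficient `p` is regular along the wall of `j`, and `s` carries the
      -- condition for the root `s(j)` to the one for `j`.
      have h2 : D.refl s * (D.refl j * g) = D.refl (D.perm' s hs ⟨j, hjs⟩) * (D.refl s * g) := by
        have h3 := D.refl_perm' hs (D.perm' s hs ⟨j, hjs⟩)
        rw [D.perm'_perm'] at h3
        rw [← mul_assoc, ← h3, mul_assoc]
      have hact : D.act (D.refl s) (D.root (D.perm' s hs ⟨j, hjs⟩).1) = D.root j := by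
        rw [D.root_perm', D.act_refl_refl]
      have h4 := ha.res (D.perm' s hs ⟨j, hjs⟩) (SchemeAction.inv (D.refl s) x)
        ((inv_mem_iff_of_isInvariant hU _).2 hx)
        ((H.isGenericPointOf_inv _ 1).2 (by rwa [hact])) (D.refl s * g)
      rw [← smul_mem_vanAt, smul_mul', H.smul_locEq _ (D.root_ne _), hact, ← h2, smul_add] at h4
      have h5 := mul_mem_vanAt (hp1 j hjs 1 x hx hx')
        (add_mem_vanAt h4 (mul_mem_vanAt (neg_mem (one_mem _)) h1))
      convert h5 using 1
      ring
  · rw [coeff_demazure_mul]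
    by_cases hjs : j = s
    · subst hjs
      have h1 := hp x hx
      rw [shiftEq, if_pos hj] at h1
      rw [mul_assoc, h1.mul_mem_iff]
      have hX := H.locEq_aff_ne_zero (D.root_ne j) 1 x
      have hX' := H.locEq_aff_ne_zero (D.root_ne j) h x
      convert hc h x hx hx' g using 1
      field_simp
    -- As for the residues, `p` is regular here, and the condition at `sg` is transported by `s`
    -- from the root `s(j)`, which is an inversion of `sg`.
    · have h1 := ha.van j g hj hg x hx hx'
      have hact : D.act (D.refl s) (D.root (D.perm' s hs ⟨j, hjs⟩).1) = D.root j := by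
        rw [D.root_perm', D.act_refl_refl]
      have h4 := ha.van (D.perm' s hs ⟨j, hjs⟩) (D.refl s * g) ((D.shifted_perm' hs ⟨j, hjs⟩).2 hj)
        (by rw [← D.isInv_refl_mul hs ⟨j, hjs⟩, ← mul_assoc, D.refl_mul_self, one_mul]; exact hg)
        (SchemeAction.inv (D.refl s) x) ((inv_mem_iff_of_isInvariant hU _).2 hx)
        ((H.isGenericPointOf_inv _ h).2 (by rwa [hact]))
      rw [← smul_mem_regAt, smul_mul', smul_div₀', H.smul_locEq _ (D.root_ne _),
        H.smul_locEq _ (D.root_ne _), hact] at h4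
      have h5 := mul_mem (hp1 j hjs h x hx hx') (sub_mem h4 h1)
      convert h5 using 1
      ring

end Hecke

/-! ### Triangularity and generation by Demazure elements. -/

section Basis

variable {E : SchC} [GrpObj E] [IsEllipticCurve E] {t : E.left.presheaf.stalk (zeroPt E)}
  {Λ : Type*} [AddCommGroup Λ] [Module.Free ℤ Λ] [Module.Finite ℤ Λ] {T : SchC} [IsIntegral T.left]
  {G J : Type*} [Group G] [SchemeAction G T.left] [Fintype J]
  {χ : Multiplicative Λ →* (T ⟶ E)} {D : HeckeDatum G Λ J} {h : 𝟙_ SchC ⟶ E}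
  {U : T.left.Opens}

lemma coeff_finset_sum' {J' : Type*} (S : Finset J') (a : J' → Twisted G T.left) (g : G) :
    (∑ i ∈ S, a i).coeff g = ∑ i ∈ S, (a i).coeff g := by
  have h1 : (∑ i ∈ S, a i).coeff = ∑ i ∈ S, (a i).coeff :=
    map_sum SkewMonoidAlgebra.coeffAddEquiv a S
  rw [h1, Finsupp.finsetSum_apply]

open scoped Classical in
/-- The local equation of the leading coefficients at `g`. -/
def leadEq (t : E.left.presheaf.stalk (zeroPt E)) (χ : Multiplicative Λ →* (T ⟶ E))
    (D : HeckeDatum G Λ J) (h : 𝟙_ SchC ⟶ E) (g : G) (x : T.left) (j : J) : T.left.functionField :=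
  if D.IsInv j g then shiftEq t χ D h j x / locEq t (aff χ (D.root j) 1) x else 1

lemma HeckeGeom.smul_shiftEq (H : HeckeGeom t χ D) {s : J} (hs : D.simple s) (j : {j // j ≠ s})
    (x : T.left) : D.refl s • shiftEq t χ D h (D.perm' s hs j) (SchemeAction.inv (D.refl s) x) =
      shiftEq t χ D h j x := by
  unfold shiftEq
  by_cases hj : D.shifted j
  · rw [if_pos hj, if_pos ((D.shifted_perm' hs j).2 hj), H.smul_locEq _ (D.root_ne _),
      D.root_perm', D.act_refl_refl]
  · rw [if_neg hj, if_neg (mt (D.shifted_perm' hs j).1 hj)]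
    exact smul_one (D.refl s)

/-- When `s` is not an inversion of `g`, the inversions of `sg` are `s` together with the `s`-images
of the inversions of `g`. This matches the leading coefficient of `p_s (δ_s - 1) e`. -/
lemma HeckeGeom.prod_leadEq_refl_mul (H : HeckeGeom t χ D) {s : J} (hs : D.simple s) {g : G}
    (hg : ¬ D.IsInv s g) (x : T.left) :
    ∏ j, leadEq t χ D h (D.refl s * g) x j = shiftEq t χ D h s x / locEq t (aff χ (D.root s) 1) x *
      D.refl s • ∏ j, leadEq t χ D h g (SchemeAction.inv (D.refl s) x) j := by
  classical
  rw [Fintype.prod_eq_mul_prod_subtype_ne _ s,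
    Fintype.prod_eq_mul_prod_subtype_ne (leadEq t χ D h g (SchemeAction.inv (D.refl s) x)) s]
  have h1 : leadEq t χ D h (D.refl s * g) x s =
      shiftEq t χ D h s x / locEq t (aff χ (D.root s) 1) x :=
    if_pos ((D.isInv_refl_mul_self g).2 hg)
  have h2 : leadEq t χ D h g (SchemeAction.inv (D.refl s) x) s = 1 := if_neg hg
  rw [h1, h2, one_mul, Finset.smul_prod']
  congr 1
  rw [← Equiv.prod_comp (D.permEquiv s hs) fun j : {j // j ≠ s} =>
    D.refl s • leadEq t χ D h g (SchemeAction.inv (D.refl s) x) j.1]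
  refine Finset.prod_congr rfl fun j _ => ?_
  change leadEq t χ D h (D.refl s * g) x j.1 =
    D.refl s • leadEq t χ D h g (SchemeAction.inv (D.refl s) x) (D.perm' s hs j).1
  unfold leadEq
  simp only [D.isInv_refl_mul hs j]
  split_ifs
  · rw [smul_div₀', H.smul_shiftEq hs j, H.smul_locEq _ (D.root_ne _), D.root_perm',
      D.act_refl_refl]
  · exact (smul_one _).symm

/-- The coefficients of maximal length of a section of the Hecke algebra are divisible by the
expected leading coefficients. -/
lemma IsHecke.div_leadEq_mem (H : HeckeGeom t χ D) {a : Twisted G T.left} (ha : IsHecke t χ D h U a)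
    {g : G} (hg : ∀ g', D.length g < D.length g' → a.coeff g' = 0) {x : T.left} (hx : x ∈ U) :
    a.coeff g / ∏ j, leadEq t χ D h g x j ∈ regAt x := by
  classical
  -- The numerator of `a_g` is shown to vanish on the unshifted wall of each non-inversion and on
  -- the shifted divisor of each inversion; inversions without a shifted divisor impose nothing and
  -- are left out of `F`.
  let s₀ : J → (𝟙_ SchC ⟶ E) := fun j => if D.IsInv j g then h else 1
  let F : Finset J := {j | ¬ D.IsInv j g ∨ D.shifted j}
  have key := H.div_prod_mem F s₀ (ha.pole x hx g) fun j hj y hy hyx => ?_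
  · convert key using 1
    have h1 : ∏ j ∈ F, locEq t (aff χ (D.root j) (s₀ j)) x =
        (∏ j, locEq t (aff χ (D.root j) 1) x) * ∏ j, leadEq t χ D h g x j := by
      rw [← Finset.prod_mul_distrib, Finset.prod_filter]
      refine Finset.prod_congr rfl fun j _ => ?_
      have hX := H.locEq_aff_ne_zero (D.root_ne j) 1 x
      by_cases hi : D.IsInv j g
      · by_cases hs : D.shifted j
        · simp only [hi, hs, leadEq, shiftEq, s₀, if_true, or_true]
          rw [mul_div_cancel₀ _ hX]
        · simp only [hi, hs, leadEq, shiftEq, if_true, if_false, not_true, or_false]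
          rw [mul_div_cancel₀ _ hX]
      · simp only [hi, leadEq, s₀, if_false, not_false_iff, true_or, if_true, mul_one]
    rw [h1, mul_div_mul_left]
    exact Finset.prod_ne_zero_iff.2 fun j _ => H.locEq_aff_ne_zero (D.root_ne _) _ _
  · have hyU := mem_of_specializes hx hyx
    have h1 : AssocAt y (∏ j, locEq t (aff χ (D.root j) 1) x)
        (∏ j, locEq t (aff χ (D.root j) 1) y) :=
      AssocAt.prod _ fun j _ => H.assocAt_locEq (D.root_ne j) 1 hyx
    rw [h1.mul_mem_vanAt_iff, H.prod_locEq (fun _ => 1) hy]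
    by_cases hi : D.IsInv j g
    · have hs : D.shifted j := by
        have := (Finset.mem_filter.1 hj).2
        tauto
      have hs₀ : s₀ j = h := if_pos hi
      rw [hs₀] at hy
      have h2 := mul_mem_vanAt (ha.van j g hs hi y hyU hy) (locEq_mem_vanAt H.mem_maximalIdeal hy.1)
      rwa [mul_assoc, div_mul_cancel₀ _ (H.locEq_aff_ne_zero (D.root_ne j) h y), mul_comm] at h2
    -- The element `s_j g` is longer than `g`, so its coefficient is zero and the residue condition
    -- reads `Res_j a_g = 0`.
    · have hs₀ : s₀ j = 1 := if_neg hi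
      rw [hs₀] at hy
      have h2 := ha.res j y hyU hy g
      rwa [hg _ (D.lt_length_refl_mul hi), add_zero] at h2

/-- The sections of the Hecke algebra are generated, under multiplication by functions and Demazure
operators from the left, by the unit element. -/
theorem IsHecke.induction (H : HeckeGeom t χ D) (hU : SchemeAction.IsInvariant G U)
    {x₀ : T.left} (hx₀ : x₀ ∈ U) (p : J → T.left.functionField)
    (hp : ∀ s, D.simple s → ∀ x ∈ U,
      AssocAt x (p s) (shiftEq t χ D h s x / locEq t (aff χ (D.root s) 1) x))
    (Q : Twisted G T.left → Prop) (Q0 : Q 0) (Q1 : Q 1) (Qadd : ∀ a b, Q a → Q b → Q (a + b))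
    (Qmul : ∀ f, (∀ x ∈ U, f ∈ regAt x) → ∀ a, Q a → Q (SkewMonoidAlgebra.single 1 f * a))
    (Qdem : ∀ s, D.simple s → ∀ a, Q a → Q (demazure D s (p s) * a))
    {a : Twisted G T.left} (ha : IsHecke t χ D h U a) : Q a := by
  classical
  -- Products of Demazure elements along reduced words: upper triangular elements with the
  -- prescribed leading coefficients.
  have hbasis : ∀ (n : ℕ) (g : G), D.length g = n → ∃ e : Twisted G T.left, Q e ∧
      IsHecke t χ D h U e ∧ (∀ g', e.coeff g' ≠ 0 → D.length g' < n ∨ g' = g) ∧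
      ∀ x ∈ U, AssocAt x (e.coeff g) (∏ j, leadEq t χ D h g x j) := by
    intro n
    induction n with
    | zero =>
      intro g hg
      obtain ⟨l, hl, rfl, hlen⟩ := D.exists_word g
      rw [hg, List.length_eq_zero_iff] at hlen
      subst hlen
      refine ⟨1, Q1, .one H, fun g' hg' => Or.inr ?_, fun x _ => ?_⟩
      · rw [SkewMonoidAlgebra.coeff_one, Finsupp.single_apply] at hg'
        simpa [eq_comm] using hg'
      · have : ∀ j, leadEq t χ D h 1 x j = 1 := fun j => if_neg (D.not_isInv_one j)
        simp only [List.map_nil, List.prod_nil, this, Finset.prod_const_one,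
          SkewMonoidAlgebra.coeff_one, Finsupp.single_eq_same]
        exact AssocAt.refl one_ne_zero
    | succ n ih =>
      intro g hg
      obtain ⟨l, hl, rfl, hlen⟩ := D.exists_word g
      rw [hg] at hlen
      obtain ⟨s, l, rfl⟩ : ∃ s l', l = s :: l' := by
        cases l with
        | nil => simp at hlen
        | cons s l => exact ⟨s, l, rfl⟩
      have hs : D.simple s := hl s (by simp)
      rw [List.map_cons, List.prod_cons] at hg ⊢
      set g₁ := (l.map D.refl).prod with hg₁
      have hlen' : D.length g₁ = n := by
        have h1 := D.length_le (l := l) fun s hs => hl s (by simp [hs])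
        have h2 := D.length_refl_mul_le hs g₁
        rw [List.length_cons] at hlen
        rw [← hg₁] at h1
        omega
      -- The word is reduced: if `s` inverted the tail, multiplication by `s` would shorten it.
      have hinv : ¬ D.IsInv s g₁ := fun hi => by
        have := D.length_refl_mul_lt hi
        omega
      obtain ⟨e, he1, he2, he3, he4⟩ := ih g₁ hlen'
      refine ⟨demazure D s (p s) * e, Qdem s hs e he1, he2.demazure_mul H hU hs (hp s hs),
        fun g' hg' => ?_, fun x hx => ?_⟩
      · rw [coeff_demazure_mul] at hg'
        by_cases hz : e.coeff g' = 0
        · have hz' : e.coeff (D.refl s * g') ≠ 0 := fun hz' => hg' (by simp [hz, hz'])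
          rcases he3 _ hz' with h1 | h1
          · have h2 := D.length_refl_mul_le hs (D.refl s * g')
            rw [← mul_assoc, D.refl_mul_self, one_mul] at h2
            exact Or.inl (by omega)
          · right
            rw [← h1, ← mul_assoc, D.refl_mul_self, one_mul]
        · left
          rcases he3 _ hz with h1 | h1
          · omega
          · rw [h1]; omega
      · have hz : e.coeff (D.refl s * g₁) = 0 := by
          by_contra hz
          rcases he3 _ hz with h1 | h1
          · omega
          · rw [h1] at hg; omega
        rw [coeff_demazure_mul, ← mul_assoc, D.refl_mul_self, one_mul, hz, sub_zero,
          H.prod_leadEq_refl_mul hs hinv]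
        exact (hp s hs x hx).mul
          ((he4 _ ((inv_mem_iff_of_isInvariant hU (D.refl s)).2 hx)).smul (D.refl s))
  -- Induction on a strict upper bound for the lengths in the support; each stage removes the
  -- coefficients of top length.
  have hind : ∀ (n : ℕ) (a : Twisted G T.left), IsHecke t χ D h U a →
      (∀ g, a.coeff g ≠ 0 → D.length g < n) → Q a := by
    intro n
    induction n with
    | zero =>
      intro a _ hz
      have : a = 0 := by
        ext g
        by_contra hg
        exact absurd (hz g hg) (by simp)
      rwa [this]
    | succ n ih =>
      intro a ha hz
      choose! e he using fun g => hbasis n g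
      let S : Finset G := a.support.filter fun g => D.length g = n
      -- The quotient of leading coefficients, which is regular by the divisibility of top
      -- coefficients.
      let f : G → T.left.functionField := fun g => a.coeff g / (e g).coeff g
      let b : Twisted G T.left := ∑ g ∈ S, SkewMonoidAlgebra.single 1 (f g) * e g
      have hS : ∀ g ∈ S, D.length g = n := fun g hg => (Finset.mem_filter.1 hg).2
      have hne : ∀ g ∈ S, ∀ x ∈ U, f g ∈ regAt x := fun g hg x hx => by
        have h1 := ha.div_leadEq_mem H (g := g) (fun g' hg' => by
          by_contra hc
          have := hz g' hc
          rw [hS g hg] at hg'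
          omega) hx
        have h2 := ((he g (hS g hg)).2.2.2 x hx).inv
        have h3 := h2.mul_mem_iff (c := a.coeff g)
        rw [inv_mul_eq_div, inv_mul_eq_div] at h3
        exact h3.2 h1
      have hbQ : Q b := by
        refine Finset.sum_induction _ Q Qadd Q0 fun g hg => ?_
        exact Qmul _ (hne g hg) _ (he g (hS g hg)).1
      have hbH : IsHecke t χ D h U b := by
        refine Finset.sum_induction _ (IsHecke t χ D h U) (fun _ _ => .add) .zero fun g hg => ?_
        exact (he g (hS g hg)).2.1.single_one_mul (hne g hg)
      have hneg : IsHecke t χ D h U (-b) := by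
        have := hbH.single_one_mul (f := -1) fun x _ => neg_mem (one_mem _)
        convert this using 1
        ext g
        rw [SkewMonoidAlgebra.coeff_single_one_mul, SkewMonoidAlgebra.coeff_neg, neg_one_mul]
        rfl
      have hcoeff : ∀ g', b.coeff g' = ∑ g ∈ S, f g * (e g).coeff g' := fun g' => by
        rw [coeff_finset_sum']
        exact Finset.sum_congr rfl fun g _ => SkewMonoidAlgebra.coeff_single_one_mul ..
      have h1 : Q (a + -b) := by
        refine ih _ (ha.add hneg) fun g hg => ?_
        rw [← sub_eq_add_neg, coeff_sub'] at hg
        by_contra hlt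
        -- In length `n` the element `e g'` is supported only at `g'`, so subtracting `b` clears
        -- exactly the top coefficients and adds no others.
        by_cases hgS : g ∈ S
        · refine hg ?_
          rw [hcoeff, Finset.sum_eq_single g, div_mul_cancel₀, sub_self]
          · exact ((he g (hS g hgS)).2.2.2 x₀ hx₀).1
          · intro g' hg' hne'
            by_contra hc
            rcases (he g' (hS g' hg')).2.2.1 g (right_ne_zero_of_mul hc) with h2 | h2
            · exact hlt h2
            · exact hne' h2.symm
          · exact fun hc => absurd hgS hc
        · have hag : a.coeff g = 0 := by
            by_contra hc
            refine hgS (Finset.mem_filter.2 ⟨?_, ?_⟩)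
            · exact Finsupp.mem_support_iff.2 hc
            · have := hz g hc
              omega
          rw [hag, zero_sub, neg_ne_zero, hcoeff] at hg
          obtain ⟨g', hg', hc⟩ := Finset.exists_ne_zero_of_sum_ne_zero hg
          rcases (he g' (hS g' hg')).2.2.1 g (right_ne_zero_of_mul hc) with h2 | h2
          · exact hlt h2
          · exact hgS (h2 ▸ hg')
      have := Qadd _ _ h1 hbQ
      rwa [neg_add_cancel_right] at this
  exact hind (a.support.sup D.length + 1) a ha fun g hg =>
    Nat.lt_succ_of_le (Finset.le_sup (f := D.length) (Finsupp.mem_support_iff.2 hg))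

end Basis

/-! ### Root data -/

section ProdDatum

variable {G G' Λ Λ' J J' : Type*} [Group G] [Group G'] [AddCommGroup Λ] [AddCommGroup Λ']

/-- The product of two reflection data. -/
def HeckeDatum.prod (D : HeckeDatum G Λ J) (D' : HeckeDatum G' Λ' J') :
    HeckeDatum (G × G') (Λ × Λ') (J ⊕ J') where
  act :=
    { toFun := fun g => AddMonoidHom.prodMap (D.act g.1) (D'.act g.2)
      map_one' := AddMonoidHom.ext fun c => Prod.ext (D.act_one c.1) (D'.act_one c.2)
      map_mul' := fun g g' => AddMonoidHom.ext fun c =>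
        Prod.ext (D.act_mul g.1 g'.1 c.1) (D'.act_mul g.2 g'.2 c.2) }
  root := Sum.elim (fun j => (D.root j, 0)) fun j => (0, D'.root j)
  refl := Sum.elim (fun j => (D.refl j, 1)) fun j => (1, D'.refl j)
  simple := Sum.elim D.simple D'.simple
  shifted := Sum.elim D.shifted D'.shifted
  root_ne_zero := by
    rintro (j | j) m h
    · exact D.root_ne_zero j m (Prod.ext_iff.1 h).1
    · exact D'.root_ne_zero j m (Prod.ext_iff.1 h).2
  indep := by
    rintro (i | i) (j | j) hij m n h <;>
      simp only [Sum.elim_inl, Sum.elim_inr, Prod.smul_mk, Prod.mk_add_mk, smul_zero, add_zero,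
        zero_add, Prod.mk_eq_zero, and_true, true_and] at h
    · exact D.indep i j (fun h => hij (congrArg _ h)) m n h
    · exact ⟨D.root_ne_zero i m h.1, D'.root_ne_zero j n h.2⟩
    · exact ⟨D'.root_ne_zero i m h.2, D.root_ne_zero j n h.1⟩
    · exact D'.indep i j (fun h => hij (congrArg _ h)) m n h
  act_refl := by
    rintro (j | j) ⟨c, c'⟩
    · obtain ⟨n, hn⟩ := D.act_refl j c
      exact ⟨n, Prod.ext hn ((D'.act_one c').trans (by simp))⟩
    · obtain ⟨n, hn⟩ := D'.act_refl j c'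
      exact ⟨n, Prod.ext ((D.act_one c).trans (by simp)) hn⟩
  act_refl_self := by
    rintro (j | j)
    · exact Prod.ext (D.act_refl_self j) ((map_zero (D'.act 1)).trans neg_zero.symm)
    · exact Prod.ext ((map_zero (D.act 1)).trans neg_zero.symm) (D'.act_refl_self j)
  refl_mul_self := by
    rintro (j | j)
    · exact Prod.ext (D.refl_mul_self j) (one_mul 1)
    · exact Prod.ext (one_mul 1) (D'.refl_mul_self j)
  perm := by
    rintro (s | s) hs (j | j) hj
    · obtain ⟨j', h1, h2, h3, h4⟩ := D.perm s hs j fun h => hj (congrArg _ h)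
      exact ⟨.inl j', fun h => h1 (Sum.inl_injective h), Prod.ext h2 (map_zero (D'.act 1)),
        Prod.ext h3 rfl, h4⟩
    · exact ⟨.inr j, Sum.inr_ne_inl, Prod.ext (map_zero (D.act _)) (D'.act_one _),
        Prod.ext (by simp) (by simp), Iff.rfl⟩
    · exact ⟨.inl j, Sum.inl_ne_inr, Prod.ext (D.act_one _) (map_zero (D'.act _)),
        Prod.ext (by simp) (by simp), Iff.rfl⟩
    · obtain ⟨j', h1, h2, h3, h4⟩ := D'.perm s hs j fun h => hj (congrArg _ h)
      exact ⟨.inr j', fun h => h1 (Sum.inr_injective h), Prod.ext (map_zero (D.act 1)) h2,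
        Prod.ext rfl h3, h4⟩
  word := by
    rintro ⟨g, g'⟩
    obtain ⟨l, h1, h2⟩ := D.word g
    obtain ⟨l', h1', h2'⟩ := D'.word g'
    refine ⟨l.map .inl ++ l'.map .inr, ?_, ?_⟩
    · simp only [List.mem_append, List.mem_map]
      rintro s (⟨s, hs, rfl⟩ | ⟨s, hs, rfl⟩)
      · exact h1 s hs
      · exact h1' s hs
    · have h3 : ((l.map .inl).map (Sum.elim (fun j => (D.refl j, (1 : G')))
          fun j => (1, D'.refl j))).prod = (g, 1) := by
        rw [List.map_map, ← h2]
        exact ((List.map_map (f := D.refl) (g := MonoidHom.inl G G') (l := l)) ▸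
          (map_list_prod (MonoidHom.inl G G') (l.map D.refl)).symm)
      have h4 : ((l'.map .inr).map (Sum.elim (fun j => (D.refl j, (1 : G')))
          fun j => (1, D'.refl j))).prod = (1, g') := by
        rw [List.map_map, ← h2']
        exact ((List.map_map (f := D'.refl) (g := MonoidHom.inr G G') (l := l')) ▸
          (map_list_prod (MonoidHom.inr G G') (l'.map D'.refl)).symm)
      rw [List.map_append, List.prod_append, h3, h4]
      simp

/-- A root of the first factor keeps second coordinate zero under the product group, so it can only
become positive as a root of the first factor. -/
lemma HeckeDatum.prod_isInv_inl (D : HeckeDatum G Λ J) (D' : HeckeDatum G' Λ' J') (j : J)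
    (g : G × G') : (D.prod D').IsInv (.inl j) g ↔ D.IsInv j g.1 := by
  constructor
  · intro h j' hj'
    exact h (.inl j') (Prod.ext hj' (map_zero (D'.act g.2⁻¹)))
  · rintro h (j' | j') hj'
    · exact h j' (congrArg Prod.fst hj')
    · have h1 : (0 : Λ') = D'.root j' := (map_zero (D'.act g.2⁻¹)).symm.trans
          (congrArg Prod.snd hj')
      have := D'.root_ne_zero j' 1 (by rw [← h1, smul_zero])
      norm_num at this

end ProdDatum

/-! ### Weyl groups, simple words, and the data of roots and coroots. -/

section RootDatum

variable {I X Y : Type*} [Finite I] [AddCommGroup X] [AddCommGroup Y]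
  [Module.Free ℤ X] [Module.Finite ℤ X] [Module.Free ℤ Y] [Module.Finite ℤ Y]
  {P : RootPairing I ℤ X Y}

lemma weyl_ext {w v : P.weylGroup} (h : ∀ x : X, w • x = v • x) : w = v := by
  apply Subtype.ext
  apply RootPairing.Equiv.weightHom_injective P
  exact LinearEquiv.ext h

lemma weyl_smul_root (w : P.weylGroup) (i : I) : w • P.root i = P.root (w • i) :=
  P.weylGroup_apply_root w i

lemma coweightAct_coroot (w : P.weylGroup) (i : I) :
    coweightAct P w (P.coroot i) = P.coroot (w • i) := by
  refine (RootPairing.Hom.coroot_coweightMap_apply P P i (w⁻¹ : P.weylGroup).1.toHom).trans ?_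
  rfl

lemma ofIdx_smul_weight (i : I) (x : X) :
    RootPairing.weylGroup.ofIdx P i • x = P.reflection i x := rfl

lemma ofIdx_mul_self (i : I) :
    RootPairing.weylGroup.ofIdx P i * RootPairing.weylGroup.ofIdx P i = 1 := by
  refine weyl_ext fun x => ?_
  rw [mul_smul, ofIdx_smul_weight, ofIdx_smul_weight, one_smul]
  simp

lemma ofIdx_reflectionPerm (i j : I) :
    RootPairing.weylGroup.ofIdx P (P.reflectionPerm j i) =
      RootPairing.weylGroup.ofIdx P j * RootPairing.weylGroup.ofIdx P i *
        RootPairing.weylGroup.ofIdx P j := by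
  refine weyl_ext fun x => ?_
  rw [mul_smul, mul_smul, ofIdx_smul_weight, ofIdx_smul_weight, ofIdx_smul_weight,
    ofIdx_smul_weight, RootPairing.reflection_reflectionPerm]
  rfl

lemma coweightAct_ofIdx (i : I) (y : Y) :
    coweightAct P (RootPairing.weylGroup.ofIdx P i) y = P.coreflection i y := by
  have h : (RootPairing.weylGroup.ofIdx P i)⁻¹ = RootPairing.weylGroup.ofIdx P i :=
    inv_eq_of_mul_eq_one_left (ofIdx_mul_self i)
  change MulOpposite.op ((RootPairing.weylGroup.ofIdx P i)⁻¹ : P.weylGroup).1 • y = _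
  rw [h]
  rfl

lemma coweightAct_one : coweightAct P 1 = AddMonoidHom.id Y := by
  ext x
  change MulOpposite.op ((1 : P.weylGroup)⁻¹).1 • x = x
  rw [inv_one]
  exact one_smul _ x

lemma coweightAct_mul (w v : P.weylGroup) :
    coweightAct P (w * v) = (coweightAct P w).comp (coweightAct P v) := by
  ext x
  change MulOpposite.op ((w * v)⁻¹ : P.weylGroup).1 • x =
    MulOpposite.op (w⁻¹ : P.weylGroup).1 • MulOpposite.op (v⁻¹ : P.weylGroup).1 • x
  rw [← mul_smul, mul_inv_rev]
  rfl

/-- The Weyl group of a finite root pairing is finite. -/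
instance finite_weylGroup : Finite P.weylGroup := by
  have := Fintype.ofFinite I
  refine Finite.of_injective (fun w : P.weylGroup => fun i : I => w • i) fun w v hwv => ?_
  refine weyl_ext fun x => ?_
  have hroot : ∀ (w : P.weylGroup) (x : X), w • x - x ∈ P.rootSpan ℤ := by
    rintro ⟨w, hw⟩ x
    induction hw using RootPairing.weylGroup.induction generalizing x with
    | mem i =>
      change P.reflection i x - x ∈ _
      rw [RootPairing.reflection_apply, sub_sub_cancel_left]
      exact neg_mem (Submodule.smul_mem _ _ (Submodule.subset_span ⟨i, rfl⟩))
    | one =>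
      change (1 : P.weylGroup) • x - x ∈ _
      rw [one_smul, sub_self]
      exact zero_mem _
    | mul w v hw hv h1 h2 =>
      have := add_mem (h1 ((⟨v, hv⟩ : P.weylGroup) • x)) (h2 x)
      rw [sub_add_sub_cancel] at this
      exact this
  have h1 : w • x - v • x ∈ P.rootSpan ℤ := by
    have := sub_mem (hroot w x) (hroot v x)
    rwa [sub_sub_sub_cancel_right] at this
  have hpair : ∀ (w : P.weylGroup) (x : X) (y : Y),
      P.toLinearMap (w • x) y = P.toLinearMap x (MulOpposite.op w.1 • y) := fun w x y =>
    LinearMap.congr_fun (RootPairing.Hom.weight_coweight_transpose_apply P P y w.1.toHom) x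
  have hco : ∀ (w : P.weylGroup) (i : I), MulOpposite.op w.1 • P.coroot i =
      P.coroot (w⁻¹ • i) := fun w i => by
    have := coweightAct_coroot w⁻¹ i
    rwa [coweightAct, inv_inv] at this
  -- Two elements inducing the same permutation of the roots differ at `x` by a vector of the root
  -- span that pairs to zero with every coroot. It lies in the radical of the root form, which meets
  -- the root span trivially.
  have h2 : w • x - v • x ∈ LinearMap.ker P.RootForm := by
    rw [LinearMap.mem_ker]
    ext y
    rw [RootPairing.rootForm_apply_apply]
    refine Finset.sum_eq_zero fun i _ => ?_
    have : P.coroot' i (w • x - v • x) = 0 := by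
      rw [map_sub, sub_eq_zero]
      change P.toLinearMap (w • x) (P.coroot i) = P.toLinearMap (v • x) (P.coroot i)
      rw [hpair, hpair, hco, hco]
      congr 2
      rw [inv_smul_eq_iff]
      exact ((congrFun hwv (v⁻¹ • i)).trans (smul_inv_smul v i)).symm
    rw [this, zero_mul]
  exact sub_eq_zero.1 (Submodule.disjoint_def.1 P.disjoint_rootSpan_ker_rootForm _ h1 h2)

variable (b : P.Base)

lemma IsPos.ne_reflectionPerm {i j : I} (hi : b.IsPos i) (hj : b.IsPos j) :
    i ≠ P.reflectionPerm j j := by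
  rintro rfl
  let := P.indexNeg
  exact ((RootPairing.Base.IsPos.neg_iff_not b j).1 hi) hj

/-- Every root is reached from simple ones by simple reflections, and its reflection is the
corresponding conjugate. -/
lemma exists_simple_word [P.IsReduced] (w : P.weylGroup) : ∃ l : List (PosIdx b),
    (∀ s ∈ l, s.1 ∈ b.support) ∧ (l.map fun i => RootPairing.weylGroup.ofIdx P i.1).prod = w := by
  let S : Submonoid P.weylGroup :=
    { carrier := {w | ∃ l : List (PosIdx b), (∀ s ∈ l, s.1 ∈ b.support) ∧
        (l.map fun i => RootPairing.weylGroup.ofIdx P i.1).prod = w}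
      one_mem' := ⟨[], by simp⟩
      mul_mem' := by
        rintro _ _ ⟨l, h, rfl⟩ ⟨l', h', rfl⟩
        refine ⟨l ++ l', fun s hs => ?_, by simp⟩
        rcases List.mem_append.1 hs with hs | hs
        exacts [h s hs, h' s hs] }
  have hrefl : ∀ i, RootPairing.weylGroup.ofIdx P i ∈ S := by
    intro i
    induction i using b.induction_reflect with
    | h₀ i hi =>
      rw [ofIdx_reflectionPerm]
      exact mul_mem (mul_mem hi hi) hi
    | h₁ i hi =>
      exact ⟨[⟨i, RootPairing.Base.isPos_of_mem_support hi⟩], by simpa using hi, by simp⟩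
    | h₂ i j hi hj =>
      have hj' : RootPairing.weylGroup.ofIdx P j ∈ S :=
        ⟨[⟨j, RootPairing.Base.isPos_of_mem_support hj⟩], by simpa using hj, by simp⟩
      rw [ofIdx_reflectionPerm]
      exact mul_mem (mul_mem hj' hi) hj'
  change w ∈ S
  obtain ⟨w, hw⟩ := w
  induction hw using RootPairing.weylGroup.induction with
  | mem i => exact hrefl i
  | one => exact one_mem S
  | mul x y hx hy h1 h2 => exact mul_mem h1 h2

/-- The reflection datum of the roots. -/
def rootDatum [P.IsReduced] : HeckeDatum P.weylGroup X (PosIdx b) where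
  act := DistribMulAction.toAddMonoidEnd P.weylGroup X
  root i := P.root i.1
  refl i := RootPairing.weylGroup.ofIdx P i.1
  simple i := i.1 ∈ b.support
  shifted _ := True
  root_ne_zero i m h := (smul_eq_zero.1 h).resolve_right (P.ne_zero i.1)
  -- In a reduced root system distinct dependent roots are opposite, and two positive roots are not.
  indep i j hij m n h := by
    refine LinearIndependent.pair_iff.1 (RootPairing.IsReduced.linearIndependent P (i := i.1)
      (j := j.1) (fun h => hij (Subtype.ext h)) fun h' => ?_) m n h
    rw [← P.reflection_apply_self, ← P.root_reflectionPerm] at h'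
    exact IsPos.ne_reflectionPerm b i.2 j.2 (P.root.injective h')
  act_refl i x := ⟨-P.coroot' i.1 x, by
    change P.reflection i.1 x = _
    rw [RootPairing.reflection_apply, neg_smul, sub_eq_add_neg]⟩
  act_refl_self i := P.reflection_apply_self i.1
  refl_mul_self i := ofIdx_mul_self i.1
  perm s hs j hj := by
    have hj' : j.1 ≠ s.1 := fun h => hj (Subtype.ext h)
    refine ⟨⟨P.reflectionPerm s.1 j.1, j.2.reflectionPerm hs hj'⟩, fun h => ?_,
      (P.root_reflectionPerm s.1 j.1).symm, ?_, Iff.rfl⟩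
    · have h1 : P.reflectionPerm s.1 j.1 = s.1 := congrArg Subtype.val h
      have h2 : j.1 = P.reflectionPerm s.1 s.1 :=
        (P.reflectionPerm_self s.1 j.1).symm.trans (congrArg _ h1)
      exact IsPos.ne_reflectionPerm b j.2 s.2 h2
    · rw [ofIdx_reflectionPerm, ← mul_assoc, ← mul_assoc, ofIdx_mul_self, one_mul]
  word := exists_simple_word b

/-- The reflection datum of the coroots. -/
def corootDatum [P.IsReduced] : HeckeDatum P.weylGroup Y (PosIdx b) where
  act := ⟨⟨coweightAct P, coweightAct_one⟩, coweightAct_mul⟩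
  root i := P.coroot i.1
  refl i := RootPairing.weylGroup.ofIdx P i.1
  simple i := i.1 ∈ b.support
  shifted _ := False
  root_ne_zero i m h := (smul_eq_zero.1 h).resolve_right (P.flip.ne_zero i.1)
  indep i j hij m n h := by
    refine LinearIndependent.pair_iff.1 (RootPairing.IsReduced.linearIndependent P.flip (i := i.1)
      (j := j.1) (fun h => hij (Subtype.ext h)) fun h' => ?_) m n h
    rw [← P.flip.reflection_apply_self, ← P.flip.root_reflectionPerm] at h'
    exact IsPos.ne_reflectionPerm b i.2 j.2 (P.coroot.injective h')
  act_refl i x := ⟨-P.root' i.1 x, by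
    change coweightAct P (RootPairing.weylGroup.ofIdx P i.1) x = _
    rw [coweightAct_ofIdx, RootPairing.coreflection_apply, neg_smul, sub_eq_add_neg]⟩
  act_refl_self i := (coweightAct_ofIdx i.1 _).trans (P.flip.reflection_apply_self i.1)
  refl_mul_self i := ofIdx_mul_self i.1
  perm s hs j hj := by
    obtain ⟨j', h1, h2, h3, -⟩ := (rootDatum b).perm s hs j hj
    refine ⟨j', h1, ?_, h3, Iff.rfl⟩
    have h4 : P.root (P.reflectionPerm s.1 j.1) = P.root j'.1 :=
      (P.root_reflectionPerm s.1 j.1).trans h2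
    refine (coweightAct_ofIdx s.1 _).trans ?_
    rw [← P.root.injective h4]
    exact (P.coroot_reflectionPerm s.1 j.1).symm
  word := exists_simple_word b

lemma rootDatum_isInv [P.IsReduced] (i : PosIdx b) (w : P.weylGroup) :
    (rootDatum b).IsInv i w ↔ InversionSet b i w := by
  have h1 : (rootDatum b).act w⁻¹ ((rootDatum b).root i) = P.root (w⁻¹ • i.1) :=
    weyl_smul_root _ _
  simp only [HeckeDatum.IsInv, h1, InversionSet]
  constructor
  · exact fun h h' => h ⟨_, h'⟩ rfl
  · intro h j hj
    rw [P.root.injective hj] at h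
    exact h j.2

end RootDatum

/-! ### The action on rational sections -/

section PolyAct

variable {G : Type*} [Group G] {X : Scheme.{0}} [IsIntegral X] [SchemeAction G X]

lemma polyAct_eq_sum (a : Twisted G X) (s : X.functionField) :
    polyAct a s = a.coeff.sum fun g c => c * g • s := rfl

lemma polyAct_add (a b : Twisted G X) (s : X.functionField) :
    polyAct (a + b) s = polyAct a s + polyAct b s := by
  simp only [polyAct_eq_sum, SkewMonoidAlgebra.coeff_add]
  exact Finsupp.sum_add_index' (fun _ => zero_mul _) fun _ _ _ => add_mul _ _ _

lemma polyAct_zero (s : X.functionField) : polyAct (0 : Twisted G X) s = 0 := rfl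

lemma polyAct_add_right (a : Twisted G X) (s s' : X.functionField) :
    polyAct a (s + s') = polyAct a s + polyAct a s' := by
  simp only [polyAct, smul_add, mul_add, Finset.sum_add_distrib]

lemma polyAct_single (g : G) (c s : X.functionField) :
    polyAct (SkewMonoidAlgebra.single g c : Twisted G X) s = c * g • s := by
  rw [polyAct_eq_sum, SkewMonoidAlgebra.coeff_single, Finsupp.sum_single_index (zero_mul _)]

lemma polyAct_one (s : X.functionField) : polyAct (1 : Twisted G X) s = s := by
  have := polyAct_single (1 : G) 1 s
  rwa [one_mul, one_smul] at this

lemma polyAct_zero_right (a : Twisted G X) : polyAct a 0 = 0 := by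
  simp [polyAct]

lemma polyAct_mul (a b : Twisted G X) (s : X.functionField) :
    polyAct (a * b) s = polyAct a (polyAct b s) := by
  induction a using SkewMonoidAlgebra.induction_on with
  | zero => rw [zero_mul, polyAct_zero, polyAct_zero]
  | add a a' h h' => rw [add_mul, polyAct_add, polyAct_add, h, h']
  | single g c =>
    induction b using SkewMonoidAlgebra.induction_on with
    | zero => rw [mul_zero, polyAct_zero, polyAct_zero_right]
    | add b b' h h' => rw [mul_add, polyAct_add, polyAct_add, h, h', polyAct_add_right]
    | single g' c' =>
      rw [SkewMonoidAlgebra.single_mul_single, polyAct_single, polyAct_single, polyAct_single,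
        smul_mul', mul_smul, mul_assoc]

lemma polyAct_neg (a : Twisted G X) (s : X.functionField) : polyAct (-a) s = -polyAct a s := by
  rw [eq_neg_iff_add_eq_zero, ← polyAct_add, neg_add_cancel, polyAct_zero]

/-- Conjugation by a rational function. -/
def conjTw (d₀ : X.functionField) (a : Twisted G X) : Twisted G X :=
  SkewMonoidAlgebra.single 1 d₀ * a * SkewMonoidAlgebra.single 1 d₀⁻¹

lemma coeff_conjTw (d₀ : X.functionField) (a : Twisted G X) (g : G) :
    (conjTw d₀ a).coeff g = d₀ * a.coeff g * (g • d₀)⁻¹ := by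
  rw [conjTw, mul_assoc, SkewMonoidAlgebra.coeff_single_one_mul]
  induction a using SkewMonoidAlgebra.induction_on with
  | zero => simp
  | add a a' h h' =>
    rw [add_mul, SkewMonoidAlgebra.coeff_add, Finsupp.add_apply, mul_add, h, h',
      SkewMonoidAlgebra.coeff_add, Finsupp.add_apply]
    ring
  | single g' c =>
    classical
    rw [SkewMonoidAlgebra.single_mul_single, mul_one, SkewMonoidAlgebra.coeff_single_apply,
      SkewMonoidAlgebra.coeff_single_apply]
    split_ifs with h
    · subst h
      rw [smul_inv'', mul_assoc]
    · simp

lemma single_one_mul_single_one (c c' : X.functionField) :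
    (SkewMonoidAlgebra.single 1 c * SkewMonoidAlgebra.single 1 c' : Twisted G X) =
      SkewMonoidAlgebra.single 1 (c * c') := by
  rw [SkewMonoidAlgebra.single_mul_single, one_smul, one_mul]

lemma conjTw_mul {d₀ : X.functionField} (h : d₀ ≠ 0) (a b : Twisted G X) :
    conjTw d₀ (a * b) = conjTw d₀ a * conjTw d₀ b := by
  have h1 : (SkewMonoidAlgebra.single 1 d₀⁻¹ * SkewMonoidAlgebra.single 1 d₀ : Twisted G X) =
      1 := by
    rw [single_one_mul_single_one, inv_mul_cancel₀ h]; rfl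
  calc conjTw d₀ (a * b) = SkewMonoidAlgebra.single 1 d₀ * a *
        (SkewMonoidAlgebra.single 1 d₀⁻¹ * SkewMonoidAlgebra.single 1 d₀) *
        b * SkewMonoidAlgebra.single 1 d₀⁻¹ := by rw [h1, mul_one, conjTw]; simp only [mul_assoc]
    _ = _ := by simp only [conjTw, mul_assoc]

lemma conjTw_conjTw {d₀ : X.functionField} (h : d₀ ≠ 0) (a : Twisted G X) :
    conjTw d₀⁻¹ (conjTw d₀ a) = a := by
  ext g
  have h' : g • d₀ ≠ 0 := (smul_ne_zero_iff_ne g).2 h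
  rw [coeff_conjTw, coeff_conjTw, smul_inv'']
  field_simp

lemma polyAct_conjTw {d₀ : X.functionField} (h : d₀ ≠ 0) (a : Twisted G X) (s : X.functionField) :
    polyAct (conjTw d₀ a) (d₀ * s) = d₀ * polyAct a s := by
  rw [conjTw, polyAct_mul, polyAct_mul, polyAct_single, polyAct_single, one_smul, one_smul,
    inv_mul_cancel_left₀ h]

end PolyAct

/-! ### Locally principal families -/

section LocPrincipal

variable {X : Scheme.{0}} [IsIntegral X]

/-- A family of local equations that is given by one function near every finite set. -/
def SemilocPrincipal (d : X → X.functionField) : Prop :=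
  ∀ S : Set X, S.Finite → ∃ (N : X.Opens) (e : X.functionField), S ⊆ N ∧ ∀ y ∈ N, AssocAt y (d y) e

namespace SemilocPrincipal

variable {d d' : X → X.functionField}

lemma one : SemilocPrincipal (fun _ : X => (1 : X.functionField)) := fun _ _ =>
  ⟨⊤, 1, fun _ _ => trivial, fun _ _ => AssocAt.refl one_ne_zero⟩

lemma mul (h : SemilocPrincipal d) (h' : SemilocPrincipal d') :
    SemilocPrincipal (fun x => d x * d' x) := fun S hS => by
  obtain ⟨N, e, h1, h2⟩ := h S hS
  obtain ⟨N', e', h1', h2'⟩ := h' S hS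
  exact ⟨N ⊓ N', e * e', fun x hx => ⟨h1 hx, h1' hx⟩, fun y hy => (h2 y hy.1).mul (h2' y hy.2)⟩

lemma div (h : SemilocPrincipal d) (h' : SemilocPrincipal d') :
    SemilocPrincipal (fun x => d x / d' x) := fun S hS => by
  obtain ⟨N, e, h1, h2⟩ := h S hS
  obtain ⟨N', e', h1', h2'⟩ := h' S hS
  exact ⟨N ⊓ N', e / e', fun x hx => ⟨h1 hx, h1' hx⟩, fun y hy => (h2 y hy.1).div (h2' y hy.2)⟩

lemma prod {J : Type*} (F : Finset J) {d : J → X → X.functionField}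
    (h : ∀ j ∈ F, SemilocPrincipal (d j)) : SemilocPrincipal (fun x => ∏ j ∈ F, d j x) := by
  classical
  induction F using Finset.induction_on with
  | empty => simpa using one
  | insert j F hj ih =>
    simp only [Finset.prod_insert hj]
    exact (h j (by simp)).mul (ih fun i hi => h i (by simp [hi]))

end SemilocPrincipal

/-- The pull-back of a parameter of `E` that is a unit at the nonzero images of the given finite
set. -/
lemma semilocPrincipal_locEq {E : SchC} [GrpObj E] [IsEllipticCurve E]
    {t : E.left.presheaf.stalk (zeroPt E)}
    (ht : IsLocalRing.maximalIdeal (E.left.presheaf.stalk (zeroPt E)) = Ideal.span {t})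
    {T : SchC} [IsIntegral T.left] (f : T ⟶ E) [IsDominant f.left] :
    SemilocPrincipal (locEq t f) := fun S hS => by
  obtain ⟨e, N, h1, h2, h3, h4⟩ := exists_semilocal_parameter ht (hS.image f.left)
  refine ⟨f.left ⁻¹ᵁ N, functionFieldMap f.left e, fun x hx => h1 ⟨x, hx, rfl⟩, fun y hy => ?_⟩
  by_cases h : f.left y = zeroPt E
  · rw [locEq_eq_functionFieldMap f h]
    refine AssocAt.functionFieldMap f.left ?_
    rw [h]
    exact h3.symm
  · rw [locEq_of_ne h, ← map_one (functionFieldMap f.left)]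
    exact (h4 _ hy h).symm.functionFieldMap f.left

/-- A semilocally principal family is principal on small invariant open subsets. -/
lemma SemilocPrincipal.exists_invariant {G : Type*} [Group G] [Finite G] [SchemeAction G X]
    {d : X → X.functionField} (h : SemilocPrincipal d) (x : X) :
    ∃ (U : X.Opens) (e : X.functionField), x ∈ U ∧ SchemeAction.IsInvariant G U ∧
      ∀ y ∈ U, AssocAt y (d y) e := by
  obtain ⟨N, e, h1, h2⟩ := h (Set.range fun g : G => SchemeAction.inv g x) (Set.finite_range _)
  exact ⟨invCore G N, e, mem_invCore.2 fun g => h1 ⟨g, rfl⟩, isInvariant_invCore N,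
    fun y hy => h2 y (invCore_le N hy)⟩

end LocPrincipal

/-! ### Hecke conditions with values in a line bundle -/

section LineHecke

variable {E : SchC} [GrpObj E] [IsEllipticCurve E] {t : E.left.presheaf.stalk (zeroPt E)}
  {Λ : Type*} [AddCommGroup Λ] [Module.Free ℤ Λ] [Module.Finite ℤ Λ] {T : SchC} [IsIntegral T.left]
  {G J : Type*} [Group G] [SchemeAction G T.left]

/-- The Hecke conditions for a reflection datum and a line bundle. -/
def lineHecke (t : E.left.presheaf.stalk (zeroPt E)) (d : T.left → T.left.functionField)
    (χ : Multiplicative Λ →* (T ⟶ E)) (D : HeckeDatum G Λ J) (h : 𝟙_ SchC ⟶ E)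
    (U : T.left.Opens) : Set (Twisted G T.left) :=
  residueSections t d (fun j => aff χ (D.root j) 1) D.refl U ∩
    {a | ∀ j g, D.shifted j → D.IsInv j g → ∀ x ∈ U, IsGenericPointOf (aff χ (D.root j) h) x →
      RegularAt d g (a.coeff g *
        (locEq t (aff χ (D.root j) 1) x / locEq t (aff χ (D.root j) h) x)) x}

lemma lineHecke_mono {d : T.left → T.left.functionField} {χ : Multiplicative Λ →* (T ⟶ E)}
    {D : HeckeDatum G Λ J} {h : 𝟙_ SchC ⟶ E} {U U' : T.left.Opens} (hUU' : U' ≤ U) :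
    lineHecke t d χ D h U ⊆ lineHecke t d χ D h U' := by
  rintro a ⟨⟨h1, h2⟩, h3⟩
  exact ⟨⟨fun x hx => h1 x (hUU' hx), fun j x hx => h2 j x (hUU' hx)⟩,
    fun j g hj hg x hx => h3 j g hj hg x (hUU' hx)⟩

variable {d : T.left → T.left.functionField} {d₀ : T.left.functionField} {U : T.left.Opens}

lemma mem_lineStalk_iff {x : T.left} (hd : AssocAt x (d x) d₀) {s : T.left.functionField} :
    s ∈ lineStalk d x ↔ d₀ * s ∈ regAt x := by
  rw [mem_lineStalk, mul_comm, hd.mul_mem_iff]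

lemma regularAt_iff (hU : SchemeAction.IsInvariant G U)
    (hd : ∀ x ∈ U, AssocAt x (d x) d₀) {x : T.left} (hx : x ∈ U) (g : G)
    (a : T.left.functionField) :
    RegularAt d g a x ↔ d₀ * a * (g • d₀)⁻¹ ∈ regAt x := by
  have hx' := (inv_mem_iff_of_isInvariant hU g).2 hx
  have h0 : d₀ ≠ 0 := (hd x hx).2.1
  have h0' : g • d₀ ≠ 0 := (smul_ne_zero_iff_ne g).2 h0
  constructor
  · intro h
    have := h d₀⁻¹ (by rw [mem_lineStalk_iff (hd _ hx'), mul_inv_cancel₀ h0]; exact one_mem _)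
    rwa [mem_lineStalk_iff (hd x hx), smul_inv'', ← mul_assoc] at this
  · intro h s hs
    rw [mem_lineStalk_iff (hd _ hx'), ← smul_mem_regAt, smul_mul'] at hs
    rw [mem_lineStalk_iff (hd x hx)]
    convert mul_mem h hs using 1
    field_simp

lemma mem_twistedSections_iff (hU : SchemeAction.IsInvariant G U)
    (hd : ∀ x ∈ U, AssocAt x (d x) d₀) (a : Twisted G T.left) :
    a ∈ twistedSections d U ↔ ∀ x ∈ U, ∀ g, (conjTw d₀ a).coeff g ∈ regAt x := by
  simp only [coeff_conjTw]
  exact forall₂_congr fun x hx => forall_congr' fun g => regularAt_iff hU hd hx g _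

/-- On an open set where the line bundle is trivial, conjugation by a trivialization reduces the
Hecke conditions to those for the trivial line bundle. -/
lemma mem_lineHecke_iff [Fintype J] {χ : Multiplicative Λ →* (T ⟶ E)} {D : HeckeDatum G Λ J}
    {h : 𝟙_ SchC ⟶ E} (H : HeckeGeom t χ D) (hU : SchemeAction.IsInvariant G U)
    (hd : ∀ x ∈ U, AssocAt x (d x) d₀) (a : Twisted G T.left) :
    a ∈ lineHecke t d χ D h U ↔ IsHecke t χ D h U (conjTw d₀ a) := by
  have key : ∀ x ∈ U, ∀ g, ∀ s, ∀ c,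
      c * (a.coeff g * g • s) ∈ lineStalk d x ↔
        c * (conjTw d₀ a).coeff g * (g • (d₀ * s)) ∈ regAt x := fun x hx g s c => by
    have h0' : g • d₀ ≠ 0 := (smul_ne_zero_iff_ne g).2 (hd x hx).2.1
    rw [mem_lineStalk_iff (hd x hx), coeff_conjTw, smul_mul']
    refine Eq.to_iff (congrArg (· ∈ regAt x) ?_)
    field_simp
  have hst : ∀ x ∈ U, ∀ g : G, ∀ s, s ∈ lineStalk d (SchemeAction.inv g x) ↔
      g • (d₀ * s) ∈ regAt x := fun x hx g s => by
    rw [mem_lineStalk_iff (hd _ ((inv_mem_iff_of_isInvariant hU g).2 hx)), smul_mem_regAt]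
  have key2 : ∀ x ∈ U, ∀ g g' s, ∀ c, c * (a.coeff g * g • s + a.coeff g' * g' • s) * d x ∈ vanAt
      x ↔
        c * ((conjTw d₀ a).coeff g * (g • (d₀ * s)) +
          (conjTw d₀ a).coeff g' * (g' • (d₀ * s))) ∈ vanAt x := fun x hx g g' s c => by
    have h0' : g • d₀ ≠ 0 := (smul_ne_zero_iff_ne g).2 (hd x hx).2.1
    have h0'' : g' • d₀ ≠ 0 := (smul_ne_zero_iff_ne g').2 (hd x hx).2.1
    rw [mul_comm _ (d x), (hd x hx).mul_mem_vanAt_iff, coeff_conjTw, coeff_conjTw, smul_mul',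
      smul_mul']
    refine Eq.to_iff (congrArg (· ∈ vanAt x) ?_)
    field_simp
  have hone : ∀ x ∈ U, ∀ g : G, g • (d₀ * d₀⁻¹) = 1 := fun x hx g => by
    rw [mul_inv_cancel₀ (hd x hx).2.1, smul_one]
  constructor
  · rintro ⟨⟨h1, h2⟩, h3⟩
    refine ⟨fun x hx g => ?_, fun j x hx hx' g => ?_, fun j g hj hg x hx hx' => ?_⟩
    · have := h1 x hx g d₀⁻¹ ((hst x hx g _).2 (by rw [hone x hx]; exact one_mem _))
      rwa [key x hx, hone x hx, mul_one, finprod_eq_prod_of_fintype] at this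
    · have := h2 j x hx hx' g d₀⁻¹ ((hst x hx g _).2 (by rw [hone x hx]; exact one_mem _))
      change _ ∈ vanAt x at this
      rwa [key2 x hx, hone x hx, hone x hx, mul_one, mul_one] at this
    · have := h3 j g hj hg x hx hx'
      rw [regularAt_iff hU hd hx] at this
      rw [coeff_conjTw]
      convert this using 1
      ring
  · intro ha
    refine ⟨⟨fun x hx g s hs => ?_, fun j x hx hx' g s hs => ?_⟩, fun j g hj hg x hx hx' => ?_⟩
    · rw [key x hx, finprod_eq_prod_of_fintype]
      exact mul_mem (ha.pole x hx g) ((hst x hx g s).1 hs)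
    · change _ ∈ vanAt x
      rw [key2 x hx, mul_smul]
      have hm := (hst x hx g s).1 hs
      set m := g • (d₀ * s)
      have h1 := mul_mem_vanAt' (ha.res j x hx hx' g) hm
      have h2 := ha.pole x hx (D.refl j * g)
      rw [H.prod_locEq (fun _ => 1) hx'] at h2
      -- The residue condition compares `g • s` with `(s_j g) • s`, here `m` and `s_j m`. As `s_j`
      -- fixes the wall, they agree modulo its equation, and the discrepancy is absorbed by the
      -- simple pole of the coefficient.
      convert add_mem_vanAt h1 (mul_mem_vanAt h2 (H.sub_mem_vanAt j hx'.1 hm)) using 1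
      ring
    · rw [regularAt_iff hU hd hx]
      have := ha.van j g hj hg x hx hx'
      rw [coeff_conjTw] at this
      convert this using 1
      ring

/-- Demazure operators satisfy the Hecke conditions. -/
lemma HeckeGeom.isHecke_demazure [Fintype J] {χ : Multiplicative Λ →* (T ⟶ E)}
    {D : HeckeDatum G Λ J} {h : 𝟙_ SchC ⟶ E} (H : HeckeGeom t χ D)
    (hU : SchemeAction.IsInvariant G U) {s : J} (hs : D.simple s) {p : T.left.functionField}
    (hp : ∀ x ∈ U, AssocAt x p (shiftEq t χ D h s x / locEq t (aff χ (D.root s) 1) x)) :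
    IsHecke t χ D h U (demazure D s p) := by
  have := (IsHecke.one (U := U) (h := h) H).demazure_mul H hU hs hp
  rwa [mul_one] at this

/-- The Hecke algebra preserves regular functions. -/
lemma IsHecke.polyAct_mem [Fintype J] {χ : Multiplicative Λ →* (T ⟶ E)}
    {D : HeckeDatum G Λ J} {h : 𝟙_ SchC ⟶ E} (H : HeckeGeom t χ D)
    (hU : SchemeAction.IsInvariant G U)
    (p : J → T.left.functionField)
    (hp : ∀ s, D.simple s → ∀ x ∈ U,
      AssocAt x (p s) (shiftEq t χ D h s x / locEq t (aff χ (D.root s) 1) x))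
    {a : Twisted G T.left} (ha : IsHecke t χ D h U a) {m : T.left.functionField}
    (hm : ∀ x ∈ U, m ∈ regAt x) : ∀ x ∈ U, polyAct a m ∈ regAt x := by
  intro x₀ hx₀
  refine IsHecke.induction H hU hx₀ p hp (fun a => ∀ m : T.left.functionField,
    (∀ x ∈ U, m ∈ regAt x) → ∀ x ∈ U, polyAct a m ∈ regAt x) ?_ ?_ ?_ ?_ ?_ ha m hm x₀ hx₀
  · intro m _ x _
    rw [polyAct_zero]; exact zero_mem _
  · intro m hm x hx
    rw [polyAct_one]; exact hm x hx
  · intro a b ha hb m hm x hx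
    rw [polyAct_add]; exact add_mem (ha m hm x hx) (hb m hm x hx)
  · intro f hf a ha m hm x hx
    rw [polyAct_mul, polyAct_single, one_smul]
    exact mul_mem (hf x hx) (ha m hm x hx)
  · intro s hs a ha m hm x hx
    rw [polyAct_mul]
    have hm' := ha m hm
    generalize polyAct a m = m' at hm'
    rw [demazure, sub_eq_add_neg, polyAct_add, polyAct_neg, polyAct_single, polyAct_single,
      one_smul, ← sub_eq_add_neg, ← mul_sub, (hp s hs x hx).mul_mem_iff, div_mul_eq_mul_div,
      mul_div_assoc]
    refine mul_mem (H.shiftEq_mem h s x) ?_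
    -- On the wall `s m - m` is divisible by its equation; off the wall that equation is `1`.
    by_cases hx' : (aff χ (D.root s) 1).left x = zeroPt E
    · exact (H.fix s hx').2 m' (hm' x hx)
    · rw [locEq_of_ne hx', div_one]
      refine sub_mem ?_ (hm' x hx)
      rw [smul_mem_regAt]
      exact hm' _ ((inv_mem_iff_of_isInvariant hU _).2 hx)

end LineHecke

/-! ### The elliptic Hecke algebras of a root datum -/

section Instances

variable {I X Y : Type*} [Finite I] [AddCommGroup X] [AddCommGroup Y]
  [Module.Free ℤ X] [Module.Finite ℤ X] [Module.Free ℤ Y] [Module.Finite ℤ Y]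
  {P : RootPairing I ℤ X Y} [P.IsReduced] (b : P.Base) {E : SchC} [GrpObj E] [IsEllipticCurve E]
  {t : E.left.presheaf.stalk (zeroPt E)}

/-- The reflection datum of `W × W` acting on `X × Y`. -/
abbrev dynDatum : HeckeDatum (P.weylGroup × P.weylGroup) (X × Y) (PosIdx b ⊕ PosIdx b) :=
  (rootDatum b).prod (corootDatum b)

variable (X Y E) in
/-- The characters of `𝔄 × 𝔄^∨`. -/
abbrev dynChi : Multiplicative (X × Y) →* (HomTorus E X ⊗ HomTorus E Y ⟶ E) :=
  prodChi (HomTorus.chiHom E) (HomTorus.chiHom E)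

lemma heckeGeom_root
    (ht : IsLocalRing.maximalIdeal (E.left.presheaf.stalk (zeroPt E)) = Ideal.span {t}) :
    HeckeGeom t (HomTorus.chiHom E (Λ := X)) (rootDatum b) :=
  ⟨ht, isTorus_chiHom, fun w => ⟨weylInv P E w, rfl, fun c => HomTorus.precomp_chi E _ c⟩⟩

lemma heckeGeom_dyn
    (ht : IsLocalRing.maximalIdeal (E.left.presheaf.stalk (zeroPt E)) = Ideal.span {t}) :
    HeckeGeom t (dynChi X Y E) (dynDatum b) := by
  refine ⟨ht, isTorus_chiHom.prod isTorus_chiHom, fun g =>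
    ⟨weylInv P E g.1 ⊗ₘ dualWeylInv P E g.2, rfl, fun c => ?_⟩⟩
  change (weylInv P E g.1 ⊗ₘ dualWeylInv P E g.2) ≫ ((fst _ _ ≫ HomTorus.chi E c.1) *
    (snd _ _ ≫ HomTorus.chi E c.2)) = (fst _ _ ≫ HomTorus.chi E (weightAct P g.1 c.1)) *
    (snd _ _ ≫ HomTorus.chi E (coweightAct P g.2 c.2))
  rw [MonObj.comp_mul, tensorHom_fst_assoc, tensorHom_snd_assoc, ← HomTorus.precomp_chi,
    ← HomTorus.precomp_chi]
  rfl

lemma aff_one {T : SchC} {Λ : Type*} [AddCommGroup Λ] (χ : Multiplicative Λ →* (T ⟶ E)) (c : Λ) :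
    aff χ c 1 = χ (Multiplicative.ofAdd c) := by
  rw [aff, constHom_one, mul_one]

variable (κ : 𝟙_ SchC ⟶ E)

lemma shiftedRoot_eq (i : I) : shiftedRoot (P := P) κ i =
    aff (HomTorus.chiHom E) (P.root i) (κ ^ (-2 : ℤ)) := by
  rw [aff, constHom_zpow, shiftedRoot, div_eq_mul_inv, zpow_neg]
  rfl

lemma fst_aff {Λ Λ' : Type*} [AddCommGroup Λ] [Module.Free ℤ Λ] [Module.Finite ℤ Λ]
    [AddCommGroup Λ'] {T T' : SchC}
    (χ : Multiplicative Λ →* (T ⟶ E)) (χ' : Multiplicative Λ' →* (T' ⟶ E)) (c : Λ)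
    (s₀ : 𝟙_ SchC ⟶ E) : fst T T' ≫ aff χ c s₀ = aff (prodChi χ χ') (c, 0) s₀ := by
  rw [aff, MonObj.comp_mul, comp_constHom, aff, prodChi_inl]

lemma heckeSections_eq (V : (HomTorus E X).left.Opens) :
    heckeSections b t κ V = lineHecke t (fun _ => 1) (HomTorus.chiHom E) (rootDatum b)
      (κ ^ (-2 : ℤ)) V := by
  have h1 : (fun i : PosIdx b => HomTorus.chi E (P.root i.1)) =
      fun j => aff (HomTorus.chiHom E) ((rootDatum b).root j) 1 := by
    funext j
    rw [aff_one]
    rfl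
  rw [heckeSections, lineHecke, h1]
  refine congrArg₂ (· ∩ ·) rfl ?_
  ext a
  simp only [vanishingSections, Set.mem_ofPred_eq, shiftedRoot_eq, ← rootDatum_isInv]
  exact ⟨fun h j g _ => h j g, fun h j g => h j g trivial⟩

/-- Only roots carry a shifted divisor, so in the product datum the vanishing condition is void on
the coroot summand. In multiplicative notation, subtracting `ħ = 2κ` is the shift by `κ ^ (-2)`. -/
lemma dynHeckeSections_eq (U : (HomTorus E X ⊗ HomTorus E Y).left.Opens) :
    dynHeckeSections b t κ U = lineHecke t (twistDivisor b t κ) (dynChi X Y E) (dynDatum b)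
      (κ ^ (-2 : ℤ)) U := by
  have h1 : (Sum.elim (fun i : PosIdx b => fst _ _ ≫ HomTorus.chi E (P.root i.1))
      (fun i : PosIdx b => snd _ _ ≫ HomTorus.chi E (P.coroot i.1))) =
      fun j => aff (dynChi X Y E) ((dynDatum b).root j) 1 := by
    funext j
    rw [aff_one]
    rcases j with j | j
    · exact (prodChi_inl (HomTorus.chiHom E) (HomTorus.chiHom E) _).symm
    · exact (prodChi_inr (HomTorus.chiHom E) (HomTorus.chiHom E) _).symm
  rw [dynHeckeSections, dynHeckeTildeSections, lineHecke, h1]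
  refine congrArg₂ (· ∩ ·) rfl ?_
  ext a
  simp only [vanishingSections, Set.mem_ofPred_eq, shiftedRoot_eq, ← rootDatum_isInv]
  have h2 : ∀ i : PosIdx b, fst (HomTorus E X) (HomTorus E Y) ≫ HomTorus.chi E (P.root i.1) =
      aff (dynChi X Y E) ((dynDatum b).root (.inl i)) 1 := fun i => congrFun h1 (.inl i)
  have h3 : ∀ i : PosIdx b, fst (HomTorus E X) (HomTorus E Y) ≫
      aff (HomTorus.chiHom E) (P.root i.1) (κ ^ (-2 : ℤ)) =
      aff (dynChi X Y E) ((dynDatum b).root (.inl i)) (κ ^ (-2 : ℤ)) := fun i => fst_aff _ _ _ _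
  simp only [h2, h3, ← HeckeDatum.prod_isInv_inl (rootDatum b) (corootDatum b)]
  constructor
  · rintro h (j | j) g hj
    · exact h j g
    · exact hj.elim
  · exact fun h j g => h (.inl j) g trivial

lemma semilocPrincipal_aff {Λ : Type*} [AddCommGroup Λ] [Module.Free ℤ Λ] [Module.Finite ℤ Λ]
    {T : SchC} [IsIntegral T.left] {χ : Multiplicative Λ →* (T ⟶ E)} (hχ : IsTorus χ)
    (ht : IsLocalRing.maximalIdeal (E.left.presheaf.stalk (zeroPt E)) = Ideal.span {t})
    {c : Λ} (hc : c ≠ 0) (s₀ : 𝟙_ SchC ⟶ E) : SemilocPrincipal (locEq t (aff χ c s₀)) := by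
  have : IsDominant (aff χ c s₀).left := hχ.isDominant ht hc s₀
  exact semilocPrincipal_locEq ht _

lemma semilocPrincipal_demazure {Λ G J : Type*} [Group G] [Fintype J] [AddCommGroup Λ]
    [Module.Free ℤ Λ] [Module.Finite ℤ Λ] {T : SchC} [IsIntegral T.left] [SchemeAction G T.left]
    {χ : Multiplicative Λ →* (T ⟶ E)} {D : HeckeDatum G Λ J} (H : HeckeGeom t χ D)
    (h : 𝟙_ SchC ⟶ E) (j : J) :
    SemilocPrincipal fun x => shiftEq t χ D h j x / locEq t (aff χ (D.root j) 1) x := by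
  refine .div ?_ (semilocPrincipal_aff H.torus H.ht (D.root_ne j) 1)
  unfold shiftEq
  split_ifs
  · exact semilocPrincipal_aff H.torus H.ht (D.root_ne j) h
  · exact .one

lemma dualBasisVec_ne_zero (i : Fin (Module.finrank ℤ X)) : dualBasisVec P i ≠ 0 := fun h => by
  rw [dualBasisVec, LinearEquiv.map_eq_zero_iff] at h
  have := LinearMap.congr_fun h (Module.finBasis ℤ X i)
  simp at this

/-- Each of the five divisors involved is the zero divisor of a translate of a nonzero character of
`𝔄 × 𝔄^∨`. -/
lemma semilocPrincipal_twistFactor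
    (ht : IsLocalRing.maximalIdeal (E.left.presheaf.stalk (zeroPt E)) = Ideal.span {t})
    {e : X} {e' : Y} (he : e ≠ 0) (he' : e' ≠ 0) (m n : ℤ)
    (z l : HomTorus E X ⊗ HomTorus E Y ⟶ E)
    (hz : z = dynChi X Y E (Multiplicative.ofAdd (e, 0)))
    (hl : l = dynChi X Y E (Multiplicative.ofAdd (0, e'))) :
    SemilocPrincipal fun x => locEq t (z / l) x / (locEq t z x * locEq t l x) *
      (locEq t (z / constHom κ _ ^ m) x / locEq t z x) *
      (locEq t (l * constHom κ _ ^ n) x / locEq t l x) := by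
  have hT : IsTorus (dynChi X Y E) := isTorus_chiHom.prod isTorus_chiHom
  have haff : ∀ (f : HomTorus E X ⊗ HomTorus E Y ⟶ E) (c : X × Y) (s₀ : 𝟙_ SchC ⟶ E), c ≠ 0 →
      f = aff (dynChi X Y E) c s₀ → SemilocPrincipal (locEq t f) := by
    rintro _ c s₀ hc rfl
    exact semilocPrincipal_aff hT ht hc s₀
  have h1 := haff z (e, 0) 1 (fun h => he (congrArg Prod.fst h)) (by rw [aff_one, hz])
  have h2 := haff l (0, e') 1 (fun h => he' (congrArg Prod.snd h)) (by rw [aff_one, hl])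
  have h3 : SemilocPrincipal (locEq t (z / l)) := by
    refine haff _ (e, -e') 1 (fun h => he (congrArg Prod.fst h)) ?_
    have h : (e, -e') = (e, (0 : Y)) - ((0 : X), e') := by simp
    rw [aff_one, hz, hl, h, ofAdd_sub, map_div]
  have h4 : SemilocPrincipal (locEq t (z / constHom κ _ ^ m)) := by
    refine haff _ (e, 0) (κ ^ (-m)) (fun h => he (congrArg Prod.fst h)) ?_
    rw [aff, hz, constHom_zpow, zpow_neg, div_eq_mul_inv]
  have h5 : SemilocPrincipal (locEq t (l * constHom κ _ ^ n)) := by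
    refine haff _ (0, e') (κ ^ n) (fun h => he' (congrArg Prod.snd h)) ?_
    rw [aff, hl, constHom_zpow]
  exact ((h3.div (h1.mul h2)).mul (h4.div h1)).mul (h5.div h2)

lemma semilocPrincipal_twistDivisor
    (ht : IsLocalRing.maximalIdeal (E.left.presheaf.stalk (zeroPt E)) = Ideal.span {t}) :
    SemilocPrincipal (twistDivisor b t κ) := by
  have h := fun i => semilocPrincipal_twistFactor κ ht ((Module.finBasis ℤ X).ne_zero i)
      (dualBasisVec_ne_zero (P := P) i) (P.toLinearMap (twoRho b) (dualBasisVec P i))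
      (P.toLinearMap (Module.finBasis ℤ X i) (twoRhoDual b))
      (fst _ _ ≫ HomTorus.chi E (Module.finBasis ℤ X i))
      (snd _ _ ≫ HomTorus.chi E (dualBasisVec P i))
      (prodChi_inl (HomTorus.chiHom E) (HomTorus.chiHom E) _).symm
      (prodChi_inr (HomTorus.chiHom E) (HomTorus.chiHom E) _).symm
  have h' := SemilocPrincipal.prod Finset.univ fun i _ => h i
  have e : twistDivisor b t κ = fun x => twistDivisor b t κ x := rfl
  rw [e]
  simp only [twistDivisor]
  exact h'

/-! ### The projection -/

lemma inv_proj (g : P.weylGroup × P.weylGroup) :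
    (SchemeAction.inv g : (HomTorus E X ⊗ HomTorus E Y).left ⟶ _) ≫ proj X Y E =
      proj X Y E ≫ SchemeAction.inv g.1 :=
  congrArg Over.Hom.left (tensorHom_fst (weylInv P E g.1) (dualWeylInv P E g.2))

instance nonempty_homTorus : Nonempty (HomTorus E Y).left :=
  ⟨genericPoint (HomTorus E Y).left⟩

/-- Equivariance of `p` for the first projection `W × W → W`: the second Weyl group acts trivially
on functions pulled back from `𝔄`. The multiplicativity of `Ψ` relies on it. -/
lemma smul_functionFieldMap_proj (g : P.weylGroup × P.weylGroup)
    (f : (HomTorus E X).left.functionField) :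
    g • functionFieldMap (proj X Y E) f = functionFieldMap (proj X Y E) (g.1 • f) := by
  have h1 := functionFieldMap_comp (SchemeAction.inv g) (proj X Y E)
  have h2 := functionFieldMap_comp (proj X Y E) (SchemeAction.inv g.1 (X := (HomTorus E X).left))
  have : ∀ (φ ψ : (HomTorus E X ⊗ HomTorus E Y).left ⟶ (HomTorus E X).left) [IsDominant φ]
      [IsDominant ψ], φ = ψ → functionFieldMap φ f = functionFieldMap ψ f := by
    rintro φ ψ _ _ rfl
    rfl
  have h3 := this _ _ (inv_proj (P := P) (E := E) g)
  rw [h1, h2] at h3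
  exact h3

lemma isInvariant_proj {V : (HomTorus E X).left.Opens}
    (hV : SchemeAction.IsInvariant P.weylGroup V) :
    SchemeAction.IsInvariant (P.weylGroup × P.weylGroup) (proj X Y E ⁻¹ᵁ V) := fun g => by
  rw [← Scheme.Hom.comp_preimage, inv_proj, Scheme.Hom.comp_preimage, hV]

end Instances

/-! ### Properness of the abelian varieties -/

section Proper

variable {E : SchC} [GrpObj E] [IsEllipticCurve E]

lemma isProper_tensor (A B : SchC) [IsProper A.hom] [IsProper B.hom] : IsProper (A ⊗ B).hom := by
  have : (A ⊗ B).hom = pullback.fst A.hom B.hom ≫ A.hom := rfl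
  rw [this]; infer_instance

instance isProper_power (n : ℕ) : IsProper (power E n).hom := by
  induction n with
  | zero =>
    change IsProper (𝟙 _)
    infer_instance
  | succ n ih => exact isProper_tensor E (power E n)

instance isProper_power_tensor (m n : ℕ) : IsProper (power E m ⊗ power E n).hom :=
  isProper_tensor _ _

lemma compactSpace_of_isProper (A : SchC) [IsProper A.hom] : CompactSpace A.left :=
  QuasiCompact.compactSpace_of_compactSpace A.hom

/-- The group structure on a power. -/
instance grpObjPower : (n : ℕ) → GrpObj (power E n)
  | 0 => inferInstanceAs (GrpObj (𝟙_ SchC))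
  | n + 1 =>
    have := grpObjPower n
    inferInstanceAs (GrpObj (E ⊗ power E n))

end Proper

/-! ### Good pairs and tensors of sections. -/

section Coproduct

variable {I X Y : Type*} [Finite I] [AddCommGroup X] [AddCommGroup Y]
  [Module.Free ℤ X] [Module.Finite ℤ X] [Module.Free ℤ Y] [Module.Finite ℤ Y]
  {P : RootPairing I ℤ X Y} [P.IsReduced] (b : P.Base) {E : SchC} [GrpObj E] [IsEllipticCurve E]
  (t : E.left.presheaf.stalk (zeroPt E)) (κ : 𝟙_ SchC ⟶ E)

instance fintypePosIdx : Fintype (PosIdx b) := Fintype.ofFinite _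

/-- Affine invariant open subsets of `𝔄 × 𝔄^∨` and `𝔄` that are compatible with the projection,
and on which the line bundle and the Demazure coefficients are trivialized. -/
structure GoodPair (U : (HomTorus E X ⊗ HomTorus E Y).left.Opens)
    (V : (HomTorus E X).left.Opens) where
  invU : SchemeAction.IsInvariant (P.weylGroup × P.weylGroup) U
  invV : SchemeAction.IsInvariant P.weylGroup V
  affU : IsAffineOpen U
  affV : IsAffineOpen V
  le : U ≤ proj X Y E ⁻¹ᵁ V
  /-- a local equation of the divisor of the line bundle -/
  d₀ : (HomTorus E X ⊗ HomTorus E Y).left.functionField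
  d₀_ne : d₀ ≠ 0
  hd : ∀ x ∈ U, AssocAt x (twistDivisor b t κ x) d₀
  /-- the Demazure coefficients of the roots -/
  p : PosIdx b → (HomTorus E X).left.functionField
  hp : ∀ s, ∀ y ∈ V, AssocAt y (p s) (shiftEq t (HomTorus.chiHom E) (rootDatum b) (κ ^ (-2 : ℤ)) s
      y /
    locEq t (aff (HomTorus.chiHom E) ((rootDatum b).root s) 1) y)
  /-- the Demazure coefficients of the coroots -/
  q : PosIdx b → (HomTorus E X ⊗ HomTorus E Y).left.functionField
  hq : ∀ s, ∀ y ∈ U, AssocAt y (q s)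
    (shiftEq t (dynChi X Y E) (dynDatum b) (κ ^ (-2 : ℤ)) (.inr s) y /
      locEq t (aff (dynChi X Y E) ((dynDatum b).root (.inr s)) 1) y)

variable {b t κ}

lemma SemilocPrincipal.exists_invariant_family {G : Type*} [Group G] [Finite G] {Z : Scheme.{0}}
    [IsIntegral Z] [SchemeAction G Z] {J : Type*} [Finite J] {d : J → Z → Z.functionField}
    (h : ∀ j, SemilocPrincipal (d j)) (x : Z) :
    ∃ (U : Z.Opens) (e : J → Z.functionField), x ∈ U ∧ SchemeAction.IsInvariant G U ∧
      ∀ j, ∀ y ∈ U, AssocAt y (d j y) (e j) := by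
  choose U e h1 h2 h3 using fun j => (h j).exists_invariant (G := G) x
  refine ⟨⟨⋂ j, U j, isOpen_iInter_of_finite fun j => (U j).isOpen⟩, e, ?_, fun g => ?_,
    fun j y hy => h3 j y (Set.mem_iInter.1 hy j)⟩
  · exact Set.mem_iInter.2 h1
  · ext y
    change SchemeAction.inv g y ∈ (⋂ j, (U j : Set Z)) ↔ y ∈ (⋂ j, (U j : Set Z))
    simp only [Set.mem_iInter]
    exact forall_congr' fun j => inv_mem_iff_of_isInvariant (h2 j) g

/-- First shrink around the orbits until the line bundle and the finitely many Demazure coefficients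
are principal; then choose `V` affine, and `U` affine inside the preimage of `V`. -/
lemma exists_goodPair
    (ht : IsLocalRing.maximalIdeal (E.left.presheaf.stalk (zeroPt E)) = Ideal.span {t})
    {U : (HomTorus E X ⊗ HomTorus E Y).left.Opens}
    (hU : SchemeAction.IsInvariant (P.weylGroup × P.weylGroup) U)
    {V : (HomTorus E X).left.Opens} (hV : SchemeAction.IsInvariant P.weylGroup V)
    {x : (HomTorus E X ⊗ HomTorus E Y).left} (hx : x ∈ U) (hxV : proj X Y E x ∈ V) :
    ∃ U' V', Nonempty (GoodPair b t κ U' V') ∧ x ∈ U' ∧ U' ≤ U ∧ V' ≤ V := by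
  obtain ⟨U₁, d₀, h1, h2, h3⟩ := (semilocPrincipal_twistDivisor b κ ht).exists_invariant
    (G := P.weylGroup × P.weylGroup) x
  obtain ⟨V₂, p, h4, h5, h6⟩ := SemilocPrincipal.exists_invariant_family (G := P.weylGroup)
    (fun s => semilocPrincipal_demazure (heckeGeom_root b ht) (κ ^ (-2 : ℤ)) s) (proj X Y E x)
  obtain ⟨U₃, q, h7, h8, h9⟩ := SemilocPrincipal.exists_invariant_family
    (G := P.weylGroup × P.weylGroup)
    (fun s : PosIdx b => semilocPrincipal_demazure (heckeGeom_dyn b ht) (κ ^ (-2 : ℤ)) (.inr s)) x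
  have hc := compactSpace_of_isProper (HomTorus E X)
  have hc' := compactSpace_of_isProper (HomTorus E X ⊗ HomTorus E Y)
  obtain ⟨V', ha, hi, hle, hxV'⟩ := exists_isAffineOpen_isInvariant (T := HomTorus E X)
    (isInvariant_inf hV h5) (x := proj X Y E x) ⟨hxV, h4⟩
  obtain ⟨U', ha', hi', hle', hxU'⟩ := exists_isAffineOpen_isInvariant
    (T := HomTorus E X ⊗ HomTorus E Y)
    (isInvariant_inf (isInvariant_inf hU h2) (isInvariant_inf h8 (isInvariant_proj hi)))
    (x := x) ⟨⟨hx, h1⟩, ⟨h7, hxV'⟩⟩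
  exact ⟨U', V', ⟨⟨hi', hi, ha', ha, fun y hy => (hle' hy).2.2, d₀, (h3 x h1).2.1,
    fun y hy => h3 y (hle' hy).1.2, p, fun s y hy => (h6 s y (hle hy).2).symm, q,
    fun s y hy => (h9 s y (hle' hy).2.1).symm⟩⟩, hxU', fun y hy => (hle' hy).1.1,
    fun y hy => (hle hy).1⟩

/-- The tensor `a ⊗ h` as a rational section of `𝕊 ⊗ p^*(𝒪 ⋊ W)`. -/
def tensorCoeff (a : Twisted (P.weylGroup × P.weylGroup) (HomTorus E X ⊗ HomTorus E Y).left)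
    (h : Twisted P.weylGroup (HomTorus E X).left) (g : P.weylGroup × P.weylGroup)
    (w : P.weylGroup) : (HomTorus E X ⊗ HomTorus E Y).left.functionField :=
  a.coeff g * functionFieldMap (proj X Y E) (h.coeff w)

open scoped Classical in
/-- The coproduct `Ψ(T)` as a rational section of `𝕊 ⊗ p^*(𝒪 ⋊ W)`. -/
def coprodCoeff (T : Twisted (P.weylGroup × P.weylGroup) (HomTorus E X ⊗ HomTorus E Y).left)
    (g : P.weylGroup × P.weylGroup) (w : P.weylGroup) :
    (HomTorus E X ⊗ HomTorus E Y).left.functionField :=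
  if w = g.1 then T.coeff g else 0

lemma isCoproduct_iff
    {T : Twisted (P.weylGroup × P.weylGroup) (HomTorus E X ⊗ HomTorus E Y).left} {m : ℕ}
    {a : Fin m → Twisted (P.weylGroup × P.weylGroup) (HomTorus E X ⊗ HomTorus E Y).left}
    {h : Fin m → Twisted P.weylGroup (HomTorus E X).left} :
    IsCoproduct P E T a h ↔ ∑ k, tensorCoeff (a k) (h k) = coprodCoeff T := by
  constructor
  · intro H
    funext g w
    rw [Finset.sum_apply, Finset.sum_apply]
    exact H g.1 g.2 w
  · intro H w v w'
    have := congrFun (congrFun H (w, v)) w'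
    rw [Finset.sum_apply, Finset.sum_apply] at this
    exact this

variable (b t κ) in
/-- The sums of tensors of sections over `U` and `V`. -/
def tensorSums (U : (HomTorus E X ⊗ HomTorus E Y).left.Opens)
    (S : Set (Twisted P.weylGroup (HomTorus E X).left)) :
    AddSubmonoid (P.weylGroup × P.weylGroup → P.weylGroup →
      (HomTorus E X ⊗ HomTorus E Y).left.functionField) :=
  AddSubmonoid.closure {F | ∃ a ∈ dynSumSections b t κ U, ∃ h ∈ S, F = tensorCoeff a h}

lemma exists_isCoproduct {U : (HomTorus E X ⊗ HomTorus E Y).left.Opens}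
    {S : Set (Twisted P.weylGroup (HomTorus E X).left)}
    {T : Twisted (P.weylGroup × P.weylGroup) (HomTorus E X ⊗ HomTorus E Y).left}
    (hT : coprodCoeff T ∈ tensorSums b t κ U S) :
    ∃ (m : ℕ)
      (a : Fin m → Twisted (P.weylGroup × P.weylGroup) (HomTorus E X ⊗ HomTorus E Y).left)
      (h : Fin m → Twisted P.weylGroup (HomTorus E X).left),
      (∀ k, a k ∈ dynSumSections b t κ U) ∧ (∀ k, h k ∈ S) ∧ IsCoproduct P E T a h := by
  obtain ⟨l, hl, hsum⟩ := AddSubmonoid.exists_list_of_mem_closure hT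
  choose! a ha h hh he using hl
  refine ⟨l.length, fun k => a l[k], fun k => h l[k], fun k => ha _ (l.getElem_mem _),
    fun k => hh _ (l.getElem_mem _), ?_⟩
  rw [isCoproduct_iff, ← hsum]
  have : ∀ k : Fin l.length, tensorCoeff (a l[k]) (h l[k]) = l[k] := fun k =>
    (he _ (l.getElem_mem _)).symm
  simp_rw [this]
  exact Fin.sum_univ_getElem l

end Coproduct

/-! ### Conjugation as a ring homomorphism, and coefficients of products. -/

section ConjTw

variable {G : Type*} [Group G] {Z : Scheme.{0}} [IsIntegral Z] [SchemeAction G Z]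

lemma conjTw_zero (d₀ : Z.functionField) : conjTw d₀ (0 : Twisted G Z) = 0 := by
  ext g
  rw [coeff_conjTw]
  simp

lemma conjTw_one {d₀ : Z.functionField} (h : d₀ ≠ 0) : conjTw d₀ (1 : Twisted G Z) = 1 := by
  rw [conjTw, mul_one, single_one_mul_single_one, mul_inv_cancel₀ h]
  rfl

lemma conjTw_add (d₀ : Z.functionField) (a c : Twisted G Z) :
    conjTw d₀ (a + c) = conjTw d₀ a + conjTw d₀ c := by
  ext g
  rw [SkewMonoidAlgebra.coeff_add, Finsupp.add_apply, coeff_conjTw, coeff_conjTw, coeff_conjTw,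
    SkewMonoidAlgebra.coeff_add, Finsupp.add_apply]
  ring

lemma conjTw_neg (d₀ : Z.functionField) (a : Twisted G Z) :
    conjTw d₀ (-a) = -conjTw d₀ a := by
  rw [eq_neg_iff_add_eq_zero, ← conjTw_add, neg_add_cancel, conjTw_zero]

end ConjTw

section MulCoeff

variable {G : Type*} [Group G] [Fintype G] {Z : Scheme.{0}} [IsIntegral Z] [SchemeAction G Z]

lemma coeff_mul' (a c : Twisted G Z) (g : G) :
    (a * c).coeff g = ∑ x, a.coeff x * x • c.coeff (x⁻¹ * g) := by
  classical
  induction a using SkewMonoidAlgebra.induction_on with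
  | zero => simp
  | add a a' h h' =>
    rw [add_mul, SkewMonoidAlgebra.coeff_add, Finsupp.add_apply, h, h', ← Finset.sum_add_distrib]
    refine Finset.sum_congr rfl fun x _ => ?_
    rw [SkewMonoidAlgebra.coeff_add, Finsupp.add_apply, add_mul]
  | single r q =>
    rw [SkewMonoidAlgebra.coeff_single_mul, Finset.sum_eq_single r]
    · rw [SkewMonoidAlgebra.coeff_single_apply, if_pos rfl]
    · intro x _ hx
      rw [SkewMonoidAlgebra.coeff_single_apply, if_neg (Ne.symm hx), zero_mul]
    · simp

end MulCoeff

/-! ### Closure of the Hecke conditions under multiplication. -/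

section HeckeMul

variable {E : SchC} [GrpObj E] [IsEllipticCurve E] {t : E.left.presheaf.stalk (zeroPt E)}
  {Λ : Type*} [AddCommGroup Λ] [Module.Free ℤ Λ] [Module.Finite ℤ Λ] {T : SchC} [IsIntegral T.left]
  {G J : Type*} [Group G] [SchemeAction G T.left] [Fintype J]
  {χ : Multiplicative Λ →* (T ⟶ E)} {D : HeckeDatum G Λ J} {h : 𝟙_ SchC ⟶ E}
  {U : T.left.Opens}

/-- Induction on the left factor, which is built from functions and Demazure elements; left
multiplication by either preserves the conditions. -/
lemma IsHecke.mul (H : HeckeGeom t χ D) (hU : SchemeAction.IsInvariant G U)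
    {x₀ : T.left} (hx₀ : x₀ ∈ U) (p : J → T.left.functionField)
    (hp : ∀ s, D.simple s → ∀ x ∈ U,
      AssocAt x (p s) (shiftEq t χ D h s x / locEq t (aff χ (D.root s) 1) x))
    {a c : Twisted G T.left} (ha : IsHecke t χ D h U a) (hc : IsHecke t χ D h U c) :
    IsHecke t χ D h U (a * c) := by
  refine IsHecke.induction H hU hx₀ p hp (fun a => IsHecke t χ D h U (a * c)) ?_ ?_ ?_ ?_ ?_ ha
  · rw [zero_mul]; exact .zero
  · rwa [one_mul]
  · intro a b ha hb
    rw [add_mul]; exact ha.add hb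
  · intro f hf a ha
    rw [mul_assoc]; exact ha.single_one_mul hf
  · intro s hs a ha
    rw [mul_assoc]; exact ha.demazure_mul H hU hs (hp s hs)

lemma IsHecke.neg {a : Twisted G T.left} (ha : IsHecke t χ D h U a) : IsHecke t χ D h U (-a) := by
  have := ha.single_one_mul (f := -1) fun x _ => neg_mem (one_mem _)
  convert this using 1
  ext g
  rw [SkewMonoidAlgebra.coeff_single_one_mul, SkewMonoidAlgebra.coeff_neg, neg_one_mul]
  rfl

/-- On a set carrying the trivializations, the set of sections is already a ring, so nothing is
added by passing to the generated algebra. -/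
lemma mem_closure_lineHecke {d : T.left → T.left.functionField} {d₀ : T.left.functionField}
    (H : HeckeGeom t χ D) (hU : SchemeAction.IsInvariant G U)
    {x₀ : T.left} (hx₀ : x₀ ∈ U) (hd : ∀ x ∈ U, AssocAt x (d x) d₀) (p : J → T.left.functionField)
    (hp : ∀ s, D.simple s → ∀ x ∈ U,
      AssocAt x (p s) (shiftEq t χ D h s x / locEq t (aff χ (D.root s) 1) x))
    {a : Twisted G T.left} (ha : a ∈ Subring.closure (lineHecke t d χ D h U)) :
    a ∈ lineHecke t d χ D h U := by
  have h0 : d₀ ≠ 0 := (hd _ hx₀).2.1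
  induction ha using Subring.closure_induction with
  | mem a ha => exact ha
  | zero =>
    rw [mem_lineHecke_iff H hU hd, conjTw_zero]
    exact .zero
  | one =>
    rw [mem_lineHecke_iff H hU hd, conjTw_one h0]
    exact .one H
  | add a c _ _ ha hc =>
    rw [mem_lineHecke_iff H hU hd] at ha hc ⊢
    rw [conjTw_add]
    exact ha.add hc
  | neg a _ ha =>
    rw [mem_lineHecke_iff H hU hd] at ha ⊢
    rw [conjTw_neg]
    exact ha.neg
  | mul a c _ _ ha hc =>
    rw [mem_lineHecke_iff H hU hd] at ha hc ⊢
    rw [conjTw_mul h0]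
    exact ha.mul H hU hx₀ p hp hc

end HeckeMul

/-! ### Multiplicativity of the coproduct and its values on generators. -/

section Coproduct

variable {I X Y : Type*} [Finite I] [AddCommGroup X] [AddCommGroup Y]
  [Module.Free ℤ X] [Module.Finite ℤ X] [Module.Free ℤ Y] [Module.Finite ℤ Y]
  {P : RootPairing I ℤ X Y} [P.IsReduced] {b : P.Base} {E : SchC} [GrpObj E] [IsEllipticCurve E]
  {t : E.left.presheaf.stalk (zeroPt E)} {κ : 𝟙_ SchC ⟶ E}

instance fintypeWeyl : Fintype P.weylGroup := Fintype.ofFinite _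

/-- The operator by which `Ψ(T)` multiplies tensors from the left. -/
def coprodOp (T : Twisted (P.weylGroup × P.weylGroup) (HomTorus E X ⊗ HomTorus E Y).left) :
    (P.weylGroup × P.weylGroup → P.weylGroup →
      (HomTorus E X ⊗ HomTorus E Y).left.functionField) →+
    (P.weylGroup × P.weylGroup → P.weylGroup →
      (HomTorus E X ⊗ HomTorus E Y).left.functionField) where
  toFun F g w := ∑ x, T.coeff x * x • F (x⁻¹ * g) (x.1⁻¹ * w)
  map_zero' := by
    funext g w
    simp
  map_add' F F' := by
    funext g w
    simp only [Pi.add_apply, smul_add, mul_add, Finset.sum_add_distrib]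

/-- Multiplicativity of `Ψ`: its tensors are supported on the graph of the first projection `W × W →
W`, which is a subgroup. -/
lemma coprodOp_coprodCoeff
    (T T' : Twisted (P.weylGroup × P.weylGroup) (HomTorus E X ⊗ HomTorus E Y).left) :
    coprodOp T (coprodCoeff T') = coprodCoeff (T * T') := by
  funext g w
  change ∑ x, T.coeff x * x • coprodCoeff T' (x⁻¹ * g) (x.1⁻¹ * w) = _
  by_cases hw : w = g.1
  · rw [coprodCoeff, if_pos hw, coeff_mul']
    refine Finset.sum_congr rfl fun x _ => ?_
    rw [coprodCoeff, if_pos (by rw [hw]; rfl)]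
  · rw [coprodCoeff, if_neg hw]
    refine Finset.sum_eq_zero fun x _ => ?_
    have hx : ¬ x.1⁻¹ * w = (x⁻¹ * g).1 := fun h => hw (mul_left_cancel h)
    rw [coprodCoeff, if_neg hx, smul_zero, mul_zero]

/-- Once `Ψ(T)` is a sum of tensors, its action is computed factor by factor; this uses that `W × W`
acts through its first factor on functions from `𝔄`. -/
lemma coprodOp_tensorCoeff {J : Type*} {S : Finset J}
    {a : J → Twisted (P.weylGroup × P.weylGroup) (HomTorus E X ⊗ HomTorus E Y).left}
    {h : J → Twisted P.weylGroup (HomTorus E X).left}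
    {T : Twisted (P.weylGroup × P.weylGroup) (HomTorus E X ⊗ HomTorus E Y).left}
    (hT : ∑ k ∈ S, tensorCoeff (a k) (h k) = coprodCoeff T)
    (a' : Twisted (P.weylGroup × P.weylGroup) (HomTorus E X ⊗ HomTorus E Y).left)
    (h' : Twisted P.weylGroup (HomTorus E X).left) :
    coprodOp T (tensorCoeff a' h') = ∑ k ∈ S, tensorCoeff (a k * a') (h k * h') := by
  classical
  have hT' : ∀ x y, ∑ k ∈ S, (a k).coeff x * functionFieldMap (proj X Y E) ((h k).coeff y) =
      if y = x.1 then T.coeff x else 0 := fun x y => by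
    have := congrFun (congrFun hT x) y
    rw [Finset.sum_apply, Finset.sum_apply] at this
    exact this
  funext g w
  rw [Finset.sum_apply, Finset.sum_apply]
  simp only [tensorCoeff, coeff_mul', map_sum, map_mul]
  change ∑ x, T.coeff x * x • (a'.coeff (x⁻¹ * g) *
    functionFieldMap (proj X Y E) (h'.coeff (x.1⁻¹ * w))) = _
  simp only [smul_mul', smul_functionFieldMap_proj]
  have h1 : ∀ k, (∑ x, (a k).coeff x * x • a'.coeff (x⁻¹ * g)) *
      (∑ y, functionFieldMap (proj X Y E) ((h k).coeff y) *
        functionFieldMap (proj X Y E) (y • h'.coeff (y⁻¹ * w))) =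
      ∑ x, ∑ y, (a k).coeff x * functionFieldMap (proj X Y E) ((h k).coeff y) *
        (x • a'.coeff (x⁻¹ * g) * functionFieldMap (proj X Y E) (y • h'.coeff (y⁻¹ * w))) := by
    intro k
    rw [Finset.sum_mul_sum]
    refine Finset.sum_congr rfl fun x _ => Finset.sum_congr rfl fun y _ => ?_
    ring
  simp only [h1]
  rw [Finset.sum_comm]
  refine Finset.sum_congr rfl fun x _ => ?_
  rw [Finset.sum_comm]
  simp only [← Finset.sum_mul, hT']
  simp only [ite_mul, zero_mul, Finset.sum_ite_eq', Finset.mem_univ, if_true]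

lemma coprodCoeff_add
    (T T' : Twisted (P.weylGroup × P.weylGroup) (HomTorus E X ⊗ HomTorus E Y).left) :
    coprodCoeff (T + T') = coprodCoeff T + coprodCoeff T' := by
  funext g w
  simp only [coprodCoeff, SkewMonoidAlgebra.coeff_add, Finsupp.add_apply, Pi.add_apply]
  split_ifs <;> simp

lemma coprodCoeff_zero :
    coprodCoeff (0 : Twisted (P.weylGroup × P.weylGroup) (HomTorus E X ⊗ HomTorus E Y).left) =
      0 := by
  funext g w
  simp [coprodCoeff]

/-- For elements involving only dual reflections `Ψ` is tensoring with `1`; this covers functions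
and the Demazure elements of the coroots. -/
lemma tensorCoeff_one_right
    (a : Twisted (P.weylGroup × P.weylGroup) (HomTorus E X ⊗ HomTorus E Y).left)
    (ha : ∀ g, g.1 ≠ 1 → a.coeff g = 0) : tensorCoeff a 1 = coprodCoeff a := by
  classical
  funext g w
  simp only [tensorCoeff, coprodCoeff, SkewMonoidAlgebra.coeff_one, Finsupp.single_apply]
  by_cases hg : g.1 = 1
  · rw [hg]
    by_cases hw : w = 1 <;> simp [hw, eq_comm]
  · rw [ha g hg]
    simp

/-- It suffices to know `Ψ` on generators: multiplication by `Ψ(T)` preserves sums of tensors when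
`Ψ(T)` is itself such a sum. -/
lemma coprodCoeff_mul_mem {U : (HomTorus E X ⊗ HomTorus E Y).left.Opens}
    {S : Set (Twisted P.weylGroup (HomTorus E X).left)} (hS : ∀ h ∈ S, ∀ h' ∈ S, h * h' ∈ S)
    {T T' : Twisted (P.weylGroup × P.weylGroup) (HomTorus E X ⊗ HomTorus E Y).left}
    (hT : coprodCoeff T ∈ tensorSums b t κ U S) (hT' : coprodCoeff T' ∈ tensorSums b t κ U S) :
    coprodCoeff (T * T') ∈ tensorSums b t κ U S := by
  obtain ⟨m, a, h, ha, hh, hs⟩ := exists_isCoproduct hT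
  rw [isCoproduct_iff] at hs
  rw [← coprodOp_coprodCoeff]
  have : (tensorSums b t κ U S) ≤ (tensorSums b t κ U S).comap (coprodOp T) := by
    refine (AddSubmonoid.closure_le (S := (tensorSums b t κ U S).comap (coprodOp T))).2 ?_
    rintro _ ⟨a', ha', h', hh', rfl⟩
    change coprodOp T (tensorCoeff a' h') ∈ tensorSums b t κ U S
    rw [coprodOp_tensorCoeff hs]
    exact sum_mem fun k _ => AddSubmonoid.subset_closure
      ⟨_, mul_mem (ha k) ha', _, hS _ (hh k) _ hh', rfl⟩
  exact this hT'

namespace GoodPair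

variable {U : (HomTorus E X ⊗ HomTorus E Y).left.Opens} {V : (HomTorus E X).left.Opens}

/-- The Demazure coefficients on `𝔄 × 𝔄^∨`. -/
def coeffs (hg : GoodPair b t κ U V) :
    PosIdx b ⊕ PosIdx b → (HomTorus E X ⊗ HomTorus E Y).left.functionField :=
  Sum.elim (fun s => functionFieldMap (proj X Y E) (hg.p s)) hg.q

/-- For roots the coefficient upstairs is literally the pull-back of the one on `𝔄`. The coproduct
formula needs the same function in both tensor factors. -/
lemma assocAt_coeffs
    (ht : IsLocalRing.maximalIdeal (E.left.presheaf.stalk (zeroPt E)) = Ideal.span {t})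
    (hg : GoodPair b t κ U V) (s : PosIdx b ⊕ PosIdx b) :
    ∀ y ∈ U, AssocAt y (hg.coeffs s)
    (shiftEq t (dynChi X Y E) (dynDatum b) (κ ^ (-2 : ℤ)) s y /
      locEq t (aff (dynChi X Y E) ((dynDatum b).root s) 1) y) := by
  intro y hy
  rcases s with s | s
  · have H := heckeGeom_root b ht
    have h1 := (hg.hp s _ (hg.le hy)).functionFieldMap (proj X Y E)
    have h2 : ∀ s₀ : 𝟙_ SchC ⟶ E, functionFieldMap (proj X Y E)
        (locEq t (aff (HomTorus.chiHom E) ((rootDatum b).root s) s₀) (proj X Y E y)) =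
        locEq t (aff (dynChi X Y E) ((dynDatum b).root (.inl s)) s₀) y := fun s₀ => by
      have hd := H.isDominant_aff ((rootDatum b).root_ne s) s₀
      have := locEq_comp (t := t) (aff (HomTorus.chiHom E) ((rootDatum b).root s) s₀)
        (fst (HomTorus E X) (HomTorus E Y)) y
      rw [← this, fst_aff _ (HomTorus.chiHom E)]
      rfl
    have h3 : shiftEq t (HomTorus.chiHom E) (rootDatum b) (κ ^ (-2 : ℤ)) s (proj X Y E y) =
        locEq t (aff (HomTorus.chiHom E) ((rootDatum b).root s) (κ ^ (-2 : ℤ))) (proj X Y E y) :=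
      if_pos trivial
    have h4 : shiftEq t (dynChi X Y E) (dynDatum b) (κ ^ (-2 : ℤ)) (.inl s) y =
        locEq t (aff (dynChi X Y E) ((dynDatum b).root (.inl s)) (κ ^ (-2 : ℤ))) y :=
      if_pos trivial
    rw [h3, map_div₀, h2, h2] at h1
    rw [h4]
    exact h1
  · exact hg.hq s y hy

lemma mem_heckeSections_iff
    (ht : IsLocalRing.maximalIdeal (E.left.presheaf.stalk (zeroPt E)) = Ideal.span {t})
    (hV : SchemeAction.IsInvariant P.weylGroup V) (a : Twisted P.weylGroup (HomTorus E X).left) :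
    a ∈ heckeSections b t κ V ↔
      IsHecke t (HomTorus.chiHom E) (rootDatum b) (κ ^ (-2 : ℤ)) V a := by
  rw [heckeSections_eq, mem_lineHecke_iff (heckeGeom_root b ht) hV
    (fun x _ => AssocAt.refl one_ne_zero)]
  have : conjTw 1 a = a := by
    ext g
    simp [coeff_conjTw]
  rw [this]

lemma mem_dynHeckeSections_iff
    (ht : IsLocalRing.maximalIdeal (E.left.presheaf.stalk (zeroPt E)) = Ideal.span {t})
    (hg : GoodPair b t κ U V)
    (a : Twisted (P.weylGroup × P.weylGroup) (HomTorus E X ⊗ HomTorus E Y).left) :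
    a ∈ dynHeckeSections b t κ U ↔
      IsHecke t (dynChi X Y E) (dynDatum b) (κ ^ (-2 : ℤ)) U (conjTw hg.d₀ a) := by
  rw [dynHeckeSections_eq, mem_lineHecke_iff (heckeGeom_dyn b ht) hg.invU hg.hd]

lemma mem_closure_heckeSections
    (ht : IsLocalRing.maximalIdeal (E.left.presheaf.stalk (zeroPt E)) = Ideal.span {t})
    (hg : GoodPair b t κ U V) {x : (HomTorus E X).left} (hx : x ∈ V)
    {a : Twisted P.weylGroup (HomTorus E X).left}
    (ha : a ∈ Subring.closure (heckeSections b t κ V)) : a ∈ heckeSections b t κ V := by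
  rw [heckeSections_eq] at ha ⊢
  exact mem_closure_lineHecke (heckeGeom_root b ht) hg.invV hx
    (fun x _ => AssocAt.refl one_ne_zero) hg.p (fun s _ => hg.hp s) ha

lemma mem_closure_dynHeckeSections
    (ht : IsLocalRing.maximalIdeal (E.left.presheaf.stalk (zeroPt E)) = Ideal.span {t})
    (hg : GoodPair b t κ U V) {x : (HomTorus E X ⊗ HomTorus E Y).left} (hx : x ∈ U)
    {a : Twisted (P.weylGroup × P.weylGroup) (HomTorus E X ⊗ HomTorus E Y).left}
    (ha : a ∈ Subring.closure (dynHeckeSections b t κ U)) : a ∈ dynHeckeSections b t κ U := by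
  rw [dynHeckeSections_eq] at ha ⊢
  exact mem_closure_lineHecke (heckeGeom_dyn b ht) hg.invU hx hg.hd hg.coeffs
    (fun s _ => hg.assocAt_coeffs ht s) ha

/-- The coproduct of a section of the dynamical Hecke algebra is a sum of tensors. -/
theorem coprodCoeff_mem
    (ht : IsLocalRing.maximalIdeal (E.left.presheaf.stalk (zeroPt E)) = Ideal.span {t})
    (hg : GoodPair b t κ U V) {x : (HomTorus E X ⊗ HomTorus E Y).left} (hx : x ∈ U)
    {T : Twisted (P.weylGroup × P.weylGroup) (HomTorus E X ⊗ HomTorus E Y).left}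
    (hT : T ∈ dynHeckeSections b t κ U) :
    coprodCoeff T ∈ tensorSums b t κ U (heckeSections b t κ V) := by
  classical
  have HA := heckeGeom_root b ht
  have HB := heckeGeom_dyn b ht
  have h0 := hg.d₀_ne
  have h0' : ∀ g : P.weylGroup × P.weylGroup, g • hg.d₀ ≠ 0 := fun g =>
    (smul_ne_zero_iff_ne g).2 h0
  have hone : (1 : Twisted P.weylGroup (HomTorus E X).left) ∈ heckeSections b t κ V :=
    (mem_heckeSections_iff ht hg.invV _).2 (.one HA)
  have hmul : ∀ h ∈ heckeSections b t κ V, ∀ h' ∈ heckeSections b t κ V,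
      h * h' ∈ heckeSections b t κ V := fun h hh h' hh' => hg.mem_closure_heckeSections ht
    (x := proj X Y E x) (hg.le hx) (mul_mem (Subring.subset_closure hh)
        (Subring.subset_closure hh'))
  have hgen : ∀ a ∈ dynSumSections b t κ U, ∀ h ∈ heckeSections b t κ V,
      tensorCoeff a h ∈ tensorSums b t κ U (heckeSections b t κ V) := fun a ha h hh =>
    AddSubmonoid.subset_closure ⟨a, ha, h, hh, rfl⟩
  have hinvinv : ∀ a : Twisted (P.weylGroup × P.weylGroup) (HomTorus E X ⊗ HomTorus E Y).left,
      conjTw hg.d₀ (conjTw hg.d₀⁻¹ a) = a := fun a => by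
    have := conjTw_conjTw (inv_ne_zero h0) a
    rwa [inv_inv] at this
  have hdem : ∀ s, (dynDatum b).simple s →
      conjTw hg.d₀⁻¹ (demazure (dynDatum b) s (hg.coeffs s)) ∈ dynHeckeSections b t κ U := by
    intro s hs
    rw [hg.mem_dynHeckeSections_iff ht, hinvinv]
    exact HB.isHecke_demazure hg.invU hs (hg.assocAt_coeffs ht s)
  have htw : ∀ a : Twisted (P.weylGroup × P.weylGroup) (HomTorus E X ⊗ HomTorus E Y).left,
      (∀ x ∈ U, ∀ g, a.coeff g ∈ regAt x) → conjTw hg.d₀⁻¹ a ∈ dynTwistedSections b t κ U :=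
    fun a ha => by
      rw [dynTwistedSections, mem_twistedSections_iff hg.invU hg.hd, hinvinv]
      exact ha
  have hsum1 : ∀ a ∈ dynHeckeSections b t κ U, a ∈ dynSumSections b t κ U := fun a ha =>
    Subring.subset_closure (Or.inl ha)
  have hsum2 : ∀ a ∈ dynTwistedSections b t κ U, a ∈ dynSumSections b t κ U := fun a ha =>
    Subring.subset_closure (Or.inr ha)
  have key := IsHecke.induction HB hg.invU hx hg.coeffs (fun s _ => hg.assocAt_coeffs ht s)
    (fun a => coprodCoeff (conjTw hg.d₀⁻¹ a) ∈ tensorSums b t κ U (heckeSections b t κ V))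
    ?_ ?_ ?_ ?_ ?_ ((hg.mem_dynHeckeSections_iff ht T).1 hT)
  · rwa [conjTw_conjTw h0] at key
  · rw [conjTw_zero, coprodCoeff_zero]
    exact zero_mem _
  · rw [conjTw_one (inv_ne_zero h0), ← tensorCoeff_one_right]
    · exact hgen _ (one_mem _) _ hone
    · intro g hg1
      rw [SkewMonoidAlgebra.coeff_one, Finsupp.single_apply, if_neg]
      rintro rfl
      exact hg1 rfl
  · intro a c ha hc
    rw [conjTw_add, coprodCoeff_add]
    exact add_mem ha hc
  · intro f hf a ha
    rw [conjTw_mul (inv_ne_zero h0)]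
    refine coprodCoeff_mul_mem hmul ?_ ha
    rw [← tensorCoeff_one_right]
    · refine hgen _ (hsum2 _ (htw _ fun x hx g => ?_)) _ hone
      rw [SkewMonoidAlgebra.coeff_single_apply]
      split_ifs
      · exact hf x hx
      · exact zero_mem _
    · intro g hg1
      rw [coeff_conjTw, SkewMonoidAlgebra.coeff_single_apply, if_neg, mul_zero, zero_mul]
      rintro rfl
      exact hg1 rfl
  · intro s hs a ha
    rw [conjTw_mul (inv_ne_zero h0)]
    refine coprodCoeff_mul_mem hmul ?_ ha
    rcases s with s | s
    · have h1 : (demazure (rootDatum b) s (hg.p s) : Twisted P.weylGroup (HomTorus E X).left) ∈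
          heckeSections b t κ V := (mem_heckeSections_iff ht hg.invV _).2
        (HA.isHecke_demazure hg.invV hs (hg.hp s))
      have h2 : conjTw hg.d₀⁻¹ (SkewMonoidAlgebra.single ((dynDatum b).refl (.inl s)) 1) ∈
          dynTwistedSections b t κ U := htw _ fun x hx g => by
        rw [SkewMonoidAlgebra.coeff_single_apply]
        split_ifs
        · exact one_mem _
        · exact zero_mem _
      -- The identity `Ψ(p (δ_s - 1)) = δ_s ⊗ p (δ_s - 1) + p (δ_s - 1) ⊗ 1`, with the elements on
      -- the left of the tensor sign conjugated by the trivialization; the terms `p δ_s ⊗ 1` cancel.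
      -- The factor `δ_s` is a section of `𝕊`.
      have h3 : coprodCoeff (conjTw hg.d₀⁻¹ (demazure (dynDatum b) (.inl s) (hg.coeffs (.inl s)))) =
          tensorCoeff (conjTw hg.d₀⁻¹ (SkewMonoidAlgebra.single ((dynDatum b).refl (.inl s)) 1))
            (demazure (rootDatum b) s (hg.p s)) +
          tensorCoeff (conjTw hg.d₀⁻¹ (demazure (dynDatum b) (.inl s) (hg.coeffs (.inl s)))) 1 := by
        funext g w
        have hr := (rootDatum b).refl_ne_one s
        have hr1 : ((dynDatum b).refl (.inl s)) = ((rootDatum b).refl s, 1) := rfl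
        have hp : hg.coeffs (.inl s) = functionFieldMap (proj X Y E) (hg.p s) := rfl
        simp only [Pi.add_apply, tensorCoeff, coprodCoeff, coeff_conjTw, demazure, coeff_sub',
          SkewMonoidAlgebra.coeff_single_apply, SkewMonoidAlgebra.coeff_one, Finsupp.single_apply,
          hr1, hp]
        generalize (rootDatum b).refl s = r at hr
        have hne : (1 : P.weylGroup × P.weylGroup) ≠ (r, 1) := fun h => hr
            (congrArg Prod.fst h).symm
        by_cases hgr : (r, 1) = g
        · subst hgr
          by_cases hw : w = r
          · subst hw
            simp only [hr.symm, hne, if_true, if_false, sub_zero, mul_one, mul_zero, add_zero,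
                map_zero]
            ring
          · by_cases hw1 : w = 1
            · subst hw1
              simp only [hr, hr.symm, hne, if_true, if_false, sub_zero, zero_sub, mul_one, map_one,
                map_neg]
              ring
            · simp [hne, hw, Ne.symm hw, Ne.symm hw1]
        · by_cases hg1 : 1 = g
          · subst hg1
            by_cases hw : w = 1
            · subst hw
              simp [hgr]
            · simp [hgr, hw, Ne.symm hw]
          · simp [hgr, hg1]
      rw [h3]
      exact add_mem (hgen _ (hsum2 _ h2) _ h1) (hgen _ (hsum1 _ (hdem _ hs)) _ hone)
    · rw [← tensorCoeff_one_right]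
      · exact hgen _ (hsum1 _ (hdem _ hs)) _ hone
      · intro g hg1
        rw [coeff_conjTw, demazure, coeff_sub', SkewMonoidAlgebra.coeff_single_apply,
          SkewMonoidAlgebra.coeff_single_apply, if_neg, if_neg, sub_zero, mul_zero, zero_mul]
        · rintro rfl
          exact hg1 rfl
        · rintro rfl
          exact hg1 rfl

end GoodPair

end Coproduct

/-! ### Sections of the line bundle as single rational functions. -/

section LineSections

variable {Z : Scheme.{0}} [IsIntegral Z] {d : Z → Z.functionField} {U : Z.Opens}

/-- Open subsets of an integral scheme are preconnected, so locally constant functions on them are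
constant. -/
lemma lineSections_const (s : lineSections d U) (x y : U) : s.1 x = s.1 y := by
  have h : _root_.IsPreconnected (U : Set Z) :=
    ((PreirreducibleSpace.isPreirreducible_univ (X := Z)).open_subset U.isOpen
      (Set.subset_univ _)).isPreconnected
  exact s.2.1.apply_eq_of_isPreconnected
    (isPreconnected_iff_preconnectedSpace.1 h).isPreconnected_univ (Set.mem_univ x) (Set.mem_univ y)

lemma lineSections_mem (s : lineSections d U) (x : U) {y : Z} (hy : y ∈ U) :
    s.1 x ∈ lineStalk d y := by
  rw [lineSections_const s x ⟨y, hy⟩]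
  exact s.2.2 ⟨y, hy⟩

/-- The section of `𝒪(D)` defined by a rational function. -/
def lineSections.mk (s : Z.functionField) (hs : ∀ x ∈ U, s ∈ lineStalk d x) : lineSections d U :=
  ⟨fun _ => s, IsLocallyConstant.const s, fun x => hs x.1 x.2⟩

end LineSections

/-! ### The local coproduct and the action on sections of the line bundle. -/

section Coproduct

variable {I X Y : Type*} [Finite I] [AddCommGroup X] [AddCommGroup Y]
  [Module.Free ℤ X] [Module.Finite ℤ X] [Module.Free ℤ Y] [Module.Finite ℤ Y]
  {P : RootPairing I ℤ X Y} [P.IsReduced] {b : P.Base} {E : SchC} [GrpObj E] [IsEllipticCurve E]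
  {t : E.left.presheaf.stalk (zeroPt E)} {κ : 𝟙_ SchC ⟶ E}

lemma heckeSections_mono {V V' : (HomTorus E X).left.Opens} (h : V' ≤ V) :
    heckeSections b t κ V ⊆ heckeSections b t κ V' := by
  rw [heckeSections_eq, heckeSections_eq]
  exact lineHecke_mono h

lemma dynHeckeSections_mono {U U' : (HomTorus E X ⊗ HomTorus E Y).left.Opens} (h : U' ≤ U) :
    dynHeckeSections b t κ U ⊆ dynHeckeSections b t κ U' := by
  rw [dynHeckeSections_eq, dynHeckeSections_eq]
  exact lineHecke_mono h

lemma dynSumSections_mono {U U' : (HomTorus E X ⊗ HomTorus E Y).left.Opens} (h : U' ≤ U) :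
    dynSumSections b t κ U ≤ dynSumSections b t κ U' :=
  Subring.closure_mono (Set.union_subset_union (dynHeckeSections_mono h)
    fun _ ha x hx => ha x (h hx))

lemma isInvariant_top {G : Type*} [Group G] {Z : Scheme.{0}} [SchemeAction G Z] :
    SchemeAction.IsInvariant G (⊤ : Z.Opens) := fun _ => rfl

/-- The coproduct of a section of the dynamical Hecke algebra is locally a finite sum of tensors. -/
theorem exists_isCoproduct_nhds
    (ht : IsLocalRing.maximalIdeal (E.left.presheaf.stalk (zeroPt E)) = Ideal.span {t})
    {U : (HomTorus E X ⊗ HomTorus E Y).left.Opens}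
    (hU : SchemeAction.IsInvariant (P.weylGroup × P.weylGroup) U)
    {T : Twisted (P.weylGroup × P.weylGroup) (HomTorus E X ⊗ HomTorus E Y).left}
    (hT : T ∈ dynHeckeSections b t κ U) {x : (HomTorus E X ⊗ HomTorus E Y).left} (hx : x ∈ U) :
    ∃ (U' : (HomTorus E X ⊗ HomTorus E Y).left.Opens) (V : (HomTorus E X).left.Opens),
      SchemeAction.IsInvariant (P.weylGroup × P.weylGroup) U' ∧
      SchemeAction.IsInvariant P.weylGroup V ∧
      x ∈ U' ∧ U' ≤ U ∧ U' ≤ proj X Y E ⁻¹ᵁ V ∧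
      ∃ (m : ℕ)
        (a : Fin m → Twisted (P.weylGroup × P.weylGroup) (HomTorus E X ⊗ HomTorus E Y).left)
        (h : Fin m → Twisted P.weylGroup (HomTorus E X).left),
        (∀ k, a k ∈ dynSumSections b t κ U') ∧ (∀ k, h k ∈ heckeSections b t κ V) ∧
        IsCoproduct P E T a h := by
  obtain ⟨U', V', ⟨hg⟩, hxU', hle, -⟩ := exists_goodPair (b := b) (κ := κ) ht hU
    (isInvariant_top (G := P.weylGroup)) hx (V := ⊤) trivial
  exact ⟨U', V', hg.invU, hg.invV, hxU', hle, hg.le,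
    exists_isCoproduct (hg.coprodCoeff_mem ht hxU' (dynHeckeSections_mono hle hT))⟩

/-- After conjugation a Hecke section preserves regular functions, although its coefficients have
poles; a section of `𝕊` does so because its coefficients are regular. -/
lemma GoodPair.polyAct_mem {U : (HomTorus E X ⊗ HomTorus E Y).left.Opens}
    {V : (HomTorus E X).left.Opens} (hg : GoodPair b t κ U V)
    (ht : IsLocalRing.maximalIdeal (E.left.presheaf.stalk (zeroPt E)) = Ideal.span {t})
    {a : Twisted (P.weylGroup × P.weylGroup) (HomTorus E X ⊗ HomTorus E Y).left}
    (ha : a ∈ dynSumSections b t κ U) {s : (HomTorus E X ⊗ HomTorus E Y).left.functionField}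
    (hs : ∀ x ∈ U, s ∈ lineStalk (twistDivisor b t κ) x) :
    ∀ x ∈ U, polyAct a s ∈ lineStalk (twistDivisor b t κ) x := by
  induction ha using Subring.closure_induction generalizing s with
  | mem a ha =>
    have h1 : ∀ x ∈ U, hg.d₀ * s ∈ regAt x := fun x hx =>
      (mem_lineStalk_iff (hg.hd x hx)).1 (hs x hx)
    suffices ∀ x ∈ U, polyAct (conjTw hg.d₀ a) (hg.d₀ * s) ∈ regAt x by
      intro x hx
      rw [mem_lineStalk_iff (hg.hd x hx), ← polyAct_conjTw hg.d₀_ne]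
      exact this x hx
    rcases ha with ha | ha
    · rw [hg.mem_dynHeckeSections_iff ht] at ha
      exact ha.polyAct_mem (heckeGeom_dyn b ht) hg.invU hg.coeffs
        (fun s _ => hg.assocAt_coeffs ht s) h1
    · rw [dynTwistedSections, mem_twistedSections_iff hg.invU hg.hd] at ha
      intro x hx
      refine sum_mem fun g _ => mul_mem (ha x hx g) ?_
      rw [smul_mem_regAt]
      exact h1 _ ((inv_mem_iff_of_isInvariant hg.invU _).2 hx)
  | zero =>
    intro x hx
    rw [polyAct_zero]
    -- Zero is written as the difference of a section with itself, so that membership comes from the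
    -- group of sections.
    exact (lineSections.mk (d := twistDivisor b t κ) s hs - lineSections.mk s hs).2.2 ⟨x, hx⟩ |>
      fun h => by rwa [show (lineSections.mk (d := twistDivisor b t κ) s hs -
        lineSections.mk s hs).1 ⟨x, hx⟩ = 0 from sub_self s] at h
  | one =>
    intro x hx
    rw [polyAct_one]
    exact hs x hx
  | add a c _ _ iha ihc =>
    intro x hx
    rw [polyAct_add]
    exact (lineSections.mk _ (iha hs) + lineSections.mk _ (ihc hs)).2.2 ⟨x, hx⟩
  | neg a _ iha =>
    intro x hx
    rw [polyAct_neg]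
    exact (-lineSections.mk _ (iha hs)).2.2 ⟨x, hx⟩
  | mul a c _ _ iha ihc =>
    intro x hx
    rw [polyAct_mul]
    exact iha (ihc hs) x hx

/-- Membership in a stalk is local, and good pairs cover every invariant open set. -/
lemma polyAct_mem_lineStalk
    (ht : IsLocalRing.maximalIdeal (E.left.presheaf.stalk (zeroPt E)) = Ideal.span {t})
    {U : (HomTorus E X ⊗ HomTorus E Y).left.Opens}
    (hU : SchemeAction.IsInvariant (P.weylGroup × P.weylGroup) U)
    {a : Twisted (P.weylGroup × P.weylGroup) (HomTorus E X ⊗ HomTorus E Y).left}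
    (ha : a ∈ dynSumSections b t κ U) {s : (HomTorus E X ⊗ HomTorus E Y).left.functionField}
    (hs : ∀ x ∈ U, s ∈ lineStalk (twistDivisor b t κ) x) :
    ∀ x ∈ U, polyAct a s ∈ lineStalk (twistDivisor b t κ) x := by
  intro x hx
  obtain ⟨U', V', ⟨hg⟩, hxU', hle, -⟩ := exists_goodPair (b := b) (κ := κ) ht hU
    (isInvariant_top (G := P.weylGroup)) hx (V := ⊤) trivial
  exact hg.polyAct_mem ht (dynSumSections_mono hle ha) (fun y hy => hs y (hle hy)) x hxU'

/-- The action of `𝓗^d + 𝕊` on the sections of `𝕃`. -/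
def lineAct (ht : IsLocalRing.maximalIdeal (E.left.presheaf.stalk (zeroPt E)) = Ideal.span {t})
    {U : (HomTorus E X ⊗ HomTorus E Y).left.Opens}
    (hU : SchemeAction.IsInvariant (P.weylGroup × P.weylGroup) U)
    (a : dynSumSections b t κ U) :
    lineSections (twistDivisor b t κ) U →+ lineSections (twistDivisor b t κ) U where
  toFun s := ⟨fun x => polyAct a.1 (s.1 x), s.2.1.comp (polyAct a.1), fun x =>
    polyAct_mem_lineStalk ht hU a.2 (fun _ hy => lineSections_mem s x hy) x.1 x.2⟩
  map_zero' := by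
    ext x
    exact polyAct_zero_right _
  map_add' s s' := by
    ext x
    exact polyAct_add_right _ _ _

end Coproduct

/-! ### Finite presentation: locality and pull-back. -/

section FinitePresentation

/-- The whole space is terminal in each comma category, which is thus connected. Finality is what
identifies the pull-back of the structure sheaf with the structure sheaf. -/
instance final_opensMap {X Y : Scheme.{0}} (f : X ⟶ Y) : (TopologicalSpace.Opens.map
    f.base).Final where
  out U := by
    have h : IsTerminal (StructuredArrow.mk (T := TopologicalSpace.Opens.map f.base) (Y := ⊤)
        (homOfLE le_top : U ⟶ (TopologicalSpace.Opens.map f.base).obj ⊤)) :=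
      IsTerminal.ofUniqueHom (fun Z => StructuredArrow.homMk (homOfLE le_top) rfl) fun Z m =>
        StructuredArrow.ext _ _ (Subsingleton.elim _ _)
    exact isConnected_of_isTerminal _ h

lemma Presentation.isFinite_mk {C : Type*} [Category C] {J : GrothendieckTopology C}
    {R : Sheaf J RingCat.{0}}
    [HasWeakSheafify J AddCommGrpCat.{0}] [J.WEqualsLocallyBijective AddCommGrpCat.{0}]
    {M : SheafOfModules.{0} R} (q : M.Presentation) (h : Finite q.generators.I)
    (h' : Finite q.relations.I) : q.IsFinite := ⟨⟨h⟩, ⟨h'⟩⟩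

/-- The definition gives presentations over the slice site of an open set; an equivalence moves them
to the open subscheme, where restriction and pull-back are available. -/
lemma exists_presentation_restrict {X : Scheme.{0}} (M : X.Modules) [M.IsFinitePresentation]
    (x : X) :
    ∃ (U : X.Opens) (q : (M.restrict U.ι).Presentation), x ∈ U ∧ q.IsFinite := by
  obtain ⟨σ, hσ⟩ := SheafOfModules.IsFinitePresentation.exists_quasicoherentData M
  have cov := σ.coversTop
  rw [Opens.coversTop_iff] at cov
  obtain ⟨i, hi⟩ := TopologicalSpace.Opens.mem_iSup.1 (show x ∈ iSup σ.X by rw [cov]; trivial)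
  have h1 : PreservesColimitsOfSize.{0, 0} (Scheme.Modules.overEquiv (σ.X i)).functor :=
    (Scheme.Modules.overEquiv (σ.X i)).toAdjunction.leftAdjoint_preservesColimits
  let q := @SheafOfModules.Presentation.map _ _ _ _ _ _ _ _ _ _ _ _ _ (σ.presentation i)
    (Scheme.Modules.overEquiv (σ.X i)).functor h1 (Iso.refl _)
  let r := @SheafOfModules.Presentation.ofIsIso _ _ _ _ _ _ _ _
    ((Scheme.Modules.overFunctorEquiv (σ.X i)).app M).hom
    ((Scheme.Modules.overFunctorEquiv (σ.X i)).app M).isIso_hom q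
  exact ⟨σ.X i, r, hi, Presentation.isFinite_mk r
    (hσ.isFinite_presentation i).isFiniteType_generators.finite
    (hσ.isFinite_presentation i).isFiniteType_relations.finite⟩

lemma isFinitePresentation_of_restrict {X : Scheme.{0}} (M : X.Modules)
    (h : ∀ x : X, ∃ (U : X.Opens) (q : (M.restrict U.ι).Presentation), x ∈ U ∧ q.IsFinite) :
    M.IsFinitePresentation := by
  choose U q hU hq using h
  let e : ∀ x, (Scheme.Modules.overEquiv (U x)).inverse.obj (M.restrict (U x).ι) ≅ M.over (U x) :=
    fun x => (Scheme.Modules.overEquiv (U x)).inverse.mapIso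
      ((Scheme.Modules.overFunctorEquiv (U x)).app M).symm ≪≫
      ((Scheme.Modules.overEquiv (U x)).unitIso.app _).symm
  have h1 : ∀ x, PreservesColimitsOfSize.{0, 0} (Scheme.Modules.overEquiv (U x)).inverse := fun x =>
    (Scheme.Modules.overEquiv (U x)).symm.toAdjunction.leftAdjoint_preservesColimits
  let r : ∀ x, (M.over (U x)).Presentation := fun x =>
    @SheafOfModules.Presentation.ofIsIso _ _ _ _ _ _ _ _ (e x).hom (e x).isIso_hom
    (@SheafOfModules.Presentation.map _ _ _ _ _ _ _ _ _ _ _ _ _ (q x)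
      (Scheme.Modules.overEquiv (U x)).inverse (h1 x)
      (TopologicalSpace.Opens.sheafOfModulesEquivOverInverseUnit _ _).symm)
  let σ : M.QuasicoherentData :=
    { I := X
      X := U
      coversTop := by
        rw [Opens.coversTop_iff]
        refine eq_top_iff.2 ?_
        exact fun x _ => TopologicalSpace.Opens.mem_iSup.2 ⟨x, hU x⟩
      presentation := r }
  exact ⟨σ, ⟨fun x => Presentation.isFinite_mk _ (hq x).isFiniteType_generators.finite
    (hq x).isFiniteType_relations.finite⟩⟩

/-- Pullback preserves sheaves of finite presentation. -/
lemma isFinitePresentation_pullback {X Y : Scheme.{0}} (f : X ⟶ Y) (M : Y.Modules)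
    [M.IsFinitePresentation] : ((Scheme.Modules.pullback f).obj M).IsFinitePresentation := by
  refine isFinitePresentation_of_restrict _ fun x => ?_
  obtain ⟨V, q, hV, hq⟩ := exists_presentation_restrict M (f x)
  let e : (Scheme.Modules.pullback (f ∣_ V)).obj (M.restrict V.ι) ≅
      ((Scheme.Modules.pullback f).obj M).restrict (f ⁻¹ᵁ V).ι :=
    (Scheme.Modules.pullback (f ∣_ V)).mapIso
      ((Scheme.Modules.restrictFunctorIsoPullback V.ι).app M) ≪≫
      (Scheme.Modules.pullbackComp (f ∣_ V) V.ι).app M ≪≫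
      (Scheme.Modules.pullbackCongr (morphismRestrict_ι f V)).app M ≪≫
      ((Scheme.Modules.pullbackComp (f ⁻¹ᵁ V).ι f).app M).symm ≪≫
      ((Scheme.Modules.restrictFunctorIsoPullback (f ⁻¹ᵁ V).ι).app _).symm
  have h1 : PreservesColimitsOfSize.{0, 0} (Scheme.Modules.pullback (f ∣_ V)) :=
    (Scheme.Modules.pullbackPushforwardAdjunction (f ∣_ V)).leftAdjoint_preservesColimits
  have h2 := @SheafOfModules.instIsIsoPullbackObjUnitToUnitOfFinal _ _ _ _ _ _ _ _ _ _
    (f ∣_ V).toRingCatSheafHom (Scheme.Modules.pullbackPushforwardAdjunction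
        (f ∣_ V)).isRightAdjoint
    (final_opensMap (f ∣_ V))
  let r := @SheafOfModules.Presentation.ofIsIso _ _ _ _ _ _ _ _ e.hom e.isIso_hom
    (@SheafOfModules.Presentation.map _ _ _ _ _ _ _ _ _ _ _ _ _ q (Scheme.Modules.pullback (f ∣_ V))
    h1 (@asIso _ _ _ _ _ h2).symm)
  exact ⟨f ⁻¹ᵁ V, r, hV, Presentation.isFinite_mk _ hq.isFiniteType_generators.finite
    hq.isFiniteType_relations.finite⟩

/-- Presentations and isomorphisms need not live on the same cover, so both are restricted to an
intersection. -/
lemma isFinitePresentation_of_locally_iso {X : Scheme.{0}} (M N : X.Modules)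
    [M.IsFinitePresentation]
    (h : ∀ x : X, ∃ U : X.Opens, x ∈ U ∧ Nonempty (M.restrict U.ι ≅ N.restrict U.ι)) :
    N.IsFinitePresentation := by
  refine isFinitePresentation_of_restrict _ fun x => ?_
  obtain ⟨V, q, hV, hq⟩ := exists_presentation_restrict M x
  obtain ⟨U, hU, ⟨e⟩⟩ := h x
  let e1 := ((Scheme.Modules.restrictFunctorComp (X.homOfLE (inf_le_right : U ⊓ V ≤ V)) V.ι).app
      M).symm ≪≫
    ((Scheme.Modules.restrictFunctorCongr (X.homOfLE_ι (inf_le_right : U ⊓ V ≤ V))).app M) ≪≫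
    ((Scheme.Modules.restrictFunctorCongr (X.homOfLE_ι (inf_le_left : U ⊓ V ≤ U))).app M).symm ≪≫
    ((Scheme.Modules.restrictFunctorComp (X.homOfLE (inf_le_left : U ⊓ V ≤ U)) U.ι).app M) ≪≫
    (Scheme.Modules.restrictFunctor (X.homOfLE (inf_le_left : U ⊓ V ≤ U))).mapIso e ≪≫
    ((Scheme.Modules.restrictFunctorComp (X.homOfLE (inf_le_left : U ⊓ V ≤ U)) U.ι).app N).symm ≪≫
    ((Scheme.Modules.restrictFunctorCongr (X.homOfLE_ι (inf_le_left : U ⊓ V ≤ U))).app N)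
  let r := @SheafOfModules.Presentation.ofIsIso _ _ _ _ _ _ _ _ e1.hom e1.isIso_hom
    (Scheme.Modules.presentationRestrict (X.homOfLE (inf_le_right : U ⊓ V ≤ V)) q)
  exact ⟨U ⊓ V, r, ⟨hU, hV⟩, Presentation.isFinite_mk _ hq.isFiniteType_generators.finite
    hq.isFiniteType_relations.finite⟩

end FinitePresentation

/-! ### Tensor sections, pulled back sections, and twisting by an invertible sheaf. -/

section Sections

variable {X Y : Scheme.{0}}

lemma presheaf_map_map (M : X.Modules) {U V W : X.Opens} (h : V ≤ U) (h' : W ≤ V) (m : Γ(M, U)) :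
    M.presheaf.map (homOfLE h').op (M.presheaf.map (homOfLE h).op m) =
      M.presheaf.map (homOfLE (h'.trans h)).op m :=
  (ConcreteCategory.congr_hom (M.presheaf.map_comp (homOfLE h).op (homOfLE h').op) m).symm

section TensorSection

variable (L M : X.Modules) (U : X.Opens)

lemma tensorSection_add_left (s s' : Γ(L, U)) (m : Γ(M, U)) :
    tensorSection L M U (s + s') m = tensorSection L M U s m + tensorSection L M U s' m := by
  unfold tensorSection
  rw [TensorProduct.add_tmul]
  exact map_add _ _ _

lemma tensorSection_add_right (s : Γ(L, U)) (m m' : Γ(M, U)) :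
    tensorSection L M U s (m + m') = tensorSection L M U s m + tensorSection L M U s m' := by
  unfold tensorSection
  rw [TensorProduct.tmul_add]
  exact map_add _ _ _

lemma tensorSection_smul_left (r : Γ(X, U)) (s : Γ(L, U)) (m : Γ(M, U)) :
    tensorSection L M U (r • s) m = r • tensorSection L M U s m :=
  ((toSheafifyModules ((presheafTensorL L.val).obj M.val)).app (.op U)).hom.map_smul r
    (s ⊗ₜ[Γ(X, U)] m : TensorProduct Γ(X, U) Γ(L, U) Γ(M, U))

lemma tensorSection_smul_right (r : Γ(X, U)) (s : Γ(L, U)) (m : Γ(M, U)) :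
    tensorSection L M U s (r • m) = r • tensorSection L M U s m := by
  rw [← tensorSection_smul_left]
  unfold tensorSection
  rw [TensorProduct.smul_tmul]

variable {L M U}

lemma tensorSection_res {U' : X.Opens} (h : U' ≤ U) (s : Γ(L, U)) (m : Γ(M, U)) :
    ((tensorL L).obj M).presheaf.map (homOfLE h).op (tensorSection L M U s m) =
      tensorSection L M U' (L.presheaf.map (homOfLE h).op s) (M.presheaf.map (homOfLE h).op m) := by
  have := PresheafOfModules.naturality_apply
    (toSheafifyModules ((presheafTensorL L.val).obj M.val)) (homOfLE h).op
    (s ⊗ₜ[Γ(X, U)] m : TensorProduct Γ(X, U) Γ(L, U) Γ(M, U))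
  exact this.symm

lemma tensorL_map_tensorSection {N : X.Modules} (f : M ⟶ N) (s : Γ(L, U)) (m : Γ(M, U)) :
    ((tensorL L).map f).app U (tensorSection L M U s m) = tensorSection L N U s (f.app U m) := by
  have := (PresheafOfModules.sheafificationAdjunction (𝟙 X.ringCatSheaf.obj)).unit.naturality
    ((presheafTensorL L.val).map ((Scheme.Modules.toPresheafOfModules X).map f))
  have := congrArg (fun φ => (PresheafOfModules.Hom.app φ (.op U)).hom
    (s ⊗ₜ[Γ(X, U)] m : TensorProduct Γ(X, U) Γ(L, U) Γ(M, U))) this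
  exact this.symm

end TensorSection

section PullbackSection

variable (p : X ⟶ Y) (F : Y.Modules) {U : X.Opens} {V : Y.Opens} (h : U ≤ p ⁻¹ᵁ V)

lemma pullbackSection_add (n n' : Γ(F, V)) :
    pullbackSection p F h (n + n') = pullbackSection p F h n + pullbackSection p F h n' := by
  unfold pullbackSection
  rw [map_add]
  exact map_add _ _ _

lemma pullbackSection_smul (r : Γ(Y, V)) (n : Γ(F, V)) :
    pullbackSection p F h (r • n) = p.appLE V U h r • pullbackSection p F h n := by
  unfold pullbackSection
  rw [Scheme.Modules.Hom.app_smul]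
  exact ((Scheme.Modules.pullback p).obj F).val.map_smul (homOfLE h).op _ _

lemma pullbackSection_res {U' : X.Opens} {V' : Y.Opens} (hU : U' ≤ U) (hV : V' ≤ V)
    (h' : U' ≤ p ⁻¹ᵁ V') (n : Γ(F, V)) :
    ((Scheme.Modules.pullback p).obj F).presheaf.map (homOfLE hU).op (pullbackSection p F h n) =
      pullbackSection p F h' (F.presheaf.map (homOfLE hV).op n) := by
  have h1 : ((Scheme.Modules.pullbackPushforwardAdjunction p).unit.app F).app V'
      (F.presheaf.map (homOfLE hV).op n) =
      ((Scheme.Modules.pullback p).obj F).presheaf.map (homOfLE (p.preimage_mono hV)).op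
        (((Scheme.Modules.pullbackPushforwardAdjunction p).unit.app F).app V n) :=
    ConcreteCategory.congr_hom
      (((Scheme.Modules.pullbackPushforwardAdjunction p).unit.app F).mapPresheaf.naturality
        (homOfLE hV).op) n
  unfold pullbackSection
  rw [h1]
  exact (presheaf_map_map _ _ _ _).trans (presheaf_map_map _ _ _ _).symm

lemma pullback_map_pullbackSection {F' : Y.Modules} (f : F ⟶ F') (n : Γ(F, V)) :
    ((Scheme.Modules.pullback p).map f).app U (pullbackSection p F h n) =
      pullbackSection p F' h (f.app V n) := by
  have h1 : ((Scheme.Modules.pullbackPushforwardAdjunction p).unit.app F').app V (f.app V n) =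
      ((Scheme.Modules.pullback p).map f).app (p ⁻¹ᵁ V)
        (((Scheme.Modules.pullbackPushforwardAdjunction p).unit.app F).app V n) :=
    congrArg (fun φ : F ⟶ (Scheme.Modules.pushforward p).obj ((Scheme.Modules.pullback p).obj F') =>
      φ.app V n) ((Scheme.Modules.pullbackPushforwardAdjunction p).unit.naturality f)
  unfold pullbackSection
  rw [h1]
  exact ConcreteCategory.congr_hom
      (((Scheme.Modules.pullback p).map f).mapPresheaf.naturality (homOfLE h).op) _

end PullbackSection

section Trivial

/-- Sheafification is locally injective; the next lemma is local surjectivity. They allow computing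
with sections of the sheaf tensor product locally in the presheaf tensor product. -/
lemma eq_of_toSheafifyModules_eq (M : X.PresheafOfModules) {U : X.Opens} (m m' : M.obj (.op U))
    (h : ((toSheafifyModules M).app (.op U)).hom m = ((toSheafifyModules M).app (.op U)).hom m')
    {x : X} (hx : x ∈ U) :
    ∃ (V : X.Opens) (hV : V ≤ U), x ∈ V ∧
      M.presheaf.map (homOfLE hV).op m = M.presheaf.map (homOfLE hV).op m' := by
  have h1 := PresheafOfModules.toPresheaf_map_sheafificationAdjunction_unit_app
    (𝟙 X.ringCatSheaf.obj) M
  have h2 : (toSheafify (Opens.grothendieckTopology X) M.presheaf).app (.op U) m =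
      (toSheafify (Opens.grothendieckTopology X) M.presheaf).app (.op U) m' := by
    rw [← h1]
    exact h
  obtain ⟨V, f, hf, hxV⟩ := Presheaf.equalizerSieve_mem (Opens.grothendieckTopology X)
    (toSheafify (Opens.grothendieckTopology X) M.presheaf) m m' h2 x hx
  exact ⟨V, f.le, hxV, hf⟩

lemma exists_toSheafifyModules_eq (M : X.PresheafOfModules) {U : X.Opens}
    (m : Γ((sheafifyModules X).obj M, U)) {x : X} (hx : x ∈ U) :
    ∃ (V : X.Opens) (hV : V ≤ U), x ∈ V ∧ ∃ m' : M.obj (.op V),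
      (((toSheafifyModules M).app (.op V)).hom m' : _) =
        (((sheafifyModules X).obj M).presheaf.map (homOfLE hV).op m :) := by
  have h1 := PresheafOfModules.toPresheaf_map_sheafificationAdjunction_unit_app
    (𝟙 X.ringCatSheaf.obj) M
  obtain ⟨V, f, ⟨m', hm'⟩, hxV⟩ := Presheaf.imageSieve_mem (Opens.grothendieckTopology X)
    (toSheafify (Opens.grothendieckTopology X) M.presheaf) m x hx
  refine ⟨V, f.le, hxV, m', ?_⟩
  rw [← h1] at hm'
  exact hm'

lemma modules_eq_of_locally_eq (M : X.Modules) {U : X.Opens} (m m' : Γ(M, U))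
    (h : ∀ x ∈ U, ∃ (V : X.Opens) (hV : V ≤ U), x ∈ V ∧
      M.presheaf.map (homOfLE hV).op m = M.presheaf.map (homOfLE hV).op m') : m = m' := by
  choose V hV hx hm using h
  refine TopCat.Sheaf.eq_of_locally_eq' ⟨M.presheaf, M.isSheaf⟩
    (fun x : U => V x.1 x.2) U (fun x => homOfLE (hV x.1 x.2)) ?_ m m' (fun x => hm x.1 x.2)
  exact fun x hx' => TopologicalSpace.Opens.mem_iSup.2 ⟨⟨x, hx'⟩, hx x hx'⟩

lemma modules_exists_glue (M : X.Modules) {J : Type*} (V : J → X.Opens) {U : X.Opens}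
    (hV : ∀ j, V j ≤ U) (hc : ∀ x ∈ U, ∃ j, x ∈ V j) (m : ∀ j, Γ(M, V j))
    (h : ∀ i j, M.presheaf.map (homOfLE (inf_le_left : V i ⊓ V j ≤ V i)).op (m i) =
      M.presheaf.map (homOfLE (inf_le_right : V i ⊓ V j ≤ V j)).op (m j)) :
    ∃ m' : Γ(M, U), ∀ j, M.presheaf.map (homOfLE (hV j)).op m' = m j := by
  obtain ⟨m', hm', -⟩ := TopCat.Sheaf.existsUnique_gluing' ⟨M.presheaf, M.isSheaf⟩ V U
    (fun j => homOfLE (hV j)) (fun x hx => TopologicalSpace.Opens.mem_iSup.2 (hc x hx)) m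
    (fun i j => h i j)
  exact ⟨m', hm'⟩

/-- Tensoring with a basis of a free module of rank one. -/
lemma tmul_bijective {R L M : Type*} [CommRing R] [AddCommGroup L] [AddCommGroup M] [Module R L]
    [Module R M] (l : L) (hl : Function.Bijective fun r : R => r • l) :
    Function.Bijective fun m : M => l ⊗ₜ[R] m := by
  let e : R ≃ₗ[R] L := LinearEquiv.ofBijective (LinearMap.toSpanSingleton R L l) hl
  have : (fun m : M => l ⊗ₜ[R] m) =
      (TensorProduct.congr e (LinearEquiv.refl R M)) ∘ (TensorProduct.lid R M).symm := by
    funext m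
    have he : e 1 = l := one_smul R l
    simp [he]
  rw [this]
  exact (LinearEquiv.bijective _).comp (LinearEquiv.bijective _)

/-- A generator `l` makes `m ↦ l ⊗ m` bijective for the presheaf tensor product on every open subset
of `U`; sheafification changes it only up to local equality and gluing. -/
lemma tensorSection_bijective {L : X.Modules} {U : X.Opens} {l : Γ(L, U)}
    (hl : ∀ (W : X.Opens) (hW : W ≤ U),
      Function.Bijective fun r : Γ(X, W) => r • (L.presheaf.map (homOfLE hW).op l : Γ(L, W)))
    (M : X.Modules) {W : X.Opens} (hW : W ≤ U) :
    Function.Bijective (tensorSection L M W (L.presheaf.map (homOfLE hW).op l)) := by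
  have inj : ∀ {W : X.Opens} (hW : W ≤ U),
      Function.Injective (tensorSection L M W (L.presheaf.map (homOfLE hW).op l)) := by
    intro W hW m m' h
    refine modules_eq_of_locally_eq M m m' fun x hx => ?_
    obtain ⟨V, hV, hxV, h'⟩ := eq_of_toSheafifyModules_eq _ _ _ h hx
    refine ⟨V, hV, hxV, (tmul_bijective _ (hl V (hV.trans hW))).1 ?_⟩
    have h1 : ∀ m : Γ(M, W), ((presheafTensorL L.val).obj M.val).presheaf.map (homOfLE hV).op
        ((L.presheaf.map (homOfLE hW).op l) ⊗ₜ[Γ(X, W)] m :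
          TensorProduct Γ(X, W) Γ(L, W) Γ(M, W)) =
        ((L.presheaf.map (homOfLE (hV.trans hW)).op l) ⊗ₜ[Γ(X, V)]
          (M.presheaf.map (homOfLE hV).op m) : TensorProduct Γ(X, V) Γ(L, V) Γ(M, V)) := by
      intro m
      rw [← presheaf_map_map L hW hV]
      rfl
    exact (h1 m).symm.trans (h'.trans (h1 m'))
  refine ⟨inj hW, fun m => ?_⟩
  have hex : ∀ x : W, ∃ (V : X.Opens) (hV : V ≤ W), x.1 ∈ V ∧ ∃ n : Γ(M, V),
      tensorSection L M V (L.presheaf.map (homOfLE (hV.trans hW)).op l) n =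
        ((tensorL L).obj M).presheaf.map (homOfLE hV).op m := by
    intro x
    obtain ⟨V, hV, hxV, m', hm'⟩ := exists_toSheafifyModules_eq
      ((presheafTensorL L.val).obj M.val) m x.2
    obtain ⟨n, hn⟩ := (tmul_bijective (M := Γ(M, V)) _ (hl V (hV.trans hW))).2 m'
    refine ⟨V, hV, hxV, n, Eq.trans ?_ hm'⟩
    rw [← hn]
    rfl
  choose V hV hx n hn using hex
  -- The local preimages agree on overlaps by the injectivity just proved, applied there.
  obtain ⟨m', hm'⟩ := modules_exists_glue M V hV (fun x hx' => ⟨⟨x, hx'⟩, hx _⟩) n (by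
    intro i j
    refine inj (inf_le_left.trans ((hV i).trans hW)) ?_
    have h1 := congrArg (((tensorL L).obj M).presheaf.map
      (homOfLE (inf_le_left : V i ⊓ V j ≤ V i)).op) (hn i)
    have h2 := congrArg (((tensorL L).obj M).presheaf.map
      (homOfLE (inf_le_right : V i ⊓ V j ≤ V j)).op) (hn j)
    rw [tensorSection_res, presheaf_map_map, presheaf_map_map] at h1 h2
    exact h1.trans h2.symm)
  refine ⟨m', modules_eq_of_locally_eq _ _ _ fun x hx' => ⟨V ⟨x, hx'⟩, hV _, hx _, ?_⟩⟩
  rw [tensorSection_res, presheaf_map_map, hm', hn]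

/-- Tensoring with an invertible sheaf does not change a sheaf locally. -/
lemma nonempty_restrict_iso_tensorL {L : X.Modules} {U : X.Opens} {l : Γ(L, U)}
    (hl : ∀ (W : X.Opens) (hW : W ≤ U),
      Function.Bijective fun r : Γ(X, W) => r • (L.presheaf.map (homOfLE hW).op l : Γ(L, W)))
    (M : X.Modules) : Nonempty (M.restrict U.ι ≅ ((tensorL L).obj M).restrict U.ι) := by
  have hle : ∀ W : U.toScheme.Opens, U.ι ''ᵁ W ≤ U := fun W => by
    rintro _ ⟨y, _, rfl⟩
    exact y.2
  let φ : (M.restrict U.ι).val ⟶ (((tensorL L).obj M).restrict U.ι).val :=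
    PresheafOfModules.homMk
      { app := fun W => AddCommGrpCat.ofHom
          { toFun := fun m : Γ(M, U.ι ''ᵁ W.unop) =>
              tensorSection L M _ (L.presheaf.map (homOfLE (hle W.unop)).op l) m
            map_zero' := by
              have := tensorSection_smul_right L M (U.ι ''ᵁ W.unop) 0
                (L.presheaf.map (homOfLE (hle W.unop)).op l) 0
              rwa [zero_smul, zero_smul] at this
            map_add' := fun m m' => tensorSection_add_right L M (U.ι ''ᵁ W.unop) _ m m' }
        naturality := fun W W' i => by
          ext m
          have := tensorSection_res (L := L) (M := M) (U.ι.image_mono i.unop.le)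
            (L.presheaf.map (homOfLE (hle W.unop)).op l) m
          rw [presheaf_map_map] at this
          exact this.symm }
      (fun W r m => tensorSection_smul_right L M (U.ι ''ᵁ W.unop) _ _ _)
  let ψ : M.restrict U.ι ⟶ ((tensorL L).obj M).restrict U.ι := ⟨φ⟩
  have hψ : IsIso ψ := by
    rw [Scheme.Modules.Hom.isIso_iff_isIso_app]
    intro W
    rw [ConcreteCategory.isIso_iff_bijective]
    exact tensorSection_bijective hl M (hle W)
  exact ⟨asIso ψ⟩

end Trivial

end Sections

/-! ### Full faithfulness at one object. -/

section Adjunctions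

/-- Up to the adjunction bijection, `R.map` is composition with the counit at `A`, so only this one
component has to be invertible. -/
lemma map_bijective_of_isIso_counit {C D : Type*} [Category* C] [Category* D] {L : C ⥤ D}
    {R : D ⥤ C} (adj : L ⊣ R) (A B : D) (h : IsIso (adj.counit.app A)) :
    Function.Bijective (fun ψ : A ⟶ B => R.map ψ) := by
  have : (fun ψ : A ⟶ B => R.map ψ) =
      (fun φ => adj.homEquiv _ _ φ) ∘ fun ψ => adj.counit.app A ≫ ψ := by
    funext ψ
    simp [Adjunction.homEquiv_unit]
  rw [this]
  exact (adj.homEquiv _ _).bijective.comp ⟨fun a b h => (cancel_epi _).1 h,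
    fun φ => ⟨inv (adj.counit.app A) ≫ φ, by simp⟩⟩

lemma map_bijective_of_isIso_unit {C D : Type*} [Category* C] [Category* D] {L : C ⥤ D}
    {R : D ⥤ C} (adj : L ⊣ R) (A B : C) (h : IsIso (adj.unit.app B)) :
    Function.Bijective (fun ψ : A ⟶ B => L.map ψ) := by
  have : (fun ψ : A ⟶ B => L.map ψ) =
      (fun φ => (adj.homEquiv _ _).symm φ) ∘ fun ψ => ψ ≫ adj.unit.app B := by
    funext ψ
    simp [Adjunction.homEquiv_counit]
  rw [this]
  exact (adj.homEquiv _ _).symm.bijective.comp ⟨fun a b h => (cancel_mono _).1 h,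
    fun φ => ⟨φ ≫ inv (adj.unit.app B), by simp⟩⟩

end Adjunctions

/-! ### The universal property of pulled back sections over affine open sets. -/

section AffineSections

/-- A quasi-coherent sheaf on an affine scheme is the sheaf of its module of sections: the counit of
the tilde adjunction is invertible at `A`. No condition on `B` is needed. -/
lemma existsUnique_app_top {R : CommRingCat.{0}} (A B : (Spec R).Modules) [A.IsQuasicoherent]
    (g : Γ(A, ⊤) →ₗ[R] Γ(B, ⊤)) : ∃! ψ : A ⟶ B, ∀ a, ψ.app ⊤ a = g a := by
  let gl : (moduleSpecΓFunctor.obj A) →ₗ[R] (moduleSpecΓFunctor.obj B) := g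
  let g' : moduleSpecΓFunctor.obj A ⟶ moduleSpecΓFunctor.obj B :=
    @ModuleCat.ofHom R _ (moduleSpecΓFunctor.obj A) (moduleSpecΓFunctor.obj B) _
      (ModuleCat.isModule _) _ (ModuleCat.isModule _) gl
  have hb := map_bijective_of_isIso_counit (tilde.adjunction (R := R)) A B
    (inferInstanceAs (IsIso A.fromTildeΓ))
  obtain ⟨ψ, hψ⟩ := hb.2 g'
  have key : ∀ ψ : A ⟶ B, moduleSpecΓFunctor.map ψ = g' ↔ ∀ a, ψ.app ⊤ a = g a := by
    intro ψ
    constructor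
    · intro h a
      exact congrArg (fun φ => φ.hom a) h
    · intro h
      ext a
      exact h a
  exact ⟨ψ, (key ψ).1 hψ, fun ψ' hψ' => hb.1 (((key _).2 hψ').trans hψ.symm)⟩

variable {X Y : Scheme.{0}}

lemma presheaf_map_self (M : X.Modules) {U : X.Opens} (h : U ≤ U) (m : Γ(M, U)) :
    M.presheaf.map (homOfLE h).op m = m :=
  ConcreteCategory.congr_hom (M.presheaf.map_id (.op U)) m

lemma presheaf_map_bijective (M : X.Modules) {U V : X.Opens} (h : V ≤ U) (h' : U ≤ V) :
    Function.Bijective (M.presheaf.map (homOfLE h).op) := by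
  obtain rfl := le_antisymm h h'
  rw [show ⇑(M.presheaf.map (homOfLE h).op) = id from funext (presheaf_map_self M h)]
  exact Function.bijective_id

lemma image_fromSpec_top {U : X.Opens} (hU : IsAffineOpen U) : hU.fromSpec ''ᵁ ⊤ = U := by
  rw [Scheme.Hom.image_top_eq_opensRange, hU.opensRange_fromSpec]

lemma appIso_inv_fromSpec {U : X.Opens} (hU : IsAffineOpen U) (s : Γ(X, U)) :
    (hU.fromSpec.appIso ⊤).inv ((Spec Γ(X, U)).presheaf.map (homOfLE le_top).op
      ((Scheme.ΓSpecIso Γ(X, U)).inv s)) =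
      X.presheaf.map (homOfLE (image_fromSpec_top hU).le).op s := by
  have e : (⊤ : (Spec Γ(X, U)).Opens) ≤ hU.fromSpec ⁻¹ᵁ U := by
    rw [hU.fromSpec_preimage_self]
  have h1 := ConcreteCategory.congr_hom (hU.fromSpec.appLE_appIso_inv e) s
  refine Eq.trans (congrArg _ ?_) h1
  have h2 : (Spec Γ(X, U)).presheaf.map (homOfLE (le_top : hU.fromSpec ⁻¹ᵁ U ≤ ⊤)).op ≫
      (Spec Γ(X, U)).presheaf.map (homOfLE e).op =
      (Spec Γ(X, U)).presheaf.map (homOfLE le_top).op := by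
    rw [← Functor.map_comp]
    rfl
  have h3 : X.presheaf.map (homOfLE (le_refl U)).op = 𝟙 _ := X.presheaf.map_id _
  rw [Scheme.Hom.appLE, hU.fromSpec_app_of_le U le_rfl, Category.assoc, Category.assoc, h2, h3,
    Category.id_comp]
  rfl

/-- The sections of a module over an affine open subset in terms of its restriction to the
spectrum. -/
def specEquiv (Z : X.Modules) {U : X.Opens} (hU : IsAffineOpen U) :
    Γ(Z, U) ≃ₗ[Γ(X, U)] Γ(Z.restrict hU.fromSpec, ⊤) :=
  LinearEquiv.ofBijective
    (show Γ(Z, U) →ₗ[Γ(X, U)] Γ(Z.restrict hU.fromSpec, ⊤) from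
    { toFun := fun z => Z.presheaf.map (homOfLE (image_fromSpec_top hU).le).op z
      map_add' := fun z z' => map_add _ z z'
      map_smul' := fun s z => by
        have := Z.val.map_smul (homOfLE (image_fromSpec_top hU).le).op s z
        refine this.trans ?_
        refine congrArg (fun r : Γ(X, hU.fromSpec ''ᵁ ⊤) =>
          r • (Z.presheaf.map (homOfLE (image_fromSpec_top hU).le).op z :
            Γ(Z, hU.fromSpec ''ᵁ ⊤))) ?_
        exact (appIso_inv_fromSpec hU s).symm })
    (presheaf_map_bijective Z (image_fromSpec_top hU).le (image_fromSpec_top hU).ge)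

lemma existsUnique_app_specEquiv (Z : X.Modules) [Z.IsQuasicoherent] {U : X.Opens}
    (hU : IsAffineOpen U) (B : (Spec Γ(X, U)).Modules) (g : Γ(Z, U) →ₗ[Γ(X, U)] Γ(B, ⊤)) :
    ∃! ψ : Z.restrict hU.fromSpec ⟶ B, ∀ z, ψ.app ⊤ (specEquiv Z hU z) = g z := by
  obtain ⟨ψ, hψ, hu⟩ := existsUnique_app_top (Z.restrict hU.fromSpec) B
    (g ∘ₗ (specEquiv Z hU).symm.toLinearMap)
  refine ⟨ψ, fun z => ?_, fun ψ' hψ' => hu ψ' fun a => ?_⟩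
  · rw [hψ]
    simp
  · have := hψ' ((specEquiv Z hU).symm a)
    rwa [LinearEquiv.apply_symm_apply] at this

section BaseChange

variable (f : X ⟶ Y) (F : Y.Modules) {U : X.Opens} {V : Y.Opens} (hU : IsAffineOpen U)
  (hV : IsAffineOpen V) (h : U ≤ f ⁻¹ᵁ V)

lemma le_fromSpec_preimage {U : X.Opens} (hU : IsAffineOpen U) {W : X.Opens} (h : U ≤ W) :
    (⊤ : (Spec Γ(X, U)).Opens) ≤ hU.fromSpec ⁻¹ᵁ W := by
  intro x _
  have := hU.range_fromSpec
  exact h (this.le ⟨x, rfl⟩)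

/-- A sheaf pushed forward from `U` sees an open set `W` only through `W ∩ V`, because `U` maps into
`V`. Morphisms into it are therefore determined by their restriction to `V`. -/
lemma isIso_restrict_unit_app (h : U ≤ f ⁻¹ᵁ V) (B : (Spec Γ(X, U)).Modules) :
    IsIso ((Scheme.Modules.restrictAdjunction hV.fromSpec).unit.app
      ((Scheme.Modules.pushforward f).obj ((Scheme.Modules.pushforward hU.fromSpec).obj B))) := by
  rw [Scheme.Modules.Hom.isIso_iff_isIso_app]
  intro W
  rw [ConcreteCategory.isIso_iff_bijective, Scheme.Modules.restrictAdjunction_unit_app_app]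
  have h1 : hU.fromSpec ⁻¹ᵁ f ⁻¹ᵁ (hV.fromSpec ''ᵁ hV.fromSpec ⁻¹ᵁ W) ≤
      hU.fromSpec ⁻¹ᵁ f ⁻¹ᵁ W :=
    Scheme.Hom.preimage_mono _ (Scheme.Hom.preimage_mono _ (hV.fromSpec.image_preimage_le W))
  refine presheaf_map_bijective B h1 ?_
  intro x hx
  have hxV : f (hU.fromSpec x) ∈ V := h (hU.range_fromSpec.le ⟨x, rfl⟩)
  obtain ⟨y, hy⟩ := hV.range_fromSpec.ge hxV
  refine ⟨y, ?_, hy⟩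
  change hV.fromSpec y ∈ W
  rw [hy]
  exact hx

/-- The morphism from `F` corresponding to a morphism from the restriction of `f^* F`. -/
def adjHom {B : (Spec Γ(X, U)).Modules}
    (G : ((Scheme.Modules.pullback f).obj F).restrict hU.fromSpec ⟶ B) :
    F ⟶ (Scheme.Modules.pushforward f).obj ((Scheme.Modules.pushforward hU.fromSpec).obj B) :=
  (Scheme.Modules.pullbackPushforwardAdjunction f).homEquiv _ _
    ((Scheme.Modules.restrictAdjunction hU.fromSpec).homEquiv _ _ G)

lemma adjHom_bijective (B : (Spec Γ(X, U)).Modules) :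
    Function.Bijective (adjHom (B := B) f F hU) :=
  ((Scheme.Modules.pullbackPushforwardAdjunction f).homEquiv _ _).bijective.comp
    ((Scheme.Modules.restrictAdjunction hU.fromSpec).homEquiv _ _).bijective

lemma adjHom_app {B : (Spec Γ(X, U)).Modules}
    (G : ((Scheme.Modules.pullback f).obj F).restrict hU.fromSpec ⟶ B) (n : Γ(F, V)) :
    (adjHom f F hU G).app V n =
      B.presheaf.map (homOfLE (le_top : hU.fromSpec ⁻¹ᵁ f ⁻¹ᵁ V ≤ ⊤)).op
        (G.app ⊤ (specEquiv _ hU (pullbackSection f F h n))) := by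
  have h1 : (adjHom f F hU G).app V n = G.app (hU.fromSpec ⁻¹ᵁ f ⁻¹ᵁ V)
      (((Scheme.Modules.pullback f).obj F).presheaf.map
        (homOfLE (hU.fromSpec.image_preimage_le (f ⁻¹ᵁ V))).op
        (((Scheme.Modules.pullbackPushforwardAdjunction f).unit.app F).app V n)) := by
    rw [adjHom, Adjunction.homEquiv_unit, Adjunction.homEquiv_unit]
    rfl
  have h2 := ConcreteCategory.congr_hom (G.mapPresheaf.naturality
    (homOfLE (le_top : hU.fromSpec ⁻¹ᵁ f ⁻¹ᵁ V ≤ ⊤)).op)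
    (specEquiv _ hU (pullbackSection f F h n))
  refine h1.trans (Eq.trans ?_ h2)
  refine congrArg (G.app (hU.fromSpec ⁻¹ᵁ f ⁻¹ᵁ V)) ?_
  have h3 := presheaf_map_map ((Scheme.Modules.pullback f).obj F)
    (image_fromSpec_top hU).le (hU.fromSpec.image_mono
      (le_top : hU.fromSpec ⁻¹ᵁ f ⁻¹ᵁ V ≤ ⊤)) (pullbackSection f F h n)
  refine Eq.trans ?_ h3.symm
  exact (presheaf_map_map ((Scheme.Modules.pullback f).obj F) _ _ _).symm

lemma smul_pushforward_fromSpec (B : (Spec Γ(X, U)).Modules) (r : Γ(Y, V))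
    (x : Γ(B, hU.fromSpec ⁻¹ᵁ f ⁻¹ᵁ V)) :
    (r • (show Γ((Scheme.Modules.pushforward f).obj
      ((Scheme.Modules.pushforward hU.fromSpec).obj B), V) from x) :
      Γ((Scheme.Modules.pushforward f).obj
      ((Scheme.Modules.pushforward hU.fromSpec).obj B), V)) = f.appLE V U h r • x := by
  rw [Scheme.Modules.smul_Spec_def]
  refine congrArg (fun s : Γ(Spec Γ(X, U), hU.fromSpec ⁻¹ᵁ f ⁻¹ᵁ V) =>
    s • (x : Γ(B, hU.fromSpec ⁻¹ᵁ f ⁻¹ᵁ V))) ?_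
  change hU.fromSpec.app (f ⁻¹ᵁ V) (f.app V r) = _
  rw [hU.fromSpec_app_of_le _ h]
  rfl

section Lift

variable {Q : Type} [AddCommGroup Q] [Module Γ(X, U) Q]

/-- Global sections of the sheaf associated with a module. -/
def tildeEquiv' {S : CommRingCat.{0}} (Q : Type) [AddCommGroup Q] [Module S Q] :
    Q ≃ₗ[S] Γ(tilde (ModuleCat.of S Q), ⊤) :=
  (tilde.isoTop (ModuleCat.of S Q)).toLinearEquiv

variable {f F}

/-- Existence for `Γ(U, f^*F) = 𝒪(U) ⊗ F(V)`. The sheaf of `Q` is pushed forward to `Y`; a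
semilinear map on `F(V)` defines a morphism on `V`, which extends over `Y`, and adjunction turns it
into a morphism out of `f^*F` restricted to `U`. -/
lemma exists_lift_pullbackSection (hU : IsAffineOpen U) (hV : IsAffineOpen V) [F.IsQuasicoherent]
    (g : Γ(F, V) →+ Q)
    (hg : ∀ (r : Γ(Y, V)) n, g (r • n) = f.appLE V U h r • g n) :
    ∃ g' : Γ((Scheme.Modules.pullback f).obj F, U) →ₗ[Γ(X, U)] Q,
      ∀ n, g' (pullbackSection f F h n) = g n := by
  let B := tilde (ModuleCat.of Γ(X, U) Q)
  let C := (Scheme.Modules.pushforward f).obj ((Scheme.Modules.pushforward hU.fromSpec).obj B)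
  let c := tildeEquiv' (S := Γ(X, U)) Q
  have hle : hU.fromSpec ⁻¹ᵁ f ⁻¹ᵁ V ≤ ⊤ := le_top
  have hb : Function.Bijective (B.presheaf.map (homOfLE hle).op) :=
    presheaf_map_bijective B hle (le_fromSpec_preimage hU h)
  let δ : Γ(F, V) →ₗ[Γ(Y, V)] Γ(C, V) :=
    { toFun := fun n => B.presheaf.map (homOfLE hle).op (c (g n))
      map_add' := fun n n' => by
        rw [map_add, map_add]
        exact map_add _ _ _
      map_smul' := fun r n => by
        refine Eq.trans ?_ (smul_pushforward_fromSpec f hU h B r _).symm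
        rw [hg, map_smul]
        exact Scheme.Modules.map_smul_Spec _ _ _ }
  obtain ⟨ψ, hψ, -⟩ := existsUnique_app_specEquiv F hV (C.restrict hV.fromSpec)
    ((specEquiv C hV).toLinearMap ∘ₗ δ)
  obtain ⟨p, hp⟩ := (map_bijective_of_isIso_unit
    (Scheme.Modules.restrictAdjunction hV.fromSpec) F C
    (isIso_restrict_unit_app f hU hV h B)).2 ψ
  obtain ⟨G, hG⟩ := (adjHom_bijective f F hU B).2 p
  have h1 : ∀ n, p.app V n = δ n := fun n => by
    refine (specEquiv C hV).injective (Eq.trans ?_ (hψ n))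
    rw [← hp]
    exact (ConcreteCategory.congr_hom
      (p.mapPresheaf.naturality (homOfLE (image_fromSpec_top hV).le).op) n).symm
  refine ⟨c.symm.toLinearMap ∘ₗ
    (show Γ(((Scheme.Modules.pullback f).obj F).restrict hU.fromSpec, ⊤) →ₗ[Γ(X, U)] Γ(B, ⊤) from
      { toFun := G.app ⊤
        map_add' := fun x y => map_add _ x y
        map_smul' := fun s x => by
          rw [Scheme.Modules.smul_Spec_def, Scheme.Modules.Hom.app_smul]
          rfl }) ∘ₗ (specEquiv _ hU).toLinearMap, fun n => ?_⟩
  refine c.injective (hb.1 ?_)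
  refine Eq.trans ?_ (h1 n)
  rw [← hG, adjHom_app f F hU h]
  refine congrArg _ ?_
  exact c.apply_symm_apply _

/-- Uniqueness, by reading the same chain of bijections backwards; quasi-coherence of the pull-back
lets a linear map on its sections over `U` be regarded as a morphism of sheaves. -/
lemma pullbackSection_hom_ext (hU : IsAffineOpen U) (hV : IsAffineOpen V) [F.IsQuasicoherent]
    [((Scheme.Modules.pullback f).obj F).IsQuasicoherent]
    (g₁ g₂ : Γ((Scheme.Modules.pullback f).obj F, U) →ₗ[Γ(X, U)] Q)
    (hg : ∀ n, g₁ (pullbackSection f F h n) = g₂ (pullbackSection f F h n)) : g₁ = g₂ := by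
  let B := tilde (ModuleCat.of Γ(X, U) Q)
  let C := (Scheme.Modules.pushforward f).obj ((Scheme.Modules.pushforward hU.fromSpec).obj B)
  let c := tildeEquiv' (S := Γ(X, U)) Q
  obtain ⟨G₁, hG₁, -⟩ := existsUnique_app_specEquiv _ hU B (c.toLinearMap ∘ₗ g₁)
  obtain ⟨G₂, hG₂, -⟩ := existsUnique_app_specEquiv _ hU B (c.toLinearMap ∘ₗ g₂)
  suffices G₁ = G₂ by
    subst this
    ext x
    exact c.injective ((hG₁ x).symm.trans (hG₂ x))
  refine (adjHom_bijective f F hU B).1 ((map_bijective_of_isIso_unit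
    (Scheme.Modules.restrictAdjunction hV.fromSpec) F C
    (isIso_restrict_unit_app f hU hV h B)).1 ?_)
  have key : ∀ n, (adjHom f F hU G₁).app V n = (adjHom f F hU G₂).app V n := fun n => by
    rw [adjHom_app f F hU h, adjHom_app f F hU h, hG₁, hG₂]
    refine congrArg _ ?_
    exact congrArg c (hg n)
  let g : Γ(F, V) →ₗ[Γ(Y, V)] Γ(C.restrict hV.fromSpec, ⊤) := (specEquiv C hV).toLinearMap ∘ₗ
    (show Γ(F, V) →ₗ[Γ(Y, V)] Γ(C, V) from
      { toFun := (adjHom f F hU G₁).app V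
        map_add' := fun x y => map_add _ x y
        map_smul' := fun s x => Scheme.Modules.Hom.app_smul _ _ _ })
  have hnat : ∀ (p : F ⟶ C) n, ((Scheme.Modules.restrictFunctor hV.fromSpec).map p).app ⊤
      (specEquiv F hV n) = specEquiv C hV (p.app V n) := fun p n =>
    ConcreteCategory.congr_hom
      (p.mapPresheaf.naturality (homOfLE (image_fromSpec_top hV).le).op) n
  refine (existsUnique_app_specEquiv F hV (C.restrict hV.fromSpec) g).unique ?_ ?_
  · exact fun n => hnat _ n
  · intro n
    refine (hnat _ n).trans ?_
    rw [← key]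
    rfl

end Lift

end BaseChange

end AffineSections

/-! ### Biadditive maps out of pulled back sections. -/

section BaseChangeLift

/-- The action to be constructed is additive but not `𝒪(U)`-linear, so the linear lift is first
taken to the tensor product and then followed by the balanced biadditive map `D`. -/
lemma exists_lift_of_universal {R S N M P : Type} [CommRing R] [CommRing S] [Algebra R S]
    [AddCommGroup N] [Module R N] [AddCommGroup M] [Module S M] [AddCommGroup P] (β : N → M)
    (hlift : ∃ g' : M →ₗ[S] TensorProduct R S N, ∀ n, g' (β n) = 1 ⊗ₜ n)
    (D : S →+ N →+ P) (hD : ∀ r s n, D (algebraMap R S r * s) n = D s (r • n)) :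
    ∃ Φ : M →+ P, ∀ s n, Φ (s • β n) = D s n := by
  obtain ⟨g', hg'⟩ := hlift
  have hD' : ∀ (r : R) (s : S) (n : N), D (r • s) n = D s (r • n) := fun r s n => by
    rw [Algebra.smul_def, hD]
  refine ⟨(TensorProduct.liftAddHom D hD').comp g'.toAddMonoidHom, fun s n => ?_⟩
  have : g' (s • β n) = s ⊗ₜ n := by
    rw [map_smul, hg', TensorProduct.smul_tmul', smul_eq_mul, mul_one]
  change TensorProduct.liftAddHom D hD' (g' (s • β n)) = _
  rw [this]
  rfl

variable {X Y : Scheme.{0}} {f : X ⟶ Y} {F : Y.Modules} {U : X.Opens} {V : Y.Opens}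
  (h : U ≤ f ⁻¹ᵁ V)

lemma exists_addHom_pullbackSection (hU : IsAffineOpen U) (hV : IsAffineOpen V) [F.IsQuasicoherent]
    {P : Type} [AddCommGroup P] (D : Γ(X, U) →+ Γ(F, V) →+ P)
    (hD : ∀ (r : Γ(Y, V)) s n, D (f.appLE V U h r * s) n = D s (r • n)) :
    ∃ Φ : Γ((Scheme.Modules.pullback f).obj F, U) →+ P,
      ∀ s n, Φ (s • pullbackSection f F h n) = D s n := by
  let _ : Algebra Γ(Y, V) Γ(X, U) := (f.appLE V U h).hom.toAlgebra
  refine exists_lift_of_universal (R := Γ(Y, V)) _ ?_ D hD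
  refine exists_lift_pullbackSection h hU hV
    (TensorProduct.mk Γ(Y, V) Γ(X, U) Γ(F, V) 1).toAddMonoidHom fun r n => ?_
  change (1 : Γ(X, U)) ⊗ₜ[Γ(Y, V)] (r • n) = _ • ((1 : Γ(X, U)) ⊗ₜ[Γ(Y, V)] n)
  rw [← TensorProduct.smul_tmul, TensorProduct.smul_tmul', Algebra.smul_def]
  rfl

/-- The quotient map by the span of the pulled back sections kills all of them, hence is zero by
uniqueness. -/
lemma pullbackSection_induction (hU : IsAffineOpen U) (hV : IsAffineOpen V) [F.IsQuasicoherent]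
    [((Scheme.Modules.pullback f).obj F).IsQuasicoherent]
    (m : Γ((Scheme.Modules.pullback f).obj F, U)) :
    m ∈ AddSubmonoid.closure {x | ∃ (s : Γ(X, U)) (n : Γ(F, V)), x = s • pullbackSection f F h
        n} := by
  let Q := Submodule.span Γ(X, U) (Set.range (pullbackSection f F h : Γ(F, V) → _))
  have h1 : Q.mkQ = 0 := pullbackSection_hom_ext h hU hV _ _ fun n => by
    rw [Submodule.mkQ_apply, LinearMap.zero_apply, Submodule.Quotient.mk_eq_zero]
    exact Submodule.subset_span ⟨n, rfl⟩
  have h2 : m ∈ Q := by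
    rw [← Submodule.Quotient.mk_eq_zero, ← Submodule.mkQ_apply, h1, LinearMap.zero_apply]
  induction h2 using Submodule.closure_induction with
  | zero => exact zero_mem _
  | add x y _ _ hx hy => exact add_mem hx hy
  | smul_mem r x hx =>
    obtain ⟨n, rfl⟩ := hx
    exact AddSubmonoid.subset_closure ⟨r, n, rfl⟩

end BaseChangeLift

lemma isQuasicoherent_of_isFinitePresentation {Z : Scheme.{0}} (M : Z.Modules)
    (hM : M.IsFinitePresentation) : M.IsQuasicoherent :=
  ⟨⟨hM.exists_quasicoherentData.choose⟩⟩

/-! ### A local equation as a basis of the line bundle. -/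

section LineBundleBasis

variable {Z : Scheme.{0}} [IsIntegral Z] {d : Z → Z.functionField} {U : Z.Opens}

lemma regValue_injective (x : U) : Function.Injective (regValue (X := Z) x) := by
  have : Nonempty U := ⟨x⟩
  have h : (regValue (X := Z) x : Γ(Z, U) → Z.functionField) =
      (Z.germToFunctionField U).hom := by
    funext r
    simp [regValue]
  rw [h]
  exact Z.germToFunctionField_injective U

lemma exists_regValue_mul_inv {d₀ : Z.functionField} (hd : ∀ x ∈ U, AssocAt x (d x) d₀)
    (s : lineSections d U) (x : U) :
    ∃ r : Γ(Z, U), ∀ y, regValue y r * d₀⁻¹ = s.1 y := by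
  have h0 : d₀ ≠ 0 := (hd _ x.2).2.1
  have h1 : ∀ y ∈ U, d₀ * s.1 x ∈ regAt y := fun y hy => by
    rw [← (hd y hy).mul_mem_iff, mul_comm, ← mem_lineStalk]
    exact lineSections_mem s x hy
  have h2 : d₀ * s.1 x * d₀⁻¹ = s.1 x := by rw [mul_right_comm, mul_inv_cancel₀ h0, one_mul]
  obtain ⟨r, hr⟩ := exists_regValue_eq U (d₀ * s.1 x) h1
  refine ⟨r, fun y => ?_⟩
  rw [hr y, h2]
  exact lineSections_const s x y

/-- Sections of `𝒪(D)` are the regular multiples of `d₀⁻¹`. The empty open set is treated apart,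
since it has no point at which to read off values. -/
lemma lineBundle_smul_bijective {d₀ : Z.functionField} (hd : ∀ x ∈ U, AssocAt x (d x) d₀)
    {l : lineSections d U} (hl : ∀ x, l.1 x = d₀⁻¹) (W : Z.Opens) (hW : W ≤ U) :
    Function.Bijective fun r : Γ(Z, W) =>
      r • ((lineBundle d).presheaf.map (homOfLE hW).op l : Γ(lineBundle d, W)) := by
  have key : ∀ (r : Γ(Z, W)) (x : W), (show lineSections d W from
      r • ((lineBundle d).presheaf.map (homOfLE hW).op l : Γ(lineBundle d, W))).1 x =
      regValue x r * d₀⁻¹ := fun r x => by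
    rw [← hl ⟨x.1, hW x.2⟩]
    rfl
  constructor
  · intro r r' h
    rcases isEmpty_or_nonempty W with hE | ⟨⟨x⟩⟩
    · have : W = ⊥ := by
        ext y
        exact ⟨fun hy => hE.elim ⟨y, hy⟩, fun hy => hy.elim⟩
      subst this
      exact Subsingleton.elim _ _
    · have h1 := congrArg (fun s : lineSections d W => s.1 x) h
      have h2 : regValue x r * d₀⁻¹ = regValue x r' * d₀⁻¹ :=
        (key r x).symm.trans (h1.trans (key r' x))
      have h0 : d₀⁻¹ ≠ 0 := inv_ne_zero (hd _ (hW x.2)).2.1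
      have h3 : regValue x r = regValue x r' := mul_right_cancel₀ h0 h2
      exact regValue_injective x h3
  · intro s
    rcases isEmpty_or_nonempty W with hE | ⟨⟨x⟩⟩
    · exact ⟨0, Subtype.ext (funext fun x => hE.elim x)⟩
    · obtain ⟨r, hr⟩ := exists_regValue_mul_inv (fun y hy => hd y (hW hy)) s x
      exact ⟨r, Subtype.ext (funext fun y => (key r y).trans (hr y))⟩

end LineBundleBasis

/-! ### Sections of `𝕃 ⊗ p^*ℱ` over good pairs. -/

section TwistedPullback

variable {I X Y : Type*} [Finite I] [AddCommGroup X] [AddCommGroup Y]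
  [Module.Free ℤ X] [Module.Finite ℤ X] [Module.Free ℤ Y] [Module.Finite ℤ Y]
  {P : RootPairing I ℤ X Y} [P.IsReduced] (b : P.Base) {E : SchC} [GrpObj E] [IsEllipticCurve E]
  (t : E.left.presheaf.stalk (zeroPt E)) (κ : 𝟙_ SchC ⟶ E) (F : (HomTorus E X).left.Modules)
  {U : (HomTorus E X ⊗ HomTorus E Y).left.Opens} {V : (HomTorus E X).left.Opens}
  (h : U ≤ proj X Y E ⁻¹ᵁ V)

/-- `s ⊗ p^* n` as a biadditive function of `s` and `n`. -/
def twistedPullbackHom : lineSections (twistDivisor b t κ) U →+ Γ(F, V) →+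
    Γ((twistedPullback b t κ).obj F, U) :=
  AddMonoidHom.mk' (fun s => AddMonoidHom.mk' (twistedPullbackSection b t κ F h s) fun n n' => by
      unfold twistedPullbackSection
      rw [pullbackSection_add]
      exact tensorSection_add_right _ _ _ _ _ _) fun s s' => by
    ext n
    exact tensorSection_add_left _ _ _ _ _ _

lemma twistedPullbackHom_smul (r : Γ((HomTorus E X).left, V))
    (s : lineSections (twistDivisor b t κ) U) (n : Γ(F, V)) :
    twistedPullbackHom b t κ F h s (r • n) =
      twistedPullbackHom b t κ F h ((proj X Y E).appLE V U h r • s) n := by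
  change tensorSection _ _ U _ (pullbackSection _ F h _) = tensorSection _ _ U _ _
  rw [pullbackSection_smul]
  exact (tensorSection_smul_right (twistBundle b t κ) _ U _ s _).trans
    (tensorSection_smul_left (twistBundle b t κ) _ U _ s _).symm

lemma twistedPullbackHom_smul_left (r : Γ((HomTorus E X ⊗ HomTorus E Y).left, U))
    (s : lineSections (twistDivisor b t κ) U) (n : Γ(F, V)) :
    twistedPullbackHom b t κ F h (r • s) n = r • twistedPullbackHom b t κ F h s n :=
  tensorSection_smul_left (twistBundle b t κ) _ U _ s _

lemma twistedPullbackHom_res {U' : (HomTorus E X ⊗ HomTorus E Y).left.Opens}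
    {V' : (HomTorus E X).left.Opens} (hU : U' ≤ U) (hV : V' ≤ V) (h' : U' ≤ proj X Y E ⁻¹ᵁ V')
    (s : lineSections (twistDivisor b t κ) U) (n : Γ(F, V)) :
    ((twistedPullback b t κ).obj F).presheaf.map (homOfLE hU).op
        (twistedPullbackHom b t κ F h s n) =
      twistedPullbackHom b t κ F h' (lineSectionsRes _ hU s)
        (F.presheaf.map (homOfLE hV).op n) := by
  refine (tensorSection_res hU _ _).trans ?_
  rw [pullbackSection_res _ F h hU hV h']
  rfl

lemma twistedPullback_map_hom {F F' : (HomTorus E X).left.Modules} (f : F ⟶ F')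
    (s : lineSections (twistDivisor b t κ) U) (n : Γ(F, V)) :
    ((twistedPullback b t κ).map f).app U (twistedPullbackHom b t κ F h s n) =
      twistedPullbackHom b t κ F' h s (f.app V n) := by
  refine (tensorL_map_tensorSection _ _ _).trans ?_
  rw [pullback_map_pullbackSection]
  rfl

variable {b t κ F}

lemma GoodPair.exists_basis (hg : GoodPair b t κ U V) :
    ∃ l : lineSections (twistDivisor b t κ) U, ∀ x, l.1 x = hg.d₀⁻¹ :=
  ⟨lineSections.mk hg.d₀⁻¹ fun x hx => by
    rw [mem_lineStalk_iff (hg.hd x hx), mul_inv_cancel₀ hg.d₀_ne]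
    exact one_mem _, fun _ => rfl⟩

lemma GoodPair.exists_smul_eq (hg : GoodPair b t κ U V)
    {l : lineSections (twistDivisor b t κ) U} (hl : ∀ x, l.1 x = hg.d₀⁻¹) 
    (s : lineSections (twistDivisor b t κ) U) :
    ∃ r : Γ((HomTorus E X ⊗ HomTorus E Y).left, U), r • l = s :=
  (lineBundle_smul_bijective hg.hd hl U le_rfl).2 s

lemma GoodPair.tensorSection_bijective (hg : GoodPair b t κ U V)
    {l : lineSections (twistDivisor b t κ) U} (hl : ∀ x, l.1 x = hg.d₀⁻¹)
    (M : (HomTorus E X ⊗ HomTorus E Y).left.Modules) :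
    Function.Bijective (tensorSection (twistBundle b t κ) M U l) :=
  EllipticHecke.tensorSection_bijective (L := twistBundle b t κ) (l := l)
    (lineBundle_smul_bijective hg.hd hl) M (le_refl U)

/-- The sections of `𝕃 ⊗ p^*ℱ` are sums of sections `s ⊗ p^* n`. -/
lemma GoodPair.mem_closure (hg : GoodPair b t κ U V) [F.IsFinitePresentation]
    (m : Γ((twistedPullback b t κ).obj F, U)) :
    m ∈ AddSubmonoid.closure {x | ∃ s n, x = twistedPullbackHom b t κ F hg.le s n} := by
  obtain ⟨l, hl⟩ := hg.exists_basis
  obtain ⟨m, rfl⟩ := (hg.tensorSection_bijective hl _).2 m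
  have := isQuasicoherent_of_isFinitePresentation F ‹_›
  have := isQuasicoherent_of_isFinitePresentation _ (isFinitePresentation_pullback (proj X Y E) F)
  have hm := pullbackSection_induction hg.le hg.affU hg.affV m
  induction hm using AddSubmonoid.closure_induction with
  | mem m hm =>
    obtain ⟨r, n, rfl⟩ := hm
    refine AddSubmonoid.subset_closure ⟨r • l, n, ?_⟩
    rw [twistedPullbackHom_smul_left]
    exact tensorSection_smul_right (twistBundle b t κ) _ U _ l _
  | zero =>
    have h0 : tensorSection (twistBundle b t κ) ((Scheme.Modules.pullback (proj X Y E)).obj F) U l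
        0 = 0 := map_zero (AddMonoidHom.mk' (tensorSection (twistBundle b t κ) _ U l)
      (tensorSection_add_right _ _ _ _))
    rw [h0]
    exact zero_mem _
  | add m m' _ _ h h' =>
    exact (tensorSection_add_right (twistBundle b t κ) _ U l m m').symm ▸ add_mem h h'

/-- The basis of `𝕃` over `U` reduces this to the universal property of `p^*ℱ`. Only balancedness
over `𝒪(V)` is required of `D`. -/
lemma GoodPair.exists_lift (hg : GoodPair b t κ U V) [F.IsFinitePresentation]
    {Q : Type} [AddCommGroup Q] (D : lineSections (twistDivisor b t κ) U →+ Γ(F, V) →+ Q)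
    (hD : ∀ r s n, D ((proj X Y E).appLE V U hg.le r • s) n = D s (r • n)) :
    ∃ Φ : Γ((twistedPullback b t κ).obj F, U) →+ Q,
      ∀ s n, Φ (twistedPullbackHom b t κ F hg.le s n) = D s n := by
  obtain ⟨l, hl⟩ := hg.exists_basis
  let e := AddEquiv.ofBijective (AddMonoidHom.mk' (tensorSection (twistBundle b t κ)
    ((Scheme.Modules.pullback (proj X Y E)).obj F) U l)
      (tensorSection_add_right _ _ _ _)) (hg.tensorSection_bijective hl _)
  have := isQuasicoherent_of_isFinitePresentation F ‹_›
  obtain ⟨Φ, hΦ⟩ := exists_addHom_pullbackSection (F := F) hg.le hg.affU hg.affV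
    (D.comp (AddMonoidHom.mk' (fun r => r • l) fun r r' => add_smul r r' l)) fun r s n => by
      change D ((_ * s) • l) n = D (s • l) (r • n)
      rw [mul_smul, hD]
  refine ⟨Φ.comp e.symm.toAddMonoidHom, fun s n => ?_⟩
  obtain ⟨r, rfl⟩ := hg.exists_smul_eq hl s
  have : twistedPullbackHom b t κ F hg.le (r • l) n =
      e (r • pullbackSection (proj X Y E) F hg.le n) := by
    rw [twistedPullbackHom_smul_left]
    exact (tensorSection_smul_right _ _ _ _ _ _).symm
  rw [this]
  change Φ (e.symm (e _)) = _
  rw [e.symm_apply_apply, hΦ]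
  rfl

/-- Locally `𝕃` has a basis, so twisting does not change the pull-back, which is finitely presented.
-/
lemma isFinitePresentation_twistedPullback
    (ht : IsLocalRing.maximalIdeal (E.left.presheaf.stalk (zeroPt E)) = Ideal.span {t})
    (F : (HomTorus E X).left.Modules) [F.IsFinitePresentation] :
    ((twistedPullback b t κ).obj F).IsFinitePresentation := by
  have := isFinitePresentation_pullback (proj X Y E) F
  refine isFinitePresentation_of_locally_iso ((Scheme.Modules.pullback (proj X Y E)).obj F) _
    fun x => ?_
  obtain ⟨U, V, ⟨hg⟩, hx, -, -⟩ := exists_goodPair (b := b) (κ := κ) (x := x) ht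
    (isInvariant_top (G := P.weylGroup × P.weylGroup)) (isInvariant_top (G := P.weylGroup))
    (U := ⊤) (V := ⊤) trivial trivial
  obtain ⟨l, hl⟩ := hg.exists_basis
  exact ⟨U, hx, nonempty_restrict_iso_tensorL (L := twistBundle b t κ) (l := l)
    (lineBundle_smul_bijective hg.hd hl) _⟩

end TwistedPullback

/-! ### Descent of rational relations by flatness. -/

section FlatRelation

open TensorProduct

/-- A common denominator makes every element of `S ⊗ K` a pure tensor; this yields injectivity of
its evaluation in the larger field below. -/
lemma exists_tmul_eq_of_isFraction {R S K : Type*} [CommRing R] [CommRing S] [Algebra R S] [Field K]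
    [Algebra R K] (hK : ∀ q : K, ∃ r d : R, algebraMap R K d ≠ 0 ∧ algebraMap R K d * q = algebraMap
        R K r)
    (y : S ⊗[R] K) : ∃ (s : S) (q : K), q ≠ 0 ∧ y = s ⊗ₜ[R] q := by
  induction y with
  | zero => exact ⟨0, 1, one_ne_zero, (zero_tmul _ _).symm⟩
  | tmul s q =>
    obtain ⟨r, d, hd, h⟩ := hK q
    refine ⟨algebraMap R S r * s, (algebraMap R K d)⁻¹, inv_ne_zero hd, ?_⟩
    rw [← Algebra.smul_def, smul_tmul, Algebra.smul_def, ← h, mul_right_comm, mul_inv_cancel₀ hd,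
      one_mul]
  | add y y' hy hy' =>
    obtain ⟨s, q, hq, rfl⟩ := hy
    obtain ⟨s', q', hq', rfl⟩ := hy'
    obtain ⟨r, d, hd, h⟩ := hK (q' / q)
    refine ⟨algebraMap R S d * s + algebraMap R S r * s', q * (algebraMap R K d)⁻¹,
      mul_ne_zero hq (inv_ne_zero hd), ?_⟩
    have h1 : d • (q * (algebraMap R K d)⁻¹) = q := by
      rw [Algebra.smul_def]
      field_simp
    have h2 : r • (q * (algebraMap R K d)⁻¹) = q' := by
      rw [Algebra.smul_def, ← h]
      field_simp
    rw [add_tmul, ← Algebra.smul_def, ← Algebra.smul_def, smul_tmul, smul_tmul, h1, h2]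

/-- A relation between coefficients over the fraction fields gives a relation between the elements
themselves, by flatness. -/
lemma sum_smul_eq_zero_of_flat {R S K L H M W J : Type*} [CommRing R] [CommRing S] [Field K]
    [Field L] [Ring H] [AddCommGroup M] [Module S M] [Finite W] {φ : R →+* S} (hφ : φ.Flat)
    {i : R →+* K} (hi : ∀ q : K, ∃ r d : R, i d ≠ 0 ∧ i d * q = i r) {j : S →+* L}
    (hj : Function.Injective j) {ψ : K →+* L} (hψ : ∀ r, ψ (i r) = j (φ r)) {e : R →+* H}
    {c : H →+ W → K} (hc : Function.Injective c) (hec : ∀ r x w, c (e r * x) w = i r * c x w)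
    {f : H →+ M} (hf : ∀ r x, f (e r * x) = φ r • f x) (B : Finset J) (s : J → S) (h : J → H)
    (hz : ∀ w, ∑ k ∈ B, j (s k) * ψ (c (h k) w) = 0) : ∑ k ∈ B, s k • f (h k) = 0 := by
  classical
  have := Fintype.ofFinite W
  let _ : Algebra R S := φ.toAlgebra
  let _ : Algebra R K := i.toAlgebra
  let _ : Module R H := Module.compHom H e
  have : Module.Flat R S := hφ
  let c' : H →ₗ[R] (W → K) :=
    { c with map_smul' := fun r x => funext fun w => hec r x w }
  -- Evaluation of tensors in the larger field. It is injective because a pure tensor `s ⊗ q` with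
  -- `q ≠ 0` and value zero has `s = 0`.
  let ev : S ⊗[R] K →+ L := liftAddHom
    ((AddMonoidHom.mul.comp j.toAddMonoidHom).compr₂ (AddMonoidHom.id L) |>.flip.comp
      ψ.toAddMonoidHom |>.flip) fun r s q => by
        change j (φ r * s) * ψ q = j s * ψ (i r * q)
        rw [map_mul, map_mul, hψ]
        ring
  have hev : ∀ s q, ev (s ⊗ₜ q) = j s * ψ q := fun s q => rfl
  have hev_inj : ∀ y, ev y = 0 → y = 0 := by
    intro y hy
    obtain ⟨s, q, hq, rfl⟩ := exists_tmul_eq_of_isFraction hi y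
    rw [hev, mul_eq_zero, or_iff_left ((map_ne_zero ψ).2 hq)] at hy
    rw [hj (hy.trans (map_zero j).symm), zero_tmul]
  -- Flatness embeds `S ⊗ H` in `S ⊗ K^W`, where the relation is tested on each coordinate through
  -- `ev`.
  have h0 : ∑ k ∈ B, s k ⊗ₜ[R] h k = 0 := by
    apply Module.Flat.lTensor_preserves_injective_linearMap (M := S) c' hc
    rw [map_zero]
    apply (piRight R R S fun _ : W => K).injective
    rw [map_zero]
    funext w
    apply hev_inj
    rw [map_sum, map_sum, Finset.sum_apply, map_sum]
    exact hz w
  let m : S ⊗[R] H →+ M := liftAddHom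
    ((smulAddHom S M).flip.comp f).flip fun r s x => by
      change (φ r * s) • f x = s • f (e r * x)
      rw [hf, mul_comm, mul_smul]
  have := congrArg m h0
  rw [map_sum, map_zero] at this
  exact this

end FlatRelation

section FunctionField

variable {Z Z' : Scheme.{0}} [IsIntegral Z] [IsIntegral Z']

lemma functionFieldMap_regValue (f : Z ⟶ Z') [IsDominant f] {U : Z.Opens} {V : Z'.Opens}
    (h : U ≤ f ⁻¹ᵁ V) (x : U) (y : V) (r : Γ(Z', V)) :
    functionFieldMap f (regValue y r) = regValue x (f.appLE V U h r) := by
  rw [regValue_eq y ⟨f x.1, h x.2⟩]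
  refine (functionFieldMap_algebraMap f x.1 _).trans (congrArg (algebraMap _ Z.functionField) ?_)
  have := Scheme.Hom.germ_stalkMap_apply f V x.1 (h x.2) r
  refine this.trans ?_
  rw [Scheme.Hom.appLE]
  exact (TopCat.Presheaf.germ_res_apply Z.presheaf (homOfLE h) x.1 x.2 (f.app V r)).symm

lemma exists_regValue_mul_eq {V : Z.Opens} (hV : IsAffineOpen V) (y : V) (q : Z.functionField) :
    ∃ r d : Γ(Z, V), regValue y d ≠ 0 ∧ regValue y d * q = regValue y r := by
  have : Nonempty V := ⟨y⟩
  have := functionField_isFractionRing_of_isAffineOpen Z V hV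
  have h : ∀ r : Γ(Z, V), algebraMap Γ(Z, V) Z.functionField r = regValue y r := fun r => by
    change (Z.germToFunctionField V).hom r = _
    simp [regValue]
  obtain ⟨r, d, hd, rfl⟩ := IsFractionRing.div_surjective (A := Γ(Z, V)) q
  have hd' : algebraMap Γ(Z, V) Z.functionField d ≠ 0 :=
    IsFractionRing.to_map_ne_zero_of_mem_nonZeroDivisors hd
  refine ⟨r, d, (h d) ▸ hd', ?_⟩
  rw [← h, ← h, mul_div_cancel₀ _ hd']

end FunctionField

/-! ### Rational relations and sections of the twisted pull-back. -/

section Operators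

variable {I X Y : Type*} [Finite I] [AddCommGroup X] [AddCommGroup Y]
  [Module.Free ℤ X] [Module.Finite ℤ X] [Module.Free ℤ Y] [Module.Finite ℤ Y]
  {P : RootPairing I ℤ X Y} [P.IsReduced] {b : P.Base} {E : SchC} [GrpObj E] [IsEllipticCurve E]
  {t : E.left.presheaf.stalk (zeroPt E)} {κ : 𝟙_ SchC ⟶ E}
  {U : (HomTorus E X ⊗ HomTorus E Y).left.Opens} {V : (HomTorus E X).left.Opens}

instance flat_proj : Flat (proj X Y E) :=
  inferInstanceAs (Flat (pullback.fst (HomTorus E X).hom (HomTorus E Y).hom))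

variable (b t κ) in
/-- The algebra generated by `𝓗(V)`. -/
abbrev heckeRing (V : (HomTorus E X).left.Opens) := Subring.closure (heckeSections b t κ V)

/-- The regular functions as elements of `𝓗(V)`. -/
def GoodPair.funHom
    (ht : IsLocalRing.maximalIdeal (E.left.presheaf.stalk (zeroPt E)) = Ideal.span {t})
    (hg : GoodPair b t κ U V) (y : V) : Γ((HomTorus E X).left, V) →+* heckeRing b t κ V where
  toFun r := ⟨SkewMonoidAlgebra.single 1 (regValue y r), Subring.subset_closure <| by
    rw [GoodPair.mem_heckeSections_iff ht hg.invV]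
    have := (IsHecke.one (U := V) (h := κ ^ (-2 : ℤ)) (heckeGeom_root b ht)).single_one_mul
      (f := regValue y r) fun x hx => by
        rw [regValue_eq y ⟨x, hx⟩]
        exact ⟨_, rfl⟩
    rwa [mul_one] at this⟩
  map_one' := Subtype.ext (congrArg (SkewMonoidAlgebra.single 1) (map_one (regValue y)))
  map_mul' r r' := Subtype.ext ((congrArg (SkewMonoidAlgebra.single 1)
    (map_mul (regValue y) r r')).trans (single_one_mul_single_one _ _).symm)
  map_zero' := Subtype.ext ((congrArg (SkewMonoidAlgebra.single 1) (map_zero (regValue y))).trans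
    (SkewMonoidAlgebra.single_zero _))
  map_add' r r' := Subtype.ext ((congrArg (SkewMonoidAlgebra.single 1)
    (map_add (regValue y) r r')).trans (SkewMonoidAlgebra.single_add _ _ _))

/-- A relation between rational sections gives a relation between sections of `𝕃 ⊗ p^*ℱ`. -/
lemma GoodPair.sum_eq_zero
    (ht : IsLocalRing.maximalIdeal (E.left.presheaf.stalk (zeroPt E)) = Ideal.span {t})
    (hg : GoodPair b t κ U V) (F : ModHecke b t κ) (x : U) {J : Type*} (B : Finset J)
    (l : J → lineSections (twistDivisor b t κ) U) (h : J → heckeRing b t κ V) (n : Γ(F.sheaf, V))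
    (hz : ∀ w, ∑ k ∈ B, (l k).1 x * functionFieldMap (proj X Y E) ((h k).1.coeff w) = 0) :
    ∑ k ∈ B, twistedPullbackHom b t κ F.sheaf hg.le (l k) (F.act V hg.invV (h k) n) = 0 := by
  obtain ⟨l₀, hl₀⟩ := hg.exists_basis
  choose s hs using fun k => hg.exists_smul_eq hl₀ (l k)
  have hval : ∀ k, (l k).1 x = regValue x (s k) * hg.d₀⁻¹ := fun k => by
    rw [← hs, ← hl₀ x]
    rfl
  let y : V := ⟨proj X Y E x.1, hg.le x.2⟩
  let e := hg.funHom ht y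
  let c : heckeRing b t κ V →+ P.weylGroup → (HomTorus E X).left.functionField :=
    AddMonoidHom.mk' (fun a w => a.1.coeff w) fun a a' => funext fun w => by
      change (a.1 + a'.1).coeff w = _
      rw [SkewMonoidAlgebra.coeff_add]
      rfl
  let f : heckeRing b t κ V →+ Γ((twistedPullback b t κ).obj F.sheaf, U) :=
    AddMonoidHom.mk' (fun a => twistedPullbackHom b t κ F.sheaf hg.le l₀ (F.act V hg.invV a n))
      fun a a' => by
        rw [map_add]
        exact map_add _ _ _
  -- The rings of functions on `V` and `U` sit in the two function fields, and the algebra generated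
  -- by `𝓗(V)` embeds by its coefficients; the map into sections is `a ↦ l₀ ⊗ p^*(a n)`.
  have key := sum_smul_eq_zero_of_flat
    (Flat.flat_appLE (proj X Y E) hg.affV hg.affU hg.le) (exists_regValue_mul_eq hg.affV y)
    (regValue_injective x) (fun r => functionFieldMap_regValue (proj X Y E) hg.le x y r)
    (e := e) (c := c) (fun a a' haa => Subtype.ext (SkewMonoidAlgebra.ext fun w =>
      congrFun haa w)) (fun r a w => SkewMonoidAlgebra.coeff_single_one_mul _ _ _) (f := f)
    (fun r a => by
      change twistedPullbackHom b t κ F.sheaf hg.le l₀ (F.act V hg.invV (e r * a) n) = _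
      rw [map_mul]
      change twistedPullbackHom b t κ F.sheaf hg.le l₀
        (F.act V hg.invV (e r) (F.act V hg.invV a n)) = _
      have h1 : F.act V hg.invV (e r) (F.act V hg.invV a n) = r • F.act V hg.invV a n :=
        F.act_fun V hg.invV y r (e r).2 _
      rw [h1, twistedPullbackHom_smul, twistedPullbackHom_smul_left]
      rfl) B s h fun w => by
      have h0 : hg.d₀⁻¹ ≠ 0 := inv_ne_zero hg.d₀_ne
      have h1 := hz w
      simp only [hval, mul_right_comm _ hg.d₀⁻¹] at h1
      rw [← Finset.sum_mul, mul_eq_zero, or_iff_left h0] at h1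
      exact h1
  refine Eq.trans (Finset.sum_congr rfl fun k _ => ?_) key
  rw [← hs, twistedPullbackHom_smul_left]
  rfl

end Operators

/-! ### The action of the coproduct on rational sections. -/

section CoprodVal

variable {I X Y : Type*} [Finite I] [AddCommGroup X] [AddCommGroup Y]
  [Module.Free ℤ X] [Module.Finite ℤ X] [Module.Free ℤ Y] [Module.Finite ℤ Y]
  {P : RootPairing I ℤ X Y} [P.IsReduced] {E : SchC} [GrpObj E] [IsEllipticCurve E]

/-- The coefficient at `δ_w` of the result of the action of `Ψ(T)` on `z ⊗ 1`. -/
def coprodVal (T : Twisted (P.weylGroup × P.weylGroup) (HomTorus E X ⊗ HomTorus E Y).left)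
    (z : (HomTorus E X ⊗ HomTorus E Y).left.functionField) (w : P.weylGroup) :
    (HomTorus E X ⊗ HomTorus E Y).left.functionField :=
  ∑ g, coprodCoeff T g w * g • z

lemma coprodVal_add
    (T T' : Twisted (P.weylGroup × P.weylGroup) (HomTorus E X ⊗ HomTorus E Y).left)
    (z : (HomTorus E X ⊗ HomTorus E Y).left.functionField) (w : P.weylGroup) :
    coprodVal (T + T') z w = coprodVal T z w + coprodVal T' z w := by
  simp only [coprodVal, coprodCoeff_add, Pi.add_apply, add_mul, Finset.sum_add_distrib]

/-- The function `f` passes through `δ_w` on the Hecke side as it does through `δ_w δ_v^d` on the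
line bundle side. This is the rational form of balancedness over `𝒪(V)`. -/
lemma coprodVal_functionFieldMap_mul
    (T : Twisted (P.weylGroup × P.weylGroup) (HomTorus E X ⊗ HomTorus E Y).left)
    (f : (HomTorus E X).left.functionField)
    (z : (HomTorus E X ⊗ HomTorus E Y).left.functionField) (w : P.weylGroup) :
    coprodVal T (functionFieldMap (proj X Y E) f * z) w =
      coprodVal T z w * functionFieldMap (proj X Y E) (w • f) := by
  rw [coprodVal, coprodVal, Finset.sum_mul]
  refine Finset.sum_congr rfl fun g _ => ?_
  rw [smul_mul', smul_functionFieldMap_proj, coprodCoeff]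
  split_ifs with hw
  · rw [hw]
    ring
  · simp

lemma sum_coprodVal_mul
    (T : Twisted (P.weylGroup × P.weylGroup) (HomTorus E X ⊗ HomTorus E Y).left)
    (z : (HomTorus E X ⊗ HomTorus E Y).left.functionField)
    (f : P.weylGroup → (HomTorus E X).left.functionField) (w : P.weylGroup) :
    ∑ u, coprodVal T z u * functionFieldMap (proj X Y E) (u • f (u⁻¹ * w)) =
      ∑ g, T.coeff g * g • (z * functionFieldMap (proj X Y E) (f (g.1⁻¹ * w))) := by
  classical
  simp only [coprodVal, Finset.sum_mul]
  rw [Finset.sum_comm]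
  refine Finset.sum_congr rfl fun g _ => ?_
  rw [smul_mul', smul_functionFieldMap_proj, Finset.sum_eq_single g.1]
  · rw [coprodCoeff, if_pos rfl, mul_assoc]
  · intro u _ hu
    rw [coprodCoeff, if_neg hu, zero_mul, zero_mul]
  · simp

/-- The rational form of `Ψ(T T') = Ψ(T) Ψ(T')`; it is the source of the multiplicativity of the
operators. -/
lemma coprodVal_mul
    (T T' : Twisted (P.weylGroup × P.weylGroup) (HomTorus E X ⊗ HomTorus E Y).left)
    (z : (HomTorus E X ⊗ HomTorus E Y).left.functionField) (w : P.weylGroup) :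
    coprodVal (T * T') z w = ∑ g, T.coeff g * g • coprodVal T' z (g.1⁻¹ * w) := by
  rw [coprodVal, ← coprodOp_coprodCoeff]
  change ∑ g, (∑ x, T.coeff x * x • coprodCoeff T' (x⁻¹ * g) (x.1⁻¹ * w)) * g • z = _
  simp only [Finset.sum_mul]
  rw [Finset.sum_comm]
  refine Finset.sum_congr rfl fun x _ => ?_
  rw [coprodVal, Finset.smul_sum, Finset.mul_sum]
  refine Fintype.sum_equiv (Equiv.mulLeft x⁻¹) _ _ fun g => ?_
  rw [Equiv.coe_mulLeft, smul_mul', smul_smul, mul_inv_cancel_left, mul_assoc]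

lemma coprodVal_single_one (f z : (HomTorus E X ⊗ HomTorus E Y).left.functionField)
    (w : P.weylGroup) :
    coprodVal (SkewMonoidAlgebra.single 1 f :
      Twisted (P.weylGroup × P.weylGroup) (HomTorus E X ⊗ HomTorus E Y).left) z w =
      f * z * functionFieldMap (proj X Y E)
        ((1 : Twisted P.weylGroup (HomTorus E X).left).coeff w) := by
  classical
  rw [coprodVal, Finset.sum_eq_single 1]
  · rw [coprodCoeff, SkewMonoidAlgebra.coeff_single_apply, if_pos rfl, one_smul,
      SkewMonoidAlgebra.coeff_one, Finsupp.single_apply]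
    by_cases hw : w = 1
    · simp [hw]
    · simp [hw, Ne.symm hw]
  · intro g _ hg
    rw [coprodCoeff, SkewMonoidAlgebra.coeff_single_apply, if_neg (Ne.symm hg), ite_self, zero_mul]
  · simp

lemma sum_polyAct_mul {J : Type*} [Fintype J]
    {a : J → Twisted (P.weylGroup × P.weylGroup) (HomTorus E X ⊗ HomTorus E Y).left}
    {h : J → Twisted P.weylGroup (HomTorus E X).left}
    {T : Twisted (P.weylGroup × P.weylGroup) (HomTorus E X ⊗ HomTorus E Y).left}
    (hT : ∑ k, tensorCoeff (a k) (h k) = coprodCoeff T)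
    (z : (HomTorus E X ⊗ HomTorus E Y).left.functionField) (w : P.weylGroup) :
    ∑ k, polyAct (a k) z * functionFieldMap (proj X Y E) ((h k).coeff w) = coprodVal T z w := by
  have h1 : ∀ k, polyAct (a k) z = ∑ g, (a k).coeff g * g • z := fun k => by
    rw [polyAct_eq_sum, Finsupp.sum_fintype _ _ fun _ => zero_mul _]
  simp only [h1, Finset.sum_mul]
  rw [Finset.sum_comm, coprodVal, ← hT]
  refine Finset.sum_congr rfl fun g _ => ?_
  rw [Finset.sum_apply, Finset.sum_apply, Finset.sum_mul]
  refine Finset.sum_congr rfl fun k _ => ?_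
  rw [tensorCoeff]
  ring

end CoprodVal

/-! ### Operators on sections over a good pair. -/

section Operators

variable {I X Y : Type*} [Finite I] [AddCommGroup X] [AddCommGroup Y]
  [Module.Free ℤ X] [Module.Finite ℤ X] [Module.Free ℤ Y] [Module.Finite ℤ Y]
  {P : RootPairing I ℤ X Y} [P.IsReduced] {b : P.Base} {E : SchC} [GrpObj E] [IsEllipticCurve E]
  {t : E.left.presheaf.stalk (zeroPt E)} {κ : 𝟙_ SchC ⟶ E}
  {U : (HomTorus E X ⊗ HomTorus E Y).left.Opens} {V : (HomTorus E X).left.Opens}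
  {T T' : Twisted (P.weylGroup × P.weylGroup) (HomTorus E X ⊗ HomTorus E Y).left}

/-- `Ψ(T) (s ⊗ 1) = ∑ k, l k ⊗ h k`. -/
def IsDecomp (T : Twisted (P.weylGroup × P.weylGroup) (HomTorus E X ⊗ HomTorus E Y).left)
    (s : lineSections (twistDivisor b t κ) U) {J : Type} [Fintype J]
    (l : J → lineSections (twistDivisor b t κ) U) (h : J → heckeRing b t κ V) : Prop :=
  ∀ x w, ∑ k, (l k).1 x * functionFieldMap (proj X Y E) ((h k).1.coeff w) = coprodVal T (s.1 x) w

lemma isDecomp_of_isCoproduct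
    (ht : IsLocalRing.maximalIdeal (E.left.presheaf.stalk (zeroPt E)) = Ideal.span {t})
    (hU : SchemeAction.IsInvariant (P.weylGroup × P.weylGroup) U) {m : ℕ}
    {a : Fin m → Twisted (P.weylGroup × P.weylGroup) (HomTorus E X ⊗ HomTorus E Y).left}
    {h : Fin m → Twisted P.weylGroup (HomTorus E X).left}
    (ha : ∀ k, a k ∈ dynSumSections b t κ U) (hh : ∀ k, h k ∈ heckeSections b t κ V)
    (H : IsCoproduct P E T a h) (s : lineSections (twistDivisor b t κ) U) :
    IsDecomp T s (fun k => lineAct ht hU ⟨a k, ha k⟩ s)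
      fun k => (⟨h k, Subring.subset_closure (hh k)⟩ : heckeRing b t κ V) :=
  fun x w => sum_polyAct_mul (isCoproduct_iff.1 H) (s.1 x) w

lemma GoodPair.exists_isDecomp
    (ht : IsLocalRing.maximalIdeal (E.left.presheaf.stalk (zeroPt E)) = Ideal.span {t})
    (hg : GoodPair b t κ U V) (x : U) (hT : T ∈ dynHeckeSections b t κ U)
    (s : lineSections (twistDivisor b t κ) U) :
    ∃ (m : ℕ) (l : Fin m → lineSections (twistDivisor b t κ) U)
      (h : Fin m → heckeRing b t κ V), IsDecomp T s l h := by
  obtain ⟨m, a, h, ha, hh, H⟩ := exists_isCoproduct (hg.coprodCoeff_mem ht x.2 hT)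
  exact ⟨m, _, _, isDecomp_of_isCoproduct ht hg.invU ha hh H s⟩

/-- The uniqueness principle behind the construction: subtract the two sums, now over the disjoint
union of the index sets, and use descent of rational relations. -/
lemma GoodPair.sum_eq_of_isDecomp
    (ht : IsLocalRing.maximalIdeal (E.left.presheaf.stalk (zeroPt E)) = Ideal.span {t})
    (hg : GoodPair b t κ U V) (F : ModHecke b t κ) (x : U) {J J' : Type} [Fintype J] [Fintype J']
    {l : J → lineSections (twistDivisor b t κ) U} {h : J → heckeRing b t κ V}
    {l' : J' → lineSections (twistDivisor b t κ) U} {h' : J' → heckeRing b t κ V}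
    (n : Γ(F.sheaf, V))
    (hz : ∀ w, ∑ k, (l k).1 x * functionFieldMap (proj X Y E) ((h k).1.coeff w) =
      ∑ k, (l' k).1 x * functionFieldMap (proj X Y E) ((h' k).1.coeff w)) :
    ∑ k, twistedPullbackHom b t κ F.sheaf hg.le (l k) (F.act V hg.invV (h k) n) =
      ∑ k, twistedPullbackHom b t κ F.sheaf hg.le (l' k) (F.act V hg.invV (h' k) n) := by
  have := hg.sum_eq_zero ht F x Finset.univ (Sum.elim l fun k => -l' k)
      (Sum.elim h h') n fun w => by
    rw [Fintype.sum_sum_type]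
    refine (congrArg₂ (· + ·) (hz w) ?_).trans (add_neg_cancel _)
    rw [← Finset.sum_neg_distrib]
    exact Finset.sum_congr rfl fun k _ => neg_mul _ _
  rw [Fintype.sum_sum_type] at this
  refine eq_of_sub_eq_zero (Eq.trans ?_ this)
  rw [sub_eq_add_neg, ← Finset.sum_neg_distrib]
  refine congrArg₂ (· + ·) rfl (Finset.sum_congr rfl fun k _ => ?_)
  change -twistedPullbackHom b t κ F.sheaf hg.le (l' k) _ =
    twistedPullbackHom b t κ F.sheaf hg.le (-l' k) _
  rw [map_neg]
  rfl

/-- `φ` is the action of `T` on the sections of `𝕃 ⊗ p^*ℱ` through `Ψ`. -/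
def GoodPair.IsOp (hg : GoodPair b t κ U V) (F : ModHecke b t κ)
    (T : Twisted (P.weylGroup × P.weylGroup) (HomTorus E X ⊗ HomTorus E Y).left)
    (φ : AddMonoid.End Γ((twistedPullback b t κ).obj F.sheaf, U)) : Prop :=
  ∀ ⦃J : Type⦄ [Fintype J] (l : J → lineSections (twistDivisor b t κ) U)
    (h : J → heckeRing b t κ V) (s : lineSections (twistDivisor b t κ) U) (n : Γ(F.sheaf, V)),
    IsDecomp T s l h → φ (twistedPullbackHom b t κ F.sheaf hg.le s n) =
      ∑ k, twistedPullbackHom b t κ F.sheaf hg.le (l k) (F.act V hg.invV (h k) n)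

namespace GoodPair

variable {F : ModHecke b t κ} {φ φ' : AddMonoid.End Γ((twistedPullback b t κ).obj F.sheaf, U)}

/-- The outcome does not depend on the decomposition, so one decomposition for each pair `(s, n)`
suffices. -/
lemma isOp_of_exists
    (ht : IsLocalRing.maximalIdeal (E.left.presheaf.stalk (zeroPt E)) = Ideal.span {t})
    (hg : GoodPair b t κ U V) (x : U)
    (H : ∀ s n, ∃ (J : Type) (_ : Fintype J) (l : J → lineSections (twistDivisor b t κ) U)
      (h : J → heckeRing b t κ V), IsDecomp T s l h ∧
      φ (twistedPullbackHom b t κ F.sheaf hg.le s n) =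
        ∑ k, twistedPullbackHom b t κ F.sheaf hg.le (l k) (F.act V hg.invV (h k) n)) :
    hg.IsOp F T φ := by
  intro J _ l h s n hd
  obtain ⟨J', _, l', h', hd', he⟩ := H s n
  rw [he]
  exact hg.sum_eq_of_isDecomp ht F x n fun w => (hd' x w).trans (hd x w).symm

lemma hom_ext (hg : GoodPair b t κ U V) {Q : Type} [AddCommGroup Q]
    {φ φ' : Γ((twistedPullback b t κ).obj F.sheaf, U) →+ Q}
    (H : ∀ s n, φ (twistedPullbackHom b t κ F.sheaf hg.le s n) =
      φ' (twistedPullbackHom b t κ F.sheaf hg.le s n)) : φ = φ' := by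
  have := F.coherent
  ext m
  induction hg.mem_closure m using AddSubmonoid.closure_induction with
  | mem m hm =>
    obtain ⟨s, n, rfl⟩ := hm
    exact H s n
  | zero => rw [map_zero, map_zero]
  | add m m' _ _ h h' => rw [map_add, map_add, h, h']

lemma IsOp.unique
    (ht : IsLocalRing.maximalIdeal (E.left.presheaf.stalk (zeroPt E)) = Ideal.span {t})
    {hg : GoodPair b t κ U V} (x : U) (hT : T ∈ dynHeckeSections b t κ U)
    (h : hg.IsOp F T φ) (h' : hg.IsOp F T φ') : φ = φ' := by
  refine hg.hom_ext fun s n => ?_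
  obtain ⟨m, l, c, hd⟩ := hg.exists_isDecomp ht x hT s
  exact (h l c s n hd).trans (h' l c s n hd).symm

lemma IsOp.add
    (ht : IsLocalRing.maximalIdeal (E.left.presheaf.stalk (zeroPt E)) = Ideal.span {t})
    {hg : GoodPair b t κ U V} (x : U) (hT : T ∈ dynHeckeSections b t κ U)
    (hT' : T' ∈ dynHeckeSections b t κ U)
    (h : hg.IsOp F T φ) (h' : hg.IsOp F T' φ') : hg.IsOp F (T + T') (φ + φ') := by
  refine hg.isOp_of_exists ht x fun s n => ?_
  obtain ⟨m, l, c, hd⟩ := hg.exists_isDecomp ht x hT s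
  obtain ⟨m', l', c', hd'⟩ := hg.exists_isDecomp ht x hT' s
  refine ⟨Fin m ⊕ Fin m', inferInstance, Sum.elim l l', Sum.elim c c', fun y w => ?_, ?_⟩
  · rw [Fintype.sum_sum_type, coprodVal_add, ← hd y w, ← hd' y w]
    rfl
  · rw [Fintype.sum_sum_type]
    exact congrArg₂ (· + ·) (h l c s n hd) (h' l' c' s n hd')

/-- Decomposing the sections that arise from `T'` once more under `T` gives a decomposition for `T *
T'`, in which the Hecke factors multiply in the right order. -/
lemma IsOp.mul
    (ht : IsLocalRing.maximalIdeal (E.left.presheaf.stalk (zeroPt E)) = Ideal.span {t})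
    {hg : GoodPair b t κ U V} (x : U) (hT : T ∈ dynHeckeSections b t κ U)
    (hT' : T' ∈ dynHeckeSections b t κ U)
    (h : hg.IsOp F T φ) (h' : hg.IsOp F T' φ') : hg.IsOp F (T * T') (φ * φ') := by
  refine hg.isOp_of_exists ht x fun s n => ?_
  obtain ⟨m', l', c', hd'⟩ := hg.exists_isDecomp ht x hT' s
  choose m l c hd using fun k => hg.exists_isDecomp ht x hT (l' k)
  refine ⟨Σ k, Fin (m k), inferInstance, fun k => l k.1 k.2, fun k => c k.1 k.2 * c' k.1,
    fun y w => ?_, ?_⟩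
  · rw [Fintype.sum_sigma, coprodVal_mul]
    have h1 : ∀ k, ∑ j, (l k j).1 y * functionFieldMap (proj X Y E) ((c k j * c' k).1.coeff w) =
        ∑ g, T.coeff g * g • ((l' k).1 y *
          functionFieldMap (proj X Y E) ((c' k).1.coeff (g.1⁻¹ * w))) := fun k => by
      rw [← sum_coprodVal_mul T _ fun u => (c' k).1.coeff u]
      simp only [← hd k y, Finset.sum_mul]
      rw [Finset.sum_comm]
      refine Finset.sum_congr rfl fun j _ => ?_
      rw [show (c k j * c' k).1 = (c k j).1 * (c' k).1 from rfl, coeff_mul', map_sum,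
        Finset.mul_sum]
      refine Finset.sum_congr rfl fun u _ => ?_
      rw [map_mul, mul_assoc]
    simp only [h1]
    rw [Finset.sum_comm]
    refine Finset.sum_congr rfl fun g _ => ?_
    rw [← Finset.mul_sum, ← Finset.smul_sum, hd' y]
  · rw [Fintype.sum_sigma]
    change φ (φ' _) = _
    rw [h' l' c' s n hd', map_sum]
    refine Finset.sum_congr rfl fun k _ => ?_
    rw [h (l k) (c k) _ _ (hd k)]
    refine Finset.sum_congr rfl fun j _ => ?_
    rw [map_mul]
    rfl

lemma isOp_smul
    (ht : IsLocalRing.maximalIdeal (E.left.presheaf.stalk (zeroPt E)) = Ideal.span {t})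
    (hg : GoodPair b t κ U V) (x : U) (r : Γ((HomTorus E X ⊗ HomTorus E Y).left, U)) :
    hg.IsOp F (SkewMonoidAlgebra.single 1 (regValue x r))
      (DistribSMul.toAddMonoidHom Γ((twistedPullback b t κ).obj F.sheaf, U) r) := by
  refine hg.isOp_of_exists ht x fun s n => ?_
  refine ⟨Unit, inferInstance, fun _ => r • s, fun _ => 1, fun y w => ?_, ?_⟩
  · rw [Fintype.sum_unique, coprodVal_single_one, regValue_eq x y]
    rfl
  · rw [Fintype.sum_unique, map_one, twistedPullbackHom_smul_left]
    rfl

lemma exists_isOp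
    (ht : IsLocalRing.maximalIdeal (E.left.presheaf.stalk (zeroPt E)) = Ideal.span {t})
    (hg : GoodPair b t κ U V) (x : U) (hT : T ∈ dynHeckeSections b t κ U) :
    ∃ φ, hg.IsOp F T φ := by
  obtain ⟨m, a, h, ha, hh, H⟩ := exists_isCoproduct (hg.coprodCoeff_mem ht x.2 hT)
  have hd := fun s => isDecomp_of_isCoproduct (V := V) ht hg.invU ha hh H s
  let c : Fin m → heckeRing b t κ V := fun k => ⟨h k, Subring.subset_closure (hh k)⟩
  let D : lineSections (twistDivisor b t κ) U →+ Γ(F.sheaf, V) →+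
      Γ((twistedPullback b t κ).obj F.sheaf, U) :=
    ∑ k, ((twistedPullbackHom b t κ F.sheaf hg.le).comp (lineAct ht hg.invU ⟨a k, ha k⟩)).compl₂
      (F.act V hg.invV (c k))
  have hDs : ∀ s n, D s n = ∑ k, twistedPullbackHom b t κ F.sheaf hg.le
      (lineAct ht hg.invU ⟨a k, ha k⟩ s) (F.act V hg.invV (c k) n) := fun s n => by
    simp only [D, AddMonoidHom.finsetSum_apply]
    rfl
  have := F.coherent
  let y : V := ⟨proj X Y E x.1, hg.le x.2⟩
  -- Balancedness: moving `r` from the line bundle to `ℱ` replaces the decomposition `(a_k (r s),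
  -- h_k)` by `(a_k s, h_k r)`. Both represent the same rational section, so the uniqueness
  -- principle applies.
  obtain ⟨φ, hφ⟩ := hg.exists_lift (F := F.sheaf) D fun r s n => by
    have h1 : r • n = F.act V hg.invV (hg.funHom ht y r) n :=
      (F.act_fun V hg.invV y r (hg.funHom ht y r).2 n).symm
    rw [hDs, hDs, h1]
    have h2 : ∀ k, F.act V hg.invV (c k) (F.act V hg.invV (hg.funHom ht y r) n) =
        F.act V hg.invV (c k * hg.funHom ht y r) n := fun k => by
      rw [map_mul]
      rfl
    simp only [h2]
    refine hg.sum_eq_of_isDecomp ht F x n fun w => (hd _ x w).trans ?_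
    have h3 : ((proj X Y E).appLE V U hg.le r • s).1 x =
        functionFieldMap (proj X Y E) (regValue y r) * s.1 x := by
      rw [functionFieldMap_regValue (proj X Y E) hg.le x y r]
      rfl
    rw [h3, coprodVal_functionFieldMap_mul, ← hd s x w, Finset.sum_mul]
    refine Finset.sum_congr rfl fun k _ => ?_
    have h4 : (c k * hg.funHom ht y r).1.coeff w = (h k).coeff w * w • regValue y r := by
      change (h k * SkewMonoidAlgebra.single 1 (regValue y r)).coeff w = _
      rw [SkewMonoidAlgebra.coeff_mul_single_one]
    rw [h4, map_mul, mul_assoc]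
  exact ⟨φ, hg.isOp_of_exists ht x fun s n => ⟨_, inferInstance, _, _, hd s, (hφ s n).trans
    (hDs s n)⟩⟩

end GoodPair

end Operators

/-! ### Gluing the local operators. -/

section Gluing

variable {I X Y : Type*} [Finite I] [AddCommGroup X] [AddCommGroup Y]
  [Module.Free ℤ X] [Module.Finite ℤ X] [Module.Free ℤ Y] [Module.Finite ℤ Y]
  {P : RootPairing I ℤ X Y} [P.IsReduced] {b : P.Base} {E : SchC} [GrpObj E] [IsEllipticCurve E]
  {t : E.left.presheaf.stalk (zeroPt E)} {κ : 𝟙_ SchC ⟶ E}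
  {U U' : (HomTorus E X ⊗ HomTorus E Y).left.Opens} {V V' : (HomTorus E X).left.Opens}
  {T T' : Twisted (P.weylGroup × P.weylGroup) (HomTorus E X ⊗ HomTorus E Y).left}
  {F : ModHecke b t κ}

/-- Restriction of sections of `𝕃 ⊗ p^*ℱ`. -/
def resHom (F : ModHecke b t κ) (h : U' ≤ U) :
    Γ((twistedPullback b t κ).obj F.sheaf, U) →+ Γ((twistedPullback b t κ).obj F.sheaf, U') :=
  (((twistedPullback b t κ).obj F.sheaf).presheaf.map (homOfLE h).op).hom

lemma resHom_resHom {U'' : (HomTorus E X ⊗ HomTorus E Y).left.Opens} (h : U' ≤ U) (h' : U'' ≤ U')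
    (m : Γ((twistedPullback b t κ).obj F.sheaf, U)) :
    resHom F h' (resHom F h m) = resHom F (h'.trans h) m :=
  presheaf_map_map _ h h' m

lemma resHom_eq_of_locally_eq {m m' : Γ((twistedPullback b t κ).obj F.sheaf, U)}
    (H : ∀ x ∈ U, ∃ (U' : (HomTorus E X ⊗ HomTorus E Y).left.Opens) (h : U' ≤ U), x ∈ U' ∧
      resHom F h m = resHom F h m') : m = m' :=
  modules_eq_of_locally_eq _ m m' H

lemma resHom_sum_twistedPullbackHom (hUV : U ≤ proj X Y E ⁻¹ᵁ V)
    (hV : SchemeAction.IsInvariant P.weylGroup V) (hU : U' ≤ U) (hV' : V' ≤ V)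
    (hg' : GoodPair b t κ U' V') {J : Type*} [Fintype J]
    (l : J → lineSections (twistDivisor b t κ) U) (h : J → heckeRing b t κ V) (n : Γ(F.sheaf, V)) :
    resHom F hU (∑ k, twistedPullbackHom b t κ F.sheaf hUV (l k) (F.act V hV (h k) n)) =
      ∑ k, twistedPullbackHom b t κ F.sheaf hg'.le (lineSectionsRes _ hU (l k))
        (F.act V' hg'.invV ⟨(h k).1, Subring.closure_mono (heckeSections_mono hV') (h k).2⟩
          (F.sheaf.presheaf.map (homOfLE hV').op n)) := by
  rw [map_sum]
  refine Finset.sum_congr rfl fun k _ => ?_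
  refine (twistedPullbackHom_res b t κ F.sheaf hUV hU hV' hg'.le _ _).trans ?_
  exact congrArg (twistedPullbackHom b t κ F.sheaf hg'.le _)
    (F.act_res V V' hV hg'.invV hV' _ (h k).2 _ n)

lemma GoodPair.IsOp.apply_resHom {hg' : GoodPair b t κ U' V'}
    {φ' : AddMonoid.End Γ((twistedPullback b t κ).obj F.sheaf, U')} (h' : hg'.IsOp F T φ')
    (hUV : U ≤ proj X Y E ⁻¹ᵁ V) (hV : SchemeAction.IsInvariant P.weylGroup V)
    (hU : U' ≤ U) (hV' : V' ≤ V) {J : Type} [Fintype J]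
    {l : J → lineSections (twistDivisor b t κ) U} {c : J → heckeRing b t κ V}
    {s : lineSections (twistDivisor b t κ) U} (hd : IsDecomp T s l c) (n : Γ(F.sheaf, V)) :
    φ' (resHom F hU (twistedPullbackHom b t κ F.sheaf hUV s n)) =
      resHom F hU (∑ k, twistedPullbackHom b t κ F.sheaf hUV (l k) (F.act V hV (c k) n)) := by
  rw [resHom_sum_twistedPullbackHom hUV hV hU hV' hg']
  refine (congrArg φ' (twistedPullbackHom_res b t κ F.sheaf hUV hU hV' hg'.le s n)).trans ?_
  exact h' _ _ _ _ fun x w => hd ⟨x.1, hU x.2⟩ w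

lemma GoodPair.IsOp.res
    (ht : IsLocalRing.maximalIdeal (E.left.presheaf.stalk (zeroPt E)) = Ideal.span {t})
    {hg : GoodPair b t κ U V} {hg' : GoodPair b t κ U' V'} (hU : U' ≤ U) (hV : V' ≤ V) (x : U)
    (hT : T ∈ dynHeckeSections b t κ U)
    {φ : AddMonoid.End Γ((twistedPullback b t κ).obj F.sheaf, U)} (h : hg.IsOp F T φ)
    {φ' : AddMonoid.End Γ((twistedPullback b t κ).obj F.sheaf, U')} (h' : hg'.IsOp F T φ')
    (m : Γ((twistedPullback b t κ).obj F.sheaf, U)) :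
    resHom F hU (φ m) = φ' (resHom F hU m) := by
  suffices AddMonoidHom.comp (resHom F hU) φ = AddMonoidHom.comp φ' (resHom F hU) from
    DFunLike.congr_fun this m
  refine hg.hom_ext fun s n => ?_
  obtain ⟨m, l, c, hd⟩ := hg.exists_isDecomp ht x hT s
  exact (congrArg (resHom F hU) (h l c s n hd)).trans
    (h'.apply_resHom hg.le hg.invV hU hV hd n).symm

/-- The intersection of two good pairs need not be good, so the comparison is made on smaller good
pairs inside both, to which each operator restricts. -/
lemma GoodPair.IsOp.compat
    (ht : IsLocalRing.maximalIdeal (E.left.presheaf.stalk (zeroPt E)) = Ideal.span {t})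
    {hg : GoodPair b t κ U V} {hg' : GoodPair b t κ U' V'}
    (hT : T ∈ dynHeckeSections b t κ U) (hT' : T ∈ dynHeckeSections b t κ U')
    {φ : AddMonoid.End Γ((twistedPullback b t κ).obj F.sheaf, U)} (h : hg.IsOp F T φ)
    {φ' : AddMonoid.End Γ((twistedPullback b t κ).obj F.sheaf, U')} (h' : hg'.IsOp F T φ')
    {m : Γ((twistedPullback b t κ).obj F.sheaf, U)}
    {m' : Γ((twistedPullback b t κ).obj F.sheaf, U')}
    (hm : resHom F (inf_le_left : U ⊓ U' ≤ U) m = resHom F (inf_le_right : U ⊓ U' ≤ U') m') :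
    resHom F (inf_le_left : U ⊓ U' ≤ U) (φ m) = resHom F (inf_le_right : U ⊓ U' ≤ U') (φ' m') := by
  refine resHom_eq_of_locally_eq fun x hx => ?_
  obtain ⟨U₃, V₃, ⟨hg₃⟩, hx₃, hU₃, hV₃⟩ := exists_goodPair (b := b) (κ := κ) ht
    (isInvariant_inf hg.invU hg'.invU) (isInvariant_inf hg.invV hg'.invV) hx
    ⟨hg.le hx.1, hg'.le hx.2⟩
  obtain ⟨φ₃, h₃⟩ := hg₃.exists_isOp (F := F) ht ⟨x, hx₃⟩
    (dynHeckeSections_mono (hU₃.trans inf_le_left) hT)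
  refine ⟨U₃, hU₃, hx₃, ?_⟩
  rw [resHom_resHom, resHom_resHom,
    h.res (hg' := hg₃) ht (hU₃.trans inf_le_left) (hV₃.trans inf_le_left) ⟨x, hx.1⟩ hT h₃,
    h'.res (hg' := hg₃) ht (hU₃.trans inf_le_right) (hV₃.trans inf_le_right) ⟨x, hx.2⟩ hT' h₃,
    ← resHom_resHom inf_le_left hU₃, ← resHom_resHom inf_le_right hU₃, hm]

/-- Over a general invariant set the module structure involves the generated algebra; its elements
become honest Hecke sections on good pairs, where the sections are closed under products. -/
lemma GoodPair.mem_dynHeckeSections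
    (ht : IsLocalRing.maximalIdeal (E.left.presheaf.stalk (zeroPt E)) = Ideal.span {t})
    (hg' : GoodPair b t κ U' V') (hU : U' ≤ U) (x : U')
    (hT : T ∈ Subring.closure (dynHeckeSections b t κ U)) : T ∈ dynHeckeSections b t κ U' :=
  hg'.mem_closure_dynHeckeSections ht x.2
    (Subring.closure_mono (dynHeckeSections_mono hU) hT)

/-- `m'` is the result of the action of `T` on `m`. -/
def IsAct (F : ModHecke b t κ)
    (T : Twisted (P.weylGroup × P.weylGroup) (HomTorus E X ⊗ HomTorus E Y).left)
    (m m' : Γ((twistedPullback b t κ).obj F.sheaf, U)) : Prop :=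
  ∀ (U' : (HomTorus E X ⊗ HomTorus E Y).left.Opens) (V' : (HomTorus E X).left.Opens)
    (hg' : GoodPair b t κ U' V') (hU : U' ≤ U) (_ : U')
    (φ : AddMonoid.End Γ((twistedPullback b t κ).obj F.sheaf, U')),
    hg'.IsOp F T φ → resHom F hU m' = φ (resHom F hU m)

lemma exists_goodPair_le
    (ht : IsLocalRing.maximalIdeal (E.left.presheaf.stalk (zeroPt E)) = Ideal.span {t})
    (hU : SchemeAction.IsInvariant (P.weylGroup × P.weylGroup) U)
    {x : (HomTorus E X ⊗ HomTorus E Y).left} (hx : x ∈ U) :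
    ∃ U' V', Nonempty (GoodPair b t κ U' V') ∧ x ∈ U' ∧ U' ≤ U := by
  obtain ⟨U', V', hg, hx', hle, -⟩ := exists_goodPair (b := b) (κ := κ) ht hU
    (isInvariant_top (G := P.weylGroup)) hx (V := ⊤) trivial
  exact ⟨U', V', hg, hx', hle⟩

/-- Choose a good pair around each point of `U`, act there, and glue; the results agree on overlaps
by `GoodPair.IsOp.compat`. -/
lemma exists_isAct
    (ht : IsLocalRing.maximalIdeal (E.left.presheaf.stalk (zeroPt E)) = Ideal.span {t})
    (hU : SchemeAction.IsInvariant (P.weylGroup × P.weylGroup) U)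
    (hT : T ∈ Subring.closure (dynHeckeSections b t κ U))
    (m : Γ((twistedPullback b t κ).obj F.sheaf, U)) : ∃ m', IsAct F T m m' := by
  choose U₁ V₁ hg hx hle using fun x : U => exists_goodPair_le (b := b) (κ := κ) ht hU x.2
  have hT₁ : ∀ x, T ∈ dynHeckeSections b t κ (U₁ x) := fun x =>
    (hg x).some.mem_dynHeckeSections ht (hle x) ⟨x.1, hx x⟩ hT
  choose φ hφ using fun x => (hg x).some.exists_isOp (F := F) ht ⟨x.1, hx x⟩ (hT₁ x)
  obtain ⟨m', hm'⟩ := modules_exists_glue _ U₁ hle (fun x hxU => ⟨⟨x, hxU⟩, hx _⟩)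
    (fun x => φ x (resHom F (hle x) m)) fun x y =>
      (hφ x).compat ht (hT₁ x) (hT₁ y) (hφ y) (by rw [resHom_resHom, resHom_resHom])
  refine ⟨m', fun U' V' hg' hU' x ψ hψ => ?_⟩
  -- The glued section was built from chosen good pairs; an arbitrary one is compared with the
  -- chosen pair around each of its points.
  refine resHom_eq_of_locally_eq fun y hy => ?_
  refine ⟨U' ⊓ U₁ ⟨y, hU' hy⟩, inf_le_left, ⟨hy, hx _⟩, ?_⟩
  have h1 := hψ.compat ht (hg'.mem_dynHeckeSections ht hU' x hT) (hT₁ ⟨y, hU' hy⟩) (hφ _)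
    (m := resHom F hU' m) (m' := resHom F (hle _) m) (by rw [resHom_resHom, resHom_resHom])
  rw [h1, ← show resHom F (hle _) m' = _ from hm' ⟨y, hU' hy⟩, resHom_resHom, resHom_resHom]

namespace IsAct

variable {m m' n n' : Γ((twistedPullback b t κ).obj F.sheaf, U)}

lemma unique
    (ht : IsLocalRing.maximalIdeal (E.left.presheaf.stalk (zeroPt E)) = Ideal.span {t})
    (hU : SchemeAction.IsInvariant (P.weylGroup × P.weylGroup) U)
    (hT : T ∈ Subring.closure (dynHeckeSections b t κ U))
    (h : IsAct F T m n) (h' : IsAct F T m n') : n = n' := by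
  refine resHom_eq_of_locally_eq fun x hx => ?_
  obtain ⟨U', V', ⟨hg⟩, hx', hle⟩ := exists_goodPair_le (b := b) (κ := κ) ht hU hx
  obtain ⟨φ, hφ⟩ := hg.exists_isOp (F := F) ht ⟨x, hx'⟩
    (hg.mem_dynHeckeSections ht hle ⟨x, hx'⟩ hT)
  exact ⟨U', hle, hx', (h _ _ hg hle ⟨x, hx'⟩ φ hφ).trans (h' _ _ hg hle ⟨x, hx'⟩ φ hφ).symm⟩

lemma add_right (h : IsAct F T m n) (h' : IsAct F T m' n') : IsAct F T (m + m') (n + n') :=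
  fun U' V' hg hU x φ hφ => by
    rw [map_add, map_add, map_add, h U' V' hg hU x φ hφ, h' U' V' hg hU x φ hφ]

lemma add_left
    (ht : IsLocalRing.maximalIdeal (E.left.presheaf.stalk (zeroPt E)) = Ideal.span {t})
    (hT : T ∈ Subring.closure (dynHeckeSections b t κ U))
    (hT' : T' ∈ Subring.closure (dynHeckeSections b t κ U))
    (h : IsAct F T m n) (h' : IsAct F T' m n') : IsAct F (T + T') m (n + n') := by
  intro U' V' hg hU x φ hφ
  have h1 := hg.mem_dynHeckeSections ht hU x hT
  have h1' := hg.mem_dynHeckeSections ht hU x hT'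
  obtain ⟨ψ, hψ⟩ := hg.exists_isOp (F := F) ht x h1
  obtain ⟨ψ', hψ'⟩ := hg.exists_isOp (F := F) ht x h1'
  rw [hφ.unique ht x (hg.mem_dynHeckeSections ht hU x (add_mem hT hT'))
    (hψ.add ht x h1 h1' hψ'), map_add, h U' V' hg hU x ψ hψ, h' U' V' hg hU x ψ' hψ']
  rfl

lemma mul
    (ht : IsLocalRing.maximalIdeal (E.left.presheaf.stalk (zeroPt E)) = Ideal.span {t})
    (hT : T ∈ Subring.closure (dynHeckeSections b t κ U))
    (hT' : T' ∈ Subring.closure (dynHeckeSections b t κ U))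
    (h : IsAct F T m' n) (h' : IsAct F T' m m') : IsAct F (T * T') m n := by
  intro U' V' hg hU x φ hφ
  have h1 := hg.mem_dynHeckeSections ht hU x hT
  have h1' := hg.mem_dynHeckeSections ht hU x hT'
  obtain ⟨ψ, hψ⟩ := hg.exists_isOp (F := F) ht x h1
  obtain ⟨ψ', hψ'⟩ := hg.exists_isOp (F := F) ht x h1'
  rw [hφ.unique ht x (hg.mem_dynHeckeSections ht hU x (mul_mem hT hT'))
    (hψ.mul ht x h1 h1' hψ'), h U' V' hg hU x ψ hψ, h' U' V' hg hU x ψ' hψ']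
  rfl

lemma smul
    (ht : IsLocalRing.maximalIdeal (E.left.presheaf.stalk (zeroPt E)) = Ideal.span {t})
    (x : U) (r : Γ((HomTorus E X ⊗ HomTorus E Y).left, U))
    (hr : SkewMonoidAlgebra.single 1 (regValue x r) ∈
      Subring.closure (dynHeckeSections (P := P) b t κ U))
    (m : Γ((twistedPullback b t κ).obj F.sheaf, U)) :
    IsAct F (SkewMonoidAlgebra.single 1 (regValue x r)) m (r • m) := by
  intro U' V' hg hU y φ hφ
  have h1 := hg.mem_dynHeckeSections ht hU y hr
  have h2 := hg.isOp_smul (F := F) ht y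
    ((HomTorus E X ⊗ HomTorus E Y).left.presheaf.map (homOfLE hU).op r)
  rw [regValue_res hU y r, regValue_eq _ x] at h2
  rw [hφ.unique ht y h1 h2]
  exact ((twistedPullback b t κ).obj F.sheaf).val.map_smul (homOfLE hU).op r m

lemma one
    (ht : IsLocalRing.maximalIdeal (E.left.presheaf.stalk (zeroPt E)) = Ideal.span {t})
    (m : Γ((twistedPullback b t κ).obj F.sheaf, U)) :
    IsAct F (1 : Twisted (P.weylGroup × P.weylGroup) (HomTorus E X ⊗ HomTorus E Y).left) m m := by
  intro U' V' hg hU y φ hφ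
  have h1 := hg.mem_dynHeckeSections ht hU y (one_mem _)
  have h2 := hg.isOp_smul (F := F) ht y 1
  rw [map_one] at h2
  rw [hφ.unique ht y h1 h2]
  exact (one_smul _ _).symm

lemma res (hU : U' ≤ U) (h : IsAct F T m n) : IsAct F T (resHom F hU m) (resHom F hU n) := by
  intro U₁ V₁ hg hU₁ x φ hφ
  rw [resHom_resHom, resHom_resHom]
  exact h U₁ V₁ hg (hU₁.trans hU) x φ hφ

lemma map
    (ht : IsLocalRing.maximalIdeal (E.left.presheaf.stalk (zeroPt E)) = Ideal.span {t})
    (hT : T ∈ Subring.closure (dynHeckeSections b t κ U)) (h : IsAct F T m n)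
    {F' : ModHecke b t κ} (f : F ⟶ F') :
    IsAct F' T (((twistedPullback b t κ).map f.hom).app U m)
      (((twistedPullback b t κ).map f.hom).app U n) := by
  intro U' V' hg hU x φ hφ
  have h1 := hg.mem_dynHeckeSections ht hU x hT
  obtain ⟨ψ, hψ⟩ := hg.exists_isOp (F := F) ht x h1
  have hres : ∀ m : Γ((twistedPullback b t κ).obj F.sheaf, U),
      resHom F' hU (((twistedPullback b t κ).map f.hom).app U m) =
        ((twistedPullback b t κ).map f.hom).app U' (resHom F hU m) := fun m =>
    (ConcreteCategory.congr_hom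
      (((twistedPullback b t κ).map f.hom).mapPresheaf.naturality (homOfLE hU).op) m).symm
  rw [hres, hres, h U' V' hg hU x ψ hψ]
  suffices AddMonoidHom.comp (((twistedPullback b t κ).map f.hom).app U').hom ψ =
      AddMonoidHom.comp φ (((twistedPullback b t κ).map f.hom).app U').hom from
    DFunLike.congr_fun this _
  refine hg.hom_ext fun s n => ?_
  obtain ⟨m, l, c, hd⟩ := hg.exists_isDecomp ht x h1 s
  refine (congrArg (((twistedPullback b t κ).map f.hom).app U').hom (hψ l c s n hd)).trans ?_
  refine Eq.trans ?_ (congrArg φ (twistedPullback_map_hom b t κ hg.le f.hom s n)).symm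
  rw [map_sum, hφ l c s _ hd]
  refine Finset.sum_congr rfl fun k _ => ?_
  refine (twistedPullback_map_hom b t κ hg.le f.hom _ _).trans ?_
  exact congrArg (twistedPullbackHom b t κ F'.sheaf hg.le (l k)) (f.comm V' hg.invV (c k) n)

/-- This gives the formula over arbitrary invariant `U` and `V`, with no affineness: the
decomposition restricts to good pairs inside them, where it computes the operator. -/
lemma of_isDecomp
    (ht : IsLocalRing.maximalIdeal (E.left.presheaf.stalk (zeroPt E)) = Ideal.span {t})
    (hUV : U ≤ proj X Y E ⁻¹ᵁ V) (hV : SchemeAction.IsInvariant P.weylGroup V)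
    (hT : T ∈ Subring.closure (dynHeckeSections b t κ U)) {J : Type} [Fintype J]
    {l : J → lineSections (twistDivisor b t κ) U} {c : J → heckeRing b t κ V}
    {s : lineSections (twistDivisor b t κ) U} (hd : IsDecomp T s l c) (n : Γ(F.sheaf, V)) :
    IsAct F T (twistedPullbackHom b t κ F.sheaf hUV s n)
      (∑ k, twistedPullbackHom b t κ F.sheaf hUV (l k) (F.act V hV (c k) n)) := by
  intro U' V' hg hU x φ hφ
  have h1 := hg.mem_dynHeckeSections ht hU x hT
  refine resHom_eq_of_locally_eq fun y hy => ?_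
  obtain ⟨U₃, V₃, ⟨hg₃⟩, hx₃, hU₃, hV₃⟩ := exists_goodPair (b := b) (κ := κ) ht
    hg.invU (isInvariant_inf hg.invV hV) hy ⟨hg.le hy, hUV (hU hy)⟩
  obtain ⟨φ₃, h₃⟩ := hg₃.exists_isOp (F := F) ht ⟨y, hx₃⟩ (dynHeckeSections_mono hU₃ h1)
  refine ⟨U₃, hU₃, hx₃, ?_⟩
  rw [hφ.res (hg' := hg₃) ht hU₃ (hV₃.trans inf_le_left) x h1 h₃, resHom_resHom, resHom_resHom,
    h₃.apply_resHom hUV hV (hU₃.trans hU) (hV₃.trans inf_le_right) hd]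

end IsAct

end Gluing

/-! ### The functor. -/

section Functor

variable {I X Y : Type*} [Finite I] [AddCommGroup X] [AddCommGroup Y]
  [Module.Free ℤ X] [Module.Finite ℤ X] [Module.Free ℤ Y] [Module.Finite ℤ Y]
  {P : RootPairing I ℤ X Y} [P.IsReduced] {b : P.Base} {E : SchC} [GrpObj E] [IsEllipticCurve E]
  {t : E.left.presheaf.stalk (zeroPt E)} {κ : 𝟙_ SchC ⟶ E}
  (ht : IsLocalRing.maximalIdeal (E.left.presheaf.stalk (zeroPt E)) = Ideal.span {t})
  (F : ModHecke b t κ) {U : (HomTorus E X ⊗ HomTorus E Y).left.Opens}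
  (hU : SchemeAction.IsInvariant (P.weylGroup × P.weylGroup) U)

/-- The action of an element of `𝓗^d(U)` on a section of `𝕃 ⊗ p^*ℱ`. -/
def dynAct (T : Subring.closure (dynHeckeSections b t κ U))
    (m : Γ((twistedPullback b t κ).obj F.sheaf, U)) : Γ((twistedPullback b t κ).obj F.sheaf, U) :=
  (exists_isAct ht hU T.2 m).choose

lemma isAct_dynAct (T : Subring.closure (dynHeckeSections b t κ U))
    (m : Γ((twistedPullback b t κ).obj F.sheaf, U)) : IsAct F T.1 m (dynAct ht F hU T m) :=
  (exists_isAct ht hU T.2 m).choose_spec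

variable {F} in
lemma IsAct.dynAct_eq {T : Subring.closure (dynHeckeSections b t κ U)}
    {m n : Γ((twistedPullback b t κ).obj F.sheaf, U)} (h : IsAct F T.1 m n) :
    dynAct ht F hU T m = n :=
  (isAct_dynAct ht F hU T m).unique ht hU T.2 h

/-- The action of `𝓗^d(U)` on the sections of `𝕃 ⊗ p^*ℱ`. -/
def dynActHom : Subring.closure (dynHeckeSections b t κ U) →+*
    AddMonoid.End Γ((twistedPullback b t κ).obj F.sheaf, U) :=
  RingHom.mk'
    { toFun := fun T => AddMonoidHom.mk' (dynAct ht F hU T) fun m m' =>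
        ((isAct_dynAct ht F hU T m).add_right (isAct_dynAct ht F hU T m')).dynAct_eq ht hU
      map_one' := AddMonoidHom.ext fun m => (IsAct.one ht m).dynAct_eq (T := 1) ht hU
      map_mul' := fun T T' => AddMonoidHom.ext fun m =>
        ((isAct_dynAct ht F hU T (dynAct ht F hU T' m)).mul ht T.2 T'.2
          (isAct_dynAct ht F hU T' m)).dynAct_eq (T := T * T') ht hU }
    fun T T' => AddMonoidHom.ext fun m =>
      ((isAct_dynAct ht F hU T m).add_left ht T.2 T'.2
        (isAct_dynAct ht F hU T' m)).dynAct_eq (T := T + T') ht hU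

/-- The `𝓗^d`-module `𝕃 ⊗ p^*ℱ` of an `𝓗`-module `ℱ`. -/
def dynModule : ModDynHecke b t κ where
  sheaf := (twistedPullback b t κ).obj F.sheaf
  coherent :=
    have := F.coherent
    isFinitePresentation_twistedPullback ht F.sheaf
  act _ hU := dynActHom ht F hU
  act_res _ _ hU hU' h a ha ha' m :=
    (IsAct.dynAct_eq (T := ⟨a, ha'⟩) ht hU' ((isAct_dynAct ht F hU ⟨a, ha⟩ m).res h)).symm
  act_fun _ hU x r h m := (IsAct.smul ht x r h m).dynAct_eq (T := ⟨_, h⟩) ht hU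

/-- The functor `ℱ ↦ 𝕃 ⊗ p^*ℱ` from `𝓗`-modules to `𝓗^d`-modules. -/
def dynFunctor : ModHecke b t κ ⥤ ModDynHecke b t κ where
  obj F := dynModule ht F
  map f := ⟨(twistedPullback b t κ).map f.hom, fun _ hU a m =>
    (((isAct_dynAct ht _ hU a m).map ht a.2 f).dynAct_eq ht hU).symm⟩
  map_id F := HeckeModule.Hom.ext ((twistedPullback b t κ).map_id F.sheaf)
  map_comp f g := HeckeModule.Hom.ext ((twistedPullback b t κ).map_comp f.hom g.hom)

end Functor

end

end EllipticHecke

/-! ### The theorem. -/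

open EllipticHecke

theorem mainTheorem3 {ι X Y : Type*} [Finite ι] [AddCommGroup X] [AddCommGroup Y]
    [Module.Free ℤ X] [Module.Finite ℤ X] [Module.Free ℤ Y] [Module.Finite ℤ Y]
    (P : RootPairing ι ℤ X Y) [P.IsReduced] (b : P.Base)
    (E : SchC) [GrpObj E] [IsEllipticCurve E]
    (t : E.left.presheaf.stalk (zeroPt E))
    (ht : IsLocalRing.maximalIdeal (E.left.presheaf.stalk (zeroPt E)) = Ideal.span {t})
    (κ : 𝟙_ SchC ⟶ E) :
    (∀ U : (HomTorus E X ⊗ HomTorus E Y).left.Opens,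
      SchemeAction.IsInvariant (P.weylGroup × P.weylGroup) U →
      ∀ T ∈ dynHeckeSections b t κ U, ∀ x ∈ U,
        ∃ (U' : (HomTorus E X ⊗ HomTorus E Y).left.Opens) (V : (HomTorus E X).left.Opens),
          SchemeAction.IsInvariant (P.weylGroup × P.weylGroup) U' ∧
          SchemeAction.IsInvariant P.weylGroup V ∧
          x ∈ U' ∧ U' ≤ U ∧ U' ≤ proj X Y E ⁻¹ᵁ V ∧
          ∃ (m : ℕ)
            (a : Fin m → Twisted (P.weylGroup × P.weylGroup) (HomTorus E X ⊗ HomTorus E Y).left)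
            (h : Fin m → Twisted P.weylGroup (HomTorus E X).left),
            (∀ k, a k ∈ dynSumSections b t κ U') ∧ (∀ k, h k ∈ heckeSections b t κ V) ∧
            IsCoproduct P E T a h) ∧
    ∃ (Φ : ModHecke b t κ ⥤ ModDynHecke b t κ)
      (e : Φ ⋙ HeckeModule.forget (dynHeckeSections b t κ) ≅
        HeckeModule.forget (heckeSections b t κ) ⋙ twistedPullback b t κ),
      ∀ (F : ModHecke b t κ)
        (U : (HomTorus E X ⊗ HomTorus E Y).left.Opens)
        (hU : SchemeAction.IsInvariant (P.weylGroup × P.weylGroup) U)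
        (V : (HomTorus E X).left.Opens) (hV : SchemeAction.IsInvariant P.weylGroup V)
        (hUV : U ≤ proj X Y E ⁻¹ᵁ V)
        (T : Twisted (P.weylGroup × P.weylGroup) (HomTorus E X ⊗ HomTorus E Y).left)
        (hT : T ∈ dynHeckeSections b t κ U) (m : ℕ)
        (a : Fin m → Twisted (P.weylGroup × P.weylGroup) (HomTorus E X ⊗ HomTorus E Y).left)
        (h : Fin m → Twisted P.weylGroup (HomTorus E X).left)
        (_ : ∀ k, a k ∈ dynSumSections b t κ U) (hh : ∀ k, h k ∈ heckeSections b t κ V)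
        (_ : IsCoproduct P E T a h)
        (s : lineSections (twistDivisor b t κ) U) (n : Γ(F.sheaf, V)),
        ∃ s' : Fin m → lineSections (twistDivisor b t κ) U,
          (∀ k x, (s' k).1 x = polyAct (a k) (s.1 x)) ∧
          (e.hom.app F).app U
              ((Φ.obj F).act U hU ⟨T, Subring.subset_closure hT⟩
                ((e.inv.app F).app U (twistedPullbackSection b t κ F.sheaf hUV s n))) =
            ∑ k, twistedPullbackSection b t κ F.sheaf hUV (s' k)
              (F.act V hV ⟨h k, Subring.subset_closure (hh k)⟩ n) := by
  -- The underlying sheaf and morphisms of the functor are those of `ℱ ↦ 𝕃 ⊗ p^*ℱ` by definition, so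
  -- the comparison isomorphism is the identity.
  refine ⟨fun U hU T hT x hx => exists_isCoproduct_nhds ht hU hT hx, dynFunctor ht,
    Iso.refl _, ?_⟩
  intro F U hU V hV hUV T hT m a h ha hh H s n
  -- A coproduct decomposition of `T`, applied to `s`, is a decomposition in the sense used for the
  -- operators; uniqueness of the action identifies the result.
  exact ⟨fun k => lineAct ht hU ⟨a k, ha k⟩ s, fun _ _ => rfl,
    (IsAct.of_isDecomp ht hUV hV (Subring.subset_closure hT)
      (isDecomp_of_isCoproduct ht hU ha hh H s) n).dynAct_eq
      (T := ⟨T, Subring.subset_closure hT⟩) ht hU⟩
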